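/- **Setting.** Let $\Sigma$ be a Riemann surface and $M=S^1\times\Sigma$, with coordinate $t$ on $S^1$ and local holomorphic coordinate $z$ on $\Sigma$. Let $\Gamma$ be a discrete group acting on $M$ by orientation-preserving diffeomorphisms that leave each fibre $\{t\}\times\Sigma$ invariant and restrict to conformal transformations of each fibre. *Equivariant cohomology.* For a manifold $X$ on which $\Gamma$ acts by diffeomorphisms, $C^{n,m}(X)$ is the space of maps $u$ from $\Gamma^{n+1}$ to the (complex valued) $m$-forms on $X$ with $u(g_0g,\dots,g_ng)=g^*u(g_0,\dots,g_n)$. It carries the differentials $(\delta u)(g_0,\dots,g_{n+1})=(-1)^m\sum_i(-1)^iu(g_0,\dots,\widehat{g_i},\dots,g_{n+1})$ and $(du)(g_0,\dots,g_n)=d(u(g_0,\dots,g_n))$, and the product $(uv)(g_0,\dots,g_{n+p})=(-1)^{nq}u(g_0,\dots,g_n)\wedge v(g_n,\dots,g_{n+p})$ for $u\in C^{n,m}$, $v\in C^{p,q}$. The equivariant cohomology $H^*(X_\Gamma)$ is the cohomology of the total complex $(C^{*,*}(X),d+\delta)$. An $m$-form $\alpha$ on $X$ is regarded as the element $g_0\mapsto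 g_0^*\alpha$ of $C^{0,m}(X)$. *The class $p_1$.* Let $J_2^+$ be the bundle of 2-jets at $0$ of orientation-preserving local diffeomorphisms $j:\mathbb R^3\to M$, $j^\mu(u)=x^\mu+y^\mu_iu^i+\tfrac12y^\mu_{ij}u^iu^j+\cdots$, and $P_2=J_2^+/SO_3$; $\Gamma$ acts on both by $j\mapsto g\circ j$. On $J_2^+$ there are the tautological forms $\theta^i_j=(y^{-1})^i_\mu dy^\mu_j-y^\mu_{jk}(y^{-1})^i_\mu(y^{-1})^k_\nu dx^\nu$ and their curvature $R^i_j=d\theta^i_j+\theta^i_k\wedge\theta^k_j$. The first Pontrjagin class $p_1=c_2\in H^4(WSO_3)$ of Gelfand–Fuchs cohomology is represented on $P_2$ by the closed $\Gamma$-invariant 4-form whose pullback to $J_2^+$ is $\tfrac12\big(R^i_i\wedge R^j_j-R^i_j\wedge R^j_i\big)$. The image of $p_1$ in $H^4(M_\Gamma)$ is the class that corresponds to the class of this form in $H^4(P_{2,\Gamma})$ under the isomorphism $H^4(M_\Gamma)\simeq H^4(P_{2,\Gamma})$ induced by the projection $P_2\to M$. *The equivariant curvature.* Let $\tilde J_2^+\subset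 J_2^+$ be the $\Gamma$-invariant subbundle of holomorphic 2-jets, i.e. of the jets with $j^t(u)=t+u^t$ and $j^z(u)=z+y^z_zu^z+y^z_tu^t+\tfrac12y^z_{zz}u^zu^z+y^z_{zt}u^zu^t+\tfrac12y^z_{tt}u^tu^t$. Choose a Kähler metric $\rho(z,\bar z)\,dz\otimes d\bar z$ on $\Sigma$, and let $\omega=(y^{-1})^z_z\,dy^z_z+dz\,\partial_z\ln\rho$ be the associated connection, a globally defined 1-form on $\tilde J_2^+$. **Theorem.** The equivariant curvature $\Omega=(d+\delta)\omega$ is the pullback to $\tilde J_2^+$ of an equivariant cochain on $M$, again denoted by $\Omega$; the cochain $-\Omega^2$ is an equivariant 4-cocycle on $M$; and it represents the image of $p_1$ in $H^4(M_\Gamma)$, that is, the class of $-\Omega^2$ is the unique class in $H^4(M_\Gamma)$ whose pullback to $P_2$ is the class of the form $\tfrac12(R^i_iR^j_j-R^i_jR^j_i)$. -/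

import Mathlib

open scoped ContDiff Manifold Topology
open Diffeology

namespace EquivJet

noncomputable section

/-! ## Diffeologies given by a local condition -/

/-- `ℝⁿ`, the domain of the plots. -/
abbrev E (n : ℕ) : Type := EuclideanSpace ℝ (Fin n)

/-- A neighbourhood of a point of `ℝⁿ` contains the image of a smooth self-map of `ℝⁿ` which is the
identity near the point. -/
lemma exists_smooth_into {n : ℕ} {u : Set (E n)} (hu : IsOpen u) {x : E n} (hx : x ∈ u) :
    ∃ f : E n → E n, ContDiff ℝ ∞ f ∧ (∀ y, f y ∈ u) ∧ f =ᶠ[𝓝 x] id := by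
  obtain ⟨ε, hε, hb⟩ := Metric.isOpen_iff.mp hu x hx
  let b : ContDiffBump x := ⟨ε / 2, ε, half_pos hε, half_lt_self hε⟩
  refine ⟨fun y => x + b y • (y - x), ?_, fun y => hb ?_, ?_⟩
  · exact contDiff_const.add (b.contDiff.smul (contDiff_id.sub contDiff_const))
  · rw [Metric.mem_ball, dist_eq_norm, add_sub_cancel_left, norm_smul, Real.norm_eq_abs,
      abs_of_nonneg b.nonneg]
    by_cases hy : dist y x < ε
    · calc b y * ‖y - x‖ ≤ 1 * ‖y - x‖ := by gcongr; exact b.le_one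
        _ < ε := by rwa [one_mul, ← dist_eq_norm]
    · rw [b.zero_of_le_dist (not_lt.mp hy), zero_mul]; exact hε
  · filter_upwards [b.eventuallyEq_one] with y hy
    simp [hy]

/-- The diffeology whose plots are the maps that satisfy a given local condition at every point. -/
@[reducible] def diffeologyOfGerms {X : Type*} (Pl : ∀ {n : ℕ}, (E n → X) → E n → Prop)
    (congr : ∀ {n : ℕ} {p q : E n → X} {x : E n}, p =ᶠ[𝓝 x] q → Pl p x → Pl q x)
    (const : ∀ {n : ℕ} (c : X) (x : E n), Pl (fun _ => c) x)
    (reparam : ∀ {n m : ℕ} {p : E m → X} {f : E n → E m} (x : E n), ContDiff ℝ ∞ f →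
      Pl p (f x) → Pl (p ∘ f) x) : DiffeologicalSpace X where
  plots n := {p | ∀ x : E n, Pl p x}
  constant_plots c := fun x => const c x
  plot_reparam hp hf := fun x => reparam x hf (hp _)
  locality {n p} h := fun x => by
    obtain ⟨u, hu, hx, h'⟩ := h x
    obtain ⟨f, hf, hfu, hfx⟩ := exists_smooth_into hu hx
    exact congr (hfx.mono fun y hy => by simp [hy]) (h' hfu hf x)

/-! ## Differential forms

A complex valued `m`-form on a diffeological space assigns to every plot a smooth `m`-form on the
domain of the plot, compatibly with smooth changes of parameters. On a smooth manifold, with its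
smooth maps `ℝⁿ → M` as plots, this is a smooth `m`-form on `M`, described by its pullbacks. -/

/-- The set of plots with domain `ℝⁿ`. -/
def Plot (X : Type*) [DiffeologicalSpace X] (n : ℕ) : Type _ := {p : E n → X // IsPlot p}

namespace Plot

variable {X Y : Type*} [DiffeologicalSpace X] [DiffeologicalSpace Y]

/-- Reparametrisation of a plot. -/
def comp {n k : ℕ} (p : Plot X n) (f : E k → E n) (hf : ContDiff ℝ ∞ f) : Plot X k :=
  ⟨p.1 ∘ f, isPlot_reparam p.2 hf⟩

/-- Image of a plot under a smooth map. -/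
def map {n : ℕ} (F : X → Y) (hF : DSmooth F) (p : Plot X n) : Plot Y n := ⟨F ∘ p.1, hF _ _ p.2⟩

end Plot

/-- Smooth complex valued differential `m`-forms on a diffeological space. -/
@[ext] structure DForm (X : Type*) [DiffeologicalSpace X] (m : ℕ) where
  /-- The pullback of the form by a plot. -/
  val : ∀ {n : ℕ}, Plot X n → E n → E n [⋀^Fin m]→L[ℝ] ℂ
  smooth : ∀ {n : ℕ} (p : Plot X n), ContDiff ℝ ∞ (val p)
  naturality : ∀ {n k : ℕ} (p : Plot X n) (f : E k → E n) (hf : ContDiff ℝ ∞ f) (x : E k),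
    val (p.comp f hf) x = (val p (f x)).compContinuousLinearMap (fderiv ℝ f x)

lemma two_le_inf : (2 : WithTop ℕ∞) ≤ ∞ :=
  WithTop.coe_le_coe.2 (le_top : (2 : ℕ∞) ≤ ⊤)

namespace DForm

variable {X Y Z : Type*} [DiffeologicalSpace X] [DiffeologicalSpace Y] [DiffeologicalSpace Z]
  {m : ℕ}

instance : Zero (DForm X m) := ⟨⟨fun _ _ => 0, fun _ => contDiff_const, fun _ _ _ _ => by ext; simp⟩⟩

instance : Add (DForm X m) := ⟨fun α β => ⟨fun p x => α.val p x + β.val p x,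
  fun p => (α.smooth p).add (β.smooth p), fun _ _ _ _ => by
    ext; simp [α.naturality, β.naturality]⟩⟩

instance : SMul ℂ (DForm X m) := ⟨fun c α => ⟨fun p x => c • α.val p x,
  fun p => (α.smooth p).const_smul c, fun _ _ _ _ => by ext; simp [α.naturality]⟩⟩

instance : Neg (DForm X m) := ⟨fun α => ⟨fun p x => -α.val p x,
  fun p => (α.smooth p).neg, fun _ _ _ _ => by ext; simp [α.naturality]⟩⟩

@[simp] lemma zero_val {n : ℕ} (p : Plot X n) (x : E n) : (0 : DForm X m).val p x = 0 := rfl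
@[simp] lemma add_val (α β : DForm X m) {n : ℕ} (p : Plot X n) (x : E n) :
    (α + β).val p x = α.val p x + β.val p x := rfl
@[simp] lemma neg_val (α : DForm X m) {n : ℕ} (p : Plot X n) (x : E n) :
    (-α).val p x = -α.val p x := rfl
@[simp] lemma smul_val (c : ℂ) (α : DForm X m) {n : ℕ} (p : Plot X n) (x : E n) :
    (c • α).val p x = c • α.val p x := rfl

lemma ext' {α β : DForm X m} (h : ∀ (n : ℕ) (p : Plot X n) (x : E n), α.val p x = β.val p x) :
    α = β := by
  apply DForm.ext; funext n p x; exact h n p x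

instance : AddCommGroup (DForm X m) where
  add_assoc _ _ _ := ext' fun _ _ _ => add_assoc _ _ _
  zero_add _ := ext' fun _ _ _ => zero_add _
  add_zero _ := ext' fun _ _ _ => add_zero _
  add_comm _ _ := ext' fun _ _ _ => add_comm _ _
  neg_add_cancel _ := ext' fun _ _ _ => neg_add_cancel _
  nsmul := nsmulRec
  zsmul := zsmulRec

/-- Pullback of forms by a smooth map. -/
def pullback (F : X → Y) (hF : DSmooth F) : DForm Y m →+ DForm X m where
  toFun α := ⟨fun p => α.val (p.map F hF), fun _ => α.smooth _,
    fun p f hf x => α.naturality (p.map F hF) f hf x⟩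
  map_zero' := rfl
  map_add' _ _ := rfl

/-- Exterior derivative. -/
def d : DForm X m →+ DForm X (m + 1) where
  toFun α := ⟨fun p => extDeriv (α.val p),
    fun {n} p => by
      have h := (α.smooth p).fderiv_right (m := ∞) (by simp)
      have h2 : ContDiff ℝ ∞
        (ContinuousAlternatingMap.alternatizeUncurryFinCLM ℝ (E n) ℂ (n := m)) :=
        ContinuousLinearMap.contDiff _
      exact h2.comp h,
    fun p f hf x => by
      have h : α.val (p.comp f hf) =
          fun x => (α.val p (f x)).compContinuousLinearMap (fderiv ℝ f x) :=
        funext (α.naturality p f hf)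
      rw [h]
      exact extDeriv_pullback (r := ∞) ((α.smooth p).differentiable (by simp) _)
        hf.contDiffAt (by simpa using two_le_inf)⟩
  map_zero' := ext' fun n p x => by
    change extDeriv (fun _ => 0) x = 0
    ext v; simp [extDeriv, ContinuousAlternatingMap.alternatizeUncurryFin_apply]
  map_add' α β := ext' fun n p x =>
    extDeriv_fun_add ((α.smooth p).differentiable (by simp) _)
      ((β.smooth p).differentiable (by simp) _)

end DForm

section Wedge

variable {V : Type*} [NormedAddCommGroup V] [NormedSpace ℝ V] {a b c : ℕ}

/-- The multilinear map `v ↦ α(v₁, …, vₐ) β(vₐ₊₁, …, vₐ₊ᵦ)`. -/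
def mulMultilinear (h : a + b = c) (α : V [⋀^Fin a]→L[ℝ] ℂ) (β : V [⋀^Fin b]→L[ℝ] ℂ) :
    ContinuousMultilinearMap ℝ (fun _ : Fin c => V) ℂ where
  toMultilinearMap := ((LinearMap.mul' ℝ ℂ).compMultilinearMap
    (MultilinearMap.domCoprod α.toMultilinearMap β.toMultilinearMap)).domDomCongr
      (finSumFinEquiv.trans (finCongr h))
  cont := by
    change Continuous fun v : Fin c → V =>
      α (fun i => v (finCongr h (finSumFinEquiv (Sum.inl i)))) *
        β (fun i => v (finCongr h (finSumFinEquiv (Sum.inr i))))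
    fun_prop

lemma mulMultilinear_apply (h : a + b = c) (α : V [⋀^Fin a]→L[ℝ] ℂ) (β : V [⋀^Fin b]→L[ℝ] ℂ)
    (v : Fin c → V) : mulMultilinear h α β v =
      α (fun i => v (Fin.cast h (Fin.castAdd b i))) *
        β (fun i => v (Fin.cast h (Fin.natAdd a i))) := rfl

/-- The wedge product of alternating forms,
`(α ∧ β)(v) = 1/(a! b!) ∑_σ sgn(σ) α(v_σ(1), …, v_σ(a)) β(v_σ(a+1), …, v_σ(a+b))`. -/
def altWedge (h : a + b = c) (α : V [⋀^Fin a]→L[ℝ] ℂ) (β : V [⋀^Fin b]→L[ℝ] ℂ) :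
    V [⋀^Fin c]→L[ℝ] ℂ :=
  ((a.factorial * b.factorial : ℝ)⁻¹) •
    ContinuousMultilinearMap.alternatization (mulMultilinear h α β)

lemma altWedge_apply (h : a + b = c) (α : V [⋀^Fin a]→L[ℝ] ℂ) (β : V [⋀^Fin b]→L[ℝ] ℂ)
    (v : Fin c → V) : altWedge h α β v = ((a.factorial * b.factorial : ℝ)⁻¹) •
      ∑ σ : Equiv.Perm (Fin c), Equiv.Perm.sign σ •
        (α (fun i => v (σ (Fin.cast h (Fin.castAdd b i)))) *
          β (fun i => v (σ (Fin.cast h (Fin.natAdd a i))))) := by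
  simp [altWedge, ContinuousMultilinearMap.alternatization_apply_apply, mulMultilinear_apply]

instance [FiniteDimensional ℝ V] : FiniteDimensional ℝ (V [⋀^Fin a]→L[ℝ] ℂ) :=
  FiniteDimensional.of_injective
    (V₂ := MultilinearMap ℝ (fun _ : Fin a => V) ℂ)
    { toFun := fun α => α.toMultilinearMap
      map_add' := fun _ _ => rfl
      map_smul' := fun _ _ => rfl }
    (fun α β h => by ext v; exact congrArg (fun f => f v) h)

lemma norm_altWedge_le (h : a + b = c) (α : V [⋀^Fin a]→L[ℝ] ℂ) (β : V [⋀^Fin b]→L[ℝ] ℂ) :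
    ‖altWedge h α β‖ ≤ ((a.factorial * b.factorial : ℝ)⁻¹ * c.factorial) * ‖α‖ * ‖β‖ := by
  refine ContinuousAlternatingMap.opNorm_le_bound _ (by positivity) fun v => ?_
  rw [altWedge_apply, norm_smul, Real.norm_of_nonneg (by positivity)]
  have key : ∀ σ ∈ (Finset.univ : Finset (Equiv.Perm (Fin c))), ‖Equiv.Perm.sign σ •
      (α (fun i => v (σ (Fin.cast h (Fin.castAdd b i)))) *
        β (fun i => v (σ (Fin.cast h (Fin.natAdd a i)))))‖ ≤ ‖α‖ * ‖β‖ * ∏ i, ‖v i‖ := by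
    intro σ _
    have h1 : ‖Equiv.Perm.sign σ •
        (α (fun i => v (σ (Fin.cast h (Fin.castAdd b i)))) *
          β (fun i => v (σ (Fin.cast h (Fin.natAdd a i)))))‖ =
        ‖α (fun i => v (σ (Fin.cast h (Fin.castAdd b i))))‖ *
          ‖β (fun i => v (σ (Fin.cast h (Fin.natAdd a i))))‖ := by
      rcases Int.units_eq_one_or (Equiv.Perm.sign σ) with hs | hs <;> simp [hs]
    have h2 : (∏ i, ‖v i‖) = (∏ i, ‖v (σ (Fin.cast h (Fin.castAdd b i)))‖) *
        ∏ i, ‖v (σ (Fin.cast h (Fin.natAdd a i)))‖ := by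
      subst h
      rw [← Equiv.prod_comp σ, Fin.prod_univ_add]
      rfl
    rw [h1, h2, mul_mul_mul_comm]
    exact mul_le_mul (α.le_opNorm _) (β.le_opNorm _) (norm_nonneg _) (by positivity)
  calc _ ≤ (a.factorial * b.factorial : ℝ)⁻¹ *
        (Fintype.card (Equiv.Perm (Fin c)) * (‖α‖ * ‖β‖ * ∏ i, ‖v i‖)) := by
        gcongr
        refine (norm_sum_le_of_le _ key).trans_eq ?_
        rw [Finset.sum_const, nsmul_eq_mul, Finset.card_univ]
    _ = _ := by rw [Fintype.card_perm, Fintype.card_fin]; ring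

lemma isBoundedBilinearMap_altWedge (h : a + b = c) :
    IsBoundedBilinearMap ℝ
      fun q : (V [⋀^Fin a]→L[ℝ] ℂ) × (V [⋀^Fin b]→L[ℝ] ℂ) => altWedge h q.1 q.2 where
  add_left _ _ _ := by ext; simp [altWedge_apply, add_mul, Finset.sum_add_distrib]
  smul_left r α β := by
    ext v
    rw [ContinuousAlternatingMap.smul_apply, altWedge_apply, altWedge_apply, smul_comm r]
    congr 1
    rw [Finset.smul_sum]
    refine Finset.sum_congr rfl fun σ _ => ?_
    rw [ContinuousAlternatingMap.smul_apply, smul_mul_assoc, smul_comm]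
  add_right _ _ _ := by ext; simp [altWedge_apply, Finset.sum_add_distrib, mul_add]
  smul_right r α β := by
    ext v
    rw [ContinuousAlternatingMap.smul_apply, altWedge_apply, altWedge_apply, smul_comm r]
    congr 1
    rw [Finset.smul_sum]
    refine Finset.sum_congr rfl fun σ _ => ?_
    rw [ContinuousAlternatingMap.smul_apply, mul_smul_comm, smul_comm]
  bound := by
    refine ⟨(a.factorial * b.factorial : ℝ)⁻¹ * c.factorial, by positivity, norm_altWedge_le h⟩

lemma contDiff_altWedge {W : Type*} [NormedAddCommGroup W] [NormedSpace ℝ W] (h : a + b = c)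
    {α : W → V [⋀^Fin a]→L[ℝ] ℂ} {β : W → V [⋀^Fin b]→L[ℝ] ℂ} (hα : ContDiff ℝ ∞ α)
    (hβ : ContDiff ℝ ∞ β) : ContDiff ℝ ∞ fun x => altWedge h (α x) (β x) :=
  ContDiff.comp
    (g := fun q : (V [⋀^Fin a]→L[ℝ] ℂ) × (V [⋀^Fin b]→L[ℝ] ℂ) => altWedge h q.1 q.2)
    (f := fun x => (α x, β x)) (isBoundedBilinearMap_altWedge h).contDiff (hα.prodMk hβ)

end Wedge

namespace DForm

variable {X : Type*} [DiffeologicalSpace X]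

/-- Wedge product of forms. -/
def wedge {a b c : ℕ} (h : a + b = c) (α : DForm X a) (β : DForm X b) : DForm X c where
  val p x := altWedge h (α.val p x) (β.val p x)
  smooth p := contDiff_altWedge h (α.smooth p) (β.smooth p)
  naturality p f hf x := by
    ext v
    simp [altWedge_apply, α.naturality, β.naturality, Function.comp_def]

end DForm


/-! ## Equivariant cochains -/

/-- An action of a (discrete) group by diffeomorphisms. -/
class SmoothAction (Γ X : Type*) [Group Γ] [DiffeologicalSpace X] [MulAction Γ X] : Prop where
  dSmooth_smul : ∀ g : Γ, DSmooth fun x : X => g • x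

section Equivariant

variable (Γ : Type*) [Group Γ] (X Y : Type*) [DiffeologicalSpace X] [DiffeologicalSpace Y]
  [MulAction Γ X] [SmoothAction Γ X] [MulAction Γ Y] [SmoothAction Γ Y]

variable {X} in
/-- The pullback `α ∘ g` of a form by the diffeomorphism `g`. -/
def translate {m : ℕ} (g : Γ) : DForm X m →+ DForm X m :=
  DForm.pullback (fun x => g • x) (SmoothAction.dSmooth_smul g)

/-- Homogeneous cochains of bidegree `(n, m)`: maps `u : Γⁿ⁺¹ → Ωᵐ(X)` with
`u(g₀g, …, gₙg) = u(g₀, …, gₙ) ∘ g`. -/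
def Cochain (n m : ℕ) : AddSubgroup ((Fin (n + 1) → Γ) → DForm X m) where
  carrier := {u | ∀ (s : Fin (n + 1) → Γ) (g : Γ), u (fun i => s i * g) = translate Γ g (u s)}
  zero_mem' _ _ := (map_zero _).symm
  add_mem' hu hv s g := by simp only [Pi.add_apply, map_add, hu s g, hv s g]
  neg_mem' hu s g := by simp only [Pi.neg_apply, map_neg, hu s g]

variable {Γ X Y}

namespace Cochain

/-- The simplicial differential
`(δu)(g₀, …, gₙ₊₁) = (-1)ᵐ ∑ᵢ (-1)ⁱ u(g₀, …, ĝᵢ, …, gₙ₊₁)`. -/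
def delta {n m : ℕ} : Cochain Γ X n m →+ Cochain Γ X (n + 1) m where
  toFun u := ⟨fun s => (-1 : ℤ) ^ m • ∑ i : Fin (n + 2), (-1 : ℤ) ^ (i : ℕ) •
      u.1 (fun j => s (i.succAbove j)), fun s g => by
    simp only [map_zsmul, map_sum]
    congr 1
    exact Finset.sum_congr rfl fun i _ => by rw [u.2 (fun j => s (i.succAbove j)) g]⟩
  map_zero' := by ext1; funext s; simp
  map_add' u v := by
    ext1; funext s
    simp [smul_add, Finset.sum_add_distrib]

/-- The de Rham differential `(du)(g₀, …, gₙ) = d(u(g₀, …, gₙ))`. -/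
def deRham {n m : ℕ} : Cochain Γ X n m →+ Cochain Γ X n (m + 1) where
  toFun u := ⟨fun s => DForm.d (u.1 s), fun s g => by beta_reduce; rw [u.2 s g]; rfl⟩
  map_zero' := by ext1; funext s; exact map_zero _
  map_add' u v := by ext1; funext s; exact map_add _ _ _

/-- The product
`(uv)(g₀, …, gₙ₊ₚ) = (-1)^(n q) u(g₀, …, gₙ) ∧ v(gₙ, …, gₙ₊ₚ)` of cochains `u` of bidegree `(n, m)`
and `v` of bidegree `(p, q)`. -/
def mul {n p N m q M : ℕ} (hN : n + p = N) (hM : m + q = M) (u : Cochain Γ X n m)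
    (v : Cochain Γ X p q) : Cochain Γ X N M :=
  ⟨fun s => (-1 : ℤ) ^ (n * q) • DForm.wedge hM
      (u.1 fun i => s ⟨i, by omega⟩) (v.1 fun j => s ⟨n + j, by omega⟩), fun s g => by
    beta_reduce
    rw [u.2 (fun i => s ⟨i, by omega⟩) g, v.2 (fun j => s ⟨n + j, by omega⟩) g, map_zsmul]
    rfl⟩

/-- The inclusion `Ωᵐ(X) → C⁰ᵐ(X)`, `α(g₀) = α ∘ g₀`. -/
def ofForm {m : ℕ} (α : DForm X m) : Cochain Γ X 0 m :=
  ⟨fun s => translate Γ (s 0) α, fun s g => by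
    apply DForm.ext'
    intro n p x
    change α.val _ x = α.val _ x
    congr 1
    exact Subtype.ext (funext fun y => mul_smul _ _ _)⟩

/-- Pullback of cochains by an equivariant smooth map. -/
def pullback {n m : ℕ} (F : X → Y) (hF : DSmooth F) (hΓ : ∀ (g : Γ) (x : X), F (g • x) = g • F x) :
    Cochain Γ Y n m →+ Cochain Γ X n m where
  toFun u := ⟨fun s => DForm.pullback F hF (u.1 s), fun s g => by
    beta_reduce
    rw [u.2 s g]
    apply DForm.ext'
    intro k p x
    change (u.1 s).val _ x = (u.1 s).val _ x
    congr 1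
    exact Subtype.ext (funext fun y => (hΓ g _).symm)⟩
  map_zero' := by ext1; funext s; exact map_zero _
  map_add' u v := by ext1; funext s; exact map_add _ _ _

end Cochain

variable (Γ X) in
/-- The bigraded group `C^{*,*}`: families of cochains `u n m` of bidegree `(n, m)`. -/
abbrev TotCochain : Type _ := ∀ n m : ℕ, Cochain Γ X n m

namespace TotCochain

/-- The component of bidegree `(n, m)` of `δu`. -/
def deltaComp (u : TotCochain Γ X) : ∀ n m : ℕ, Cochain Γ X n m
  | 0, _ => 0
  | n + 1, m => Cochain.delta (u n m)

/-- The component of bidegree `(n, m)` of `du`. -/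
def deRhamComp (u : TotCochain Γ X) : ∀ n m : ℕ, Cochain Γ X n m
  | _, 0 => 0
  | n, m + 1 => Cochain.deRham (u n m)

/-- The total differential `d + δ`. -/
def D : TotCochain Γ X →+ TotCochain Γ X where
  toFun u := fun n m => deRhamComp u n m + deltaComp u n m
  map_zero' := by
    funext n m
    cases n <;> cases m <;> simp [deRhamComp, deltaComp]
  map_add' u v := by
    funext n m
    cases n <;> cases m <;> (simp [deRhamComp, deltaComp]; try abel)

/-- The product of the bigraded algebra `C^{*,*}`. -/
def mul (u v : TotCochain Γ X) : TotCochain Γ X := fun N M =>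
  ∑ n : Fin (N + 1), ∑ m : Fin (M + 1),
    Cochain.mul (p := N - n) (q := M - m) (by omega) (by omega) (u n m) (v (N - n) (M - m))

/-- A differential form of degree `m` as an equivariant cochain, of bidegree `(0, m)`. -/
def ofForm {m : ℕ} (α : DForm X m) : TotCochain Γ X :=
  Pi.single 0 (Pi.single m (Cochain.ofForm α))

/-- Pullback by an equivariant smooth map. -/
def pullback (F : X → Y) (hF : DSmooth F) (hΓ : ∀ (g : Γ) (x : X), F (g • x) = g • F x) :
    TotCochain Γ Y →+ TotCochain Γ X where
  toFun u := fun n m => Cochain.pullback F hF hΓ (u n m)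
  map_zero' := by funext n m; exact map_zero _
  map_add' u v := by funext n m; exact map_add _ _ _

lemma D_pullback (F : X → Y) (hF : DSmooth F) (hΓ : ∀ (g : Γ) (x : X), F (g • x) = g • F x)
    (u : TotCochain Γ Y) : D (pullback F hF hΓ u) = pullback F hF hΓ (D u) := by
  have h1 : ∀ n m, deRhamComp (pullback F hF hΓ u) n m =
      Cochain.pullback F hF hΓ (deRhamComp u n m) := by
    rintro n (_ | m)
    · exact (map_zero _).symm
    · rfl
  have h2 : ∀ n m, deltaComp (pullback F hF hΓ u) n m =
      Cochain.pullback F hF hΓ (deltaComp u n m) := by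
    rintro (_ | n) m
    · exact (map_zero _).symm
    · ext1; funext s
      change (-1 : ℤ) ^ m • ∑ i : Fin (n + 2), (-1 : ℤ) ^ (i : ℕ) •
        DForm.pullback F hF ((u n m).1 (fun j => s (i.succAbove j))) =
          DForm.pullback F hF ((-1 : ℤ) ^ m • ∑ i : Fin (n + 2), (-1 : ℤ) ^ (i : ℕ) •
            (u n m).1 (fun j => s (i.succAbove j)))
      simp only [map_zsmul, map_sum]
  funext n m
  exact (congrArg₂ (· + ·) (h1 n m) (h2 n m)).trans (map_add _ _ _).symm

variable (Γ X) in
/-- The cochains of total degree `k`. -/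
def degree (k : ℕ) : AddSubgroup (TotCochain Γ X) where
  carrier := {u | ∀ n m : ℕ, n + m ≠ k → u n m = 0}
  zero_mem' _ _ _ := rfl
  add_mem' hu hv n m h := by simp [hu n m h, hv n m h]
  neg_mem' hu n m h := by simp [hu n m h]

variable (Γ X) in
/-- The equivariant cocycles of total degree `k`. -/
def cocycles (k : ℕ) : AddSubgroup (TotCochain Γ X) := degree Γ X k ⊓ (D (Γ := Γ) (X := X)).ker

end TotCochain

variable (Γ X) in
/-- The equivariant cohomology `Hᵏ(X_Γ)`, with complex coefficients: cocycles of total degree `k`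
modulo coboundaries. The total differential being homogeneous, a cochain of degree `k` of the
form `(d + δ)v` is `(d + δ)v'`, with `v'` the component of degree `k - 1` of `v`. -/
abbrev EquivCohomology (k : ℕ) : Type _ :=
  TotCochain.cocycles Γ X k ⧸
    (TotCochain.D (Γ := Γ) (X := X)).range.addSubgroupOf (TotCochain.cocycles Γ X k)

namespace EquivCohomology

variable {k : ℕ}

/-- The class of a cocycle. -/
def mk (u : TotCochain Γ X) (hu : u ∈ TotCochain.cocycles Γ X k) : EquivCohomology Γ X k :=
  QuotientAddGroup.mk ⟨u, hu⟩

/-- The map induced in cohomology by an equivariant smooth map. -/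
def pullback (F : X → Y) (hF : DSmooth F) (hΓ : ∀ (g : Γ) (x : X), F (g • x) = g • F x) :
    EquivCohomology Γ Y k →+ EquivCohomology Γ X k :=
  QuotientAddGroup.map _ _
    (((TotCochain.pullback F hF hΓ).comp (TotCochain.cocycles Γ Y k).subtype).codRestrict
      (TotCochain.cocycles Γ X k) (by
        rintro ⟨u, hu, hu'⟩
        refine ⟨fun n m h => ?_, ?_⟩
        · change Cochain.pullback F hF hΓ (u n m) = 0
          rw [hu n m h, map_zero]
        · have h : TotCochain.D u = 0 := hu'
          change TotCochain.D (TotCochain.pullback F hF hΓ u) = 0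
          rw [TotCochain.D_pullback, h, map_zero]))
    (by
      rintro ⟨u, hu⟩ ⟨v, hv⟩
      refine ⟨TotCochain.pullback F hF hΓ v, ?_⟩
      rw [TotCochain.D_pullback, hv]
      rfl)

end EquivCohomology

end Equivariant

/-! ## The manifold `S¹ × Σ` and its 2-jets of frames -/

/-- The model `ℝ³` of `S¹ × Σ`, with coordinates `(uᵗ, uᶻ)`. -/
abbrev V3 : Type := ℝ × ℂ

/-- The model with corners of `S¹ × Σ` as a real manifold. -/
abbrev IM := (modelWithCornersSelf ℝ (EuclideanSpace ℝ (Fin 1))).prod (modelWithCornersSelf ℝ ℂ)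

section Jets

variable (S : Type*) [TopologicalSpace S] [ChartedSpace ℂ S]

/-- The three-dimensional manifold `M = S¹ × Σ`. -/
abbrev Mfd : Type _ := Circle × S

/-- The plots of `M = S¹ × Σ` are the smooth maps `ℝⁿ → M`. -/
instance : DiffeologicalSpace (Mfd S) :=
  diffeologyOfGerms (fun {n} p x => ContMDiffAt 𝓘(ℝ, E n) IM ∞ p x)
    (fun h hp => hp.congr_of_eventuallyEq h.symm)
    (fun _ _ => contMDiffAt_const)
    (fun x hf hp => ContMDiffAt.comp x hp hf.contDiffAt.contMDiffAt)

variable {S}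

/-- The local coordinates `(t - t₀, z)` of `M` near the point `x = (e^{i t₀}, s)`, with `z` a
holomorphic coordinate of `Σ` near `s`. -/
def coordAt (x : Mfd S) : Mfd S → V3 := fun y =>
  (Complex.arg ((y.1 / x.1 : Circle) : ℂ), chartAt ℂ x.2 y.2)

/-- `j` is the germ at `0` of an orientation-preserving diffeomorphism from a neighbourhood of `0`
in `ℝ³` to an open subset of `M`. -/
def IsFrame (j : V3 → Mfd S) : Prop :=
  (∀ᶠ v in 𝓝 (0 : V3), ContMDiffAt 𝓘(ℝ, V3) IM ∞ j v) ∧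
    0 < (fderiv ℝ (coordAt (j 0) ∘ j) 0).det

/-- `j` and `j'` have the same 2-jet at `0`: the same value at `0`, and the same derivatives of
order one and two after composition with smooth functions (such as local coordinates) on a
neighbourhood of this value. -/
def SameJet (j j' : V3 → Mfd S) : Prop :=
  j 0 = j' 0 ∧ ∀ f : Mfd S → V3, (∀ᶠ y in 𝓝 (j 0), ContMDiffAt IM 𝓘(ℝ, V3) ∞ f y) →
    fderiv ℝ (f ∘ j) 0 = fderiv ℝ (f ∘ j') 0 ∧
      fderiv ℝ (fderiv ℝ (f ∘ j)) 0 = fderiv ℝ (fderiv ℝ (f ∘ j')) 0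

variable (S) in
/-- Equality of 2-jets, as an equivalence relation. -/
def jetSetoid : Setoid {j : V3 → Mfd S // IsFrame j} where
  r j j' := SameJet j.1 j'.1
  iseqv :=
    { refl := fun _ => ⟨rfl, fun _ _ => ⟨rfl, rfl⟩⟩
      symm := fun {j j'} h => ⟨h.1.symm, fun f hf => by
        rw [← h.1] at hf
        exact ⟨(h.2 f hf).1.symm, (h.2 f hf).2.symm⟩⟩
      trans := fun {j j' j''} h h' => ⟨h.1.trans h'.1, fun f hf => by
        have hf' := hf
        rw [h.1] at hf'
        exact ⟨(h.2 f hf).1.trans (h'.2 f hf').1, (h.2 f hf).2.trans (h'.2 f hf').2⟩⟩ }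

variable (S) in
/-- The bundle `J₂⁺` of 2-jets at `0` of orientation-preserving diffeomorphisms `ℝ³ → M`. -/
def J2 : Type _ := Quotient (jetSetoid S)

namespace J2

/-- The 2-jet of `j`. -/
def mk (j : V3 → Mfd S) (hj : IsFrame j) : J2 S := Quotient.mk (jetSetoid S) ⟨j, hj⟩

/-- A germ that represents a given 2-jet. -/
def rep (J : J2 S) : V3 → Mfd S := (Quotient.out (s := jetSetoid S) J).1

/-- The projection `J₂⁺ → M`. -/
def base : J2 S → Mfd S := Quotient.lift (fun j => j.1 0) fun _ _ h => h.1

/-- The plots of `J₂⁺` are, locally, the families `y ↦ (2-jet of F(y, ·))` of jets with `F` smooth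
in all variables. In local coordinates: the coordinates of the jet depend smoothly on `y`. -/
instance : DiffeologicalSpace (J2 S) :=
  diffeologyOfGerms
    (fun {n} p x => ∃ F : E n × V3 → Mfd S,
      (∀ᶠ q in 𝓝 (x, (0 : V3)), ContMDiffAt 𝓘(ℝ, E n × V3) IM ∞ F q) ∧
        ∀ᶠ y in 𝓝 x, ∃ h : IsFrame (fun v => F (y, v)), p y = J2.mk _ h)
    (by
      rintro n p q x hpq ⟨F, hF, hp⟩
      refine ⟨F, hF, ?_⟩
      filter_upwards [hpq, hp] with y hy hp'
      obtain ⟨h, hh⟩ := hp'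
      exact ⟨h, hy ▸ hh⟩)
    (by
      intro n J x
      obtain ⟨⟨j, hj⟩, rfl⟩ := Quotient.exists_rep J
      refine ⟨fun q => j q.2, ?_, Filter.Eventually.of_forall fun y => ⟨hj, rfl⟩⟩
      have h : Filter.Tendsto (fun q : E n × V3 => q.2) (𝓝 (x, 0)) (𝓝 0) :=
        continuous_snd.tendsto _
      filter_upwards [h.eventually hj.1] with q hq
      exact ContMDiffAt.comp q hq contDiff_snd.contDiffAt.contMDiffAt)
    (by
      rintro n m p f x hf ⟨F, hF, hp⟩
      have hg : ContDiff ℝ ∞ fun q : E n × V3 => (f q.1, q.2) :=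
        (hf.comp contDiff_fst).prodMk contDiff_snd
      refine ⟨fun q => F (f q.1, q.2), ?_, ?_⟩
      · have h : Filter.Tendsto (fun q : E n × V3 => (f q.1, q.2)) (𝓝 (x, 0)) (𝓝 (f x, 0)) :=
          hg.continuous.tendsto _
        filter_upwards [h.eventually hF] with q hq
        exact ContMDiffAt.comp q hq hg.contDiffAt.contMDiffAt
      · exact (hf.continuous.tendsto x).eventually hp)

lemma dSmooth_base : DSmooth (base : J2 S → Mfd S) := by
  intro n p hp x
  obtain ⟨F, hF, h⟩ := hp x
  have h1 : ContMDiffAt 𝓘(ℝ, E n) IM ∞ (fun y => F (y, 0)) x :=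
    ContMDiffAt.comp (g := F) (f := fun y : E n => (y, (0 : V3))) x hF.self_of_nhds
      (contDiff_id.prodMk contDiff_const).contDiffAt.contMDiffAt
  refine h1.congr_of_eventuallyEq ?_
  filter_upwards [h] with y hy
  obtain ⟨hy, e⟩ := hy
  exact congrArg base e

end J2

/-- The rotations of `ℝ³`: linear maps of determinant one that preserve `(uᵗ)² + |uᶻ|²`. -/
def IsRotation (A : V3 →L[ℝ] V3) : Prop :=
  (∀ v, (A v).1 ^ 2 + ‖(A v).2‖ ^ 2 = v.1 ^ 2 + ‖v.2‖ ^ 2) ∧ A.det = 1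

variable (S) in
/-- The quotient `P₂ = J₂⁺ / SO₃` by the right action `j ↦ j ∘ A` of `SO₃` on jets. -/
def P2 : Type _ := Quot fun J J' : J2 S => ∃ (j : V3 → Mfd S) (A : V3 →L[ℝ] V3)
  (hj : IsFrame j) (hj' : IsFrame (j ∘ A)), IsRotation A ∧ J = J2.mk j hj ∧ J' = J2.mk (j ∘ A) hj'

namespace P2

/-- The quotient map `J₂⁺ → P₂`. -/
def proj : J2 S → P2 S := Quot.mk _

/-- The quotient diffeology: plots of `P₂` are the maps that lift locally to plots of `J₂⁺`. -/
instance : DiffeologicalSpace (P2 S) :=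
  diffeologyOfGerms
    (fun {n} p x => ∃ P : Plot (J2 S) n, p =ᶠ[𝓝 x] proj ∘ P.1)
    (fun h ⟨P, hP⟩ => ⟨P, h.symm.trans hP⟩)
    (by
      intro n c x
      obtain ⟨J, rfl⟩ := Quot.exists_rep c
      exact ⟨⟨fun _ => J, isPlot_const⟩, Filter.Eventually.of_forall fun _ => rfl⟩)
    (fun x hf ⟨P, hP⟩ => ⟨P.comp _ hf, (hf.continuous.tendsto x).eventually hP⟩)

lemma dSmooth_proj : DSmooth (proj : J2 S → P2 S) :=
  fun _ p hp _ => ⟨⟨p, hp⟩, Filter.Eventually.of_forall fun _ => rfl⟩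

/-- The projection `P₂ → M`. -/
def base : P2 S → Mfd S := Quot.lift J2.base (by
  rintro _ _ ⟨j, A, hj, hj', -, rfl, rfl⟩
  change j 0 = j (A 0)
  rw [map_zero])

lemma dSmooth_base : DSmooth (base : P2 S → Mfd S) := by
  intro n p hp x
  obtain ⟨P, hP⟩ := hp x
  refine (J2.dSmooth_base n P.1 P.2 x).congr_of_eventuallyEq ?_
  filter_upwards [hP] with y hy
  exact congrArg base hy

end P2

/-- `j` is the germ of a map that is a translation on the circle and holomorphic along the
surfaces: `jᵗ(u) = t + uᵗ` and `jᶻ(u)` is holomorphic in `uᶻ`. -/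
def IsHolomorphicGerm (j : V3 → Mfd S) : Prop :=
  ∀ᶠ v in 𝓝 (0 : V3), (j v).1 = (j 0).1 * Circle.exp v.1 ∧
    MDifferentiableAt 𝓘(ℂ, ℂ) 𝓘(ℂ, ℂ) (fun z : ℂ => (j (v.1, z)).2) v.2

variable (S) in
/-- The subbundle of holomorphic 2-jets: the jets of the germs with `jᵗ(u) = t + uᵗ` and `jᶻ(u)`
holomorphic in `uᶻ`, i.e.
`jᶻ(u) = z + yᶻ_z uᶻ + yᶻ_t uᵗ + ½ yᶻ_zz uᶻuᶻ + yᶻ_zt uᶻuᵗ + ½ yᶻ_tt uᵗuᵗ`. -/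
def HolJ2 : Type _ := {J : J2 S // ∃ (j : V3 → Mfd S) (hj : IsFrame j),
  IsHolomorphicGerm j ∧ J = J2.mk j hj}

namespace HolJ2

/-- The subspace diffeology. -/
instance : DiffeologicalSpace (HolJ2 S) where
  plots n := {p : E n → HolJ2 S | (fun y => (p y).1) ∈ DiffeologicalSpace.plots (X := J2 S) n}
  constant_plots c := DiffeologicalSpace.constant_plots (X := J2 S) c.1
  plot_reparam {_ _ p _} hp hf :=
    DiffeologicalSpace.plot_reparam (X := J2 S) (p := fun y => (p y).1) hp hf
  locality {_ p} h := DiffeologicalSpace.locality (X := J2 S) (p := fun y => (p y).1) h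

/-- The inclusion in `J₂⁺`. -/
def incl : HolJ2 S → J2 S := Subtype.val

lemma dSmooth_incl : DSmooth (incl : HolJ2 S → J2 S) := fun _ _ hp => hp

/-- The projection to `M`. -/
def base : HolJ2 S → Mfd S := J2.base ∘ incl

lemma dSmooth_base : DSmooth (base : HolJ2 S → Mfd S) := J2.dSmooth_base.comp dSmooth_incl

end HolJ2

/-! ## Groups of loops of conformal transformations -/

/-- `Γ` acts on `M = S¹ × Σ` by orientation-preserving diffeomorphisms, leaving every fibre `{t} × Σ`
invariant and restricting to conformal transformations of the fibres. -/
class IsConformalLoopAction (Γ S : Type*) [TopologicalSpace S] [ChartedSpace ℂ S] [Group Γ]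
    [MulAction Γ (Mfd S)] : Prop where
  contMDiff_smul : ∀ g : Γ, ContMDiff IM IM ∞ fun x : Mfd S => g • x
  orientation : ∀ (g : Γ) (j : V3 → Mfd S), IsFrame j →
    0 < (fderiv ℝ (coordAt (g • j 0) ∘ fun v => g • j v) 0).det
  smul_fst : ∀ (g : Γ) (x : Mfd S), (g • x).1 = x.1
  conformal : ∀ (g : Γ) (t : Circle), MDifferentiable 𝓘(ℂ, ℂ) 𝓘(ℂ, ℂ) fun s : S => (g • (t, s)).2

section Action

variable {Γ : Type*} [Group Γ] [MulAction Γ (Mfd S)] [IsConformalLoopAction Γ S]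

instance : SmoothAction Γ (Mfd S) where
  dSmooth_smul g _ _ hp x :=
    (IsConformalLoopAction.contMDiff_smul g).contMDiffAt.comp x (hp x)

lemma IsFrame.smul {j : V3 → Mfd S} (hj : IsFrame j) (g : Γ) : IsFrame fun v => g • j v :=
  ⟨hj.1.mono fun v hv => (IsConformalLoopAction.contMDiff_smul g).contMDiffAt.comp v hv,
    IsConformalLoopAction.orientation g j hj⟩

lemma SameJet.smul {j j' : V3 → Mfd S} (h : SameJet j j') (g : Γ) :
    SameJet (fun v => g • j v) fun v => g • j' v := by
  refine ⟨congrArg (g • ·) h.1, fun f hf => h.2 (fun x => f (g • x)) ?_⟩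
  have hg := IsConformalLoopAction.contMDiff_smul (S := S) g
  filter_upwards [(hg.continuous.tendsto (j 0)).eventually hf] with y hy
  exact ContMDiffAt.comp y hy hg.contMDiffAt

/-- The action of `Γ` on `J₂⁺` by left composition of jets. -/
instance : MulAction Γ (J2 S) where
  smul g := Quotient.map (fun j => ⟨fun v => g • j.1 v, j.2.smul g⟩) fun _ _ h => SameJet.smul h g
  one_smul J := by
    obtain ⟨j, rfl⟩ := Quotient.exists_rep J
    exact congrArg (Quotient.mk _) (Subtype.ext (funext fun v => one_smul Γ (j.1 v)))
  mul_smul g g' J := by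
    obtain ⟨j, rfl⟩ := Quotient.exists_rep J
    exact congrArg (Quotient.mk _) (Subtype.ext (funext fun v => mul_smul g g' (j.1 v)))

lemma J2.smul_mk (g : Γ) (j : V3 → Mfd S) (hj : IsFrame j) :
    g • J2.mk j hj = J2.mk (fun v => g • j v) (hj.smul g) := rfl

lemma J2.base_smul (g : Γ) (J : J2 S) : J2.base (g • J) = g • J2.base J := by
  obtain ⟨j, rfl⟩ := Quotient.exists_rep J
  rfl

instance : SmoothAction Γ (J2 S) where
  dSmooth_smul g n p hp x := by
    obtain ⟨F, hF, h⟩ := hp x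
    refine ⟨fun q => g • F q, ?_, ?_⟩
    · filter_upwards [hF] with q hq
      exact (IsConformalLoopAction.contMDiff_smul g).contMDiffAt.comp q hq
    · filter_upwards [h] with y hy
      obtain ⟨hy, e⟩ := hy
      exact ⟨hy.smul g, congrArg (g • ·) e⟩

/-- The induced action of `Γ` on `P₂`. -/
instance : MulAction Γ (P2 S) where
  smul g := Quot.map (g • ·) (by
    rintro _ _ ⟨j, A, hj, hj', hA, rfl, rfl⟩
    exact ⟨fun v => g • j v, A, hj.smul g, hj'.smul g, hA, rfl, rfl⟩)
  one_smul P := by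
    obtain ⟨J, rfl⟩ := Quot.exists_rep P
    exact congrArg P2.proj (one_smul Γ J)
  mul_smul g g' P := by
    obtain ⟨J, rfl⟩ := Quot.exists_rep P
    exact congrArg P2.proj (mul_smul g g' J)

lemma P2.base_smul (g : Γ) (P : P2 S) : P2.base (g • P) = g • P2.base P := by
  obtain ⟨J, rfl⟩ := Quot.exists_rep P
  exact J2.base_smul g J

instance : SmoothAction Γ (P2 S) where
  dSmooth_smul g n p hp x := by
    obtain ⟨P, hP⟩ := hp x
    refine ⟨P.map _ (SmoothAction.dSmooth_smul g), ?_⟩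
    filter_upwards [hP] with y hy
    exact congrArg (g • ·) hy

lemma IsHolomorphicGerm.smul {j : V3 → Mfd S} (h : IsHolomorphicGerm j) (g : Γ) :
    IsHolomorphicGerm fun v => g • j v := by
  filter_upwards [h.eventually_nhds] with v hv
  refine ⟨by simpa only [IsConformalLoopAction.smul_fst] using hv.self_of_nhds.1, ?_⟩
  have h1 := (IsConformalLoopAction.conformal g (j v).1) (j v).2
  have h2 := MDifferentiableAt.comp (g := fun s => (g • ((j v).1, s)).2)
    (f := fun z : ℂ => (j (v.1, z)).2) v.2 h1 hv.self_of_nhds.2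
  refine h2.congr_of_eventuallyEq ?_
  have hc : Filter.Tendsto (fun z : ℂ => (v.1, z)) (𝓝 v.2) (𝓝 v) :=
    (Continuous.prodMk_right v.1).tendsto v.2
  filter_upwards [hc.eventually hv] with z hz
  have e : j (v.1, z) = ((j v).1, (j (v.1, z)).2) :=
    Prod.ext (hz.1.trans hv.self_of_nhds.1.symm) rfl
  exact congrArg (fun x => (g • x).2) e

/-- The action of `Γ` on the bundle of holomorphic 2-jets. -/
instance : MulAction Γ (HolJ2 S) where
  smul g J := ⟨g • J.1, by
    obtain ⟨j, hj, hol, e⟩ := J.2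
    exact ⟨_, hj.smul g, hol.smul g, by rw [e]; rfl⟩⟩
  one_smul J := Subtype.ext (one_smul Γ J.1)
  mul_smul g g' J := Subtype.ext (mul_smul g g' J.1)

lemma HolJ2.base_smul (g : Γ) (J : HolJ2 S) : HolJ2.base (g • J) = g • HolJ2.base J :=
  J2.base_smul g J.1

instance : SmoothAction Γ (HolJ2 S) where
  dSmooth_smul g n p hp :=
    SmoothAction.dSmooth_smul (X := J2 S) g n (fun y => (p y).1) (HolJ2.dSmooth_incl n p hp)

end Action

/-! ## The tautological connection and the first Pontrjagin form -/

namespace J2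

/-- The coordinates `y = (y^μ_i)` of a jet, with respect to local coordinates `κ` on `M`. -/
def coordY (κ : Mfd S → V3) (J : J2 S) : V3 →L[ℝ] V3 := fderiv ℝ (κ ∘ J.rep) 0

/-- The coordinates `(y^μ_{ij})` of a jet, with respect to local coordinates `κ` on `M`. -/
def coordYY (κ : Mfd S → V3) (J : J2 S) : V3 →L[ℝ] V3 →L[ℝ] V3 :=
  fderiv ℝ (fderiv ℝ (κ ∘ J.rep)) 0

/-- The linear coordinates `(uᵗ, Re uᶻ, Im uᶻ)` of `ℝ³`. -/
def coord : Fin 3 → V3 → ℝ := ![fun v => v.1, fun v => v.2.re, fun v => v.2.im]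

/-- The basis of `ℝ³` dual to these coordinates. -/
def vec : Fin 3 → V3 := ![(1, 0), (0, 1), (0, Complex.I)]

/-- The value at `x` on the tangent vector `w` of the pullback by `p : ℝⁿ → J₂⁺` of the
matrix-valued 1-form `θ = y⁻¹ dy - y⁻¹ y₂(y⁻¹ dx, ·)`, that is
`θ^i_j = (y⁻¹)^i_μ dy^μ_j - y^μ_{jk} (y⁻¹)^i_μ (y⁻¹)^k_ν dx^ν`. -/
def tautValue {n : ℕ} (p : E n → J2 S) (x w : E n) : V3 →L[ℝ] V3 :=
  let κ := coordAt (base (p x))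
  let yinv := (coordY κ (p x)).inverse
  yinv ∘L (fderiv ℝ (fun x' => coordY κ (p x')) x w -
    coordYY κ (p x) (yinv (fderiv ℝ (fun x' => κ (base (p x'))) x w)))

/-- `θ` is the matrix of the tautological connection forms `θ^i_j` on `J₂⁺`. -/
def IsTautological (θ : Fin 3 → Fin 3 → DForm (J2 S) 1) : Prop :=
  ∀ (i j : Fin 3) (n : ℕ) (p : Plot (J2 S) n) (x w : E n),
    (θ i j).val p x ![w] = (coord i (tautValue p.1 x w (vec j)) : ℂ)

/-- The curvature `R^i_j = dθ^i_j + θ^i_k θ^k_j`. -/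
def curvature (θ : Fin 3 → Fin 3 → DForm (J2 S) 1) (i j : Fin 3) : DForm (J2 S) 2 :=
  DForm.d (θ i j) + ∑ k, DForm.wedge rfl (θ i k) (θ k j)

/-- The first Pontrjagin form `p₁ = c₂(R) = ½ (R^i_i R^j_j - R^i_j R^j_i)`. -/
def pontrjagin (θ : Fin 3 → Fin 3 → DForm (J2 S) 1) : DForm (J2 S) 4 :=
  (1 / 2 : ℂ) • (DForm.wedge rfl (∑ i, curvature θ i i) (∑ j, curvature θ j j) -
    ∑ i, ∑ j, DForm.wedge rfl (curvature θ i j) (curvature θ j i))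

end J2

/-! ## The connection of a Kähler metric -/

variable (S) in
/-- A Kähler metric `ρ dz ⊗ dz̄` on a Riemann surface: a positive smooth function `ρ` in every
holomorphic coordinate `z = φ`, with the transformation rule of the coefficient of `dz ⊗ dz̄`. -/
structure KahlerMetric where
  /-- The coefficient `ρ` in the holomorphic coordinate `φ`. -/
  coeff : OpenPartialHomeomorph S ℂ → ℂ → ℝ
  smooth : ∀ φ ∈ IsManifold.maximalAtlas 𝓘(ℂ, ℂ) ω S, ContDiffOn ℝ ∞ (coeff φ) φ.target
  pos : ∀ φ ∈ IsManifold.maximalAtlas 𝓘(ℂ, ℂ) ω S, ∀ z ∈ φ.target, 0 < coeff φ z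
  transform : ∀ φ ∈ IsManifold.maximalAtlas 𝓘(ℂ, ℂ) ω S,
    ∀ ψ ∈ IsManifold.maximalAtlas 𝓘(ℂ, ℂ) ω S, ∀ z ∈ (φ.symm.trans ψ).source,
      coeff φ z = coeff ψ (ψ (φ.symm z)) * ‖deriv (fun z => ψ (φ.symm z)) z‖ ^ 2

/-- The derivative `∂f/∂z = ½ (∂f/∂x - i ∂f/∂y)` of a real function. -/
def dz (f : ℂ → ℝ) (z : ℂ) : ℂ :=
  (1 / 2) * (fderiv ℝ f z 1 - Complex.I * fderiv ℝ f z Complex.I)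

namespace HolJ2

/-- The coordinate `yᶻ_z` of a holomorphic jet, with respect to a holomorphic coordinate `z = φ`. -/
def coordYzz (φ : OpenPartialHomeomorph S ℂ) (J : HolJ2 S) : ℂ :=
  fderiv ℝ (fun v => φ (J.1.rep v).2) 0 ((0, 1) : V3)

/-- `α` is the connection form `(y⁻¹)ᶻ_z dyᶻ_z + dz ∂_z ln ρ` associated with the metric `ρ`, in every
holomorphic coordinate `z = φ` of `Σ`. -/
def IsConnection (ρ : KahlerMetric S) (α : DForm (HolJ2 S) 1) : Prop :=
  ∀ φ ∈ IsManifold.maximalAtlas 𝓘(ℂ, ℂ) ω S, ∀ (n : ℕ) (p : Plot (HolJ2 S) n) (x w : E n),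
    (base (p.1 x)).2 ∈ φ.source → α.val p x ![w] =
      (coordYzz φ (p.1 x))⁻¹ * fderiv ℝ (fun x' => coordYzz φ (p.1 x')) x w +
        dz (fun z => Real.log (ρ.coeff φ z)) (φ (base (p.1 x)).2) *
          fderiv ℝ (fun x' => φ (base (p.1 x')).2) x w

end HolJ2

end Jets

end

end EquivJet

open EquivJet

/-! The two classes are compared on a third space over `M`: the space `HolP2` of holomorphic 2-jets
up to rotation, which maps equivariantly both to `P₂` and to `M`.

Cohomology is moved between these spaces by one principle. Let `f : X → Y` be equivariant, with
plots lifting locally, and let the fibres of `f` be smoothly contractible by a homotopy that need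
not be equivariant. Fibre integration over the homotopy gives an operator `K` on forms with `dK + Kd
= 1 - h₀*`, where `h₀*` has values in the pullbacks from `Y`, and `K` kills pullbacks from `Y`.
Conjugated by the last group argument, `K` acts on equivariant cochains. It does not commute with
`δ`, but subtracting `D(Ku)` makes a cochain with basic differential basic in one more simplicial
degree (`TotCochain.sub_D_homotopyOp_mem_range`), and finitely many corrections suffice in a fixed
total degree. Hence pullback is injective in degrees at least two and surjective in degrees at least
one, in particular bijective in degree four.

The fibres of `P₂ → M` contract because of the metric `dt² + ρ|dz|²` and its Levi-Civita connection.
A jet up to rotation amounts to an inner product on `ℝ³` (the metric read in the frame) and a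
covariant second derivative; inner products form a convex set, and the covariant second derivative
can be scaled to zero. Gram–Schmidt turns the path of inner products into a path of frames
(`P2.isFibreContraction_contract`). For holomorphic jets the change of frame is kept of the form `uᶻ
↦ a uᶻ + b uᵗ` with `uᵗ` fixed, so that holomorphy survives (`HolP2.isFibreContraction_contract`).

The curvature `Ω = Dω` descends to `M` because along two lifts of the same plot of `M` the
connection form differs by `f⁻¹ df`, with `f` the quotient of the two coordinates `yᶻ_z`. This form
is closed, and `f` does not change when both lifts are moved by the same element of `Γ`
(`HolJ2.descends_D_conn`). The Pontrjagin form descends to `P₂` because rotations act on the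
curvature by conjugation, and it is closed because at any given point a gauge can be chosen in which
the connection vanishes.

On holomorphic jets the matrix `θ` has vanishing `t`-row, and its lower block is multiplication by
the complex form `θᶻ_z = a + i b`. Consequently `p₁` becomes `da² + db²`, which for `R = dθᶻ_z`
equals `-R² + d(R a + a R)` (`HolJ2.pullback_pontrjagin`). Up to rotation the factor `f` above has
modulus one; so `a`, `R` and `β = ω - θᶻ_z` all live on `HolP2`, and there `Ω = R + Dβ`. Squaring,
`-Ω²` and `p₁` are cohomologous on `HolP2` (`HolP2.exists_D_eq`). The unique class on `M` that pulls
back to `p₁` on `P₂` therefore has the same pullback to `HolP2` as `-Ω²`, and injectivity for `HolP2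
→ M` identifies the two. -/

namespace EquivJet

/-! ### Signed sums over permutations. -/

section Antisymmetrization

variable {V W : Type*} [AddCommGroup W] {N : ℕ}

/-- The signed sum of a function of `N` vectors over all permutations of its arguments. -/
def asum (m : (Fin N → V) → W) (v : Fin N → V) : W :=
  ∑ σ : Equiv.Perm (Fin N), Equiv.Perm.sign σ • m (fun i => v (σ i))

lemma asum_perm (m : (Fin N → V) → W) (τ : Equiv.Perm (Fin N)) (v : Fin N → V) :
    asum (fun v => m (fun i => v (τ i))) v = Equiv.Perm.sign τ • asum m v := by
  unfold asum
  rw [Finset.smul_sum, ← Equiv.sum_comp (Equiv.mulRight τ)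
    (fun σ => Equiv.Perm.sign τ • Equiv.Perm.sign σ • m fun i => v (σ i))]
  refine Finset.sum_congr rfl fun σ _ => ?_
  rw [Equiv.coe_mulRight, Equiv.Perm.sign_mul, smul_smul]
  congr 1
  rcases Int.units_eq_one_or (Equiv.Perm.sign τ) with h | h <;> simp [h]

lemma asum_congr {m m' : (Fin N → V) → W} (h : ∀ v, m v = m' v) (v : Fin N → V) :
    asum m v = asum m' v := by
  rw [funext h]

lemma asum_finset_sum {ι : Type*} (s : Finset ι) (m : ι → (Fin N → V) → W) (v : Fin N → V) :
    asum (fun v => ∑ i ∈ s, m i v) v = ∑ i ∈ s, asum (m i) v := by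
  unfold asum
  simp only [Finset.smul_sum]
  exact Finset.sum_comm

lemma asum_units_smul (c : ℤˣ) (m : (Fin N → V) → W) (v : Fin N → V) :
    asum (fun v => c • m v) v = c • asum m v := by
  unfold asum
  rw [Finset.smul_sum]
  refine Finset.sum_congr rfl fun σ _ => ?_
  rw [smul_smul, smul_smul, mul_comm]

/-- Each inner permutation is absorbed by the outer sum at the cost of its sign, which cancels the
sign already present; the `k!` inner terms therefore contribute equally. This is how iterated
antisymmetrizations are merged into one. -/
lemma asum_sum_perm {k : ℕ} (ι : Equiv.Perm (Fin k) → Equiv.Perm (Fin N))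
    (hι : ∀ τ, Equiv.Perm.sign (ι τ) = Equiv.Perm.sign τ) (m : (Fin N → V) → W) (v : Fin N → V) :
    asum (fun v => ∑ τ : Equiv.Perm (Fin k), Equiv.Perm.sign τ • m (fun i => v (ι τ i))) v =
      k.factorial • asum m v := by
  rw [asum_finset_sum]
  simp only [asum_units_smul]
  rw [Finset.sum_congr rfl (g := fun _ => asum m v), Finset.sum_const, Finset.card_univ,
    Fintype.card_perm, Fintype.card_fin]
  intro τ _
  rw [asum_perm, hι, smul_smul, Int.units_mul_self, one_smul]

lemma asum_smul {R : Type*} [Ring R] [Module R W] (c : R) (m : (Fin N → V) → W) (v : Fin N → V) :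
    asum (fun v => c • m v) v = c • asum m v := by
  unfold asum
  rw [Finset.smul_sum]
  refine Finset.sum_congr rfl fun σ _ => ?_
  rw [smul_comm]

end Antisymmetrization

section Products

variable {V : Type*} {a b c : ℕ}

/-- A permutation of the first block, extended by the identity on the second, is a permutation of
all arguments with the same sign, so `asum_sum_perm` applies. -/
lemma smul_asum_mul_right {h : a + b = c} (m : (Fin a → V) → ℂ) (n : (Fin b → V) → ℂ)
    (v : Fin c → V) :
    asum (fun v => asum m (fun i => v (Fin.cast h (Fin.castAdd b i))) *
      n (fun i => v (Fin.cast h (Fin.natAdd a i)))) v = a.factorial •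
    asum (fun v => m (fun i => v (Fin.cast h (Fin.castAdd b i))) *
      n (fun i => v (Fin.cast h (Fin.natAdd a i)))) v := by
  subst h
  rw [← asum_sum_perm (fun τ => finSumFinEquiv.permCongr (Equiv.Perm.sumCongr τ 1))
    (fun τ => by simp [Equiv.Perm.sign_permCongr, Equiv.Perm.sign_sumCongr])]
  refine asum_congr (fun v => ?_) v
  rw [asum, Finset.sum_mul]
  refine Finset.sum_congr rfl fun τ _ => ?_
  simp [Equiv.permCongr_apply, smul_mul_assoc]

lemma smul_asum_mul_left {h : a + b = c} (m : (Fin a → V) → ℂ) (n : (Fin b → V) → ℂ)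
    (v : Fin c → V) :
    asum (fun v => m (fun i => v (Fin.cast h (Fin.castAdd b i))) *
      asum n (fun i => v (Fin.cast h (Fin.natAdd a i)))) v = b.factorial •
    asum (fun v => m (fun i => v (Fin.cast h (Fin.castAdd b i))) *
      n (fun i => v (Fin.cast h (Fin.natAdd a i)))) v := by
  subst h
  rw [← asum_sum_perm (fun τ => finSumFinEquiv.permCongr (Equiv.Perm.sumCongr 1 τ))
    (fun τ => by simp [Equiv.Perm.sign_permCongr, Equiv.Perm.sign_sumCongr])]
  refine asum_congr (fun v => ?_) v
  rw [asum, Finset.mul_sum]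
  refine Finset.sum_congr rfl fun τ _ => ?_
  simp [Equiv.permCongr_apply, mul_smul_comm]

/-- The permutations of the tail are those permutations of all arguments that fix the first one,
with the same sign. -/
lemma asum_tail (m : V → (Fin a → V) → ℂ) (v : Fin (a + 1) → V) :
    asum (fun v => asum (m (v 0)) (fun i => v i.succ)) v = a.factorial •
      asum (fun v => m (v 0) (fun i => v i.succ)) v := by
  rw [← asum_sum_perm (fun τ => Equiv.Perm.decomposeFin.symm (0, τ))
    (fun τ => by simp)]
  refine asum_congr (fun v => ?_) v
  rw [asum]
  refine Finset.sum_congr rfl fun τ _ => ?_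
  simp

end Products

/-! ### The Leibniz rule for the wedge product. -/

section Wedge

variable {V : Type*} [NormedAddCommGroup V] [NormedSpace ℝ V] {a b c : ℕ}

lemma asum_alternating (α : V [⋀^Fin a]→L[ℝ] ℂ) (v : Fin a → V) :
    asum α v = a.factorial • α v := by
  unfold asum
  rw [Finset.sum_congr rfl (g := fun _ => α v), Finset.sum_const, Finset.card_univ,
    Fintype.card_perm, Fintype.card_fin]
  intro σ _
  have := α.toAlternatingMap.map_perm v σ
  change Equiv.Perm.sign σ • α (v ∘ σ) = _
  change α (v ∘ σ) = Equiv.Perm.sign σ • α v at this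
  rw [this, smul_smul, Int.units_mul_self, one_smul]

lemma altWedge_eq_asum (h : a + b = c) (α : V [⋀^Fin a]→L[ℝ] ℂ) (β : V [⋀^Fin b]→L[ℝ] ℂ)
    (v : Fin c → V) : altWedge h α β v = ((a.factorial * b.factorial : ℝ)⁻¹) •
      asum (fun v => α (fun i => v (Fin.cast h (Fin.castAdd b i))) *
          β (fun i => v (Fin.cast h (Fin.natAdd a i)))) v := altWedge_apply h α β v

/-- `alternatizeUncurryFin f` already sums over the choice of the first argument. Antisymmetrizing
it gives `a + 1` equal terms on the one hand and `(a + 1)!` copies of an alternating map on the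
other; dividing by `a + 1` leaves `a!`. Both sides of the Leibniz rule can thus be written as plain
signed sums. -/
lemma asum_uncurry (f : V →L[ℝ] V [⋀^Fin a]→L[ℝ] ℂ) (v : Fin (a + 1) → V) :
    asum (fun v => f (v 0) (fun i => v i.succ)) v =
      (a.factorial : ℝ) • ContinuousAlternatingMap.alternatizeUncurryFin f v := by
  have h1 := asum_alternating (ContinuousAlternatingMap.alternatizeUncurryFin f) v
  have h2 : asum (fun v => ContinuousAlternatingMap.alternatizeUncurryFin f v) v =
      (a + 1) • asum (fun v => f (v 0) (fun i => v i.succ)) v := by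
    simp only [ContinuousAlternatingMap.alternatizeUncurryFin_apply]
    rw [asum_finset_sum, Finset.sum_congr rfl
      (g := fun _ => asum (fun v => f (v 0) (fun i => v i.succ)) v), Finset.sum_const,
      Finset.card_univ, Fintype.card_fin]
    intro i _
    -- The inverse of `i.cycleRange` puts `v i` in front and keeps the order of the others. Its sign
    -- `(-1)^i` cancels the sign of the term.
    have h3 := asum_perm (fun v => f (v 0) (fun i => v i.succ)) i.cycleRange.symm v
    simp only [Fin.cycleRange_symm_zero, Fin.cycleRange_symm_succ, Equiv.Perm.sign_symm,
      Fin.sign_cycleRange] at h3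
    have h4 : asum (fun v => (-1 : ℤ) ^ (i : ℕ) • f (v i) (i.removeNth v)) v =
        (-1 : ℤ) ^ (i : ℕ) • asum (fun v => f (v i) (i.removeNth v)) v := asum_smul _ _ _
    rw [h4]
    change (-1 : ℤ) ^ (i : ℕ) • asum (fun v => f (v i) (fun j => v (i.succAbove j))) v = _
    rw [h3, Units.smul_def, smul_smul]
    simp [← mul_pow]
  rw [h2, Nat.factorial_succ, mul_smul] at h1
  have h5 := smul_right_injective ℂ (Nat.succ_ne_zero a) h1
  rw [h5, Nat.cast_smul_eq_nsmul]

/-- The contribution of the first factor to the exterior derivative of a wedge product. -/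
lemma alternatizeUncurryFin_altWedge_left (h : a + b = c) (h' : a + 1 + b = c + 1)
    (f : V →L[ℝ] V [⋀^Fin a]→L[ℝ] ℂ) (β : V [⋀^Fin b]→L[ℝ] ℂ)
    (F : V →L[ℝ] V [⋀^Fin c]→L[ℝ] ℂ) (hF : ∀ x, F x = altWedge h (f x) β) :
    ContinuousAlternatingMap.alternatizeUncurryFin F =
      altWedge h' (ContinuousAlternatingMap.alternatizeUncurryFin f) β := by
  ext v
  have h1 := asum_uncurry F v
  simp only [hF, altWedge_eq_asum] at h1
  -- `F` is itself an antisymmetrization over the last `c` arguments; merging it into the one over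
  -- all `c + 1` arguments costs the factor `c!`, which cancels the `c!` produced by `asum_uncurry`.
  rw [asum_smul, asum_tail (fun x v => f x (fun i => v (Fin.cast h (Fin.castAdd b i))) *
          β (fun i => v (Fin.cast h (Fin.natAdd a i))))] at h1
  rw [altWedge_eq_asum]
  have h2 : ∀ v : Fin (c + 1) → V,
      ContinuousAlternatingMap.alternatizeUncurryFin f
        (fun i => v (Fin.cast h' (Fin.castAdd b i))) * β (fun i => v (Fin.cast h' (Fin.natAdd _ i)))
      = (a.factorial : ℝ)⁻¹ • (asum (fun v => f (v 0) (fun i => v i.succ))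
        (fun i => v (Fin.cast h' (Fin.castAdd b i))) *
          β (fun i => v (Fin.cast h' (Fin.natAdd _ i)))) := by
    intro v
    rw [asum_uncurry, smul_mul_assoc, inv_smul_smul₀]
    exact_mod_cast a.factorial_ne_zero
  rw [asum_congr h2, asum_smul, smul_asum_mul_right]
  have h3 : (c.factorial : ℝ) ≠ 0 := by exact_mod_cast c.factorial_ne_zero
  have h4 : ((a + 1).factorial : ℝ) ≠ 0 := by exact_mod_cast (a + 1).factorial_ne_zero
  have h5 : asum (fun v : Fin (c + 1) → V =>
      f (v (Fin.cast h' (Fin.castAdd b 0))) (fun i => v (Fin.cast h' (Fin.castAdd b i.succ))) *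
        β (fun i => v (Fin.cast h' (Fin.natAdd (a + 1) i)))) v =
      asum (fun v => f (v 0) (fun i => v (Fin.cast h (Fin.castAdd b i)).succ) *
        β (fun i => v (Fin.cast h (Fin.natAdd a i)).succ)) v := by
    refine asum_congr (fun v => ?_) v
    congr 2
    funext i
    congr 1
    ext; simp; omega
  rw [h5]
  rw [← inv_smul_smul₀ h3 (ContinuousAlternatingMap.alternatizeUncurryFin F v), ← h1,
    ← Nat.cast_smul_eq_nsmul ℝ, ← Nat.cast_smul_eq_nsmul ℝ, smul_smul, smul_smul, smul_smul,
    smul_smul]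
  congr 1
  field_simp

/-- The contribution of the second factor to the exterior derivative of a wedge product. -/
lemma alternatizeUncurryFin_altWedge_right (h : a + b = c) (h' : a + (b + 1) = c + 1)
    (α : V [⋀^Fin a]→L[ℝ] ℂ) (f : V →L[ℝ] V [⋀^Fin b]→L[ℝ] ℂ)
    (F : V →L[ℝ] V [⋀^Fin c]→L[ℝ] ℂ) (hF : ∀ x, F x = altWedge h α (f x)) :
    ContinuousAlternatingMap.alternatizeUncurryFin F =
      (-1 : ℤ) ^ a • altWedge h' α (ContinuousAlternatingMap.alternatizeUncurryFin f) := by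
  ext v
  have h1 := asum_uncurry F v
  simp only [hF, altWedge_eq_asum] at h1
  rw [asum_smul, asum_tail (fun x v => α (fun i => v (Fin.cast h (Fin.castAdd b i))) *
          f x (fun i => v (Fin.cast h (Fin.natAdd a i))))] at h1
  rw [ContinuousAlternatingMap.smul_apply, altWedge_eq_asum]
  have h2 : ∀ v : Fin (c + 1) → V,
      α (fun i => v (Fin.cast h' (Fin.castAdd _ i))) *
        ContinuousAlternatingMap.alternatizeUncurryFin f
          (fun i => v (Fin.cast h' (Fin.natAdd _ i)))
      = (b.factorial : ℝ)⁻¹ • (α (fun i => v (Fin.cast h' (Fin.castAdd _ i))) *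
         asum (fun v => f (v 0) (fun i => v i.succ))
          (fun i => v (Fin.cast h' (Fin.natAdd _ i)))) := by
    intro v
    rw [asum_uncurry, mul_smul_comm, inv_smul_smul₀]
    exact_mod_cast b.factorial_ne_zero
  rw [asum_congr h2, asum_smul, smul_asum_mul_left]
  have h3 : (c.factorial : ℝ) ≠ 0 := by exact_mod_cast c.factorial_ne_zero
  have h4 : ((b + 1).factorial : ℝ) ≠ 0 := by exact_mod_cast (b + 1).factorial_ne_zero
  have ha : a < c + 1 := by omega
  -- The vector along which one differentiates is moved past the `a` arguments of `α`. The sign of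
  -- this cycle is the sign `(-1)^a` of the Leibniz rule.
  have h5 := asum_perm (fun v : Fin (c + 1) → V =>
      α (fun i => v (Fin.cast h (Fin.castAdd b i)).succ) *
        f (v 0) (fun i => v (Fin.cast h (Fin.natAdd a i)).succ))
      (Fin.cycleRange ⟨a, ha⟩).symm v
  simp only [Fin.cycleRange_symm_zero, Fin.cycleRange_symm_succ, Equiv.Perm.sign_symm,
      Fin.sign_cycleRange] at h5
  have h6 : asum (fun v : Fin (c + 1) → V =>
      α (fun i => v (Fin.cast h' (Fin.castAdd (b + 1) i))) *
      f (v (Fin.cast h' (Fin.natAdd a 0))) (fun i => v (Fin.cast h' (Fin.natAdd a i.succ)))) v =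
      asum (fun v => α (fun i => v (Fin.succAbove ⟨a, ha⟩ (Fin.cast h (Fin.castAdd b i)))) *
        f (v ⟨a, ha⟩) (fun i => v (Fin.succAbove ⟨a, ha⟩ (Fin.cast h (Fin.natAdd a i))))) v := by
    refine asum_congr (fun v => ?_) v
    congr 2
    · funext i
      congr 1
      ext; simp [Fin.succAbove, Fin.lt_def]
    · funext i
      congr 1
      ext; simp [Fin.succAbove, Fin.lt_def]; omega
  rw [h6, h5]
  rw [← inv_smul_smul₀ h3 (ContinuousAlternatingMap.alternatizeUncurryFin F v), ← h1,
    ← Nat.cast_smul_eq_nsmul ℝ, ← Nat.cast_smul_eq_nsmul ℝ]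
  generalize asum (W := ℂ) _ v = X
  have h7 : ((-1 : ℤˣ) ^ a • X) = ((-1 : ℝ) ^ a) • X := by
    rw [Units.smul_def]; push_cast
    rw [← Int.cast_smul_eq_zsmul ℝ]; push_cast; rfl
  have h8 : ∀ Y : ℂ, ((-1 : ℤ) ^ a • Y) = ((-1 : ℝ) ^ a) • Y := by
    intro Y
    rw [← Int.cast_smul_eq_zsmul ℝ]; push_cast; rfl
  rw [h7, h8]
  simp only [smul_smul]
  congr 1
  have h9 : ((-1 : ℝ) ^ a) * (-1) ^ a = 1 := by rw [← mul_pow]; simp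
  field_simp
  linear_combination (-1 : ℝ) * h9

/-- The wedge is bounded bilinear, so its derivative is the sum of the terms where one factor is
differentiated; alternatization is linear and is computed on each term separately. -/
lemma extDeriv_altWedge (h : a + b = c) (h₁ : a + 1 + b = c + 1) (h₂ : a + (b + 1) = c + 1)
    {α : V → V [⋀^Fin a]→L[ℝ] ℂ} {β : V → V [⋀^Fin b]→L[ℝ] ℂ} {x : V}
    (hα : DifferentiableAt ℝ α x) (hβ : DifferentiableAt ℝ β x) :
    extDeriv (fun y => altWedge h (α y) (β y)) x =
      altWedge h₁ (extDeriv α x) (β x) + (-1 : ℤ) ^ a • altWedge h₂ (α x) (extDeriv β x) := by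
  have hB := isBoundedBilinearMap_altWedge (V := V) h
  have hd := (hB.hasFDerivAt (α x, β x)).comp x (hα.hasFDerivAt.prodMk hβ.hasFDerivAt)
  have e : fderiv ℝ (fun y => altWedge h (α y) (β y)) x =
      hB.deriv (α x, β x) ∘L ((fderiv ℝ α x).prod 0) +
      hB.deriv (α x, β x) ∘L (ContinuousLinearMap.prod 0 (fderiv ℝ β x)) := by
    rw [show fderiv ℝ (fun y => altWedge h (α y) (β y)) x = _ from hd.fderiv]
    ext1 w
    rw [add_apply]
    simp only [ContinuousLinearMap.comp_apply, ContinuousLinearMap.prod_apply,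
      zero_apply]
    rw [← map_add]
    simp
  have z1 : ∀ α : V [⋀^Fin a]→L[ℝ] ℂ, altWedge h α 0 = 0 := fun α => by
    ext v; simp [altWedge_apply]
  have z2 : ∀ β : V [⋀^Fin b]→L[ℝ] ℂ, altWedge h 0 β = 0 := fun α => by
    ext v; simp [altWedge_apply]
  rw [extDeriv, e, ← ContinuousAlternatingMap.alternatizeUncurryFinCLM_apply, map_add]
  congr 1
  · refine alternatizeUncurryFin_altWedge_left h h₁ (fderiv ℝ α x) (β x) _ fun w => ?_
    change hB.deriv (α x, β x) (fderiv ℝ α x w, 0) = _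
    rw [hB.deriv_apply]
    simp [z1]
  · refine alternatizeUncurryFin_altWedge_right h h₂ (α x) (fderiv ℝ β x) _ fun w => ?_
    change hB.deriv (α x, β x) (0, fderiv ℝ β x w) = _
    rw [hB.deriv_apply]
    simp [z2]

lemma altWedge_one_one (α β : V [⋀^Fin 1]→L[ℝ] ℂ) (v w : V) :
    altWedge (rfl : 1 + 1 = 2) α β ![v, w] = α ![v] * β ![w] - α ![w] * β ![v] := by
  have e : ∀ x : Fin 1 → V, x = ![x 0] := fun x => by ext i; fin_cases i; rfl
  rw [altWedge_apply, Finset.sum_eq_multiset_sum]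
  have hu : (Finset.univ : Finset (Equiv.Perm (Fin 2))) = {1, Equiv.swap 0 1} := by decide
  rw [← Finset.sum_eq_multiset_sum, hu, Finset.sum_pair (by decide)]
  rw [Equiv.Perm.sign_swap (by decide)]
  rw [e (fun i => ![v, w] ((1 : Equiv.Perm (Fin 2)) (Fin.cast rfl (Fin.castAdd 1 i)))),
    e (fun i => ![v, w] ((1 : Equiv.Perm (Fin 2)) (Fin.cast rfl (Fin.natAdd 1 i)))),
    e (fun i => ![v, w] ((Equiv.swap 0 1 : Equiv.Perm (Fin 2)) (Fin.cast rfl (Fin.castAdd 1 i)))),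
    e (fun i => ![v, w] ((Equiv.swap 0 1 : Equiv.Perm (Fin 2)) (Fin.cast rfl (Fin.natAdd 1 i))))]
  simp [sub_eq_add_neg]

end Wedge

end EquivJet

namespace EquivJet

noncomputable section

/-! ### The differential graded algebra of forms on a diffeological space. -/

namespace DForm

variable {X Y Z : Type*} [DiffeologicalSpace X] [DiffeologicalSpace Y] [DiffeologicalSpace Z]
  {a b c m : ℕ}

instance : Module ℂ (DForm X m) where
  one_smul _ := ext' fun _ _ _ => one_smul _ _
  mul_smul _ _ _ := ext' fun _ _ _ => mul_smul _ _ _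
  smul_zero k := ext' fun {n} _ _ => smul_zero (A := E n [⋀^Fin m]→L[ℝ] ℂ) k
  smul_add k α β := ext' fun _ p x => smul_add k (α.val p x) (β.val p x)
  add_smul k l α := ext' fun _ p x => add_smul k l (α.val p x)
  zero_smul α := ext' fun _ p x => zero_smul ℂ (α.val p x)

@[simp] lemma sub_val (α β : DForm X m) {n : ℕ} (p : Plot X n) (x : E n) :
    (α - β).val p x = α.val p x - β.val p x := by
  rw [sub_eq_add_neg, add_val, neg_val, sub_eq_add_neg]

/-- The value of a form on a plot, as a homomorphism. -/
def valHom {n : ℕ} (p : Plot X n) (x : E n) : DForm X m →+ E n [⋀^Fin m]→L[ℝ] ℂ where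
  toFun α := α.val p x
  map_zero' := rfl
  map_add' _ _ := rfl

lemma zsmul_val (k : ℤ) (α : DForm X m) {n : ℕ} (p : Plot X n) (x : E n) :
    (k • α).val p x = k • α.val p x := map_zsmul (valHom p x) k α

lemma sum_val {ι : Type*} (s : Finset ι) (α : ι → DForm X m) {n : ℕ} (p : Plot X n) (x : E n) :
    (∑ i ∈ s, α i).val p x = ∑ i ∈ s, (α i).val p x := map_sum (valHom p x) α s

lemma d_val (α : DForm X m) {n : ℕ} (p : Plot X n) : (d α).val p = extDeriv (α.val p) := rfl

lemma d_d (α : DForm X m) : d (d α) = 0 := ext' fun n p x => by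
  rw [d_val, d_val, extDeriv_extDeriv (α.smooth p) (by simpa using two_le_inf)]
  rfl

lemma d_smul (k : ℂ) (α : DForm X m) : d (k • α) = k • d α := ext' fun n p x => by
  rw [smul_val, d_val, d_val]
  have hα : DifferentiableAt ℝ (α.val p) x := (α.smooth p).differentiable (by simp) x
  ext v
  rw [ContinuousAlternatingMap.smul_apply, extDeriv_apply hα, Finset.smul_sum]
  refine (extDeriv_apply (hα.const_smul k) v).trans ?_
  refine Finset.sum_congr rfl fun i _ => ?_
  change (-1) ^ (i : ℕ) • fderiv ℝ (fun y => k • α.val p y (i.removeNth v)) x (v i) = _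
  rw [fderiv_fun_const_smul (hα.continuousAlternatingMap_apply_const _), smul_comm]
  rfl

lemma d_wedge (h : a + b = c) (h₁ : a + 1 + b = c + 1) (h₂ : a + (b + 1) = c + 1)
    (α : DForm X a) (β : DForm X b) :
    d (wedge h α β) = wedge h₁ (d α) β + (-1 : ℤ) ^ a • wedge h₂ α (d β) :=
  ext' fun n p x => by
    rw [add_val, zsmul_val]
    exact extDeriv_altWedge h h₁ h₂ ((α.smooth p).differentiable (by simp) x)
      ((β.smooth p).differentiable (by simp) x)

lemma pullback_d (F : X → Y) (hF : DSmooth F) (α : DForm Y m) :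
    pullback F hF (d α) = d (pullback F hF α) := rfl

lemma pullback_wedge (F : X → Y) (hF : DSmooth F) (h : a + b = c) (α : DForm Y a)
    (β : DForm Y b) :
    pullback F hF (wedge h α β) = wedge h (pullback F hF α) (pullback F hF β) := rfl

lemma pullback_congr {F G : X → Y} (hF : DSmooth F) (hG : DSmooth G) (h : F = G)
    (α : DForm Y m) : pullback F hF α = pullback G hG α := by
  subst h; rfl

section WedgeAlgebra

variable (h : a + b = c)

/-- The wedge product as a biadditive map. -/
def wedgeHom : DForm X a →+ DForm X b →+ DForm X c :=
  AddMonoidHom.mk' (fun α => AddMonoidHom.mk' (fun β => wedge h α β) fun β β' =>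
      ext' fun _ p x => (isBoundedBilinearMap_altWedge h).add_right (α.val p x) _ _)
    fun α α' => by
      ext1 β
      exact ext' fun _ p x => (isBoundedBilinearMap_altWedge h).add_left _ _ (β.val p x)

lemma add_wedge (α α' : DForm X a) (β : DForm X b) :
    wedge h (α + α') β = wedge h α β + wedge h α' β := map_add ((wedgeHom h).flip β) _ _
lemma wedge_add (α : DForm X a) (β β' : DForm X b) :
    wedge h α (β + β') = wedge h α β + wedge h α β' := (wedgeHom h α).map_add _ _
lemma neg_wedge (α : DForm X a) (β : DForm X b) : wedge h (-α) β = -wedge h α β :=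
  map_neg ((wedgeHom h).flip β) _
lemma wedge_neg (α : DForm X a) (β : DForm X b) : wedge h α (-β) = -wedge h α β :=
  (wedgeHom h α).map_neg _
@[simp] lemma zero_wedge (β : DForm X b) : wedge h (0 : DForm X a) β = 0 := map_zero ((wedgeHom h).flip β)
@[simp] lemma wedge_zero (α : DForm X a) : wedge h α (0 : DForm X b) = 0 := (wedgeHom h α).map_zero
lemma wedge_zsmul (k : ℤ) (α : DForm X a) (β : DForm X b) :
    wedge h α (k • β) = k • wedge h α β := map_zsmul (wedgeHom h α) k β
lemma zsmul_wedge (k : ℤ) (α : DForm X a) (β : DForm X b) :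
    wedge h (k • α) β = k • wedge h α β := map_zsmul ((wedgeHom h).flip β) k α
lemma wedge_sum {ι : Type*} (s : Finset ι) (α : DForm X a) (β : ι → DForm X b) :
    wedge h α (∑ i ∈ s, β i) = ∑ i ∈ s, wedge h α (β i) := map_sum (wedgeHom h α) β s
lemma sum_wedge {ι : Type*} (s : Finset ι) (α : ι → DForm X a) (β : DForm X b) :
    wedge h (∑ i ∈ s, α i) β = ∑ i ∈ s, wedge h (α i) β := map_sum ((wedgeHom h).flip β) α s
lemma smul_wedge (k : ℂ) (α : DForm X a) (β : DForm X b) :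
    wedge h (k • α) β = k • wedge h α β := ext' fun n p x => by
  ext v
  change altWedge h (k • α.val p x) (β.val p x) v = k • altWedge h (α.val p x) (β.val p x) v
  rw [altWedge_apply, altWedge_apply, smul_comm k]
  congr 1
  rw [Finset.smul_sum]
  refine Finset.sum_congr rfl fun σ _ => ?_
  rw [ContinuousAlternatingMap.smul_apply, smul_mul_assoc, smul_comm]
lemma wedge_smul (k : ℂ) (α : DForm X a) (β : DForm X b) :
    wedge h α (k • β) = k • wedge h α β := ext' fun n p x => by
  ext v
  change altWedge h (α.val p x) (k • β.val p x) v = k • altWedge h (α.val p x) (β.val p x) v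
  rw [altWedge_apply, altWedge_apply, smul_comm k]
  congr 1
  rw [Finset.smul_sum]
  refine Finset.sum_congr rfl fun σ _ => ?_
  rw [ContinuousAlternatingMap.smul_apply, mul_smul_comm, smul_comm]

end WedgeAlgebra

lemma wedge_comm_one (α β : DForm X 1) :
    wedge (rfl : 1 + 1 = 2) α β = -wedge (rfl : 1 + 1 = 2) β α := ext' fun n p x => by
  ext v
  have e : v = ![v 0, v 1] := by ext i : 1; fin_cases i <;> rfl
  rw [e]
  change altWedge rfl (α.val p x) (β.val p x) _ = -altWedge rfl (β.val p x) (α.val p x) _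
  rw [altWedge_one_one, altWedge_one_one]
  ring

lemma wedge_self_one (α : DForm X 1) : wedge (rfl : 1 + 1 = 2) α α = 0 := by
  have h := wedge_comm_one α α
  have h2 : (2 : ℂ) • wedge (rfl : 1 + 1 = 2) α α = 0 := by
    rw [two_smul ℂ (wedge (rfl : 1 + 1 = 2) α α)]; nth_rewrite 1 [h]; exact neg_add_cancel _
  exact (smul_eq_zero_iff_right (two_ne_zero' ℂ)).mp h2

/-- The value of a form on a plot at a point depends only on the germ of the plot. -/
lemma val_congr (α : DForm X m) {n : ℕ} {p q : Plot X n} {x : E n} (h : p.1 =ᶠ[𝓝 x] q.1) :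
    α.val p x = α.val q x := by
  obtain ⟨u, hu, hu', hx⟩ := eventually_nhds_iff.mp h
  obtain ⟨f, hf, hfu, hfx⟩ := exists_smooth_into hu' hx
  -- `f` maps everything into the set where the plots agree, so the reparametrised plots are equal.
  -- As `f` is the identity near `x`, naturality shows that reparametrising by `f` does not change
  -- the value at `x`.
  have e : p.comp f hf = q.comp f hf := Subtype.ext (funext fun y => hu _ (hfu y))
  have h1 := α.naturality p f hf x
  have h2 := α.naturality q f hf x
  have hd : fderiv ℝ f x = ContinuousLinearMap.id ℝ (E n) := by
    rw [hfx.fderiv_eq, fderiv_id]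
  have hfx' : f x = x := hfx.self_of_nhds
  rw [hd, hfx'] at h1 h2
  rw [e] at h1
  have h3 := h1.symm.trans h2
  ext v
  exact congrArg (fun β : E n [⋀^Fin m]→L[ℝ] ℂ => β v) h3

end DForm

/-! ## Subductions -/

section Subduction

variable {X Y Z : Type*} [DiffeologicalSpace X] [DiffeologicalSpace Y] [DiffeologicalSpace Z]

/-- A smooth map along which plots lift locally. -/
structure IsSubduction (f : X → Y) : Prop where
  dSmooth : DSmooth f
  exists_lift : ∀ {n : ℕ} (q : Plot Y n) (x : E n), ∃ P : Plot X n, q.1 =ᶠ[𝓝 x] f ∘ P.1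

/-- A form descends along `f` if its values on two plots with the same image under `f` agree. -/
def DForm.Descends (f : X → Y) {m : ℕ} (α : DForm X m) : Prop :=
  ∀ {n : ℕ} (P P' : Plot X n) (x : E n), f ∘ P.1 =ᶠ[𝓝 x] f ∘ P'.1 → α.val P x = α.val P' x

lemma DForm.descends_pullback {f : X → Y} (hf : DSmooth f) {m : ℕ} (β : DForm Y m) :
    (DForm.pullback f hf β).Descends f :=
  fun P P' _ h => β.val_congr (p := P.map f hf) (q := P'.map f hf) h

/-- The value of the descended form on a plot at `x` is that of `α` on a local lift near `x`.
Descent makes this independent of the lift, so one lift serves for all nearby points, and smoothness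
and naturality are inherited from `α`. -/
lemma IsSubduction.exists_pullback_eq {f : X → Y} (hf : IsSubduction f) {m : ℕ} {α : DForm X m}
    (hα : α.Descends f) : ∃ β : DForm Y m, DForm.pullback f hf.dSmooth β = α := by
  choose L hL using @hf.exists_lift
  refine ⟨⟨fun {n} q x => α.val (L q x) x, ?_, ?_⟩, ?_⟩
  · intro n q
    rw [contDiff_iff_contDiffAt]
    intro x₀
    refine (α.smooth (L q x₀)).contDiffAt.congr_of_eventuallyEq ?_
    filter_upwards [(hL q x₀).eventually_nhds] with x hx
    exact hα _ _ _ ((hL q x).symm.trans hx)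
  · intro n k q φ hφ x
    rw [← α.naturality _ φ hφ]
    refine hα _ _ _ ((hL _ x).symm.trans ?_)
    exact hφ.continuous.continuousAt.eventually (hL q (φ x))
  · refine DForm.ext' fun n p x => hα _ _ _ (hL (p.map f hf.dSmooth) x).symm

lemma IsSubduction.pullback_injective {f : X → Y} (hf : IsSubduction f) {m : ℕ} :
    Function.Injective (DForm.pullback f hf.dSmooth : DForm Y m →+ DForm X m) := by
  rw [injective_iff_map_eq_zero]
  intro β hβ
  refine DForm.ext' fun n q x => ?_
  obtain ⟨P, hP⟩ := hf.exists_lift q x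
  rw [β.val_congr (q := P.map f hf.dSmooth) hP]
  exact congrArg (fun γ : DForm X m => γ.val P x) hβ

end Subduction

/-! ### Descent of equivariant cochains. -/

section Cochains

variable {Γ : Type*} [Group Γ] {X Y : Type*} [DiffeologicalSpace X] [DiffeologicalSpace Y]
  [MulAction Γ X] [SmoothAction Γ X] [MulAction Γ Y] [SmoothAction Γ Y]
  {f : X → Y} (hf : IsSubduction f) (hΓ : ∀ (g : Γ) (x : X), f (g • x) = g • f x)

lemma pullback_translate (hf : DSmooth f) (hΓ : ∀ (g : Γ) (x : X), f (g • x) = g • f x) {m : ℕ}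
    (g : Γ) (α : DForm Y m) :
    DForm.pullback f hf (translate Γ g α) = translate Γ g (DForm.pullback f hf α) :=
  DForm.pullback_congr ((SmoothAction.dSmooth_smul g).comp hf)
    (hf.comp (SmoothAction.dSmooth_smul g)) (funext fun x => (hΓ g x).symm) α

/-- The values descend one by one. Their equivariance needs no further condition: it can be tested
after pullback, which is injective. -/
lemma Cochain.exists_pullback_eq {n m : ℕ} {u : Cochain Γ X n m}
    (hu : ∀ s, (u.1 s).Descends f) : ∃ v : Cochain Γ Y n m,
      Cochain.pullback f hf.dSmooth hΓ v = u := by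
  choose v hv using fun s => hf.exists_pullback_eq (hu s)
  refine ⟨⟨v, fun s g => hf.pullback_injective ?_⟩, Subtype.ext (funext hv)⟩
  rw [hv, pullback_translate hf.dSmooth hΓ, hv]
  exact u.2 s g

lemma Cochain.pullback_injective {n m : ℕ} :
    Function.Injective (Cochain.pullback f hf.dSmooth hΓ : Cochain Γ Y n m →+ Cochain Γ X n m) := by
  intro u v h
  refine Subtype.ext (funext fun s => hf.pullback_injective ?_)
  exact congrFun (congrArg Subtype.val h) s

lemma TotCochain.pullback_injective :
    Function.Injective (TotCochain.pullback f hf.dSmooth hΓ) := by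
  intro u v h
  funext n m
  exact Cochain.pullback_injective hf hΓ (congrFun (congrFun h n) m)

/-- Every value of the cochain descends along `f`. -/
def TotCochain.Descends (f : X → Y) (u : TotCochain Γ X) : Prop :=
  ∀ n m s, ((u n m).1 s).Descends f

lemma TotCochain.exists_pullback_eq {u : TotCochain Γ X} (hu : u.Descends f) :
    ∃ v : TotCochain Γ Y, TotCochain.pullback f hf.dSmooth hΓ v = u := by
  choose v hv using fun n m => Cochain.exists_pullback_eq hf hΓ (hu n m)
  exact ⟨v, funext fun n => funext fun m => hv n m⟩

end Cochains

/-! ### The bigraded differential algebra of equivariant cochains. -/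

section Algebra

variable {Γ : Type*} [Group Γ] {X Y : Type*} [DiffeologicalSpace X] [DiffeologicalSpace Y]
  [MulAction Γ X] [SmoothAction Γ X] [MulAction Γ Y] [SmoothAction Γ Y]

namespace Cochain

variable {n m p q N M : ℕ}

lemma deRham_deRham (u : Cochain Γ X n m) : deRham (deRham u) = 0 :=
  Subtype.ext (funext fun s => DForm.d_d (u.1 s))

lemma delta_apply (u : Cochain Γ X n m) (s : Fin (n + 2) → Γ) :
    (delta u).1 s = (-1 : ℤ) ^ m • ∑ i : Fin (n + 2), (-1 : ℤ) ^ (i : ℕ) •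
      u.1 (i.removeNth s) := rfl

lemma mul_apply (hN : n + p = N) (hM : m + q = M) (u : Cochain Γ X n m)
    (v : Cochain Γ X p q) (s : Fin (N + 1) → Γ) :
    (mul hN hM u v).1 s = (-1 : ℤ) ^ (n * q) • DForm.wedge hM
      (u.1 fun i => s ⟨i, by omega⟩) (v.1 fun j => s ⟨n + j, by omega⟩) := rfl

/-- The sign `(-1)^m` in `delta` flips when `d` raises the form degree. It is there to make the
differentials anticommute, so that `(d + δ)² = 0`. -/
lemma delta_deRham (u : Cochain Γ X n m) : delta (deRham u) = -deRham (delta u) := by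
  refine Subtype.ext (funext fun s => ?_)
  change (-1 : ℤ) ^ (m + 1) • ∑ i : Fin (n + 2), (-1 : ℤ) ^ (i : ℕ) •
      DForm.d (u.1 (i.removeNth s)) = -DForm.d ((delta u).1 s)
  rw [delta_apply, map_zsmul, map_sum]
  simp only [map_zsmul, pow_succ]
  simp

/-- For `i ≤ j`, deleting entry `j + 1` and then `i` gives the same tuple as deleting `i` and then
`j`, and the two terms carry opposite signs. The double sum is a sum of such pairs. -/
lemma delta_delta (u : Cochain Γ X n m) : delta (delta u) = 0 := by
  refine Subtype.ext (funext fun s => ?_)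
  rw [delta_apply]
  simp only [delta_apply, Finset.smul_sum]
  rw [Fin.sum_sum_eq_sum_triangle_add]
  refine Finset.sum_eq_zero fun i _ => Finset.sum_eq_zero fun j hj => ?_
  rw [Finset.mem_Ici] at hj
  have e : i.removeNth (j.succ.removeNth s) = j.removeNth (i.castSucc.removeNth s) := by
    rw [Fin.removeNth_removeNth_eq_swap]
    simp [Fin.predAbove, hj, Fin.succAbove]
  rw [e]
  simp only [smul_smul, ← add_smul]
  convert zero_smul ℤ _
  simp only [Fin.val_castSucc, Fin.val_succ]
  ring

lemma add_mul (hN : n + p = N) (hM : m + q = M) (u u' : Cochain Γ X n m) (v : Cochain Γ X p q) :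
    mul hN hM (u + u') v = mul hN hM u v + mul hN hM u' v :=
  Subtype.ext (funext fun s => by
    rw [mul_apply]
    simp only [AddSubgroup.coe_add, Pi.add_apply, DForm.add_wedge, smul_add, mul_apply])

lemma mul_add (hN : n + p = N) (hM : m + q = M) (u : Cochain Γ X n m) (v v' : Cochain Γ X p q) :
    mul hN hM u (v + v') = mul hN hM u v + mul hN hM u v' :=
  Subtype.ext (funext fun s => by
    rw [mul_apply]
    simp only [AddSubgroup.coe_add, Pi.add_apply, DForm.wedge_add, smul_add, mul_apply])

/-- The product sign `(-1)^(nq)` changes by `(-1)^n` when `d` raises `q`; with the `(-1)^m` of the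
Leibniz rule for forms this gives the total-degree sign `(-1)^(n + m)`. -/
lemma deRham_mul (hN : n + p = N) (hM : m + q = M) (h₁ : m + 1 + q = M + 1)
    (h₂ : m + (q + 1) = M + 1) (u : Cochain Γ X n m) (v : Cochain Γ X p q) :
    deRham (mul hN hM u v) =
      mul hN h₁ (deRham u) v + (-1 : ℤ) ^ (n + m) • mul hN h₂ u (deRham v) := by
  refine Subtype.ext (funext fun s => ?_)
  change DForm.d ((mul hN hM u v).1 s) = (mul hN h₁ (deRham u) v).1 s +
    (-1 : ℤ) ^ (n + m) • (mul hN h₂ u (deRham v)).1 s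
  rw [mul_apply, mul_apply, mul_apply, map_zsmul, DForm.d_wedge hM h₁ h₂, smul_add, smul_smul,
    smul_smul]
  congr 2
  have h : (-1 : ℤ) ^ n * (-1) ^ n = 1 := by rw [← mul_pow]; simp
  rw [Nat.mul_succ, pow_add, pow_add]
  linear_combination (-(-1 : ℤ) ^ (n * q) * (-1) ^ m) * h

/-- The two factors share the vertex `gₙ`. Faces `0, …, n` of the product come from `δu`, and faces
`n + 1, …, N + 1` from `δv`. The last face of `δu` and the zeroth face of `δv` are the extra terms
on the right, and they cancel each other. -/
lemma delta_mul (hN : n + p = N) (hM : m + q = M) (h₁ : n + 1 + p = N + 1)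
    (h₂ : n + (p + 1) = N + 1) (u : Cochain Γ X n m) (v : Cochain Γ X p q) :
    delta (mul hN hM u v) =
      mul h₁ hM (delta u) v + (-1 : ℤ) ^ (n + m) • mul h₂ hM u (delta v) := by
  refine Subtype.ext (funext fun s => ?_)
  change (delta (mul hN hM u v)).1 s = (mul h₁ hM (delta u) v).1 s +
    (-1 : ℤ) ^ (n + m) • (mul h₂ hM u (delta v)).1 s
  rw [delta_apply, mul_apply, mul_apply, delta_apply, delta_apply]
  simp only [mul_apply]
  have hc : n + 1 + (p + 1) = N + 2 := by omega
  rw [← Equiv.sum_comp (finCongr hc), Fin.sum_univ_add, Fin.sum_univ_castSucc (n := n + 1),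
    Fin.sum_univ_succ (n := p + 1), DForm.zsmul_wedge, DForm.wedge_zsmul, DForm.add_wedge,
    DForm.wedge_add, DForm.sum_wedge, DForm.wedge_sum]
  simp only [DForm.zsmul_wedge, DForm.wedge_zsmul]
  -- Deleting one of the entries `0, …, n` affects only the arguments of `u`, and shifts the block
  -- on which `v` is evaluated by one.
  have e1 : ∀ i : Fin (n + 1),
      DForm.wedge hM (u.1 fun j : Fin (n + 1) =>
          (finCongr hc (Fin.castAdd (p + 1) i)).removeNth s ⟨j, by omega⟩)
        (v.1 fun j : Fin (p + 1) =>
          (finCongr hc (Fin.castAdd (p + 1) i)).removeNth s ⟨n + j, by omega⟩) =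
      DForm.wedge hM (u.1 (i.castSucc.removeNth fun j : Fin (n + 2) => s ⟨j, by omega⟩))
        (v.1 fun j : Fin (p + 1) => s ⟨n + 1 + j, by omega⟩) := by
    intro i
    congr 2
    · refine congrArg _ (funext fun j => ?_)
      simp only [Fin.removeNth]
      congr 1
      ext
      simp only [Fin.succAbove, Fin.lt_def]
      (split_ifs <;> simp_all); order
    · refine congrArg _ (funext fun j => ?_)
      simp only [Fin.removeNth]
      congr 1
      ext
      simp only [Fin.succAbove, Fin.lt_def]
      split_ifs with h
      · simp at h; omega
      · simp; omega
  -- Deleting a later entry leaves the arguments of `u` alone and is face `i + 1` of the block `gₙ,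
  -- …, gₙ₊ₚ₊₁`.
  have e2 : ∀ i : Fin (p + 1),
      DForm.wedge hM (u.1 fun j : Fin (n + 1) =>
          (finCongr hc (Fin.natAdd (n + 1) i)).removeNth s ⟨j, by omega⟩)
        (v.1 fun j : Fin (p + 1) =>
          (finCongr hc (Fin.natAdd (n + 1) i)).removeNth s ⟨n + j, by omega⟩) =
      DForm.wedge hM (u.1 fun j : Fin (n + 1) => s ⟨j, by omega⟩)
        (v.1 (i.succ.removeNth fun j : Fin (p + 2) => s ⟨n + j, by omega⟩)) := by
    intro i
    congr 2
    · refine congrArg _ (funext fun j => ?_)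
      simp only [Fin.removeNth]
      congr 1
      ext
      simp only [Fin.succAbove, Fin.lt_def]
      split_ifs with h
      · simp
      · simp at h; omega
    · refine congrArg _ (funext fun j => ?_)
      simp only [Fin.removeNth]
      congr 1
      ext
      simp only [Fin.succAbove, Fin.lt_def]
      split_ifs with h h' h'
      · simp
      · simp at h h'; omega
      · simp at h h'; omega
      · simp; omega
  -- The two superfluous faces: both evaluate `u` on `g₀, …, gₙ` and `v` on `gₙ₊₁, …, gₙ₊ₚ₊₁`.
  have e3 : DForm.wedge hM
      (u.1 ((Fin.last (n + 1)).removeNth fun j : Fin (n + 2) => s ⟨j, by omega⟩))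
        (v.1 fun j : Fin (p + 1) => s ⟨n + 1 + j, by omega⟩) =
      DForm.wedge hM (u.1 fun j : Fin (n + 1) => s ⟨j, by omega⟩)
        (v.1 (Fin.removeNth 0 fun j : Fin (p + 2) => s ⟨n + j, by omega⟩)) := by
    congr 2
    · refine congrArg _ (funext fun j => ?_)
      simp [Fin.removeNth]
    · refine congrArg _ (funext fun j => ?_)
      simp only [Fin.removeNth]
      congr 1
      ext
      simp; omega
  simp only [e1, e2, e3]
  simp only [smul_add, Finset.smul_sum, smul_smul]
  rw [show ∀ A B C D : DForm X M, A + B + (C + D) = A + D + (B + C) from fun _ _ _ _ => by abel,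
    ← add_smul]
  have hz : (-1 : ℤ) ^ ((n + 1) * q) * ((-1) ^ m * (-1) ^ ((Fin.last (n + 1)).val)) +
      (-1) ^ (n + m) * ((-1) ^ (n * q) * ((-1) ^ q * (-1) ^ ((0 : Fin (p + 2)).val))) = 0 := by
    simp only [Fin.val_last, Fin.val_zero]
    ring
  rw [hz, zero_smul, add_zero]
  congr 1
  · refine Finset.sum_congr rfl fun i _ => ?_
    congr 1
    simp only [finCongr_apply, Fin.val_cast, Fin.val_castAdd, Fin.val_castSucc]
    rw [← hM, Nat.succ_mul, pow_add, pow_add]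
    ring
  · refine Finset.sum_congr rfl fun i _ => ?_
    congr 1
    simp only [finCongr_apply, Fin.val_cast, Fin.val_natAdd, Fin.val_succ]
    rw [← hM]
    ring

lemma pullback_mul (F : X → Y) (hF : DSmooth F) (hΓ : ∀ (g : Γ) (x : X), F (g • x) = g • F x)
    (hN : n + p = N) (hM : m + q = M) (u : Cochain Γ Y n m) (v : Cochain Γ Y p q) :
    pullback F hF hΓ (mul hN hM u v) = mul hN hM (pullback F hF hΓ u) (pullback F hF hΓ v) :=
  Subtype.ext (funext fun s => by
    change DForm.pullback F hF ((mul hN hM u v).1 s) = _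
    rw [mul_apply, map_zsmul, mul_apply]
    rfl)

end Cochain

namespace TotCochain

/-- The cochain concentrated in one bidegree. -/
def single (n m : ℕ) : Cochain Γ X n m →+ TotCochain Γ X where
  toFun u := Pi.single n (Pi.single m u)
  map_zero' := by simp
  map_add' u v := by simp [Pi.single_add]

lemma single_self {n m : ℕ} (u : Cochain Γ X n m) : single n m u n m = u := by
  simp [single]

lemma single_ne {n m n' m' : ℕ} (u : Cochain Γ X n m) (h : ¬(n' = n ∧ m' = m)) :
    single n m u n' m' = 0 := by
  by_cases hn : n' = n
  · subst hn
    change (Pi.single n' (Pi.single m u) : TotCochain Γ X) n' m' = 0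
    rw [Pi.single_eq_same, Pi.single_eq_of_ne fun hm => h ⟨rfl, hm⟩]
  · change (Pi.single n (Pi.single m u) : TotCochain Γ X) n' m' = 0
    rw [Pi.single_eq_of_ne hn, Pi.zero_apply]

lemma ofForm_eq_single {m : ℕ} (α : DForm X m) :
    (ofForm α : TotCochain Γ X) = single 0 m (Cochain.ofForm α) := rfl

lemma single_mem_degree {n m k : ℕ} (h : n + m = k) (u : Cochain Γ X n m) :
    single n m u ∈ degree Γ X k := fun n' m' h' =>
  single_ne u (by rintro ⟨rfl, rfl⟩; exact h' h)

/-- A homogeneous cochain has only finitely many nonzero components, so additive identities such as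
the Leibniz rule reduce to cochains in a single bidegree. -/
lemma eq_sum_single {k : ℕ} {u : TotCochain Γ X} (hu : u ∈ degree Γ X k) :
    u = ∑ n ∈ Finset.range (k + 1), single n (k - n) (u n (k - n)) := by
  funext n m
  rw [Finset.sum_apply, Finset.sum_apply]
  by_cases h : n + m = k
  · obtain rfl : m = k - n := by omega
    rw [Finset.sum_eq_single n, single_self]
    · intro n' _ hn'
      exact single_ne _ fun h' => hn' h'.1.symm
    · intro h'
      exact absurd (Finset.mem_range.mpr (by omega)) h'
  · rw [hu n m h]
    refine (Finset.sum_eq_zero fun n' hn' => single_ne _ ?_).symm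
    rintro ⟨rfl, rfl⟩
    exact h (by have := Finset.mem_range.mp hn'; omega)

lemma D_apply (u : TotCochain Γ X) (n m : ℕ) : D u n m = deRhamComp u n m + deltaComp u n m := rfl

lemma D_single {n m : ℕ} (u : Cochain Γ X n m) :
    D (single n m u) = single n (m + 1) (Cochain.deRham u) + single (n + 1) m (Cochain.delta u) := by
  funext n' m'
  rw [D_apply, Pi.add_apply, Pi.add_apply]
  congr 1
  · cases m' with
    | zero => exact (single_ne _ (by simp)).symm
    | succ m' =>
      change Cochain.deRham (single n m u n' m') = _
      by_cases h : n' = n ∧ m' = m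
      · obtain ⟨rfl, rfl⟩ := h
        rw [single_self, single_self]
      · rw [single_ne _ h, single_ne _ (by simpa using h), map_zero]
  · cases n' with
    | zero => exact (single_ne _ (by simp)).symm
    | succ n' =>
      change Cochain.delta (single n m u n' m') = _
      by_cases h : n' = n ∧ m' = m
      · obtain ⟨rfl, rfl⟩ := h
        rw [single_self, single_self]
      · rw [single_ne _ h, single_ne _ (by simpa using h), map_zero]

lemma D_D (u : TotCochain Γ X) : D (D u) = 0 := by
  have hd : ∀ n m, Cochain.delta (deRhamComp u n m) = -deRhamComp
      (fun n m => deltaComp u n m) (n + 1) m := by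
    rintro n (_ | m)
    · exact (map_zero _).trans neg_zero.symm
    · exact Cochain.delta_deRham (u n m)
  funext n m
  rw [D_apply]
  have h1 : deRhamComp (D u) n m = deRhamComp (fun n m => deltaComp u n m) n m := by
    cases m with
    | zero => rfl
    | succ m =>
      change Cochain.deRham (deRhamComp u n m + deltaComp u n m) =
        Cochain.deRham (deltaComp u n m)
      rw [map_add]
      cases m with
      | zero => exact (congrArg (· + _) (map_zero _)).trans (zero_add _)
      | succ m => exact (congrArg (· + _) (Cochain.deRham_deRham _)).trans (zero_add _)
  rw [h1]
  cases n with
  | zero =>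
    cases m with
    | zero => exact add_zero _
    | succ m => exact (congrArg (· + _) (map_zero _)).trans (zero_add _)
  | succ n =>
    change _ + Cochain.delta (deRhamComp u n m + deltaComp u n m) = 0
    rw [map_add, hd, ← add_assoc, add_neg_cancel, zero_add]
    cases n with
    | zero => exact map_zero _
    | succ n => exact Cochain.delta_delta _

lemma D_mem_degree {k : ℕ} {u : TotCochain Γ X} (hu : u ∈ degree Γ X k) :
    D u ∈ degree Γ X (k + 1) := by
  intro n m h
  rw [D_apply]
  have h1 : deRhamComp u n m = 0 := by
    cases m with
    | zero => rfl
    | succ m => exact (congrArg _ (hu n m (by omega))).trans (map_zero _)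
  have h2 : deltaComp u n m = 0 := by
    cases n with
    | zero => rfl
    | succ n => exact (congrArg _ (hu n m (by omega))).trans (map_zero _)
  rw [h1, h2, add_zero]

/-- The component of total degree `k` of a cochain. -/
def component (k : ℕ) (u : TotCochain Γ X) : TotCochain Γ X :=
  fun n m => if n + m = k then u n m else 0

lemma component_mem_degree (k : ℕ) (u : TotCochain Γ X) : component k u ∈ degree Γ X k :=
  fun _ _ h => if_neg h

/-- `D` raises the total degree by exactly one, so only the degree `k` part of `u` contributes to `D
u` in degree `k + 1`. A primitive of a homogeneous cochain can thus be replaced by a homogeneous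
one. -/
lemma D_component {k : ℕ} {u : TotCochain Γ X} (hu : D u ∈ degree Γ X (k + 1)) :
    D (component k u) = D u := by
  funext n m
  by_cases h : n + m = k + 1
  · rw [D_apply, D_apply]
    congr 1
    · cases m with
      | zero => rfl
      | succ m =>
        change Cochain.deRham (if n + m = k then u n m else 0) = _
        rw [if_pos (by omega)]
        rfl
    · cases n with
      | zero => rfl
      | succ n =>
        change Cochain.delta (if n + m = k then u n m else 0) = _
        rw [if_pos (by omega)]
        rfl
  · rw [hu n m h, D_mem_degree (component_mem_degree k u) n m h]

lemma add_mul (u u' v : TotCochain Γ X) : mul (u + u') v = mul u v + mul u' v := by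
  funext N M
  change mul (u + u') v N M = mul u v N M + mul u' v N M
  simp only [mul, Pi.add_apply, Cochain.add_mul, Finset.sum_add_distrib]

lemma mul_add (u v v' : TotCochain Γ X) : mul u (v + v') = mul u v + mul u v' := by
  funext N M
  change mul u (v + v') N M = mul u v N M + mul u v' N M
  simp only [mul, Pi.add_apply, Cochain.mul_add, Finset.sum_add_distrib]

lemma zero_mul (v : TotCochain Γ X) : mul 0 v = 0 := by
  have h := add_mul 0 0 v
  rwa [add_zero, left_eq_add] at h

lemma mul_zero (u : TotCochain Γ X) : mul u 0 = 0 := by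
  have h := mul_add u 0 0
  rwa [add_zero, left_eq_add] at h

lemma mul_single_single {n m p q N M : ℕ} (hN : n + p = N) (hM : m + q = M)
    (u : Cochain Γ X n m) (v : Cochain Γ X p q) :
    mul (single n m u) (single p q v) = single N M (Cochain.mul hN hM u v) := by
  have z1 : ∀ {n m p q N M : ℕ} (hN : n + p = N) (hM : m + q = M) (v : Cochain Γ X p q),
      Cochain.mul hN hM (0 : Cochain Γ X n m) v = 0 := fun hN hM v =>
    Subtype.ext (funext fun s => by
      rw [Cochain.mul_apply]
      exact (congrArg _ (DForm.zero_wedge hM _)).trans (smul_zero _))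
  have z2 : ∀ {n m p q N M : ℕ} (hN : n + p = N) (hM : m + q = M) (u : Cochain Γ X n m),
      Cochain.mul hN hM u (0 : Cochain Γ X p q) = 0 := fun hN hM v =>
    Subtype.ext (funext fun s => by
      rw [Cochain.mul_apply]
      exact (congrArg _ (DForm.wedge_zero hM _)).trans (smul_zero _))
  funext N' M'
  by_cases h : N' = N ∧ M' = M
  · obtain ⟨rfl, rfl⟩ := h
    rw [single_self, mul, Finset.sum_eq_single ⟨n, by omega⟩, Finset.sum_eq_single ⟨m, by omega⟩]
    -- In `mul` the complementary bidegree is `(N' - n, M' - m)`, equal to `(p, q)` but not by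
    -- definition. Generalising it allows the equality to be substituted.
    · have key : ∀ (p' q' : ℕ) (hp : n + p' = N') (hq : m + q' = M'),
          Cochain.mul hp hq (single n m u n m) (single p q v p' q') = Cochain.mul hN hM u v := by
        intro p' q' hp hq
        obtain rfl : p' = p := by omega
        obtain rfl : q' = q := by omega
        rw [single_self, single_self]
      exact key _ _ _ _
    · intro m' _ hm'
      rw [single_ne u (by rintro ⟨-, h⟩; exact hm' (Fin.ext h)), z1]
    · simp
    · intro n' _ hn'
      refine Finset.sum_eq_zero fun m' _ => ?_
      rw [single_ne u (by rintro ⟨h, -⟩; exact hn' (Fin.ext h)), z1]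
    · simp
  · rw [single_ne _ h, mul]
    refine Finset.sum_eq_zero fun n' _ => Finset.sum_eq_zero fun m' _ => ?_
    by_cases h' : (n' : ℕ) = n ∧ (m' : ℕ) = m
    · rw [single_ne v (by omega), z2]
    · rw [single_ne u h', z1]

/-- The Leibniz rule. -/
lemma D_mul {k l : ℕ} {u v : TotCochain Γ X} (hu : u ∈ degree Γ X k) (hv : v ∈ degree Γ X l) :
    D (mul u v) = mul (D u) v + (-1 : ℤ) ^ k • mul u (D v) := by
  have key : ∀ {n m p q : ℕ} (u : Cochain Γ X n m) (v : Cochain Γ X p q),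
      D (mul (single n m u) (single p q v)) = mul (D (single n m u)) (single p q v) +
        (-1 : ℤ) ^ (n + m) • mul (single n m u) (D (single p q v)) := by
    intro n m p q u v
    have e1 : n + 1 + p = n + p + 1 := by omega
    have e2 : m + 1 + q = m + q + 1 := by omega
    rw [mul_single_single rfl rfl, D_single, Cochain.deRham_mul rfl rfl e2 rfl,
      Cochain.delta_mul rfl rfl e1 rfl, D_single, D_single, add_mul, mul_add,
      mul_single_single rfl e2, mul_single_single e1 rfl,
      mul_single_single (q := q + 1) (N := n + p) (M := m + q + 1) rfl rfl,
      mul_single_single (p := p + 1) (N := n + p + 1) (M := m + q) rfl rfl, map_add, map_add, map_zsmul, map_zsmul,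
      smul_add]
    abel
  -- By additivity in `u` and then in `v`, only products of cochains of single bidegree remain, and
  -- these are `key`.
  rw [eq_sum_single hu]
  refine Finset.sum_induction _ (fun u => D (mul u v) = mul (D u) v + (-1 : ℤ) ^ k • mul u (D v))
    (fun a b ha hb => ?_) ?_ fun i hi => ?_
  · rw [add_mul, map_add, map_add, add_mul, add_mul, ha, hb, smul_add]
    abel
  · rw [map_zero, zero_mul, zero_mul, map_zero, smul_zero, add_zero]
  have hik : i + (k - i) = k := by have := Finset.mem_range.mp hi; omega
  rw [eq_sum_single hv]
  generalize u i (k - i) = w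
  refine Finset.sum_induction _ (fun v => D (mul (single i (k - i) w) v) =
    mul (D (single i (k - i) w)) v + (-1 : ℤ) ^ k • mul (single i (k - i) w) (D v))
    (fun a b ha hb => ?_) ?_ fun j _ => ?_
  · rw [mul_add, map_add, map_add, mul_add, mul_add, ha, hb, smul_add]
    abel
  · rw [map_zero, mul_zero, mul_zero, map_zero, smul_zero, add_zero]
  · have h := key w (v j (l - j))
    rwa [hik] at h

lemma pullback_mul (F : X → Y) (hF : DSmooth F) (hΓ : ∀ (g : Γ) (x : X), F (g • x) = g • F x)
    (u v : TotCochain Γ Y) :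
    pullback F hF hΓ (mul u v) = mul (pullback F hF hΓ u) (pullback F hF hΓ v) := by
  funext N M
  change Cochain.pullback F hF hΓ (mul u v N M) = _
  simp only [mul, map_sum, Cochain.pullback_mul]
  rfl

lemma pullback_single (F : X → Y) (hF : DSmooth F) (hΓ : ∀ (g : Γ) (x : X), F (g • x) = g • F x)
    {n m : ℕ} (u : Cochain Γ Y n m) :
    pullback F hF hΓ (single n m u) = single n m (Cochain.pullback F hF hΓ u) := by
  funext n' m'
  change Cochain.pullback F hF hΓ (single n m u n' m') = _
  by_cases h : n' = n ∧ m' = m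
  · obtain ⟨rfl, rfl⟩ := h
    rw [single_self, single_self]
  · rw [single_ne _ h, single_ne _ h, map_zero]

lemma pullback_ofForm (F : X → Y) (hF : DSmooth F) (hΓ : ∀ (g : Γ) (x : X), F (g • x) = g • F x)
    {m : ℕ} (α : DForm Y m) :
    pullback F hF hΓ (ofForm α) = ofForm (DForm.pullback F hF α) := by
  rw [ofForm_eq_single, ofForm_eq_single, pullback_single]
  congr 1
  exact Subtype.ext (funext fun s => pullback_translate hF hΓ (s 0) α)

lemma mul_mem_degree {k l : ℕ} {u v : TotCochain Γ X} (hu : u ∈ degree Γ X k)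
    (hv : v ∈ degree Γ X l) : mul u v ∈ degree Γ X (k + l) := by
  rw [eq_sum_single hu]
  refine Finset.sum_induction _ (fun u => mul u v ∈ degree Γ X (k + l))
    (fun a b ha hb => by rw [add_mul]; exact add_mem ha hb) (by rw [zero_mul]; exact zero_mem _)
    fun i hi => ?_
  have := Finset.mem_range.mp hi
  rw [eq_sum_single hv]
  generalize u i (k - i) = w
  refine Finset.sum_induction _ (fun v => mul (single i (k - i) w) v ∈ degree Γ X (k + l))
    (fun a b ha hb => by rw [mul_add]; exact add_mem ha hb) (by rw [mul_zero]; exact zero_mem _)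
    fun j hj => ?_
  have := Finset.mem_range.mp hj
  rw [mul_single_single rfl rfl]
  exact single_mem_degree (by omega) _

/-- An invariant form is a `δ`-closed cochain. -/
lemma D_ofForm {m : ℕ} {α : DForm X m} (hα : ∀ g : Γ, translate Γ g α = α) :
    D (ofForm α : TotCochain Γ X) = ofForm (DForm.d α) := by
  rw [ofForm_eq_single, D_single]
  have h : Cochain.delta (Cochain.ofForm α : Cochain Γ X 0 m) = 0 := by
    refine Subtype.ext (funext fun s => ?_)
    rw [Cochain.delta_apply]
    change (-1 : ℤ) ^ m • ∑ i : Fin 2, (-1 : ℤ) ^ (i : ℕ) • translate Γ _ α = 0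
    simp only [hα]
    rw [Fin.sum_univ_two]
    simp
  rw [h, map_zero, add_zero]
  rfl

lemma mul_ofForm_ofForm {a b c : ℕ} (h : a + b = c) (α : DForm X a) (β : DForm X b) :
    mul (ofForm α : TotCochain Γ X) (ofForm β) = ofForm (DForm.wedge h α β) := by
  rw [ofForm_eq_single, ofForm_eq_single, mul_single_single (rfl : 0 + 0 = 0) h]
  refine congrArg (single 0 c) (Subtype.ext (funext fun s => ?_))
  rw [Cochain.mul_apply, Nat.zero_mul, pow_zero, one_smul]
  rfl

end TotCochain

end Algebra

/-! ## Integration over the unit interval -/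

section ParametricIntegral

variable {P W : Type*} [NormedAddCommGroup P] [NormedSpace ℝ P] [NormedAddCommGroup W]
  [NormedSpace ℝ W]

/-- Differentiation under the integral sign. Joint continuity of the derivative bounds it on a
compact neighbourhood, so no integrability hypothesis is needed. -/
lemma hasFDerivAt_integral_unitInterval [ProperSpace P] {G : ℝ → P → W}
    (hG : ContDiff ℝ 1 (Function.uncurry G)) (x : P) :
    HasFDerivAt (fun x => ∫ r in (0 : ℝ)..1, G r x)
      (∫ r in (0 : ℝ)..1, fderiv ℝ (G r) x) x := by
  have hG' : Continuous fun q : ℝ × P => fderiv ℝ (G q.1) q.2 := by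
    have h : ContDiff ℝ 0 fun q : ℝ × P => fderiv ℝ (G q.1) q.2 :=
      ContDiff.fderiv (f := fun (q : ℝ × P) y => G q.1 y) (m := 1)
        (hG.comp ((contDiff_fst.comp contDiff_fst).prodMk contDiff_snd)) contDiff_snd (by simp)
    exact h.continuous
  have hd : ∀ r y, HasFDerivAt (G r) (fderiv ℝ (G r) y) y := fun r y =>
    ((hG.comp (contDiff_const.prodMk contDiff_id)).differentiable (by simp) y :
      DifferentiableAt ℝ (G r) y).hasFDerivAt
  -- The dominating constant: a bound for the derivative on the compact set `[0, 1] × closedBall x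
  -- 1`.
  obtain ⟨C, hC⟩ := ((isCompact_Icc (a := (0 : ℝ)) (b := 1)).prod
    (isCompact_closedBall x 1)).exists_bound_of_continuousOn hG'.continuousOn
  have : SecondCountableTopologyEither ℝ (P →L[ℝ] W) :=
    secondCountableTopologyEither_of_left ℝ (P →L[ℝ] W)
  refine intervalIntegral.hasFDerivAt_integral_of_dominated_of_fderiv_le
    (F := fun y r => G r y) (F' := fun y r => fderiv ℝ (G r) y) (bound := fun _ => C)
    (Metric.ball_mem_nhds x one_pos) ?_ ?_ ?_ ?_ ?_ ?_
  · refine Filter.Eventually.of_forall fun y => Continuous.aestronglyMeasurable ?_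
    exact hG.continuous.comp (continuous_id.prodMk continuous_const)
  · refine Continuous.intervalIntegrable ?_ _ _
    exact hG.continuous.comp (continuous_id.prodMk continuous_const)
  · refine Continuous.aestronglyMeasurable ?_
    exact hG'.comp (continuous_id.prodMk continuous_const)
  · refine Filter.Eventually.of_forall fun r hr y hy => hC (r, y) ⟨?_, ?_⟩
    · rw [Set.uIoc_of_le zero_le_one] at hr
      exact ⟨hr.1.le, hr.2⟩
    · exact Metric.ball_subset_closedBall hy
  · exact intervalIntegrable_const
  · exact Filter.Eventually.of_forall fun r _ y _ => hd r y

end ParametricIntegral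

/-- Induction on the order of differentiability: the derivative is an integral of the same kind,
with values in `P →L[ℝ] W`. Hence `W` varies in the induction, and `P` and `W` share a universe so
that `P →L[ℝ] W` can take the place of `W`. -/
lemma contDiff_integral_unitInterval {P : Type} [NormedAddCommGroup P] [NormedSpace ℝ P]
    [ProperSpace P] {W : Type} [NormedAddCommGroup W] [NormedSpace ℝ W] [CompleteSpace W]
    {G : ℝ → P → W} (hG : ContDiff ℝ ∞ (Function.uncurry G)) :
    ContDiff ℝ ∞ fun x => ∫ r in (0 : ℝ)..1, G r x := by
  rw [contDiff_infty]
  intro n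
  induction n generalizing W with
  | zero =>
    refine contDiff_zero.mpr ?_
    exact intervalIntegral.continuous_parametric_intervalIntegral_of_continuous'
      (f := fun x r => G r x) (hG.continuous.comp continuous_swap) 0 1
  | succ n ih =>
    have hd := fun x => hasFDerivAt_integral_unitInterval (hG.of_le (by simp)) x
    push_cast
    rw [contDiff_succ_iff_fderiv]
    refine ⟨fun x => (hd x).differentiableAt, by simp, ?_⟩
    rw [show fderiv ℝ (fun x => ∫ r in (0 : ℝ)..1, G r x) = _ from funext fun x => (hd x).fderiv]
    refine ih (G := fun r x => fderiv ℝ (G r) x) ?_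
    exact ContDiff.fderiv (f := fun (q : ℝ × P) y => G q.1 y) (m := ∞)
        (hG.comp ((contDiff_fst.comp contDiff_fst).prodMk contDiff_snd)) contDiff_snd (by simp)

/-! ## The cylinder over a parameter space -/

/-- The first basis vector of `ℝⁿ⁺¹`. -/
def cylVec (n : ℕ) : E (n + 1) := EuclideanSpace.single 0 1

/-- The inclusion `ℝⁿ → ℝⁿ⁺¹` with vanishing first coordinate. -/
def cylIncl (n : ℕ) : E n →L[ℝ] E (n + 1) :=
  LinearMap.toContinuousLinearMap
    { toFun := fun x => WithLp.toLp 2 (Fin.cons 0 x.ofLp)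
      map_add' := fun x y => by
        ext i
        refine Fin.cases ?_ (fun i => ?_) i <;> simp
      map_smul' := fun c x => by
        ext i
        refine Fin.cases ?_ (fun i => ?_) i <;> simp }

/-- The projection `ℝⁿ⁺¹ → ℝⁿ` forgetting the first coordinate. -/
def cylProj (n : ℕ) : E (n + 1) →L[ℝ] E n :=
  LinearMap.toContinuousLinearMap
    { toFun := fun y => WithLp.toLp 2 fun i => y i.succ
      map_add' := fun x y => by ext i; simp
      map_smul' := fun c x => by ext i; simp }

/-- The first coordinate on `ℝⁿ⁺¹`. -/
def cylTime (n : ℕ) : E (n + 1) →L[ℝ] ℝ := EuclideanSpace.proj 0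

/-- The embedding of `ℝⁿ` in `ℝⁿ⁺¹` with first coordinate `r`. -/
def cylSlice {n : ℕ} (r : ℝ) (x : E n) : E (n + 1) := r • cylVec n + cylIncl n x

section Cylinder

variable {n : ℕ}

@[simp] lemma cylProj_vec : cylProj n (cylVec n) = 0 := by
  ext i; simp [cylProj, cylVec]

@[simp] lemma cylProj_incl (x : E n) : cylProj n (cylIncl n x) = x := by
  ext i; simp [cylProj, cylIncl]

@[simp] lemma cylTime_vec : cylTime n (cylVec n) = 1 := by
  simp [cylTime, cylVec]

@[simp] lemma cylTime_incl (x : E n) : cylTime n (cylIncl n x) = 0 := by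
  simp [cylTime, cylIncl]

@[simp] lemma cylProj_slice (r : ℝ) (x : E n) : cylProj n (cylSlice r x) = x := by
  simp [cylSlice]

@[simp] lemma cylTime_slice (r : ℝ) (x : E n) : cylTime n (cylSlice r x) = r := by
  simp [cylSlice]

lemma hasFDerivAt_cylSlice (r : ℝ) (x : E n) :
    HasFDerivAt (cylSlice (n := n) r) (cylIncl n) x :=
  (cylIncl n).hasFDerivAt.const_add _

lemma contDiff_cylSlice : ContDiff ℝ ∞ fun q : ℝ × E n => cylSlice q.1 q.2 :=
  (contDiff_fst.smul contDiff_const).add ((cylIncl n).contDiff.comp contDiff_snd)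

lemma contDiff_cylSlice_right (r : ℝ) : ContDiff ℝ ∞ (cylSlice (n := n) r) :=
  contDiff_cylSlice.comp (contDiff_const.prodMk contDiff_id)

/-- The map `(r, x) ↦ (r, φ(x))`. -/
def cylMap {k : ℕ} (φ : E k → E n) (y : E (k + 1)) : E (n + 1) :=
  cylSlice (cylTime k y) (φ (cylProj k y))

lemma contDiff_cylMap {k : ℕ} {φ : E k → E n} (hφ : ContDiff ℝ ∞ φ) : ContDiff ℝ ∞ (cylMap φ) :=
  contDiff_cylSlice.comp (g := fun q : ℝ × E n => cylSlice q.1 q.2)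
    ((cylTime k).contDiff.prodMk (hφ.comp (cylProj k).contDiff))

lemma fderiv_cylMap {k : ℕ} {φ : E k → E n} (hφ : ContDiff ℝ ∞ φ) (y w : E (k + 1)) :
    fderiv ℝ (cylMap φ) y w =
      cylTime k w • cylVec n + cylIncl n (fderiv ℝ φ (cylProj k y) (cylProj k w)) := by
  have h1 : HasFDerivAt (fun y => cylTime k y • cylVec n)
      ((cylTime k).smulRight (cylVec n)) y := (cylTime k).hasFDerivAt.smul_const (cylVec n)
  have h2 : HasFDerivAt φ _ (cylProj k y) := (hφ.differentiable (by simp) _).hasFDerivAt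
  have h3 := (cylIncl n).hasFDerivAt.comp y (h2.comp y (cylProj k).hasFDerivAt)
  have h4 : HasFDerivAt (cylMap φ) _ y := h1.add h3
  rw [h4.fderiv]
  rfl

/-- Contraction with the first basis vector, restricted to `ℝⁿ`. -/
def cylContract (n m : ℕ) : (E (n + 1) [⋀^Fin (m + 1)]→L[ℝ] ℂ) →L[ℝ] E n [⋀^Fin m]→L[ℝ] ℂ :=
  ContinuousAlternatingMap.compContinuousLinearMapCLM (cylIncl n) ∘L
    ContinuousLinearMap.apply ℝ _ (cylVec n) ∘L
      (ContinuousAlternatingMap.curryLeftLI (𝕜 := ℝ) (E := E (n + 1)) (F := ℂ)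
        (n := m)).toContinuousLinearMap

lemma cylContract_apply {m : ℕ} (β : E (n + 1) [⋀^Fin (m + 1)]→L[ℝ] ℂ) (v : Fin m → E n) :
    cylContract n m β v = β (Matrix.vecCons (cylVec n) fun i => cylIncl n (v i)) := rfl

/-- A linear map that respects the time vector and acts by `A` on the slices commutes with the
contraction. The derivatives of the maps `(r, x) ↦ (r, φ(x))` are of this kind. -/
lemma cylContract_compContinuousLinearMap {k m : ℕ} (β : E (n + 1) [⋀^Fin (m + 1)]→L[ℝ] ℂ)
    (L : E (k + 1) →L[ℝ] E (n + 1)) (A : E k →L[ℝ] E n) (h0 : L (cylVec k) = cylVec n)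
    (h1 : ∀ w, L (cylIncl k w) = cylIncl n (A w)) :
    cylContract k m (β.compContinuousLinearMap L) =
      (cylContract n m β).compContinuousLinearMap A := by
  ext v
  rw [cylContract_apply, ContinuousAlternatingMap.compContinuousLinearMap_apply,
    ContinuousAlternatingMap.compContinuousLinearMap_apply, cylContract_apply]
  congr 1
  funext i
  refine Fin.cases ?_ (fun i => ?_) i
  · exact h0
  · exact h1 _

lemma integral_compContinuousLinearMap {k m : ℕ} {F : ℝ → E n [⋀^Fin m]→L[ℝ] ℂ}
    (hF : Continuous F) (A : E k →L[ℝ] E n) :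
    ∫ r in (0 : ℝ)..1, (F r).compContinuousLinearMap A =
      (∫ r in (0 : ℝ)..1, F r).compContinuousLinearMap A :=
  ContinuousLinearMap.intervalIntegral_comp_comm
    (ContinuousAlternatingMap.compContinuousLinearMapCLM (F := ℂ) (ι := Fin m) A)
    (hF.intervalIntegrable 0 1)

end Cylinder

/-! ## Fibrewise contractions -/

section Homotopy

variable {X Y : Type*} [DiffeologicalSpace X]

/-- A smooth homotopy `h`, along the fibres of `f`, between a map constant on the fibres and the
identity. -/
structure IsFibreContraction (f : X → Y) (h : ℝ → X → X) : Prop where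
  isPlot : ∀ {n : ℕ} (p : Plot X n), IsPlot fun y : E (n + 1) => h (cylTime n y) (p.1 (cylProj n y))
  map_fibre : ∀ r x, f (h r x) = f x
  one : ∀ x, h 1 x = x
  zero : ∀ x x', f x = f x' → h 0 x = h 0 x'

namespace IsFibreContraction

variable {f : X → Y} {h : ℝ → X → X} (H : IsFibreContraction f h)

/-- The image of a plot under the homotopy. -/
def cylPlot {n : ℕ} (p : Plot X n) : Plot X (n + 1) := ⟨_, H.isPlot p⟩

lemma dSmooth (H : IsFibreContraction f h) (r : ℝ) : DSmooth (h r) := fun n p hp => by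
  have e : h r ∘ p = (H.cylPlot ⟨p, hp⟩).1 ∘ cylSlice r := by
    funext x
    simp [cylPlot]
  rw [e]
  exact isPlot_reparam (H.cylPlot ⟨p, hp⟩).2 (contDiff_cylSlice_right r)

lemma continuous_val_slice {m n : ℕ} (α : DForm X m) (p : Plot X n) (x : E n) :
    Continuous fun r => α.val (H.cylPlot p) (cylSlice r x) :=
  (α.smooth (H.cylPlot p)).continuous.comp
    (contDiff_cylSlice.continuous.comp (continuous_id.prodMk continuous_const))

/-- The cylinder over a reparametrised plot is the cylinder over the plot, reparametrised by `(r, x)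
↦ (r, φ(x))`. This gives the naturality of the homotopy operator. -/
lemma cylContract_val_comp {m n k : ℕ} (α : DForm X (m + 1)) (p : Plot X n) (φ : E k → E n)
    (hφ : ContDiff ℝ ∞ φ) (r : ℝ) (x : E k) :
    cylContract k m (α.val (H.cylPlot (p.comp φ hφ)) (cylSlice r x)) =
      (cylContract n m (α.val (H.cylPlot p) (cylSlice r (φ x)))).compContinuousLinearMap
        (fderiv ℝ φ x) := by
  have e : H.cylPlot (p.comp φ hφ) = (H.cylPlot p).comp (cylMap φ) (contDiff_cylMap hφ) :=
    Subtype.ext (funext fun y => by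
      change h _ _ = h _ _
      simp [cylMap, Plot.comp])
  have eΦ : cylMap φ (cylSlice r x) = cylSlice r (φ x) := by simp [cylMap]
  rw [e, α.naturality, eΦ]
  refine cylContract_compContinuousLinearMap _ _ _ ?_ fun w => ?_
  · rw [fderiv_cylMap hφ]; simp
  · rw [fderiv_cylMap hφ]; simp

lemma contDiff_cylContract_val {m n : ℕ} (α : DForm X (m + 1)) (p : Plot X n) :
    ContDiff ℝ ∞ fun q : ℝ × E n => cylContract n m (α.val (H.cylPlot p) (cylSlice q.1 q.2)) := by
  have hG : ContDiff ℝ ∞ fun q : ℝ × E n => α.val (H.cylPlot p) (cylSlice q.1 q.2) :=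
    (α.smooth (H.cylPlot p)).comp contDiff_cylSlice
  exact (cylContract n m).contDiff.comp hG

/-- The homotopy operator on forms. -/
def homotopyOp {m : ℕ} (α : DForm X (m + 1)) : DForm X m where
  val {n} p x := ∫ r in (0 : ℝ)..1, cylContract n m (α.val (H.cylPlot p) (cylSlice r x))
  smooth {n} p := contDiff_integral_unitInterval (P := E n) (W := E n [⋀^Fin m]→L[ℝ] ℂ)
    (G := fun r x => cylContract n m (α.val (H.cylPlot p) (cylSlice r x)))
    (H.contDiff_cylContract_val α p)
  naturality {n k} p φ hφ x := by
    simp only [H.cylContract_val_comp α p φ hφ]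
    exact integral_compContinuousLinearMap ((cylContract n m).continuous.comp
      (H.continuous_val_slice α p (φ x))) _

lemma homotopyOp_apply {m n : ℕ} (α : DForm X (m + 1)) (p : Plot X n) (x : E n)
    (v : Fin m → E n) : (H.homotopyOp α).val p x v = ∫ r in (0 : ℝ)..1,
      α.val (H.cylPlot p) (cylSlice r x) (Matrix.vecCons (cylVec n) fun i => cylIncl n (v i)) :=
  (ContinuousLinearMap.intervalIntegral_comp_comm
    (ContinuousAlternatingMap.apply ℝ (E n) ℂ v)
    (Continuous.intervalIntegrable ((cylContract n m).continuous.comp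
      (H.continuous_val_slice α p x)) _ _)).symm

/-- Restricted to the slice at time `r`, the cylinder over `p` is the plot `h r ∘ p`. -/
lemma val_slice {m n : ℕ} (α : DForm X m) (p : Plot X n) (r : ℝ) (x : E n) (v : Fin m → E n) :
    α.val (H.cylPlot p) (cylSlice r x) (fun i => cylIncl n (v i)) =
      (DForm.pullback (h r) (H.dSmooth r) α).val p x v := by
  have e : p.map (h r) (H.dSmooth r) = (H.cylPlot p).comp (cylSlice r) (contDiff_cylSlice_right r) :=
    Subtype.ext (funext fun y => by
      change h _ _ = h _ _
      simp)
  change _ = α.val (p.map (h r) (H.dSmooth r)) x v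
  rw [e, α.naturality, (hasFDerivAt_cylSlice r x).fderiv]
  rfl

lemma pullback_one {m : ℕ} (α : DForm X m) : DForm.pullback (h 1) (H.dSmooth 1) α = α :=
  DForm.pullback_congr (H.dSmooth 1) dSmooth_id (funext H.one) α

/-- The fundamental theorem of calculus along the homotopy. -/
lemma integral_deriv_val {m n : ℕ} (α : DForm X m) (p : Plot X n) (x : E n) (v : Fin m → E n) :
    ∫ r in (0 : ℝ)..1, fderiv ℝ (fun y => α.val (H.cylPlot p) y fun i => cylIncl n (v i))
      (cylSlice r x) (cylVec n) =
      α.val p x v - (DForm.pullback (h 0) (H.dSmooth 0) α).val p x v := by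
  have hs : ContDiff ℝ ∞ fun y => α.val (H.cylPlot p) y fun i => cylIncl n (v i) :=
    (ContinuousAlternatingMap.apply ℝ (E (n + 1)) ℂ fun i => cylIncl n (v i)).contDiff.comp
      (α.smooth (H.cylPlot p))
  have hr : ∀ r : ℝ, HasDerivAt (fun r => cylSlice r x) (cylVec n) r := fun r => by
    simpa [cylSlice] using ((hasDerivAt_id r).smul_const (cylVec n)).add_const (cylIncl n x)
  rw [intervalIntegral.integral_eq_sub_of_hasDerivAt
    (f := fun r => α.val (H.cylPlot p) (cylSlice r x) fun i => cylIncl n (v i))]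
  · rw [H.val_slice, H.val_slice, H.pullback_one]
  · intro r _
    exact (hs.differentiable (by simp) _).hasFDerivAt.comp_hasDerivAt r (hr r)
  · refine Continuous.intervalIntegrable ?_ _ _
    exact ((hs.continuous_fderiv (by simp)).comp (contDiff_cylSlice.continuous.comp
      (continuous_id.prodMk continuous_const))).clm_apply continuous_const

/-- The homotopy formula in form degree zero, where the term `d K` is absent: it is the fundamental
theorem of calculus along the homotopy. -/
lemma homotopyOp_d_zero (α : DForm X 0) :
    H.homotopyOp (DForm.d α) = α - DForm.pullback (h 0) (H.dSmooth 0) α :=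
  DForm.ext' fun n p x => by
    ext v
    rw [homotopyOp_apply, DForm.sub_val, ContinuousAlternatingMap.sub_apply,
      ← H.integral_deriv_val α p x v]
    congr 1
    funext r
    rw [DForm.d_val, extDeriv_apply ((α.smooth _).differentiable (by simp) _)]
    rw [Fin.sum_univ_one]
    simp only [Fin.val_zero, pow_zero, one_smul]
    rw [Subsingleton.elim (Fin.removeNth _ _) fun i => cylIncl n (v i)]
    rfl

/-- The homotopy formula. -/
lemma d_homotopyOp_add {m : ℕ} (α : DForm X (m + 1)) :
    DForm.d (H.homotopyOp α) + H.homotopyOp (DForm.d α) =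
      α - DForm.pullback (h 0) (H.dSmooth 0) α :=
  DForm.ext' fun n p x => by
    ext v
    have hα : ∀ y, DifferentiableAt ℝ (α.val (H.cylPlot p)) y :=
      fun y => (α.smooth (H.cylPlot p)).differentiable (by simp) y
    have hs : ∀ u : Fin (m + 1) → E (n + 1), ContDiff ℝ ∞ fun y => α.val (H.cylPlot p) y u :=
      fun u => (ContinuousAlternatingMap.apply ℝ (E (n + 1)) ℂ u).contDiff.comp
        (α.smooth (H.cylPlot p))
    have hc : ∀ (u : Fin (m + 1) → E (n + 1)) (w : E (n + 1)), Continuous fun r =>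
        fderiv ℝ (fun y => α.val (H.cylPlot p) y u) (cylSlice r x) w := fun u w =>
      (((hs u).continuous_fderiv (by simp)).comp (contDiff_cylSlice.continuous.comp
        (continuous_id.prodMk continuous_const))).clm_apply continuous_const
    rw [DForm.add_val, DForm.sub_val, ContinuousAlternatingMap.sub_apply,
      ContinuousAlternatingMap.add_apply, ← H.integral_deriv_val α p x v, DForm.d_val,
      extDeriv_apply (((H.homotopyOp α).smooth p).differentiable (by simp) _), homotopyOp_apply]
    -- The terms of `d(Kα)`: differentiate under the integral and pass to a derivative on the
    -- cylinder in a slice direction.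
    have h1 : ∀ i : Fin (m + 1), fderiv ℝ (fun y => (H.homotopyOp α).val p y (i.removeNth v)) x
        (v i) = ∫ r in (0 : ℝ)..1, fderiv ℝ (fun y => α.val (H.cylPlot p) y
          (Matrix.vecCons (cylVec n) fun j => cylIncl n (i.removeNth v j))) (cylSlice r x)
            (cylIncl n (v i)) := fun i => by
      set u : Fin (m + 1) → E (n + 1) :=
        Matrix.vecCons (cylVec n) fun j => cylIncl n (i.removeNth v j) with hu
      have hG : ContDiff ℝ ∞ (Function.uncurry fun r y => α.val (H.cylPlot p) (cylSlice r y) u) :=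
        (hs u).comp contDiff_cylSlice
      have h2 := hasFDerivAt_integral_unitInterval (hG.of_le (by simp)) x
      simp only [homotopyOp_apply]
      rw [h2.fderiv]
      have h3 : ∀ r, fderiv ℝ (fun y => α.val (H.cylPlot p) (cylSlice r y) u) x =
          fderiv ℝ (fun y => α.val (H.cylPlot p) y u) (cylSlice r x) ∘L cylIncl n := fun r =>
        ((((hs u).differentiable (by simp) _).hasFDerivAt).comp x
          (hasFDerivAt_cylSlice r x)).fderiv
      simp only [h3]
      refine (ContinuousLinearMap.intervalIntegral_comp_comm
        (ContinuousLinearMap.apply ℝ ℂ (v i)) (Continuous.intervalIntegrable ?_ _ _)).symm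
      exact (((hs u).continuous_fderiv (by simp)).comp (contDiff_cylSlice.continuous.comp
        (continuous_id.prodMk continuous_const))).clm_comp continuous_const
    -- The terms of `dα` on the cylinder with the time vector in first place: one time derivative,
    -- which integrates to the boundary values, and slice derivatives with one more sign than in
    -- `d(Kα)`, so that these cancel.
    have h4 : ∀ r, (DForm.d α).val (H.cylPlot p) (cylSlice r x)
        (Matrix.vecCons (cylVec n) fun i => cylIncl n (v i)) =
        fderiv ℝ (fun y => α.val (H.cylPlot p) y fun i => cylIncl n (v i))
          (cylSlice r x) (cylVec n) - ∑ i : Fin (m + 1), (-1 : ℤ) ^ (i : ℕ) •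
          fderiv ℝ (fun y => α.val (H.cylPlot p) y
          (Matrix.vecCons (cylVec n) fun j => cylIncl n (i.removeNth v j))) (cylSlice r x)
            (cylIncl n (v i)) := fun r => by
      rw [DForm.d_val, extDeriv_apply (hα _), Fin.sum_univ_succ, sub_eq_add_neg,
        ← Finset.sum_neg_distrib]
      congr 1
      · simp only [Fin.val_zero, pow_zero, one_smul]
        rfl
      · refine Finset.sum_congr rfl fun i _ => ?_
        rw [Fin.val_succ, pow_succ, mul_neg_one, neg_smul]
        have hu : i.succ.removeNth (Matrix.vecCons (cylVec n) fun i => cylIncl n (v i)) =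
            Matrix.vecCons (cylVec n) fun j => cylIncl n (i.removeNth v j) := by
          funext j
          refine Fin.cases ?_ (fun j => ?_) j <;> simp [Fin.removeNth]
        rw [hu]
        rfl
    simp only [h1, h4]
    rw [intervalIntegral.integral_sub, intervalIntegral.integral_finsetSum]
    · have h5 : ∀ i : Fin (m + 1), ∫ r in (0 : ℝ)..1, (-1 : ℤ) ^ (i : ℕ) •
          fderiv ℝ (fun y => α.val (H.cylPlot p) y
          (Matrix.vecCons (cylVec n) fun j => cylIncl n (i.removeNth v j))) (cylSlice r x)
            (cylIncl n (v i)) = (-1 : ℤ) ^ (i : ℕ) • ∫ r in (0 : ℝ)..1,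
          fderiv ℝ (fun y => α.val (H.cylPlot p) y
          (Matrix.vecCons (cylVec n) fun j => cylIncl n (i.removeNth v j))) (cylSlice r x)
            (cylIncl n (v i)) := fun i => by
        simp only [← Int.cast_smul_eq_zsmul ℝ]
        exact intervalIntegral.integral_smul _ _
      simp only [h5]
      abel
    · intro i _
      exact (Continuous.const_smul (hc _ _) _).intervalIntegrable _ _
    · exact (hc _ _).intervalIntegrable _ _
    · exact (continuous_finsetSum _ fun i _ =>
        Continuous.const_smul (hc _ _) _).intervalIntegrable _ _

/-- The homotopy stays in the fibres, so the image of the cylinder under `f` does not depend on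
time, and a basic form vanishes when the time vector is inserted. -/
lemma homotopyOp_pullback [DiffeologicalSpace Y] {m : ℕ} (hf : DSmooth f) (β : DForm Y (m + 1)) :
    H.homotopyOp (DForm.pullback f hf β) = 0 := DForm.ext' fun n p x => by
  ext v
  rw [homotopyOp_apply]
  have e : (H.cylPlot p).map f hf = (p.map f hf).comp (cylProj n) (cylProj n).contDiff :=
    Subtype.ext (funext fun y => H.map_fibre _ _)
  have h1 : ∀ r : ℝ, (DForm.pullback f hf β).val (H.cylPlot p) (cylSlice r x)
      (Matrix.vecCons (cylVec n) fun i => cylIncl n (v i)) = 0 := fun r => by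
    change β.val ((H.cylPlot p).map f hf) _ _ = 0
    rw [e, β.naturality, ContinuousAlternatingMap.compContinuousLinearMap_apply]
    refine ContinuousAlternatingMap.map_coord_zero _ 0 ?_
    simp
  simp [h1]

lemma homotopyOp_add {m : ℕ} (α β : DForm X (m + 1)) :
    H.homotopyOp (α + β) = H.homotopyOp α + H.homotopyOp β := DForm.ext' fun n p x => by
  ext v
  rw [DForm.add_val, ContinuousAlternatingMap.add_apply, homotopyOp_apply, homotopyOp_apply,
    homotopyOp_apply, ← intervalIntegral.integral_add]
  · rfl
  all_goals
    exact (((ContinuousAlternatingMap.apply ℝ (E (n + 1)) ℂ _).continuous.comp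
      (H.continuous_val_slice _ p x))).intervalIntegrable _ _

/-- `h 0` takes the same value at all points of a fibre, so two lifts of a plot of `Y` have the same
image under `h 0`; a form pulled back by `h 0` therefore descends. -/
lemma pullback_zero_mem_range [DiffeologicalSpace Y] (hf : IsSubduction f) {m : ℕ} (α : DForm X m) :
    DForm.pullback (h 0) (H.dSmooth 0) α ∈ (DForm.pullback f hf.dSmooth (m := m)).range := by
  obtain ⟨β, hβ⟩ := hf.exists_pullback_eq (α := DForm.pullback (h 0) (H.dSmooth 0) α)
    fun P P' x hPP => α.val_congr (p := P.map _ (H.dSmooth 0)) (q := P'.map _ (H.dSmooth 0)) <| by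
      filter_upwards [hPP] with y hy
      exact H.zero _ _ hy
  exact ⟨β, hβ⟩

end IsFibreContraction

end Homotopy

/-! ## Equivariant cohomology of a bundle with contractible fibres -/

section Translate

variable {Γ : Type*} [Group Γ] {X : Type*} [DiffeologicalSpace X] [MulAction Γ X]
  [SmoothAction Γ X] {m : ℕ}

lemma translate_translate (g g' : Γ) (α : DForm X m) :
    translate Γ g (translate Γ g' α) = translate Γ (g' * g) α :=
  DForm.pullback_congr ((SmoothAction.dSmooth_smul g').comp (SmoothAction.dSmooth_smul g)) _
    (funext fun x => (mul_smul g' g x).symm) α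

lemma translate_one (α : DForm X m) : translate Γ 1 α = α :=
  DForm.pullback_congr _ dSmooth_id (funext fun x => one_smul Γ x) α

end Translate

section CohomologyClasses

variable {Γ : Type*} [Group Γ] {X Y : Type*} [DiffeologicalSpace X] [DiffeologicalSpace Y]
  [MulAction Γ X] [SmoothAction Γ X] [MulAction Γ Y] [SmoothAction Γ Y] {k : ℕ}

namespace TotCochain

lemma pullback_mem_cocycles {F : X → Y} (hF : DSmooth F)
    (hΓ : ∀ (g : Γ) (x : X), F (g • x) = g • F x) {u : TotCochain Γ Y} (hu : u ∈ cocycles Γ Y k) :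
    pullback F hF hΓ u ∈ cocycles Γ X k := by
  refine ⟨fun n m h => ?_, ?_⟩
  · change Cochain.pullback F hF hΓ (u n m) = 0
    rw [hu.1 n m h, map_zero]
  · change D (pullback F hF hΓ u) = 0
    rw [D_pullback, hu.2, map_zero]

end TotCochain

namespace EquivCohomology

lemma mk_eq_mk {u v : TotCochain Γ X} (hu : u ∈ TotCochain.cocycles Γ X k)
    (hv : v ∈ TotCochain.cocycles Γ X k) : mk u hu = mk v hv ↔ ∃ x, TotCochain.D x = v - u := by
  rw [mk, mk, QuotientAddGroup.eq, AddSubgroup.mem_addSubgroupOf, ← sub_eq_neg_add]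
  rfl

lemma zero_eq_mk : (0 : EquivCohomology Γ X k) = mk 0 (zero_mem _) := rfl

lemma exists_mk (c : EquivCohomology Γ X k) : ∃ u hu, c = mk u hu := by
  obtain ⟨⟨u, hu⟩, rfl⟩ := QuotientAddGroup.mk_surjective c
  exact ⟨u, hu, rfl⟩

lemma pullback_mk {F : X → Y} (hF : DSmooth F) (hΓ : ∀ (g : Γ) (x : X), F (g • x) = g • F x)
    {u : TotCochain Γ Y} (hu : u ∈ TotCochain.cocycles Γ Y k) :
    pullback F hF hΓ (mk u hu) =
      mk (TotCochain.pullback F hF hΓ u) (TotCochain.pullback_mem_cocycles hF hΓ hu) := rfl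

end EquivCohomology

end CohomologyClasses

section Contraction

variable {Γ : Type*} [Group Γ] {X Y : Type*} [DiffeologicalSpace X] [DiffeologicalSpace Y]
  [MulAction Γ X] [SmoothAction Γ X] [MulAction Γ Y] [SmoothAction Γ Y]
  {f : X → Y} {h : ℝ → X → X}

namespace Cochain

variable {n m : ℕ}

/-- Basicness of an equivariant cochain is a condition on its values alone, because the descended
values are automatically equivariant. -/
lemma mem_range_pullback (hf : IsSubduction f) (hΓ : ∀ (g : Γ) (x : X), f (g • x) = g • f x)
    {u : Cochain Γ X n m} : u ∈ (pullback f hf.dSmooth hΓ (n := n) (m := m)).range ↔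
      ∀ s, u.1 s ∈ (DForm.pullback f hf.dSmooth (m := m)).range := by
  constructor
  · rintro ⟨v, rfl⟩ s
    exact ⟨v.1 s, rfl⟩
  · intro hu
    refine exists_pullback_eq hf hΓ fun s => ?_
    obtain ⟨β, hβ⟩ := hu s
    rw [← hβ]
    exact DForm.descends_pullback hf.dSmooth β

lemma delta_mem_range (hf : IsSubduction f) (hΓ : ∀ (g : Γ) (x : X), f (g • x) = g • f x)
    {u : Cochain Γ X n m} (hu : u ∈ (pullback f hf.dSmooth hΓ (n := n) (m := m)).range) :
    delta u ∈ (pullback f hf.dSmooth hΓ (n := n + 1) (m := m)).range := by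
  obtain ⟨v, rfl⟩ := hu
  refine ⟨delta v, Subtype.ext (funext fun s => ?_)⟩
  change DForm.pullback f hf.dSmooth ((delta v).1 s) = _
  rw [delta_apply, delta_apply, map_zsmul, map_sum]
  simp only [map_zsmul]
  rfl

/-- The homotopy operator on equivariant cochains. -/
def homotopyOp (H : IsFibreContraction f h) (u : Cochain Γ X n (m + 1)) : Cochain Γ X n m :=
  -- The contraction need not commute with `Γ`. Moving back by the last argument, applying the
  -- operator and moving forward again restores the equivariance rule; the price is that the
  -- operator no longer commutes with `δ`.
  ⟨fun s => translate Γ (s (Fin.last n)) (H.homotopyOp (translate Γ (s (Fin.last n))⁻¹ (u.1 s))),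
    fun s g => by
      beta_reduce
      rw [u.2 s g, translate_translate, translate_translate]
      congr 3
      group⟩

lemma homotopyOp_apply (H : IsFibreContraction f h) (u : Cochain Γ X n (m + 1))
    (s : Fin (n + 1) → Γ) : (homotopyOp H u).1 s =
      translate Γ (s (Fin.last n)) (H.homotopyOp (translate Γ (s (Fin.last n))⁻¹ (u.1 s))) := rfl

lemma homotopyOp_eq_zero (H : IsFibreContraction f h) (hf : IsSubduction f)
    (hΓ : ∀ (g : Γ) (x : X), f (g • x) = g • f x) {u : Cochain Γ X n (m + 1)}
    (hu : u ∈ (pullback f hf.dSmooth hΓ (n := n) (m := m + 1)).range) : homotopyOp H u = 0 := by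
  obtain ⟨v, rfl⟩ := hu
  refine Subtype.ext (funext fun s => ?_)
  rw [homotopyOp_apply]
  change translate Γ _ (H.homotopyOp (translate Γ _ (DForm.pullback f hf.dSmooth (v.1 s)))) = 0
  rw [← pullback_translate hf.dSmooth hΓ, H.homotopyOp_pullback, map_zero]

lemma translate_mem_range (hf : IsSubduction f) (hΓ : ∀ (g : Γ) (x : X), f (g • x) = g • f x)
    (g : Γ) {α : DForm X m} (hα : α ∈ (DForm.pullback f hf.dSmooth (m := m)).range) :
    translate Γ g α ∈ (DForm.pullback f hf.dSmooth (m := m)).range := by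
  obtain ⟨β, rfl⟩ := hα
  exact ⟨translate Γ g β, pullback_translate hf.dSmooth hΓ g β⟩

/-- By the homotopy formula conjugated by the last group element, the difference is the conjugate of
a pullback by `h 0`, which is basic; translating a basic form keeps it basic. -/
lemma sub_homotopyOp_mem_range (H : IsFibreContraction f h) (hf : IsSubduction f)
    (hΓ : ∀ (g : Γ) (x : X), f (g • x) = g • f x) (u : Cochain Γ X n (m + 1)) :
    u - deRham (homotopyOp H u) - homotopyOp H (deRham u) ∈
      (pullback f hf.dSmooth hΓ (n := n) (m := m + 1)).range := by
  rw [mem_range_pullback hf hΓ]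
  intro s
  set g := s (Fin.last n)
  have e : (u - deRham (homotopyOp H u) - homotopyOp H (deRham u)).1 s =
      translate Γ g (DForm.pullback (h 0) (H.dSmooth 0) (translate Γ g⁻¹ (u.1 s))) := by
    change u.1 s - DForm.d (translate Γ g (H.homotopyOp (translate Γ g⁻¹ (u.1 s)))) -
      translate Γ g (H.homotopyOp (DForm.d (translate Γ g⁻¹ (u.1 s)))) = _
    have h1 := H.d_homotopyOp_add (translate Γ g⁻¹ (u.1 s))
    rw [eq_sub_iff_add_eq, ← eq_sub_iff_add_eq'] at h1
    rw [h1, map_sub, map_add, translate_translate, inv_mul_cancel, translate_one, sub_add_eq_sub_sub]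
    rfl
  rw [e]
  exact translate_mem_range hf hΓ g (H.pullback_zero_mem_range hf _)

lemma sub_homotopyOp_mem_range_zero (H : IsFibreContraction f h) (hf : IsSubduction f)
    (hΓ : ∀ (g : Γ) (x : X), f (g • x) = g • f x) (u : Cochain Γ X n 0) :
    u - homotopyOp H (deRham u) ∈ (pullback f hf.dSmooth hΓ (n := n) (m := 0)).range := by
  rw [mem_range_pullback hf hΓ]
  intro s
  set g := s (Fin.last n)
  have e : (u - homotopyOp H (deRham u)).1 s =
      translate Γ g (DForm.pullback (h 0) (H.dSmooth 0) (translate Γ g⁻¹ (u.1 s))) := by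
    change u.1 s - translate Γ g (H.homotopyOp (DForm.d (translate Γ g⁻¹ (u.1 s)))) = _
    have h1 := H.homotopyOp_d_zero (translate Γ g⁻¹ (u.1 s))
    rw [h1, map_sub, translate_translate, inv_mul_cancel, translate_one, sub_sub_cancel]
  rw [e]
  exact translate_mem_range hf hΓ g (H.pullback_zero_mem_range hf _)

end Cochain

namespace TotCochain

/-- The homotopy operator on the total complex. -/
def homotopyOp (H : IsFibreContraction f h) (u : TotCochain Γ X) : TotCochain Γ X :=
  fun n m => Cochain.homotopyOp H (u n (m + 1))

lemma homotopyOp_mem_degree (H : IsFibreContraction f h) {k : ℕ} {u : TotCochain Γ X}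
    (hu : u ∈ degree Γ X (k + 1)) : homotopyOp H u ∈ degree Γ X k := by
  intro n m hnm
  refine Subtype.ext (funext fun s => ?_)
  change (Cochain.homotopyOp H (u n (m + 1))).1 s = 0
  have h0 : H.homotopyOp (0 : DForm X (m + 1)) = 0 := by
    have h := H.homotopyOp_add (0 : DForm X (m + 1)) 0
    rwa [add_zero, left_eq_add] at h
  rw [hu n (m + 1) (by omega), Cochain.homotopyOp_apply]
  change translate Γ _ (H.homotopyOp (translate Γ _ 0)) = 0
  rw [map_zero, h0, map_zero]

/-- The inductive step on the simplicial degree. For `n ≤ j` the component of bidegree `(n - 1, m +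
1)` is basic, hence killed by `K`, and contributes nothing to the `δ` part of `D(Ku)`. Since `D u`
is basic and `δ` preserves basic cochains, `d(u n m)` is basic and `K d` vanishes on it. What is
left is `u - dKu - Kdu`, which is basic. -/
lemma sub_D_homotopyOp_mem_range (H : IsFibreContraction f h) (hf : IsSubduction f)
    (hΓ : ∀ (g : Γ) (x : X), f (g • x) = g • f x) {u : TotCochain Γ X}
    (hDu : ∀ n m, D u n m ∈ (Cochain.pullback f hf.dSmooth hΓ (n := n) (m := m)).range) {j : ℕ}
    (hu : ∀ n < j, ∀ m, u n m ∈ (Cochain.pullback f hf.dSmooth hΓ (n := n) (m := m)).range) :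
    ∀ n < j + 1, ∀ m, (u - D (homotopyOp H u)) n m ∈
      (Cochain.pullback f hf.dSmooth hΓ (n := n) (m := m)).range := by
  intro n hn m
  have h1 : deltaComp (homotopyOp H u) n m = 0 := by
    cases n with
    | zero => rfl
    | succ n =>
      change Cochain.delta (Cochain.homotopyOp H (u n (m + 1))) = 0
      rw [Cochain.homotopyOp_eq_zero H hf hΓ (hu n (by omega) _), map_zero]
  have h2 : Cochain.homotopyOp H (Cochain.deRham (u n m)) = 0 := by
    refine Cochain.homotopyOp_eq_zero H hf hΓ ?_
    have h3 : deltaComp u n (m + 1) ∈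
        (Cochain.pullback f hf.dSmooth hΓ (n := n) (m := m + 1)).range := by
      cases n with
      | zero => exact zero_mem _
      | succ n => exact Cochain.delta_mem_range hf hΓ (hu n (by omega) _)
    have h4 := sub_mem (hDu n (m + 1)) h3
    rwa [D_apply, add_sub_cancel_right] at h4
  change u n m - (deRhamComp (homotopyOp H u) n m + deltaComp (homotopyOp H u) n m) ∈ _
  rw [h1, add_zero]
  cases m with
  | zero =>
    have h3 := Cochain.sub_homotopyOp_mem_range_zero H hf hΓ (u n 0)
    rw [h2, sub_zero] at h3
    change u n 0 - 0 ∈ _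
    rwa [sub_zero]
  | succ m =>
    have h3 := Cochain.sub_homotopyOp_mem_range H hf hΓ (u n (m + 1))
    rwa [h2, sub_zero] at h3

/-- A cochain with basic differential is basic up to a coboundary. -/
lemma exists_eq_pullback_add_D (H : IsFibreContraction f h) (hf : IsSubduction f)
    (hΓ : ∀ (g : Γ) (x : X), f (g • x) = g • f x) {k : ℕ} {u : TotCochain Γ X}
    (hu : u ∈ degree Γ X (k + 1)) (hDu : D u ∈ (pullback f hf.dSmooth hΓ).range) :
    ∃ w ∈ degree Γ Y (k + 1), ∃ x, u = pullback f hf.dSmooth hΓ w + D x := by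
  have hD : ∀ n m, D u n m ∈ (Cochain.pullback f hf.dSmooth hΓ (n := n) (m := m)).range := by
    obtain ⟨v, hv⟩ := hDu
    intro n m
    rw [← hv]
    exact ⟨v n m, rfl⟩
  have key : ∀ j, ∃ x, u - D x ∈ degree Γ X (k + 1) ∧ ∀ n < j, ∀ m, (u - D x) n m ∈
      (Cochain.pullback f hf.dSmooth hΓ (n := n) (m := m)).range := by
    intro j
    induction j with
    | zero => exact ⟨0, by rwa [map_zero, sub_zero], fun n hn => absurd hn (Nat.not_lt_zero n)⟩
    | succ j ih =>
      obtain ⟨x, hx, hj⟩ := ih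
      refine ⟨x + homotopyOp H (u - D x), ?_, ?_⟩
      · rw [map_add, ← sub_sub]
        exact sub_mem hx (D_mem_degree (homotopyOp_mem_degree H hx))
      · rw [map_add, ← sub_sub]
        refine sub_D_homotopyOp_mem_range H hf hΓ (fun n m => ?_) hj
        rw [map_sub, D_D, sub_zero]
        exact hD n m
  -- A cochain of total degree `k + 1` has no components of simplicial degree `k + 2` or more, so `k
  -- + 2` corrections make it basic throughout.
  obtain ⟨x, hx, hj⟩ := key (k + 2)
  have hall : ∀ n m, ∃ w, Cochain.pullback f hf.dSmooth hΓ w = (u - D x) n m := by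
    intro n m
    by_cases hn : n < k + 2
    · exact hj n hn m
    · rw [hx n m (by omega)]
      exact ⟨0, map_zero _⟩
  choose w hw using hall
  have hw' : pullback f hf.dSmooth hΓ w = u - D x := funext fun n => funext fun m => hw n m
  refine ⟨w, fun n m hnm => Cochain.pullback_injective hf hΓ ?_, x, ?_⟩
  · rw [hw, hx n m hnm, map_zero]
  · rw [hw', sub_add_cancel]

end TotCochain

namespace EquivCohomology

/-- A cocycle has differential zero, which is basic; so it is basic up to a coboundary, and its
descended part is closed because pullback of cochains is injective. -/
lemma pullback_surjective (H : IsFibreContraction f h) (hf : IsSubduction f)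
    (hΓ : ∀ (g : Γ) (x : X), f (g • x) = g • f x) (k : ℕ) :
    Function.Surjective (pullback f hf.dSmooth hΓ (k := k + 1)) := by
  intro c
  obtain ⟨u, hu, rfl⟩ := exists_mk c
  obtain ⟨w, hw, x, e⟩ := TotCochain.exists_eq_pullback_add_D H hf hΓ hu.1
    ⟨0, by rw [map_zero]; exact hu.2.symm⟩
  have hDw : TotCochain.D w = 0 := by
    refine TotCochain.pullback_injective hf hΓ ?_
    have h1 : TotCochain.D u = 0 := hu.2
    rwa [e, map_add, TotCochain.D_D, add_zero, TotCochain.D_pullback, ← map_zero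
      (TotCochain.pullback f hf.dSmooth hΓ)] at h1
  have hw' : w ∈ TotCochain.cocycles Γ Y (k + 1) := ⟨hw, hDw⟩
  exact ⟨mk w hw', (pullback_mk hf.dSmooth hΓ hw').trans
    ((mk_eq_mk _ _).mpr ⟨x, by rw [e, add_sub_cancel_left]⟩)⟩

/-- If the pullback of `u` is `D v`, then `v` has basic differential and is itself basic up to a
coboundary; its descended part is a primitive of `u`. The degree is at least two because the
primitive must have degree at least one for the descent of cochains to apply. -/
lemma pullback_injective (H : IsFibreContraction f h) (hf : IsSubduction f)
    (hΓ : ∀ (g : Γ) (x : X), f (g • x) = g • f x) (k : ℕ) :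
    Function.Injective (pullback f hf.dSmooth hΓ (k := k + 2)) := by
  rw [injective_iff_map_eq_zero]
  intro c hc
  obtain ⟨u, hu, rfl⟩ := exists_mk c
  rw [zero_eq_mk, pullback_mk, eq_comm, mk_eq_mk] at hc
  obtain ⟨v, hv⟩ := hc
  rw [sub_zero] at hv
  have hdeg : TotCochain.D v ∈ TotCochain.degree Γ X (k + 1 + 1) := by
    rw [hv]
    exact (TotCochain.pullback_mem_cocycles hf.dSmooth hΓ hu).1
  -- The given primitive `v` may be inhomogeneous; it is replaced by its component of degree `k +
  -- 1`.
  obtain ⟨w, -, x, e⟩ := TotCochain.exists_eq_pullback_add_D H hf hΓ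
    (TotCochain.component_mem_degree (k + 1) v)
    ⟨u, by rw [TotCochain.D_component hdeg, hv]⟩
  have h2 := TotCochain.D_component hdeg
  rw [e, map_add, TotCochain.D_D, add_zero, TotCochain.D_pullback, hv] at h2
  rw [zero_eq_mk, eq_comm, mk_eq_mk]
  exact ⟨w, by rw [sub_zero]; exact TotCochain.pullback_injective hf hΓ h2⟩

end EquivCohomology

end Contraction

/-! ## Local coordinates on `S¹ × Σ` -/

section SecondDerivatives

variable {U V W : Type*} [NormedAddCommGroup U] [NormedSpace ℝ U] [NormedAddCommGroup V]
  [NormedSpace ℝ V] [NormedAddCommGroup W] [NormedSpace ℝ W]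

lemma ContDiffAt.differentiableAt_fderiv {g : V → W} {x : V} (hg : ContDiffAt ℝ ∞ g x) :
    DifferentiableAt ℝ (fderiv ℝ g) x :=
  (hg.fderiv_right (m := 1) (by simpa [one_add_one_eq_two] using two_le_inf)).differentiableAt one_ne_zero

lemma ContDiffAt.eventually_differentiableAt {g : V → W} {x : V} (hg : ContDiffAt ℝ ∞ g x) :
    ∀ᶠ y in 𝓝 x, DifferentiableAt ℝ g y :=
  ((hg.of_le (m := 1) (by simp)).eventually (by simp)).mono fun _ h =>
    h.differentiableAt one_ne_zero

lemma fderiv_comp_eventuallyEq {g : V → W} {b : U → V} {x : U} (hg : ContDiffAt ℝ ∞ g (b x))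
    (hb : ContDiffAt ℝ ∞ b x) :
    fderiv ℝ (g ∘ b) =ᶠ[𝓝 x] fun y => (fderiv ℝ g (b y)).comp (fderiv ℝ b y) := by
  filter_upwards [ContDiffAt.eventually_differentiableAt hb, hb.continuousAt.eventually
    (ContDiffAt.eventually_differentiableAt hg)] with y h1 h2
  exact fderiv_comp y h2 h1

lemma fderiv_fderiv_comp {g : V → W} {b : U → V} {x : U} (hg : ContDiffAt ℝ ∞ g (b x))
    (hb : ContDiffAt ℝ ∞ b x) (u v : U) : fderiv ℝ (fderiv ℝ (g ∘ b)) x u v =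
      fderiv ℝ (fderiv ℝ g) (b x) (fderiv ℝ b x u) (fderiv ℝ b x v) +
        fderiv ℝ g (b x) (fderiv ℝ (fderiv ℝ b) x u v) := by
  rw [(fderiv_comp_eventuallyEq hg hb).fderiv_eq]
  have h1 : HasFDerivAt (fun y => fderiv ℝ g (b y))
      ((fderiv ℝ (fderiv ℝ g) (b x)).comp (fderiv ℝ b x)) x :=
    (ContDiffAt.differentiableAt_fderiv hg).hasFDerivAt.comp x
      (hb.differentiableAt (by simp)).hasFDerivAt
  have h2 := (ContDiffAt.differentiableAt_fderiv hb).hasFDerivAt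
  rw [(h1.clm_comp h2).fderiv]
  simp [add_comm]

lemma fderiv_fderiv_symm {g : V → W} {x : V} (hg : ContDiffAt ℝ ∞ g x) (u v : V) :
    fderiv ℝ (fderiv ℝ g) x u v = fderiv ℝ (fderiv ℝ g) x v u :=
  (hg.isSymmSndFDerivAt (by simpa using two_le_inf)) u v

/-- The polynomial map `u ↦ c + A u + ½ B(u, u)`. -/
def quadMap (c : V) (A : U →L[ℝ] V) (B : U →L[ℝ] U →L[ℝ] V) (u : U) : V :=
  c + A u + (1 / 2 : ℝ) • B u u

lemma quadMap_zero (c : V) (A : U →L[ℝ] V) (B : U →L[ℝ] U →L[ℝ] V) : quadMap c A B 0 = c := by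
  simp [quadMap]

lemma contDiff_quadMap (c : V) (A : U →L[ℝ] V) (B : U →L[ℝ] U →L[ℝ] V) :
    ContDiff ℝ ∞ (quadMap c A B) := by
  unfold quadMap
  have h : ContDiff ℝ ∞ fun u => B u u := B.contDiff.clm_apply contDiff_id
  exact (contDiff_const.add A.contDiff).add (contDiff_const.smul h)

lemma fderiv_quadMap (c : V) (A : U →L[ℝ] V) {B : U →L[ℝ] U →L[ℝ] V} (hB : ∀ u v, B u v = B v u) :
    fderiv ℝ (quadMap c A B) = fun u => A + B u := by
  funext u
  have h := ((hasFDerivAt_const (𝕜 := ℝ) c u).add (A.hasFDerivAt (x := u))).add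
    ((B.hasFDerivAt (x := u)).clm_apply (hasFDerivAt_id (𝕜 := ℝ) u) |>.const_smul (1 / 2 : ℝ))
  refine (HasFDerivAt.fderiv (f := quadMap c A B) h).trans ?_
  ext v
  simp only [zero_add, add_apply, smul_apply,
    ContinuousLinearMap.coe_comp, Function.comp_apply, id_eq, ContinuousLinearMap.flip_apply,
    ContinuousLinearMap.id_apply]
  rw [hB v u, ← two_smul ℝ, smul_smul]
  norm_num

lemma fderiv_quadMap_zero (c : V) (A : U →L[ℝ] V) {B : U →L[ℝ] U →L[ℝ] V}
    (hB : ∀ u v, B u v = B v u) : fderiv ℝ (quadMap c A B) 0 = A := by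
  simp [fderiv_quadMap c A hB]

lemma fderiv_fderiv_quadMap_zero (c : V) (A : U →L[ℝ] V) {B : U →L[ℝ] U →L[ℝ] V}
    (hB : ∀ u v, B u v = B v u) : fderiv ℝ (fderiv ℝ (quadMap c A B)) 0 = B := by
  rw [fderiv_quadMap c A hB]
  simp [fderiv_const_add, ContinuousLinearMap.fderiv]

end SecondDerivatives

section RealStructure

variable {S : Type*} [TopologicalSpace S] [ChartedSpace ℂ S]

lemma mem_contDiffGroupoid_real {e : OpenPartialHomeomorph ℂ ℂ}
    (he : e ∈ contDiffGroupoid ω 𝓘(ℂ, ℂ)) : e ∈ contDiffGroupoid ∞ 𝓘(ℝ, ℂ) := by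
  rw [contDiffGroupoid, mem_groupoid_of_pregroupoid] at he ⊢
  exact ⟨(he.1.restrict_scalars ℝ).of_le le_top, (he.2.restrict_scalars ℝ).of_le le_top⟩

lemma mem_maximalAtlas_real {φ : OpenPartialHomeomorph S ℂ}
    (hφ : φ ∈ IsManifold.maximalAtlas 𝓘(ℂ, ℂ) ω S) :
    φ ∈ IsManifold.maximalAtlas 𝓘(ℝ, ℂ) ∞ S := fun e he =>
  ⟨mem_contDiffGroupoid_real (hφ e he).1, mem_contDiffGroupoid_real (hφ e he).2⟩

lemma isManifold_real [IsManifold 𝓘(ℂ, ℂ) ω S] : IsManifold 𝓘(ℝ, ℂ) ∞ S :=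
  { compatible := fun he he' => mem_contDiffGroupoid_real
      ((contDiffGroupoid ω 𝓘(ℂ, ℂ)).compatible he he') }

end RealStructure

section Coordinates

variable {S : Type*} [TopologicalSpace S] [ChartedSpace ℂ S]

/-- `κ` restricts to smooth local coordinates on a neighbourhood of `m`. -/
structure IsCoord (κ : Mfd S → V3) (m : Mfd S) : Prop where
  smooth : ∀ᶠ y in 𝓝 m, ContMDiffAt IM 𝓘(ℝ, V3) ∞ κ y
  exists_inverse : ∃ l : V3 → Mfd S, (∀ᶠ v in 𝓝 (κ m), ContMDiffAt 𝓘(ℝ, V3) IM ∞ l v) ∧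
    (∀ᶠ v in 𝓝 (κ m), κ (l v) = v) ∧ ∀ᶠ y in 𝓝 m, l (κ y) = y

namespace IsCoord

variable {κ κ' : Mfd S → V3} {m : Mfd S}

lemma continuousAt (h : IsCoord κ m) : ContinuousAt κ m := h.smooth.self_of_nhds.continuousAt

lemma eventually (h : IsCoord κ m) : ∀ᶠ m' in 𝓝 m, IsCoord κ m' := by
  obtain ⟨l, h1, h2, h3⟩ := h.exists_inverse
  filter_upwards [h.smooth.eventually_nhds, h.continuousAt.eventually h1.eventually_nhds,
    h.continuousAt.eventually h2.eventually_nhds, h3.eventually_nhds] with m' a b c d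
  exact ⟨a, l, b, c, d⟩

/-- The transition map from one system of coordinates to another. -/
lemma exists_transition (h : IsCoord κ m) {V : Type*} [NormedAddCommGroup V] [NormedSpace ℝ V]
    {f : Mfd S → V} (hf : ∀ᶠ y in 𝓝 m, ContMDiffAt IM 𝓘(ℝ, V) ∞ f y) :
    ∃ τ : V3 → V, (∀ᶠ v in 𝓝 (κ m), ContDiffAt ℝ ∞ τ v) ∧ ∀ᶠ y in 𝓝 m, f y = τ (κ y) := by
  obtain ⟨l, h1, h2, h3⟩ := h.exists_inverse
  have hl : l (κ m) = m := h3.self_of_nhds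
  have hc : ContinuousAt l (κ m) := h1.self_of_nhds.continuousAt
  refine ⟨f ∘ l, ?_, ?_⟩
  · rw [ContinuousAt, hl] at hc
    filter_upwards [h1, hc.eventually hf] with v hv hv'
    exact (ContMDiffAt.comp v hv' hv).contDiffAt
  · filter_upwards [h3] with y hy
    exact congrArg f hy.symm

lemma smul {Γ : Type*} [Group Γ] [MulAction Γ (Mfd S)] [IsConformalLoopAction Γ S] {g : Γ}
    (h : IsCoord κ (g • m)) : IsCoord (fun x => κ (g • x)) m := by
  have hg := IsConformalLoopAction.contMDiff_smul (S := S) g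
  have hg' := IsConformalLoopAction.contMDiff_smul (S := S) g⁻¹
  obtain ⟨l, h1, h2, h3⟩ := h.exists_inverse
  refine ⟨?_, fun v => g⁻¹ • l v, ?_, ?_, ?_⟩
  · filter_upwards [(hg.continuous.tendsto m).eventually h.smooth] with y hy
    exact ContMDiffAt.comp y hy hg.contMDiffAt
  · filter_upwards [h1] with v hv
    exact hg'.contMDiffAt.comp v hv
  · filter_upwards [h2] with v hv
    rw [smul_inv_smul, hv]
  · filter_upwards [(hg.continuous.tendsto m).eventually h3] with y hy
    rw [hy, inv_smul_smul]

end IsCoord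

lemma contMDiffAt_coord {W : Type*} [NormedAddCommGroup W] [NormedSpace ℝ W] {F : W → Mfd S}
    {w : W} {V : Type*} [NormedAddCommGroup V] [NormedSpace ℝ V]
    {f : Mfd S → V} (hf : ContMDiffAt IM 𝓘(ℝ, V) ∞ f (F w))
    (hF : ContMDiffAt 𝓘(ℝ, W) IM ∞ F w) : ContDiffAt ℝ ∞ (fun w => f (F w)) w :=
  (ContMDiffAt.comp w hf hF).contDiffAt

/-- The local coordinates `(t - t₀, z)` with `z = φ` a holomorphic coordinate. -/
def prodCoord (t : Circle) (φ : OpenPartialHomeomorph S ℂ) : Mfd S → V3 := fun y =>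
  (Complex.arg ((y.1 / t : Circle) : ℂ), φ y.2)

/-- The argument is the imaginary part of the principal logarithm, which is smooth off the slit. -/
lemma contMDiffAt_arg_div {t y : Circle} (h : ((y / t : Circle) : ℂ) ∈ Complex.slitPlane) :
    ContMDiffAt (𝓡 1) 𝓘(ℝ, ℝ) ∞ (fun y : Circle => Complex.arg ((y / t : Circle) : ℂ)) y := by
  have h1 : ContMDiff (𝓡 1) (𝓡 1) ∞ (fun y : Circle => y / t) := by
    have : LieGroup (𝓡 1) ∞ Circle := LieGroup.of_le (n := ω) le_top
    exact contMDiff_id.div contMDiff_const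
  have h2 : ContMDiff (𝓡 1) 𝓘(ℝ, ℂ) ∞ (fun y : Circle => (y : ℂ)) :=
    haveI : Fact (Module.finrank ℝ ℂ = 1 + 1) := ⟨Complex.finrank_real_complex⟩
    contMDiff_coe_sphere
  have h3 : ContDiffAt ℝ ∞ Complex.arg ((y / t : Circle) : ℂ) := by
    have h4 := (Complex.contDiffAt_log h (n := ∞)).restrict_scalars ℝ
    have h5 := Complex.imCLM.contDiff.contDiffAt.comp _ h4
    exact h5.congr_of_eventuallyEq (Filter.Eventually.of_forall fun z => (Complex.log_im z).symm)
  exact (h3.contMDiffAt.comp (y / t) h2.contMDiffAt).comp y h1.contMDiffAt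

/-- The angle is measured from `t` with the cut opposite to `t`, so the coordinate serves at every
point of the circle other than `-t`. The inverse is the exponential on the circle factor and
`φ.symm` on the other. -/
lemma isCoord_prodCoord {φ : OpenPartialHomeomorph S ℂ}
    (hφ : φ ∈ IsManifold.maximalAtlas 𝓘(ℝ, ℂ) ∞ S) {t : Circle} {m : Mfd S} (hm : m.2 ∈ φ.source)
    (ht : ((m.1 / t : Circle) : ℂ) ∈ Complex.slitPlane) : IsCoord (prodCoord t φ) m := by
  have hs : IsOpen {y : Mfd S | ((y.1 / t : Circle) : ℂ) ∈ Complex.slitPlane ∧ y.2 ∈ φ.source} := by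
    refine IsOpen.inter (Complex.isOpen_slitPlane.preimage ?_) (φ.open_source.preimage continuous_snd)
    fun_prop
  have hlog : Complex.log ((m.1 / t : Circle) : ℂ) ∈ {z : ℂ | z.im ∈ Set.Ioo (-Real.pi) Real.pi} := by
    rw [Set.mem_ofPred_eq, Complex.log_im]
    exact ⟨Complex.neg_pi_lt_arg _,
      lt_of_le_of_ne (Complex.arg_le_pi _) (Complex.mem_slitPlane_iff_arg.mp ht).1⟩
  rw [Set.mem_ofPred_eq, Complex.log_im] at hlog
  have ht' : IsOpen {v : V3 | v.1 ∈ Set.Ioo (-Real.pi) Real.pi ∧ v.2 ∈ φ.target} :=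
    IsOpen.inter (isOpen_Ioo.preimage continuous_fst) (φ.open_target.preimage continuous_snd)
  refine ⟨?_, fun v => (t * Circle.exp v.1, φ.symm v.2), ?_, ?_, ?_⟩
  · filter_upwards [hs.mem_nhds ⟨ht, hm⟩] with y hy
    have h1 := (contMDiffAt_arg_div hy.1).comp y
      (contMDiffAt_fst (I := 𝓡 1) (J := 𝓘(ℝ, ℂ)) (M := Circle) (N := S))
    have h2 := ((contMDiffOn_of_mem_maximalAtlas hφ).contMDiffAt
      (φ.open_source.mem_nhds hy.2)).comp y
      (contMDiffAt_snd (I := 𝓡 1) (J := 𝓘(ℝ, ℂ)) (M := Circle) (N := S))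
    exact h1.prodMk_space h2
  · filter_upwards [ht'.mem_nhds ⟨hlog, φ.map_source hm⟩] with v hv
    have h1 : ContMDiff 𝓘(ℝ, V3) (𝓡 1) ∞ (fun v : V3 => t * Circle.exp v.1) := by
      have : LieGroup (𝓡 1) ∞ Circle := LieGroup.of_le (n := ω) le_top
      exact contMDiff_const.mul (contMDiff_circleExp.comp contDiff_fst.contMDiff)
    have h2 : ContMDiffAt 𝓘(ℝ, V3) 𝓘(ℝ, ℂ) ∞ (fun v : V3 => φ.symm v.2) v :=
      ((contMDiffOn_symm_of_mem_maximalAtlas hφ).contMDiffAt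
        (φ.open_target.mem_nhds hv.2)).comp v contDiff_snd.contMDiff.contMDiffAt
    exact h1.contMDiffAt.prodMk h2
  · filter_upwards [ht'.mem_nhds ⟨hlog, φ.map_source hm⟩] with v hv
    refine Prod.ext ?_ (φ.right_inv hv.2)
    change Complex.arg ((t * Circle.exp v.1 / t : Circle) : ℂ) = v.1
    rw [mul_div_cancel_left]
    exact Circle.arg_exp hv.1.1 hv.1.2.le
  · filter_upwards [hs.mem_nhds ⟨ht, hm⟩] with y hy
    refine Prod.ext ?_ (φ.left_inv hy.2)
    change t * Circle.exp (Complex.arg ((y.1 / t : Circle) : ℂ)) = y.1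
    rw [Circle.exp_arg, mul_div_cancel]

lemma div_self_mem_slitPlane (t : Circle) : ((t / t : Circle) : ℂ) ∈ Complex.slitPlane := by
  simp

lemma isCoord_prodCoord_self {φ : OpenPartialHomeomorph S ℂ}
    (hφ : φ ∈ IsManifold.maximalAtlas 𝓘(ℝ, ℂ) ∞ S) {m : Mfd S} (hm : m.2 ∈ φ.source) :
    IsCoord (prodCoord m.1 φ) m :=
  isCoord_prodCoord hφ hm (div_self_mem_slitPlane m.1)

lemma isCoord_coordAt [IsManifold 𝓘(ℝ, ℂ) ∞ S] (m : Mfd S) : IsCoord (coordAt m) m :=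
  isCoord_prodCoord_self (IsManifold.chart_mem_maximalAtlas m.2) (mem_chart_source ℂ m.2)

end Coordinates

/-! ## Jets in local coordinates -/

section JetCoordinates

variable {S : Type*} [TopologicalSpace S] [ChartedSpace ℂ S] {κ κ' : Mfd S → V3} {m : Mfd S}
  {j j' : V3 → Mfd S}

section Transition

variable {V : Type*} [NormedAddCommGroup V] [NormedSpace ℝ V] {f : Mfd S → V} {τ : V3 → V}

lemma fderiv_comp_transition (hj : ContMDiffAt 𝓘(ℝ, V3) IM ∞ j 0)
    (hκ : ContMDiffAt IM 𝓘(ℝ, V3) ∞ κ (j 0)) (hτ : ContDiffAt ℝ ∞ τ (κ (j 0)))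
    (h : ∀ᶠ y in 𝓝 (j 0), f y = τ (κ y)) :
    fderiv ℝ (f ∘ j) 0 = (fderiv ℝ τ (κ (j 0))).comp (fderiv ℝ (κ ∘ j) 0) := by
  have e : f ∘ j =ᶠ[𝓝 0] τ ∘ (κ ∘ j) := hj.continuousAt.eventually h
  rw [e.fderiv_eq]
  exact (fderiv_comp_eventuallyEq (g := τ) (b := κ ∘ j) hτ
    (contMDiffAt_coord hκ hj)).self_of_nhds

lemma fderiv_fderiv_comp_transition (hj : ContMDiffAt 𝓘(ℝ, V3) IM ∞ j 0)
    (hκ : ContMDiffAt IM 𝓘(ℝ, V3) ∞ κ (j 0)) (hτ : ContDiffAt ℝ ∞ τ (κ (j 0)))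
    (h : ∀ᶠ y in 𝓝 (j 0), f y = τ (κ y)) (u v : V3) :
    fderiv ℝ (fderiv ℝ (f ∘ j)) 0 u v =
      fderiv ℝ (fderiv ℝ τ) (κ (j 0)) (fderiv ℝ (κ ∘ j) 0 u) (fderiv ℝ (κ ∘ j) 0 v) +
        fderiv ℝ τ (κ (j 0)) (fderiv ℝ (fderiv ℝ (κ ∘ j)) 0 u v) := by
  have e : f ∘ j =ᶠ[𝓝 0] τ ∘ (κ ∘ j) := hj.continuousAt.eventually h
  rw [e.fderiv.fderiv_eq]
  exact fderiv_fderiv_comp (g := τ) (b := κ ∘ j) hτ (contMDiffAt_coord hκ hj) u v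

end Transition

/-- Near the base point every test function is a smooth function of the coordinates, so by the chain
rule it sees no more of a germ than the coordinates do. With the analogous statement for second
derivatives this means that the coordinates of a jet determine it. -/
lemma fderiv_comp_eq_of_coord (hj : ContMDiffAt 𝓘(ℝ, V3) IM ∞ j 0)
    (hj' : ContMDiffAt 𝓘(ℝ, V3) IM ∞ j' 0) (h0 : j 0 = j' 0) (hκ : IsCoord κ (j 0))
    (h1 : fderiv ℝ (κ ∘ j) 0 = fderiv ℝ (κ ∘ j') 0)
    {f : Mfd S → V3} (hf : ∀ᶠ y in 𝓝 (j 0), ContMDiffAt IM 𝓘(ℝ, V3) ∞ f y) :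
    fderiv ℝ (f ∘ j) 0 = fderiv ℝ (f ∘ j') 0 := by
  obtain ⟨τ, hτ, e⟩ := hκ.exists_transition hf
  have hκ' := hκ.smooth.self_of_nhds
  rw [fderiv_comp_transition hj hκ' hτ.self_of_nhds e]
  rw [h0] at hκ' hτ e
  rw [fderiv_comp_transition hj' hκ' hτ.self_of_nhds e, h1, h0]

lemma sameJet_of_coord (hj : ContMDiffAt 𝓘(ℝ, V3) IM ∞ j 0)
    (hj' : ContMDiffAt 𝓘(ℝ, V3) IM ∞ j' 0) (h0 : j 0 = j' 0) (hκ : IsCoord κ (j 0))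
    (h1 : fderiv ℝ (κ ∘ j) 0 = fderiv ℝ (κ ∘ j') 0)
    (h2 : fderiv ℝ (fderiv ℝ (κ ∘ j)) 0 = fderiv ℝ (fderiv ℝ (κ ∘ j')) 0) : SameJet j j' := by
  refine ⟨h0, fun f hf => ⟨fderiv_comp_eq_of_coord hj hj' h0 hκ h1 hf, ?_⟩⟩
  obtain ⟨τ, hτ, e⟩ := hκ.exists_transition hf
  have hκ' := hκ.smooth.self_of_nhds
  refine ContinuousLinearMap.ext fun u => ContinuousLinearMap.ext fun v => ?_
  rw [fderiv_fderiv_comp_transition hj hκ' hτ.self_of_nhds e]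
  rw [h0] at hκ' hτ e
  rw [fderiv_fderiv_comp_transition hj' hκ' hτ.self_of_nhds e, h1, h2, h0]

/-- Orientation is a condition on the first derivative only, so it passes to any smooth germ with
the same 1-jet. -/
lemma isFrame_of_coord [IsManifold 𝓘(ℝ, ℂ) ∞ S]
    (hj : ∀ᶠ v in 𝓝 (0 : V3), ContMDiffAt 𝓘(ℝ, V3) IM ∞ j v)
    (hj' : IsFrame j') (h0 : j 0 = j' 0) (hκ : IsCoord κ (j 0))
    (h1 : fderiv ℝ (κ ∘ j) 0 = fderiv ℝ (κ ∘ j') 0) : IsFrame j := by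
  refine ⟨hj, ?_⟩
  rw [fderiv_comp_eq_of_coord hj.self_of_nhds hj'.1.self_of_nhds h0 hκ h1
    (isCoord_coordAt (j 0)).smooth, h0]
  exact hj'.2

/-- The second derivative of a composition, from the first and second derivatives. -/
def quadComp (Y : V3 →L[ℝ] V3) (YY : V3 →L[ℝ] V3 →L[ℝ] V3) (A : V3 →L[ℝ] V3)
    (B : V3 →L[ℝ] V3 →L[ℝ] V3) : V3 →L[ℝ] V3 →L[ℝ] V3 :=
  ((ContinuousLinearMap.compL ℝ V3 V3 V3).flip A).comp (YY.comp A) +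
    (ContinuousLinearMap.compL ℝ V3 V3 V3 Y).comp B

lemma contDiffAt_quadComp {W : Type*} [NormedAddCommGroup W] [NormedSpace ℝ W]
    {Y A : W → V3 →L[ℝ] V3} {YY B : W → V3 →L[ℝ] V3 →L[ℝ] V3} {x : W} (hY : ContDiffAt ℝ ∞ Y x)
    (hYY : ContDiffAt ℝ ∞ YY x) (hA : ContDiffAt ℝ ∞ A x) (hB : ContDiffAt ℝ ∞ B x) :
    ContDiffAt ℝ ∞ (fun x => quadComp (Y x) (YY x) (A x) (B x)) x := by
  have h1 : ContDiffAt ℝ ∞ (fun x => (ContinuousLinearMap.compL ℝ V3 V3 V3).flip (A x)) x :=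
    (ContinuousLinearMap.contDiff _).contDiffAt.comp x hA
  have h2 : ContDiffAt ℝ ∞ (fun x => ContinuousLinearMap.compL ℝ V3 V3 V3 (Y x)) x :=
    (ContinuousLinearMap.contDiff _).contDiffAt.comp x hY
  exact (h1.clm_comp (hYY.clm_comp hA)).add (h2.clm_comp hB)

namespace J2

variable {J J' : J2 S}

lemma isFrame_rep (J : J2 S) : IsFrame J.rep := (Quotient.out (s := jetSetoid S) J).2

lemma mk_rep (J : J2 S) : mk J.rep J.isFrame_rep = J := Quotient.out_eq (s := jetSetoid S) J

lemma sameJet_rep_mk (hj : IsFrame j) : SameJet (mk j hj).rep j :=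
  Quotient.exact (s := jetSetoid S) (Quotient.out_eq (s := jetSetoid S) (mk j hj))

lemma mk_eq_mk (hj : IsFrame j) (hj' : IsFrame j') (h : SameJet j j') : mk j hj = mk j' hj' :=
  Quotient.sound (s := jetSetoid S) h

lemma base_mk (hj : IsFrame j) : base (mk j hj) = j 0 := rfl

lemma rep_zero (J : J2 S) : J.rep 0 = base J := by
  conv_rhs => rw [← mk_rep J]
  rfl

lemma contMDiffAt_rep (J : J2 S) : ContMDiffAt 𝓘(ℝ, V3) IM ∞ J.rep 0 :=
  J.isFrame_rep.1.self_of_nhds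

/-- `coordY` is defined through an arbitrarily chosen representative of the jet; equality of jets
makes the choice immaterial. -/
lemma coordY_mk (hj : IsFrame j) (hκ : ∀ᶠ y in 𝓝 (j 0), ContMDiffAt IM 𝓘(ℝ, V3) ∞ κ y) :
    coordY κ (mk j hj) = fderiv ℝ (κ ∘ j) 0 := by
  have h := sameJet_rep_mk hj
  exact (h.2 κ (by rwa [h.1])).1

lemma coordYY_mk (hj : IsFrame j) (hκ : ∀ᶠ y in 𝓝 (j 0), ContMDiffAt IM 𝓘(ℝ, V3) ∞ κ y) :
    coordYY κ (mk j hj) = fderiv ℝ (fderiv ℝ (κ ∘ j)) 0 := by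
  have h := sameJet_rep_mk hj
  exact (h.2 κ (by rwa [h.1])).2

lemma ext_coord (hκ : IsCoord κ (base J)) (h0 : base J = base J')
    (h1 : coordY κ J = coordY κ J') (h2 : coordYY κ J = coordYY κ J') : J = J' := by
  rw [← mk_rep J, ← mk_rep J']
  refine mk_eq_mk _ _ (sameJet_of_coord J.contMDiffAt_rep J'.contMDiffAt_rep ?_ ?_ h1 h2)
  · rw [rep_zero, rep_zero, h0]
  · rwa [rep_zero]

lemma coordY_transition {τ : V3 → V3} (hκ : IsCoord κ (base J))
    (hτ : ContDiffAt ℝ ∞ τ (κ (base J))) (h : ∀ᶠ y in 𝓝 (base J), κ' y = τ (κ y)) :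
    coordY κ' J = (fderiv ℝ τ (κ (base J))).comp (coordY κ J) := by
  rw [← rep_zero] at hκ hτ h ⊢
  exact fderiv_comp_transition J.contMDiffAt_rep hκ.smooth.self_of_nhds hτ h

lemma coordYY_transition {τ : V3 → V3} (hκ : IsCoord κ (base J))
    (hτ : ContDiffAt ℝ ∞ τ (κ (base J))) (h : ∀ᶠ y in 𝓝 (base J), κ' y = τ (κ y)) (u v : V3) :
    coordYY κ' J u v = fderiv ℝ (fderiv ℝ τ) (κ (base J)) (coordY κ J u) (coordY κ J v) +
      fderiv ℝ τ (κ (base J)) (coordYY κ J u v) := by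
  rw [← rep_zero] at hκ hτ h ⊢
  exact fderiv_fderiv_comp_transition J.contMDiffAt_rep hκ.smooth.self_of_nhds hτ h u v

lemma coordYY_symm (hκ : IsCoord κ (base J)) (u v : V3) :
    coordYY κ J u v = coordYY κ J v u := by
  rw [← rep_zero] at hκ
  exact fderiv_fderiv_symm (contMDiffAt_coord hκ.smooth.self_of_nhds J.contMDiffAt_rep) u v

lemma det_coordY_coordAt (J : J2 S) : 0 < (coordY (coordAt (base J)) J).det := by
  have h := J.isFrame_rep.2
  rwa [rep_zero] at h

/-- The definition of a frame controls the determinant only in the coordinates `coordAt`. The matrix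
there factors through the one in `κ`, which must therefore be nonsingular, though its determinant
may be negative. -/
lemma det_coordY_ne_zero [IsManifold 𝓘(ℝ, ℂ) ∞ S] (hκ : IsCoord κ (base J)) :
    (coordY κ J).det ≠ 0 := by
  obtain ⟨τ, hτ, e⟩ := hκ.exists_transition (isCoord_coordAt (base J)).smooth
  have h := det_coordY_coordAt J
  rw [coordY_transition hκ hτ.self_of_nhds e] at h
  intro h0
  have h1 : ((fderiv ℝ τ (κ (base J))).comp (coordY κ J)).det =
      (fderiv ℝ τ (κ (base J))).det * (coordY κ J).det := LinearMap.det_comp _ _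
  rw [h1, h0, mul_zero] at h
  exact h.false

lemma isInvertible_coordY [IsManifold 𝓘(ℝ, ℂ) ∞ S] (hκ : IsCoord κ (base J)) :
    (coordY κ J).IsInvertible :=
  ⟨(coordY κ J).toContinuousLinearEquivOfDetNeZero (det_coordY_ne_zero hκ), by simp⟩

section Smul

variable {Γ : Type*} [Group Γ] [MulAction Γ (Mfd S)] [IsConformalLoopAction Γ S]

lemma coordY_smul {g : Γ} (hκ : IsCoord κ (g • base J)) :
    coordY κ (g • J) = coordY (fun x => κ (g • x)) J := by
  conv_lhs => rw [← mk_rep J, smul_mk]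
  rw [coordY_mk]
  · rfl
  · rw [rep_zero]
    exact hκ.smooth

lemma coordYY_smul {g : Γ} (hκ : IsCoord κ (g • base J)) :
    coordYY κ (g • J) = coordYY (fun x => κ (g • x)) J := by
  conv_lhs => rw [← mk_rep J, smul_mk]
  rw [coordYY_mk]
  · rfl
  · rw [rep_zero]
    exact hκ.smooth

end Smul

section Plots

variable {n : ℕ} {p : E n → J2 S}

lemma contMDiffAt_base (hp : IsPlot p) (x : E n) :
    ContMDiffAt 𝓘(ℝ, E n) IM ∞ (fun y => base (p y)) x := dSmooth_base n p hp x

lemma eventually_isCoord (hp : IsPlot p) {x : E n} (hκ : IsCoord κ (base (p x))) :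
    ∀ᶠ y in 𝓝 x, IsCoord κ (base (p y)) :=
  (contMDiffAt_base hp x).continuousAt.eventually hκ.eventually

lemma contDiffAt_coord_base (hp : IsPlot p) {x : E n} (hκ : IsCoord κ (base (p x))) :
    ContDiffAt ℝ ∞ (fun y => κ (base (p y))) x :=
  contMDiffAt_coord (f := κ) hκ.smooth.self_of_nhds (contMDiffAt_base hp x)

/-- Near the point the plot is the family of 2-jets of a map smooth in parameter and frame variables
jointly, and its partial derivatives in the frame variables at `0` are smooth in the parameter. -/
lemma contDiffAt_coordY_and_coordYY (hp : IsPlot p) {x : E n} (hκ : IsCoord κ (base (p x))) :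
    ContDiffAt ℝ ∞ (fun y => coordY κ (p y)) x ∧ ContDiffAt ℝ ∞ (fun y => coordYY κ (p y)) x := by
  obtain ⟨F, hF, hp'⟩ := hp x
  have hb : F (x, 0) = base (p x) := by
    obtain ⟨h, e⟩ := hp'.self_of_nhds
    rw [e]
    rfl
  have hc : ContinuousAt F (x, 0) := hF.self_of_nhds.continuousAt
  have hκ' := hκ.smooth
  rw [ContinuousAt, hb] at hc
  have hG : ∀ᶠ q : E n × V3 in 𝓝 (x, 0), ContDiffAt ℝ ∞ (fun q => κ (F q)) q := by
    filter_upwards [hF, hc.eventually hκ'] with q hq hq'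
    exact contMDiffAt_coord hq' hq
  have hG1 : ∀ q : E n × V3, ContDiffAt ℝ ∞ (fun q => κ (F q)) q →
      ContDiffAt ℝ ∞ (fun q : E n × V3 => fderiv ℝ (fun v => κ (F (q.1, v))) q.2) q := fun q hq => by
    refine ContDiffAt.fderiv (n := ∞) (f := fun (q : E n × V3) v => κ (F (q.1, v)))
      (g := fun q => q.2) ?_ contDiff_snd.contDiffAt (by simp)
    exact ContDiffAt.comp (g := fun q : E n × V3 => κ (F q))
      (f := fun z : (E n × V3) × V3 => (z.1.1, z.2)) (q, q.2) hq
      ((contDiff_fst.comp contDiff_fst).prodMk contDiff_snd).contDiffAt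
  have hG2 : ContDiffAt ℝ ∞ (fun q : E n × V3 => fderiv ℝ (fun v => κ (F (q.1, v))) q.2) (x, 0) :=
    hG1 _ hG.self_of_nhds
  have h1 : ContDiffAt ℝ ∞ (fun y => fderiv ℝ (fun v => κ (F (y, v))) 0) x :=
    ContDiffAt.comp (g := fun q : E n × V3 => fderiv ℝ (fun v => κ (F (q.1, v))) q.2)
      (f := fun y => (y, (0 : V3))) x hG2 (contDiff_id.prodMk contDiff_const).contDiffAt
  have h2 : ContDiffAt ℝ ∞ (fun y => fderiv ℝ (fderiv ℝ (fun v => κ (F (y, v)))) 0) x :=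
    ContDiffAt.fderiv (n := ∞) (f := fun (y : E n) v => fderiv ℝ (fun v => κ (F (y, v))) v)
      (g := fun _ => (0 : V3)) hG2 contDiffAt_const (by simp)
  have hκy : ∀ᶠ y in 𝓝 x, ∀ᶠ z in 𝓝 (F (y, 0)), ContMDiffAt IM 𝓘(ℝ, V3) ∞ κ z := by
    have h3 : Filter.Tendsto (fun y => F (y, 0)) (𝓝 x) (𝓝 (base (p x))) :=
      hc.comp (Continuous.prodMk_left (0 : V3)).continuousAt
    exact h3.eventually hκ'.eventually_nhds
  constructor
  · refine h1.congr_of_eventuallyEq ?_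
    filter_upwards [hp', hκy] with y hy hy'
    obtain ⟨h, e⟩ := hy
    rw [e, coordY_mk h hy']
    rfl
  · refine h2.congr_of_eventuallyEq ?_
    filter_upwards [hp', hκy] with y hy hy'
    obtain ⟨h, e⟩ := hy
    rw [e, coordYY_mk h hy']
    rfl

lemma contDiffAt_coordY (hp : IsPlot p) {x : E n} (hκ : IsCoord κ (base (p x))) :
    ContDiffAt ℝ ∞ (fun y => coordY κ (p y)) x := (contDiffAt_coordY_and_coordYY hp hκ).1

lemma contDiffAt_coordYY (hp : IsPlot p) {x : E n} (hκ : IsCoord κ (base (p x))) :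
    ContDiffAt ℝ ∞ (fun y => coordYY κ (p y)) x := (contDiffAt_coordY_and_coordYY hp hκ).2

/-- A family of jets whose coordinates are smooth is a plot. -/
lemma isPlot_of_coord [IsManifold 𝓘(ℝ, ℂ) ∞ S] (hb : Continuous fun y => base (p y))
    (h : ∀ x, ∃ κ, IsCoord κ (base (p x)) ∧ ∀ᶠ y in 𝓝 x,
      ContDiffAt ℝ ∞ (fun y => κ (base (p y))) y ∧ ContDiffAt ℝ ∞ (fun y => coordY κ (p y)) y ∧
        ContDiffAt ℝ ∞ (fun y => coordYY κ (p y)) y) : IsPlot p := by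
  intro x
  obtain ⟨κ, hκ, hs⟩ := h x
  obtain ⟨l, h1, h2, h3⟩ := hκ.exists_inverse
  -- A family of germs with the prescribed jets: the quadratic Taylor polynomials in the
  -- coordinates, carried to `M` by a local inverse of `κ`.
  let G : E n × V3 → V3 := fun q => quadMap (κ (base (p q.1))) (coordY κ (p q.1))
    (coordYY κ (p q.1)) q.2
  have hG : ∀ᶠ q : E n × V3 in 𝓝 (x, 0), ContDiffAt ℝ ∞ G q := by
    filter_upwards [(continuous_fst.tendsto (x, (0 : V3))).eventually hs] with q hq
    have hf : ContDiffAt ℝ ∞ (fun q : E n × V3 => q.1) q := contDiff_fst.contDiffAt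
    have hv : ContDiffAt ℝ ∞ (fun q : E n × V3 => q.2) q := contDiff_snd.contDiffAt
    have a := ContDiffAt.comp (g := fun y => κ (base (p y))) q hq.1 hf
    have b := ContDiffAt.comp (g := fun y => coordY κ (p y)) q hq.2.1 hf
    have c := ContDiffAt.comp (g := fun y => coordYY κ (p y)) q hq.2.2 hf
    have d : ContDiffAt ℝ ∞ (fun q : E n × V3 => (1 / 2 : ℝ) • coordYY κ (p q.1) q.2 q.2) q :=
      ((c.clm_apply hv).clm_apply hv).const_smul (1 / 2 : ℝ)
    exact (a.add (b.clm_apply hv)).add d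
  have hG0 : G (x, 0) = κ (base (p x)) := quadMap_zero _ _ _
  have hGc : Filter.Tendsto G (𝓝 (x, 0)) (𝓝 (κ (base (p x)))) := by
    rw [← hG0]
    exact hG.self_of_nhds.continuousAt
  have hF : ∀ᶠ q : E n × V3 in 𝓝 (x, 0), ContMDiffAt 𝓘(ℝ, E n × V3) IM ∞ (fun q => l (G q)) q := by
    filter_upwards [hG, hGc.eventually h1] with q hq hq'
    exact ContMDiffAt.comp q hq' hq.contMDiffAt
  refine ⟨fun q => l (G q), hF, ?_⟩
  have hb' := (hb.tendsto x).eventually (h3.and hκ.eventually)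
  have hcurry := (hF.and (hGc.eventually h2)).curry_nhds
  filter_upwards [hb', hcurry] with y hy hy'
  have hsm : ∀ᶠ v in 𝓝 (0 : V3), ContMDiffAt 𝓘(ℝ, V3) IM ∞ (fun v => l (G (y, v))) v := by
    filter_upwards [hy'] with v hv
    exact ContMDiffAt.comp (g := fun q : E n × V3 => l (G q)) (f := fun v => (y, v)) v hv.1
      (contDiff_const.prodMk contDiff_id).contDiffAt.contMDiffAt
  have e0 : l (G (y, 0)) = (p y).rep 0 := by
    rw [rep_zero]
    change l (quadMap _ _ _ 0) = _
    rw [quadMap_zero, hy.1]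
  have hκy : IsCoord κ (l (G (y, 0))) := by rw [e0, rep_zero]; exact hy.2
  have e1 : (κ ∘ fun v => l (G (y, v))) =ᶠ[𝓝 0]
      quadMap (κ (base (p y))) (coordY κ (p y)) (coordYY κ (p y)) := by
    filter_upwards [hy'] with v hv using hv.2
  -- Symmetry is what makes the second derivative of the polynomial at `0` equal to `coordYY`,
  -- instead of its symmetrization.
  have hsymm := coordYY_symm hy.2
  have e2 : fderiv ℝ (κ ∘ fun v => l (G (y, v))) 0 = fderiv ℝ (κ ∘ (p y).rep) 0 := by
    rw [e1.fderiv_eq, fderiv_quadMap_zero _ _ hsymm]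
    rfl
  have e3 : fderiv ℝ (fderiv ℝ (κ ∘ fun v => l (G (y, v)))) 0 =
      fderiv ℝ (fderiv ℝ (κ ∘ (p y).rep)) 0 := by
    rw [e1.fderiv.fderiv_eq, fderiv_fderiv_quadMap_zero _ _ hsymm]
    rfl
  have hfr : IsFrame fun v => l (G (y, v)) := isFrame_of_coord hsm (p y).isFrame_rep e0 hκy e2
  refine ⟨hfr, ?_⟩
  rw [← mk_rep (p y)]
  exact (mk_eq_mk _ _ (sameJet_of_coord hsm.self_of_nhds (p y).contMDiffAt_rep e0 hκy e2 e3)).symm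

end Plots

/-! ### The right action on frames of quadratic changes of variables of `ℝ³`. -/

section Act

variable {A : V3 →L[ℝ] V3} {B : V3 →L[ℝ] V3 →L[ℝ] V3}

lemma fderiv_comp_quadMap {f : V3 → V3} (hf : ContDiffAt ℝ ∞ f 0) (hB : ∀ u v, B u v = B v u) :
    fderiv ℝ (f ∘ quadMap 0 A B) 0 = (fderiv ℝ f 0).comp A := by
  have h : fderiv ℝ (f ∘ quadMap 0 A B) 0 = _ := (fderiv_comp_eventuallyEq (g := f)
    (b := quadMap 0 A B) (x := 0) (by rwa [quadMap_zero]) (contDiff_quadMap 0 A B).contDiffAt).self_of_nhds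
  refine h.trans ?_
  beta_reduce
  rw [quadMap_zero, fderiv_quadMap_zero _ _ hB]

lemma fderiv_fderiv_comp_quadMap {f : V3 → V3} (hf : ContDiffAt ℝ ∞ f 0)
    (hB : ∀ u v, B u v = B v u) (u v : V3) :
    fderiv ℝ (fderiv ℝ (f ∘ quadMap 0 A B)) 0 u v =
      fderiv ℝ (fderiv ℝ f) 0 (A u) (A v) + fderiv ℝ f 0 (B u v) := by
  rw [fderiv_fderiv_comp (by rwa [quadMap_zero]) (contDiff_quadMap 0 A B).contDiffAt, quadMap_zero,
    fderiv_quadMap_zero _ _ hB, fderiv_fderiv_quadMap_zero _ _ hB]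

lemma isFrame_comp_quadMap [IsManifold 𝓘(ℝ, ℂ) ∞ S] (hj : IsFrame j) (hA : 0 < A.det)
    (hB : ∀ u v, B u v = B v u) : IsFrame (j ∘ quadMap 0 A B) := by
  have hq := contDiff_quadMap 0 A B
  have ht : Filter.Tendsto (quadMap 0 A B) (𝓝 0) (𝓝 0) := by
    have := hq.continuous.tendsto 0
    rwa [quadMap_zero] at this
  refine ⟨?_, ?_⟩
  · filter_upwards [ht.eventually hj.1] with v hv
    exact ContMDiffAt.comp v hv hq.contDiffAt.contMDiffAt
  · have h := fderiv_comp_quadMap (A := A) (f := coordAt (j 0) ∘ j)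
      (contMDiffAt_coord (isCoord_coordAt (j 0)).smooth.self_of_nhds hj.1.self_of_nhds) hB
    change 0 < (fderiv ℝ (coordAt (j (quadMap 0 A B 0)) ∘ j ∘ quadMap 0 A B) 0).det
    rw [quadMap_zero]
    change fderiv ℝ (coordAt (j 0) ∘ j ∘ quadMap 0 A B) 0 = _ at h
    rw [h]
    exact (mul_pos hj.2 hA).trans_eq (LinearMap.det_comp _ _).symm

variable [IsManifold 𝓘(ℝ, ℂ) ∞ S]

/-- The right action of the 2-jet of `u ↦ A u + ½ B(u, u)` on 2-jets. -/
def act (J : J2 S) (A : V3 →L[ℝ] V3) (B : V3 →L[ℝ] V3 →L[ℝ] V3) (hA : 0 < A.det)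
    (hB : ∀ u v, B u v = B v u) : J2 S :=
  mk (J.rep ∘ quadMap 0 A B) (isFrame_comp_quadMap J.isFrame_rep hA hB)

variable (hA : 0 < A.det) (hB : ∀ u v, B u v = B v u)

lemma base_act : base (act J A B hA hB) = base J := by
  rw [act, base_mk, Function.comp_apply, quadMap_zero, rep_zero]

lemma coordY_act (hκ : IsCoord κ (base J)) :
    coordY κ (act J A B hA hB) = (coordY κ J).comp A := by
  rw [← rep_zero] at hκ
  rw [act, coordY_mk]
  · exact fderiv_comp_quadMap (contMDiffAt_coord hκ.smooth.self_of_nhds J.contMDiffAt_rep) hB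
  · rw [Function.comp_apply, quadMap_zero]
    exact hκ.smooth

lemma coordYY_act (hκ : IsCoord κ (base J)) (u v : V3) :
    coordYY κ (act J A B hA hB) u v = coordYY κ J (A u) (A v) + coordY κ J (B u v) := by
  rw [← rep_zero] at hκ
  rw [act, coordYY_mk]
  · exact fderiv_fderiv_comp_quadMap
      (contMDiffAt_coord hκ.smooth.self_of_nhds J.contMDiffAt_rep) hB u v
  · rw [Function.comp_apply, quadMap_zero]
    exact hκ.smooth

lemma coordYY_act_eq (hκ : IsCoord κ (base J)) :
    coordYY κ (act J A B hA hB) = quadComp (coordY κ J) (coordYY κ J) A B :=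
  ContinuousLinearMap.ext fun u => ContinuousLinearMap.ext fun v => coordYY_act hA hB hκ u v

/-- The action is defined on the chosen representative; the coordinate formulas show that any other
representative gives the same jet. -/
lemma act_mk (hj : IsFrame j) : act (mk j hj) A B hA hB =
    mk (j ∘ quadMap 0 A B) (isFrame_comp_quadMap hj hA hB) := by
  have hκ := isCoord_coordAt (j 0)
  have hκ' : IsCoord (coordAt (j 0)) ((j ∘ quadMap 0 A B) 0) := by
    rwa [Function.comp_apply, quadMap_zero]
  have hs := contMDiffAt_coord (f := coordAt (j 0)) hκ.smooth.self_of_nhds hj.1.self_of_nhds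
  refine ext_coord (κ := coordAt (j 0)) ?_ ?_ ?_ ?_
  · rwa [base_act]
  · rw [base_act, base_mk, base_mk, Function.comp_apply, quadMap_zero]
  · rw [coordY_act hA hB hκ, coordY_mk _ hκ.smooth, coordY_mk _ hκ'.smooth]
    exact (fderiv_comp_quadMap hs hB).symm
  · refine ContinuousLinearMap.ext fun u => ContinuousLinearMap.ext fun v => ?_
    rw [coordYY_act hA hB hκ, coordYY_mk _ hκ.smooth, coordYY_mk _ hκ'.smooth,
      coordY_mk _ hκ.smooth]
    exact (fderiv_fderiv_comp_quadMap hs hB u v).symm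

/-- The coordinates of the transformed jets are polynomial in those of the jets and in `A` and `B`,
hence smooth in the parameter, and a family of jets with smooth coordinates is a plot. -/
lemma isPlot_act {n : ℕ} {p : E n → J2 S} (hp : IsPlot p) {A : E n → V3 →L[ℝ] V3}
    {B : E n → V3 →L[ℝ] V3 →L[ℝ] V3} (hA : ∀ x, 0 < (A x).det)
    (hB : ∀ x u v, B x u v = B x v u) (hsA : ContDiff ℝ ∞ A) (hsB : ContDiff ℝ ∞ B) :
    IsPlot fun x => act (p x) (A x) (B x) (hA x) (hB x) := by
  have hb : ∀ x, base (act (p x) (A x) (B x) (hA x) (hB x)) = base (p x) := fun x => base_act _ _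
  refine isPlot_of_coord ?_ fun x => ⟨coordAt (base (p x)), ?_, ?_⟩
  · simp only [hb]
    exact continuous_iff_continuousAt.mpr fun x => (contMDiffAt_base hp x).continuousAt
  · rw [hb]
    exact isCoord_coordAt _
  · filter_upwards [(eventually_isCoord hp (isCoord_coordAt (base (p x)))).eventually_nhds] with y hy
    have hy0 := hy.self_of_nhds
    have hY := contDiffAt_coordY hp hy0
    refine ⟨?_, ?_, ?_⟩
    · simp only [hb]
      exact contDiffAt_coord_base hp hy0
    · refine (hY.clm_comp hsA.contDiffAt).congr_of_eventuallyEq ?_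
      filter_upwards [hy] with z hz
      exact coordY_act _ _ hz
    · have hYY := contDiffAt_coordYY hp hy0
      refine (contDiffAt_quadComp hY hYY hsA.contDiffAt hsB.contDiffAt).congr_of_eventuallyEq ?_
      filter_upwards [hy] with z hz
      exact coordYY_act_eq _ _ hz

end Act

end J2

end JetCoordinates

/-! ## The tautological connection -/

namespace DForm

variable {X : Type*} [DiffeologicalSpace X]

lemma d_apply_one (α : DForm X 1) {n : ℕ} (p : Plot X n) (x u v : E n) :
    (d α).val p x ![u, v] = fderiv ℝ (fun y => α.val p y ![v]) x u -
      fderiv ℝ (fun y => α.val p y ![u]) x v := by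
  have hd : DifferentiableAt ℝ (α.val p) x := (α.smooth p).differentiable (by simp) x
  have h : ∀ w w' : E n, fderiv ℝ (fun y => α.val p y ![w]) x w' =
      fderiv ℝ (α.val p) x w' ![w] := by
    intro w w'
    let L : (E n [⋀^Fin 1]→L[ℝ] ℂ) →L[ℝ] ℂ := LinearMap.toContinuousLinearMap
      { toFun := fun α => α ![w], map_add' := fun _ _ => rfl, map_smul' := fun _ _ => rfl }
    exact congrArg (fun T => T w') (L.hasFDerivAt.comp x hd.hasFDerivAt).fderiv
  rw [h, h]
  change extDeriv (α.val p) x ![u, v] = _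
  rw [extDeriv, ContinuousAlternatingMap.alternatizeUncurryFin_apply, Fin.sum_univ_two]
  have e0 : Fin.removeNth 0 ![u, v] = ![v] := by
    ext i : 1
    fin_cases i
    rfl
  have e1 : Fin.removeNth 1 ![u, v] = ![u] := by
    ext i : 1
    fin_cases i
    rfl
  rw [e0, e1]
  simp [sub_eq_add_neg]

/-- A 1-form from its values on tangent vectors. -/
def ofOneForm (ν : ∀ {n : ℕ}, Plot X n → E n → E n →L[ℝ] ℂ)
    (hs : ∀ {n : ℕ} (p : Plot X n), ContDiff ℝ ∞ (ν p))
    (hn : ∀ {n k : ℕ} (p : Plot X n) (f : E k → E n) (hf : ContDiff ℝ ∞ f) (x : E k),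
      ν (p.comp f hf) x = (ν p (f x)).comp (fderiv ℝ f x)) : DForm X 1 where
  val p x := ContinuousAlternatingMap.ofSubsingletonLIE (0 : Fin 1) (ν p x)
  smooth {n} p := ((ContinuousAlternatingMap.ofSubsingletonLIE (𝕜 := ℝ) (E := E n) (F := ℂ)
    (0 : Fin 1)).contDiff (n := ∞)).comp (hs p)
  naturality p f hf x := by
    ext v
    rw [hn p f hf x]
    rfl

lemma ext_one {α β : DForm X 1} (h : ∀ (n : ℕ) (p : Plot X n) (x w : E n),
    α.val p x ![w] = β.val p x ![w]) : α = β := by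
  refine ext' fun n p x => ?_
  ext v
  have e : v = ![v 0] := by
    ext i : 1
    fin_cases i
    rfl
  rw [e]
  exact h n p x _

end DForm

section TautForm

variable {W : Type*} [NormedAddCommGroup W] [NormedSpace ℝ W] {X X' : W → V3}
  {Y Y' : W → V3 →L[ℝ] V3} {YY YY' : W → V3 →L[ℝ] V3 →L[ℝ] V3} {x : W}

/-- The matrix-valued 1-form `y⁻¹ dy - y⁻¹ y₂(y⁻¹ dx, ·)`. -/
def tautForm (X : W → V3) (Y : W → V3 →L[ℝ] V3) (YY : W → V3 →L[ℝ] V3 →L[ℝ] V3) (x : W) :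
    W →L[ℝ] V3 →L[ℝ] V3 :=
  (ContinuousLinearMap.compL ℝ V3 V3 V3 (Y x).inverse).comp
    (fderiv ℝ Y x - (YY x).comp ((Y x).inverse.comp (fderiv ℝ X x)))

/-- Multiplied by `y`, the form loses its inverses: with `e` the frame components of the velocity,
`y θ = dy - y₂(e, ·)`. The transformation rules are all checked in this form and then `y` is
cancelled. -/
lemma comp_tautForm (h : (Y x).IsInvertible) {w : W} {e : V3} (he : Y x e = fderiv ℝ X x w) :
    (Y x).comp (tautForm X Y YY x w) = fderiv ℝ Y x w - YY x e := by
  change (Y x).comp ((Y x).inverse.comp (fderiv ℝ Y x w - YY x ((Y x).inverse (fderiv ℝ X x w)))) = _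
  rw [← he, h.inverse_apply_self, ← ContinuousLinearMap.comp_assoc, h.self_comp_inverse,
    ContinuousLinearMap.id_comp]

lemma comp_left_cancel {B C D : V3 →L[ℝ] V3} (h : B.IsInvertible)
    (e : B.comp C = B.comp D) : C = D :=
  ContinuousLinearMap.ext fun v => h.injective (congrArg (fun T => T v) e)

lemma exists_eq_fderiv (h : (Y x).IsInvertible) (w : W) : ∃ e, Y x e = fderiv ℝ X x w :=
  h.surjective _

lemma contDiffAt_tautForm (hX : ContDiffAt ℝ ∞ X x) (hY : ContDiffAt ℝ ∞ Y x)
    (hYY : ContDiffAt ℝ ∞ YY x) (h : (Y x).IsInvertible) :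
    ContDiffAt ℝ ∞ (tautForm X Y YY) x := by
  have h1 : ContDiffAt ℝ ∞ (fun x => (Y x).inverse) x :=
    ContDiffAt.comp x h.contDiffAt_map_inverse hY
  have h2 : ContDiffAt ℝ ∞ (fun x => ContinuousLinearMap.compL ℝ V3 V3 V3 (Y x).inverse) x :=
    (ContinuousLinearMap.contDiff _).contDiffAt.comp x h1
  exact h2.clm_comp ((hY.fderiv_right (by simp)).sub
    (hYY.clm_comp (h1.clm_comp (hX.fderiv_right (by simp)))))

lemma tautForm_congr (hX : X =ᶠ[𝓝 x] X') (hY : Y =ᶠ[𝓝 x] Y') (hYY : YY =ᶠ[𝓝 x] YY') :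
    tautForm X Y YY =ᶠ[𝓝 x] tautForm X' Y' YY' := by
  filter_upwards [hX.eventually_nhds, hY.eventually_nhds, hYY] with y h1 h2 h3
  have h1 : X =ᶠ[𝓝 y] X' := h1
  have h2 : Y =ᶠ[𝓝 y] Y' := h2
  rw [tautForm, tautForm, h1.fderiv_eq, h2.fderiv_eq, h2.self_of_nhds, h3]

lemma tautForm_comp {W' : Type*} [NormedAddCommGroup W'] [NormedSpace ℝ W'] {f : W' → W} {z : W'}
    (hX : DifferentiableAt ℝ X (f z)) (hY : DifferentiableAt ℝ Y (f z))
    (hf : DifferentiableAt ℝ f z) :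
    tautForm (X ∘ f) (Y ∘ f) (YY ∘ f) z = (tautForm X Y YY (f z)).comp (fderiv ℝ f z) := by
  rw [tautForm, tautForm, fderiv_comp z hX hf, fderiv_comp z hY hf]
  rfl

/-- In new coordinates both `dy` and `y₂` acquire a term with the second derivative of `τ`; since
`dx = y e`, the two terms are equal and cancel in `dy - y₂(e, ·)`. -/
lemma tautForm_transition {τ : V3 → V3} (hτ : ContDiffAt ℝ ∞ τ (X x))
    (hX : DifferentiableAt ℝ X x) (hY : DifferentiableAt ℝ Y x)
    (hX' : X' =ᶠ[𝓝 x] fun y => τ (X y))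
    (hY' : Y' =ᶠ[𝓝 x] fun y => (fderiv ℝ τ (X y)).comp (Y y))
    (hYY' : ∀ u v, YY' x u v = fderiv ℝ (fderiv ℝ τ) (X x) (Y x u) (Y x v) +
      fderiv ℝ τ (X x) (YY x u v))
    (h : (Y x).IsInvertible) (h' : (Y' x).IsInvertible) :
    tautForm X' Y' YY' x = tautForm X Y YY x := by
  refine ContinuousLinearMap.ext fun w => comp_left_cancel h' ?_
  obtain ⟨e, he⟩ := exists_eq_fderiv (X := X) h w
  have dX' : fderiv ℝ X' x = (fderiv ℝ τ (X x)).comp (fderiv ℝ X x) := by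
    rw [hX'.fderiv_eq]
    exact fderiv_comp x (hτ.differentiableAt (by simp)) hX
  have dY' : ∀ w, fderiv ℝ Y' x w = (fderiv ℝ (fderiv ℝ τ) (X x) (fderiv ℝ X x w)).comp (Y x) +
      (fderiv ℝ τ (X x)).comp (fderiv ℝ Y x w) := by
    intro w
    rw [hY'.fderiv_eq]
    have h1 : HasFDerivAt (fun y => fderiv ℝ τ (X y))
        ((fderiv ℝ (fderiv ℝ τ) (X x)).comp (fderiv ℝ X x)) x :=
      (ContDiffAt.differentiableAt_fderiv hτ).hasFDerivAt.comp x hX.hasFDerivAt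
    rw [(h1.clm_comp hY.hasFDerivAt).fderiv]
    ext <;> simp [add_comm]
  have he' : Y' x e = fderiv ℝ X' x w := by
    rw [hY'.self_of_nhds, dX', ContinuousLinearMap.comp_apply, he]
    rfl
  rw [comp_tautForm h' he', dY', ← he, hY'.self_of_nhds, ContinuousLinearMap.comp_assoc,
    comp_tautForm h he]
  refine ContinuousLinearMap.ext fun v => ?_
  change fderiv ℝ (fderiv ℝ τ) (X x) (Y x e) (Y x v) + fderiv ℝ τ (X x) (fderiv ℝ Y x w v) -
    YY' x e v = fderiv ℝ τ (X x) (fderiv ℝ Y x w v - YY x e v)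
  rw [hYY', map_sub]
  abel

/-- A linear change of frame leaves the second-order part tensorial, so the only inhomogeneous term
is the `y dA` coming from `dy`. This is the transformation rule of a connection, `A θ' = θ A + dA`.
-/
lemma tautForm_gauge {A : W → V3 →L[ℝ] V3} (hA : DifferentiableAt ℝ A x)
    (hY : DifferentiableAt ℝ Y x) (hX' : X' =ᶠ[𝓝 x] X)
    (hY' : Y' =ᶠ[𝓝 x] fun y => (Y y).comp (A y))
    (hYY' : ∀ u v, YY' x u v = YY x (A x u) (A x v))
    (h : (Y x).IsInvertible) (h' : (Y' x).IsInvertible) (w : W) :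
    (A x).comp (tautForm X' Y' YY' x w) = (tautForm X Y YY x w).comp (A x) + fderiv ℝ A x w := by
  refine comp_left_cancel h ?_
  obtain ⟨e', he'⟩ := exists_eq_fderiv (X := X') h' w
  have he : Y x (A x e') = fderiv ℝ X x w := by
    rw [← hX'.fderiv_eq, ← he', hY'.self_of_nhds]
    rfl
  have dY' : fderiv ℝ Y' x w = (Y x).comp (fderiv ℝ A x w) + (fderiv ℝ Y x w).comp (A x) := by
    rw [hY'.fderiv_eq, (hY.hasFDerivAt.clm_comp hA.hasFDerivAt).fderiv]
    rfl
  have h1 : (Y x).comp ((A x).comp (tautForm X' Y' YY' x w)) = fderiv ℝ Y' x w - YY' x e' := by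
    rw [← comp_tautForm h' he', hY'.self_of_nhds]
    rfl
  rw [h1, ContinuousLinearMap.comp_add, ← ContinuousLinearMap.comp_assoc, comp_tautForm h he, dY']
  refine ContinuousLinearMap.ext fun v => ?_
  change Y x (fderiv ℝ A x w v) + fderiv ℝ Y x w (A x v) - YY' x e' v =
    fderiv ℝ Y x w (A x v) - YY x (A x e') (A x v) + Y x (fderiv ℝ A x w v)
  rw [hYY']
  abel

end TautForm

/-- The linear coordinates of `ℝ³`. -/
def coordL : Fin 3 → V3 →L[ℝ] ℝ := ![ContinuousLinearMap.fst ℝ ℝ ℂ,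
  Complex.reCLM.comp (ContinuousLinearMap.snd ℝ ℝ ℂ),
  Complex.imCLM.comp (ContinuousLinearMap.snd ℝ ℝ ℂ)]

lemma coordL_apply (i : Fin 3) (v : V3) : coordL i v = J2.coord i v := by
  fin_cases i <;> rfl

lemma sum_coord_smul_vec (v : V3) : ∑ i, J2.coord i v • J2.vec i = v := by
  rw [Fin.sum_univ_three]
  refine Prod.ext ?_ (Complex.ext ?_ ?_) <;> simp [J2.coord, J2.vec]

/-- The entry `(i, j)` of the matrix of an endomorphism of `ℝ³`. -/
def entry (i j : Fin 3) : (V3 →L[ℝ] V3) →L[ℝ] ℂ :=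
  Complex.ofRealCLM.comp ((coordL i).comp (ContinuousLinearMap.apply ℝ V3 (J2.vec j)))

lemma entry_apply (i j : Fin 3) (A : V3 →L[ℝ] V3) :
    entry i j A = (J2.coord i (A (J2.vec j)) : ℂ) := by
  rw [← coordL_apply]
  rfl

lemma entry_comp (i j : Fin 3) (A B : V3 →L[ℝ] V3) :
    entry i j (A.comp B) = ∑ k, entry i k A * entry k j B := by
  simp only [entry_apply, ContinuousLinearMap.comp_apply]
  conv_lhs => rw [← sum_coord_smul_vec (B (J2.vec j))]
  rw [map_sum, ← coordL_apply, map_sum]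
  push_cast
  refine Finset.sum_congr rfl fun k _ => ?_
  rw [map_smul, map_smul, smul_eq_mul, coordL_apply, Complex.ofReal_mul, mul_comm]

/-- The complex matrix of an endomorphism of `ℝ³`. -/
def toMat (A : V3 →L[ℝ] V3) : Matrix (Fin 3) (Fin 3) ℂ := Matrix.of fun i j => entry i j A

lemma toMat_comp (A B : V3 →L[ℝ] V3) : toMat (A.comp B) = toMat A * toMat B := by
  ext i j
  exact entry_comp i j A B

/-- `B` and `C` are conjugate by `A`. The hypothesis is the intertwining relation because that is
the shape in which the gauge rule for curvature is obtained. -/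
lemma toMat_trace_eq {A B C : V3 →L[ℝ] V3} (hA : A.IsInvertible) (h : A.comp B = C.comp A) :
    (toMat B).trace = (toMat C).trace := by
  have hB : B = A.inverse.comp (C.comp A) := by
    rw [← h, ← ContinuousLinearMap.comp_assoc, hA.inverse_comp_self, ContinuousLinearMap.id_comp]
  rw [hB, toMat_comp, Matrix.trace_mul_comm, ← toMat_comp, ContinuousLinearMap.comp_assoc,
    hA.self_comp_inverse, ContinuousLinearMap.comp_id]

namespace J2

variable {S : Type*} [TopologicalSpace S] [ChartedSpace ℂ S] {κ κ' : Mfd S → V3}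

/-- The tautological form along a family of jets, in given local coordinates on `M`. -/
def tautAt {n : ℕ} (κ : Mfd S → V3) (p : E n → J2 S) : E n → E n →L[ℝ] V3 →L[ℝ] V3 :=
  tautForm (fun y => κ (base (p y))) (fun y => coordY κ (p y)) fun y => coordYY κ (p y)

/-- The tautological form along a family of jets. -/
def tautCLM {n : ℕ} (p : E n → J2 S) (x : E n) : E n →L[ℝ] V3 →L[ℝ] V3 :=
  tautAt (coordAt (base (p x))) p x

lemma tautCLM_apply {n : ℕ} (p : E n → J2 S) (x w : E n) : tautCLM p x w = tautValue p x w := rfl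

variable [IsManifold 𝓘(ℝ, ℂ) ∞ S]

section Plots

variable {n : ℕ} {p : E n → J2 S} {x : E n}

/-- The form does not depend on the coordinates by `tautForm_transition`. Smoothness, where the
chart varies with the point, and invariance under `Γ` both rest on this. -/
lemma tautAt_eq_tautAt (hp : IsPlot p) (hκ : IsCoord κ (base (p x)))
    (hκ' : IsCoord κ' (base (p x))) : tautAt κ' p x = tautAt κ p x := by
  obtain ⟨τ, hτ, e⟩ := hκ.exists_transition hκ'.smooth
  have hb := (contMDiffAt_base hp x).continuousAt
  have hX := contDiffAt_coord_base hp hκ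
  refine tautForm_transition (τ := τ) hτ.self_of_nhds (hX.differentiableAt (by simp))
    ((contDiffAt_coordY hp hκ).differentiableAt (by simp)) (hb.eventually e) ?_
    (fun u v => coordYY_transition hκ hτ.self_of_nhds e u v) (isInvertible_coordY hκ)
    (isInvertible_coordY hκ')
  filter_upwards [eventually_isCoord hp hκ, hX.continuousAt.eventually hτ,
    hb.eventually e.eventually_nhds] with y h1 h2 h3
  exact coordY_transition h1 h2 h3

lemma tautCLM_eq (hp : IsPlot p) (hκ : IsCoord κ (base (p x))) : tautCLM p x = tautAt κ p x :=
  tautAt_eq_tautAt hp hκ (isCoord_coordAt _)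

lemma tautCLM_eventuallyEq (hp : IsPlot p) (hκ : IsCoord κ (base (p x))) :
    tautCLM p =ᶠ[𝓝 x] tautAt κ p :=
  (eventually_isCoord hp hκ).mono fun _ h => tautCLM_eq hp h

lemma contDiff_tautCLM (hp : IsPlot p) : ContDiff ℝ ∞ (tautCLM p) := by
  rw [contDiff_iff_contDiffAt]
  intro x
  have hκ := isCoord_coordAt (base (p x))
  exact (contDiffAt_tautForm (contDiffAt_coord_base hp hκ) (contDiffAt_coordY hp hκ)
    (contDiffAt_coordYY hp hκ) (isInvertible_coordY hκ)).congr_of_eventuallyEq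
      (tautCLM_eventuallyEq hp hκ)

lemma tautCLM_comp (hp : IsPlot p) {k : ℕ} {f : E k → E n} (hf : ContDiff ℝ ∞ f) (z : E k) :
    tautCLM (p ∘ f) z = (tautCLM p (f z)).comp (fderiv ℝ f z) := by
  have hκ := isCoord_coordAt (base (p (f z)))
  have hX := (contDiffAt_coord_base hp hκ).differentiableAt (by simp)
  have hY := (contDiffAt_coordY hp hκ).differentiableAt (by simp)
  have h := tautForm_comp (YY := fun y => coordYY (coordAt (base (p (f z)))) (p y)) hX hY
    (hf.differentiable (by simp) z)
  exact h

/-- The coordinates of `g • J` with respect to `κ` are those of `J` with respect to `κ ∘ g`, and the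
tautological form does not depend on the coordinates. -/
lemma tautCLM_smul {Γ : Type*} [Group Γ] [MulAction Γ (Mfd S)] [IsConformalLoopAction Γ S]
    (hp : IsPlot p) (g : Γ) : tautCLM (fun y => g • p y) x = tautCLM p x := by
  have hκ : IsCoord (coordAt (g • base (p x))) (g • base (p x)) := isCoord_coordAt _
  rw [tautCLM_eq hp hκ.smul, tautCLM, base_smul]
  have hp' : IsPlot fun y => g • p y := SmoothAction.dSmooth_smul (X := J2 S) g n p hp
  have hev := eventually_isCoord (x := x) hp' (κ := coordAt (g • base (p x))) (by rwa [base_smul])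
  simp only [base_smul] at hev
  refine (tautForm_congr ?_ ?_ ?_).self_of_nhds
  · exact Filter.Eventually.of_forall fun y => by simp only [base_smul]
  · filter_upwards [hev] with y hy using coordY_smul hy
  · filter_upwards [hev] with y hy using coordYY_smul hy

/-- `p'` is obtained from `p`, near `x`, by the family `A` of linear changes of frame. -/
def IsGauge (p p' : E n → J2 S) (A : E n → V3 →L[ℝ] V3) (x : E n) : Prop :=
  ∀ᶠ y in 𝓝 x, base (p' y) = base (p y) ∧
    coordY (coordAt (base (p x))) (p' y) = (coordY (coordAt (base (p x))) (p y)).comp (A y) ∧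
    ∀ u v, coordYY (coordAt (base (p x))) (p' y) u v =
      coordYY (coordAt (base (p x))) (p y) (A y u) (A y v)

lemma IsGauge.tautCLM {p' : E n → J2 S} (hp : IsPlot p) (hp' : IsPlot p')
    {A : E n → V3 →L[ℝ] V3} (hA : ContDiffAt ℝ ∞ A x) (h : IsGauge p p' A x) :
    ∀ᶠ y in 𝓝 x, ∀ w, (A y).comp (tautCLM p' y w) =
      (tautCLM p y w).comp (A y) + fderiv ℝ A y w := by
  have hκ := isCoord_coordAt (base (p x))
  have hκ' : IsCoord (coordAt (base (p x))) (base (p' x)) := by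
    rw [h.self_of_nhds.1]
    exact hκ
  filter_upwards [h.eventually_nhds, eventually_isCoord hp hκ, eventually_isCoord hp' hκ',
    ContDiffAt.eventually_differentiableAt hA] with y hy h1 h2 h3 w
  rw [tautCLM_eq hp h1, tautCLM_eq hp' h2]
  refine tautForm_gauge h3 ((contDiffAt_coordY hp h1).differentiableAt (by simp)) ?_ ?_
    hy.self_of_nhds.2.2 (isInvertible_coordY h1) (isInvertible_coordY h2) w
  · filter_upwards [hy] with z hz
    rw [hz.1]
  · filter_upwards [hy] with z hz using hz.2.1

end Plots

/-- The tautological connection forms `θ^i_j`. -/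
def taut (i j : Fin 3) : DForm (J2 S) 1 :=
  DForm.ofOneForm (fun p x => (entry i j).comp (tautCLM p.1 x))
    (fun p => contDiff_const.clm_comp (contDiff_tautCLM p.2))
    (fun p f hf x => by
      rw [ContinuousLinearMap.comp_assoc]
      exact congrArg _ (tautCLM_comp p.2 hf x))

lemma taut_val (i j : Fin 3) {n : ℕ} (p : Plot (J2 S) n) (x w : E n) :
    (taut i j).val p x ![w] = entry i j (tautCLM p.1 x w) := rfl

lemma isTautological_taut : IsTautological (taut (S := S)) := fun i j n p x w => by
  rw [taut_val, entry_apply, tautCLM_apply]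

lemma translate_taut {Γ : Type*} [Group Γ] [MulAction Γ (Mfd S)] [IsConformalLoopAction Γ S]
    (g : Γ) (i j : Fin 3) : translate Γ g (taut (S := S) i j) = taut i j :=
  DForm.ext_one fun n p x w => by
    change entry i j (tautCLM (fun y => g • p.1 y) x w) = _
    rw [tautCLM_smul p.2 g]
    rfl

lemma translate_pontrjagin {Γ : Type*} [Group Γ] [MulAction Γ (Mfd S)] [IsConformalLoopAction Γ S]
    (g : Γ) : translate Γ g (pontrjagin (taut (S := S))) = pontrjagin taut := by
  have hc : ∀ i j, translate Γ g (curvature (taut (S := S)) i j) = curvature taut i j := by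
    intro i j
    rw [curvature, map_add, map_sum]
    conv_rhs => rw [← translate_taut g i j]
    congr 1
    refine Finset.sum_congr rfl fun k _ => ?_
    conv_rhs => rw [← translate_taut g i k, ← translate_taut g k j]
    rfl
  have hw : ∀ α β : DForm (J2 S) 2, translate Γ g (DForm.wedge (c := 4) rfl α β) =
      DForm.wedge rfl (translate Γ g α) (translate Γ g β) := fun _ _ => rfl
  have hsm : ∀ (c : ℂ) (α : DForm (J2 S) 4), translate Γ g (c • α) = c • translate Γ g α :=
    fun _ _ => rfl
  simp only [pontrjagin, hsm, map_sub, map_sum, hw, hc]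

end J2

/-! ## Curvature and the first Pontrjagin form -/

section CurvatureForm

variable {W : Type*} [NormedAddCommGroup W] [NormedSpace ℝ W]

/-- The curvature `dΘ + Θ ∧ Θ` of a matrix-valued 1-form. -/
def curvForm (Θ : W → W →L[ℝ] V3 →L[ℝ] V3) (x u v : W) : V3 →L[ℝ] V3 :=
  fderiv ℝ Θ x u v - fderiv ℝ Θ x v u + (Θ x u).comp (Θ x v) - (Θ x v).comp (Θ x u)

/-- The algebra behind the covariance of curvature. Here `a` and `b` stand for the derivatives of
the gauge `A` in two directions and `r` for its second derivative in both, the same in the two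
hypotheses; `p, q` and `p', q'` are the derivatives of the connection before and after. On
antisymmetrizing, `r` drops out. -/
lemma gauge_identity {R : Type*} [Ring R] {A a b t t' s s' p q p' q' r : R}
    (h₁ : a * s' + A * p' = p * A + t' * a + r) (h₂ : b * s + A * q' = q * A + t * b + r)
    (h₃ : A * s = t * A + a) (h₄ : A * s' = t' * A + b) :
    A * (p' - q' + s * s' - s' * s) = (p - q + t * t' - t' * t) * A := by
  have ha : a = A * s - t * A := by rw [h₃]; abel
  have hb : b = A * s' - t' * A := by rw [h₄]; abel
  have e : A * (p' - q' + s * s' - s' * s) =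
      (A * p' - A * q') + A * (s * s') - A * (s' * s) := by noncomm_ring
  rw [e, eq_sub_of_add_eq' h₁, eq_sub_of_add_eq' h₂, ha, hb]
  noncomm_ring

/-- Differentiate the rule `A Θ' = Θ A + dA` once and antisymmetrize: the inhomogeneous terms cancel
and the curvature is conjugated. -/
lemma curvForm_gauge {Θ Θ' : W → W →L[ℝ] V3 →L[ℝ] V3} {A : W → V3 →L[ℝ] V3} {x : W}
    (hΘ : ContDiffAt ℝ ∞ Θ x) (hΘ' : ContDiffAt ℝ ∞ Θ' x) (hA : ContDiffAt ℝ ∞ A x)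
    (h : ∀ᶠ y in 𝓝 x, ∀ w, (A y).comp (Θ' y w) = (Θ y w).comp (A y) + fderiv ℝ A y w) (u v : W) :
    (A x).comp (curvForm Θ' x u v) = (curvForm Θ x u v).comp (A x) := by
  have h1 : ∀ u v : W, (fderiv ℝ A x u).comp (Θ' x v) + (A x).comp (fderiv ℝ Θ' x u v) =
      (fderiv ℝ Θ x u v).comp (A x) + (Θ x v).comp (fderiv ℝ A x u) +
        fderiv ℝ (fderiv ℝ A) x u v := by
    intro u v
    have e : (fun y => (A y).comp (Θ' y v)) =ᶠ[𝓝 x]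
        fun y => (Θ y v).comp (A y) + fderiv ℝ A y v := h.mono fun y hy => hy v
    have dA : HasFDerivAt A (fderiv ℝ A x) x := (hA.differentiableAt (by simp)).hasFDerivAt
    have eA : HasFDerivAt (fderiv ℝ A) (fderiv ℝ (fderiv ℝ A) x) x :=
      (ContDiffAt.differentiableAt_fderiv hA).hasFDerivAt
    have dA2 := eA.clm_apply (hasFDerivAt_const (𝕜 := ℝ) v x)
    have eΘ : HasFDerivAt Θ (fderiv ℝ Θ x) x := (hΘ.differentiableAt (by simp)).hasFDerivAt
    have eΘ' : HasFDerivAt Θ' (fderiv ℝ Θ' x) x := (hΘ'.differentiableAt (by simp)).hasFDerivAt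
    have dΘ := eΘ.clm_apply (hasFDerivAt_const (𝕜 := ℝ) v x)
    have dΘ' := eΘ'.clm_apply (hasFDerivAt_const (𝕜 := ℝ) v x)
    have e1 := e.fderiv_eq (𝕜 := ℝ)
    rw [(dA.clm_comp dΘ').fderiv, ((dΘ.clm_comp dA).fun_add dA2).fderiv] at e1
    have e2 := congrArg (fun T => T u) e1
    refine ContinuousLinearMap.ext fun w => ?_
    have e3 := congrArg (fun T => T w) e2
    simp at e3
    simp only [add_apply, ContinuousLinearMap.comp_apply]
    rw [add_comm, e3]
    abel
  have h0 := h.self_of_nhds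
  have b := h1 v u
  -- Symmetry of the second derivative of `A` gives both relations the same remainder `r`.
  rw [fderiv_fderiv_symm hA v u] at b
  exact gauge_identity (h1 u v) b (h0 u) (h0 v)

end CurvatureForm

namespace J2

variable {S : Type*} [TopologicalSpace S] [ChartedSpace ℂ S] [IsManifold 𝓘(ℝ, ℂ) ∞ S]

lemma curvature_taut_val (i j : Fin 3) {n : ℕ} (p : Plot (J2 S) n) (x u v : E n) :
    (curvature (taut (S := S)) i j).val p x ![u, v] = entry i j (curvForm (tautCLM p.1) x u v) := by
  have hd : DifferentiableAt ℝ (tautCLM p.1) x :=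
    (contDiff_tautCLM p.2).differentiable (by simp) x
  have h : ∀ u v : E n, fderiv ℝ (fun y => (taut i j).val p y ![v]) x u =
      entry i j (fderiv ℝ (tautCLM p.1) x u v) := by
    intro u v
    have h1 := (entry i j).hasFDerivAt.comp x
      (hd.hasFDerivAt.clm_apply (hasFDerivAt_const (𝕜 := ℝ) v x))
    refine (congrArg (fun T => T u) h1.fderiv).trans ?_
    simp
  rw [curvature, DForm.add_val, DForm.sum_val, ContinuousAlternatingMap.add_apply, DForm.d_apply_one, h, h]
  have h2 : ∀ k, ((taut (S := S) i k).wedge rfl (taut k j)).val p x ![u, v] =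
      entry i k (tautCLM p.1 x u) * entry k j (tautCLM p.1 x v) -
        entry i k (tautCLM p.1 x v) * entry k j (tautCLM p.1 x u) := fun k =>
    altWedge_one_one _ _ _ _
  rw [curvForm, map_sub, map_add, map_sub, entry_comp, entry_comp, add_sub_assoc,
    ← Finset.sum_sub_distrib]
  congr 1
  rw [ContinuousAlternatingMap.sum_apply]
  exact Finset.sum_congr rfl fun k _ => h2 k

lemma wedge_curvature_val (i j k l : Fin 3) {n : ℕ} (p : Plot (J2 S) n) (x : E n)
    (v : Fin 4 → E n) :
    ((curvature (taut (S := S)) i j).wedge rfl (curvature taut k l)).val p x v =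
      ((Nat.factorial 2 * Nat.factorial 2 : ℝ)⁻¹) • ∑ σ : Equiv.Perm (Fin 4),
        Equiv.Perm.sign σ • (toMat (curvForm (tautCLM p.1) x (v (σ 0)) (v (σ 1))) i j *
          toMat (curvForm (tautCLM p.1) x (v (σ 2)) (v (σ 3))) k l) := by
  refine (altWedge_apply _ _ _ _).trans ?_
  congr 1
  refine Finset.sum_congr rfl fun σ _ => ?_
  have e : ∀ f : Fin 2 → E n, f = ![f 0, f 1] := fun f => by
    ext i : 1
    fin_cases i <;> rfl
  rw [e fun a => v (σ (Fin.cast _ (Fin.castAdd 2 a))), e fun a => v (σ (Fin.cast _ (Fin.natAdd 2 a))),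
    curvature_taut_val, curvature_taut_val]
  rfl

/-- The form is rewritten through traces of curvature endomorphisms, so that its invariance under
conjugation becomes visible. -/
lemma pontrjagin_taut_val {n : ℕ} (p : Plot (J2 S) n) (x : E n) (v : Fin 4 → E n) :
    (pontrjagin (taut (S := S))).val p x v =
      (1 / 2 : ℂ) * ((Nat.factorial 2 * Nat.factorial 2 : ℝ)⁻¹ • ∑ σ : Equiv.Perm (Fin 4),
        Equiv.Perm.sign σ •
          ((toMat (curvForm (tautCLM p.1) x (v (σ 0)) (v (σ 1)))).trace *
            (toMat (curvForm (tautCLM p.1) x (v (σ 2)) (v (σ 3)))).trace -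
          (toMat (curvForm (tautCLM p.1) x (v (σ 0)) (v (σ 1))) *
            toMat (curvForm (tautCLM p.1) x (v (σ 2)) (v (σ 3)))).trace)) := by
  have e1 : DForm.wedge (c := 4) rfl (∑ i, curvature (taut (S := S)) i i) (∑ j, curvature taut j j) =
      ∑ i, ∑ j, DForm.wedge rfl (curvature taut i i) (curvature taut j j) := by
    rw [DForm.sum_wedge]
    exact Finset.sum_congr rfl fun i _ => DForm.wedge_sum _ _ _ _
  rw [pontrjagin, e1, DForm.smul_val, ContinuousAlternatingMap.smul_apply, smul_eq_mul]
  congr 1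
  simp only [DForm.sub_val, DForm.sum_val, ContinuousAlternatingMap.sub_apply,
    ContinuousAlternatingMap.sum_apply, wedge_curvature_val, ← Finset.smul_sum]
  rw [← smul_sub]
  congr 1
  have comm : ∀ f : Fin 3 → Fin 3 → Equiv.Perm (Fin 4) → ℂ,
      ∑ i, ∑ j, ∑ σ, f i j σ = ∑ σ, ∑ i, ∑ j, f i j σ := by
    intro f
    rw [Finset.sum_comm]
    conv_rhs => rw [Finset.sum_comm]
    rw [Finset.sum_comm]
    refine Finset.sum_congr rfl fun i _ => Finset.sum_comm
  rw [comm, comm, ← Finset.sum_sub_distrib]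
  refine Finset.sum_congr rfl fun σ _ => ?_
  simp only [← Finset.smul_sum]
  rw [← smul_sub]
  congr 2
  · simp only [Matrix.trace, Matrix.diag_apply]
    rw [Finset.sum_mul_sum]

/-- If `A` intertwines the curvatures, it also intertwines their products, and all traces agree. -/
lemma pontrjagin_val_congr {n : ℕ} {p p' : Plot (J2 S) n} {x : E n} {A : V3 →L[ℝ] V3}
    (hA : A.IsInvertible) (h : ∀ u v, A.comp (curvForm (tautCLM p'.1) x u v) =
      (curvForm (tautCLM p.1) x u v).comp A) :
    (pontrjagin (taut (S := S))).val p x = (pontrjagin taut).val p' x := by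
  ext v
  rw [pontrjagin_taut_val, pontrjagin_taut_val]
  congr 2
  refine Finset.sum_congr rfl fun σ _ => ?_
  have h2 : ∀ a b c d, A.comp ((curvForm (tautCLM p'.1) x a b).comp
      (curvForm (tautCLM p'.1) x c d)) = ((curvForm (tautCLM p.1) x a b).comp
        (curvForm (tautCLM p.1) x c d)).comp A := by
    intro a b c d
    rw [← ContinuousLinearMap.comp_assoc, h, ContinuousLinearMap.comp_assoc, h,
      ContinuousLinearMap.comp_assoc]
  rw [← toMat_trace_eq hA (h _ _), ← toMat_trace_eq hA (h _ _), ← toMat_comp, ← toMat_comp,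
    toMat_trace_eq hA (h2 _ _ _ _)]

lemma IsGauge.pontrjagin_eq {n : ℕ} {p p' : Plot (J2 S) n} {x : E n} {A : E n → V3 →L[ℝ] V3}
    (h : IsGauge p.1 p'.1 A x) (hA : ContDiffAt ℝ ∞ A x) (hA' : (A x).IsInvertible) :
    (pontrjagin (taut (S := S))).val p x = (pontrjagin taut).val p' x :=
  pontrjagin_val_congr hA' (curvForm_gauge (contDiff_tautCLM p.2).contDiffAt
    (contDiff_tautCLM p'.2).contDiffAt hA (h.tautCLM p.2 p'.2 hA))

lemma isGauge_act {n : ℕ} {p : Plot (J2 S) n} {A : E n → V3 →L[ℝ] V3} (hA : ∀ x, 0 < (A x).det)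
    (x : E n) : IsGauge p.1 (fun y => act (p.1 y) (A y) 0 (hA y) fun _ _ => rfl) A x := by
  filter_upwards [eventually_isCoord p.2 (isCoord_coordAt (base (p.1 x)))] with y hy
  refine ⟨base_act _ _, coordY_act _ _ hy, fun u v => ?_⟩
  rw [coordYY_act _ _ hy]
  simp

/-- `dR` is a sum of terms `dθ ∧ θ` and `θ ∧ dθ`, each containing an undifferentiated factor `θ`; so
it vanishes at a point where `θ` does. -/
lemma d_curvature_val_eq_zero {θ : Fin 3 → Fin 3 → DForm (J2 S) 1} {n : ℕ} {p : Plot (J2 S) n}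
    {x : E n} (h : ∀ i j, (θ i j).val p x = 0) (i j : Fin 3) :
    (DForm.d (curvature θ i j)).val p x = 0 := by
  rw [curvature, map_add, DForm.d_d, zero_add, map_sum, DForm.sum_val]
  refine Finset.sum_eq_zero fun k _ => ?_
  have e : DForm.d ((θ i k).wedge rfl (θ k j)) = _ := DForm.d_wedge rfl rfl rfl (θ i k) (θ k j)
  rw [e, DForm.add_val, DForm.zsmul_val]
  change altWedge _ _ ((θ k j).val p x) + (-1 : ℤ) ^ 1 • altWedge _ ((θ i k).val p x) _ = 0
  rw [h, h]
  ext v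
  simp [altWedge_apply]

lemma d_wedge_val_eq_zero {X : Type*} [DiffeologicalSpace X] {α β : DForm X 2} {n : ℕ}
    {p : Plot X n} {x : E n} (hα : (DForm.d α).val p x = 0) (hβ : (DForm.d β).val p x = 0) :
    (DForm.d (α.wedge (c := 4) rfl β)).val p x = 0 := by
  have e : DForm.d (α.wedge (c := 4) rfl β) = _ := DForm.d_wedge (a := 2) (b := 2) (c := 4) rfl rfl rfl α β
  rw [e, DForm.add_val, DForm.zsmul_val]
  change altWedge _ ((DForm.d α).val p x) _ + (-1 : ℤ) ^ 2 • altWedge _ _ ((DForm.d β).val p x) = 0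
  rw [hα, hβ]
  ext v
  simp [altWedge_apply]

lemma d_pontrjagin_val_eq_zero {θ : Fin 3 → Fin 3 → DForm (J2 S) 1} {n : ℕ} {p : Plot (J2 S) n}
    {x : E n} (h : ∀ i j, (θ i j).val p x = 0) : (DForm.d (pontrjagin θ)).val p x = 0 := by
  have hs : ∀ (f : Fin 3 → DForm (J2 S) 2), (∀ i, (DForm.d (f i)).val p x = 0) →
      (DForm.d (∑ i, f i)).val p x = 0 := fun f hf => by
    rw [map_sum, DForm.sum_val]
    exact Finset.sum_eq_zero fun i _ => hf i
  rw [pontrjagin, DForm.d_smul, DForm.smul_val, map_sub, DForm.sub_val, map_sum, DForm.sum_val,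
    d_wedge_val_eq_zero (hs _ fun i => d_curvature_val_eq_zero h i i)
      (hs _ fun i => d_curvature_val_eq_zero h i i), Finset.sum_eq_zero]
  · ext v
    simp
  intro i _
  rw [map_sum, DForm.sum_val]
  exact Finset.sum_eq_zero fun j _ => d_wedge_val_eq_zero (d_curvature_val_eq_zero h i j)
    (d_curvature_val_eq_zero h j i)

/-- By the gauge rule, a change of frame with `A = 1` and `dA = -θ` at `x` makes the connection
vanish at `x`. -/
lemma exists_gauge_tautCLM_eq_zero {n : ℕ} (p : Plot (J2 S) n) (x : E n) :
    ∃ (p₁ p' : Plot (J2 S) n) (A : E n → V3 →L[ℝ] V3), p₁.1 =ᶠ[𝓝 x] p.1 ∧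
      (∀ y, IsGauge p₁.1 p'.1 A y) ∧ ContDiff ℝ ∞ A ∧ (∀ y, 0 < (A y).det) ∧
        tautCLM p'.1 x = 0 := by
  -- The affine gauge with the prescribed value and derivative at `x`.
  let A₀ : E n → V3 →L[ℝ] V3 := fun y => ContinuousLinearMap.id ℝ V3 - tautCLM p.1 x (y - x)
  have hA₀ : ContDiff ℝ ∞ A₀ := contDiff_const.sub
    ((tautCLM p.1 x).contDiff.comp (contDiff_id.sub contDiff_const))
  have hdet : Continuous fun y => (A₀ y).det :=
    ContinuousLinearMap.continuous_det.comp hA₀.continuous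
  have hA₀x : A₀ x = ContinuousLinearMap.id ℝ V3 := by simp [A₀]
  -- The gauge must have positive determinant on the whole parameter space to give a plot.
  -- Precomposing with `f` achieves this without changing the germ at `x`.
  obtain ⟨f, hf, hfu, hfx⟩ := exists_smooth_into (isOpen_lt continuous_const hdet)
    (x := x) (u := {y | 0 < (A₀ y).det}) (by
      rw [Set.mem_ofPred_eq, hA₀x]
      have h1 : (ContinuousLinearMap.id ℝ V3).det = 1 := LinearMap.det_id
      rw [h1]
      exact one_pos)
  let A : E n → V3 →L[ℝ] V3 := A₀ ∘ f
  have hA : ContDiff ℝ ∞ A := hA₀.comp hf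
  have hdetA : ∀ y, 0 < (A y).det := hfu
  let p' : Plot (J2 S) n := ⟨fun y => act (p.1 y) (A y) 0 (hdetA y) fun _ _ => rfl,
    isPlot_act p.2 hdetA (fun _ _ _ => rfl) hA contDiff_const⟩
  have hg : ∀ y, IsGauge p.1 p'.1 A y := isGauge_act hdetA
  refine ⟨p, p', A, Filter.EventuallyEq.rfl, hg, hA, hdetA, ?_⟩
  have hAx : A =ᶠ[𝓝 x] A₀ := hfx.mono fun y hy => congrArg A₀ hy
  refine ContinuousLinearMap.ext fun w => ?_
  have h1 := ((hg x).tautCLM p.2 p'.2 hA.contDiffAt).self_of_nhds w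
  have h2 : fderiv ℝ A x w = -tautCLM p.1 x w := by
    rw [hAx.fderiv_eq]
    have h3 : HasFDerivAt A₀ (0 - (tautCLM p.1 x).comp (ContinuousLinearMap.id ℝ (E n))) x :=
      (hasFDerivAt_const _ x).sub ((tautCLM p.1 x).hasFDerivAt.comp x
        ((hasFDerivAt_id x).sub_const x))
    rw [h3.fderiv]
    simp
  rw [hAx.self_of_nhds, hA₀x, h2, ContinuousLinearMap.id_comp, ContinuousLinearMap.comp_id,
    add_neg_cancel] at h1
  rw [h1]
  rfl

/-- The form takes the same values on gauge-equivalent plots, so its differential may be computed in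
a gauge where the connection vanishes at the point, and there `dR = 0`. -/
lemma d_pontrjagin_taut : DForm.d (pontrjagin (taut (S := S))) = 0 := by
  refine DForm.ext' fun n p x => ?_
  obtain ⟨p₁, p', A, h1, hg, hA, hdet, h0⟩ := exists_gauge_tautCLM_eq_zero p x
  have e : (pontrjagin (taut (S := S))).val p₁ = (pontrjagin taut).val p' := funext fun y =>
    (hg y).pontrjagin_eq hA.contDiffAt
      ⟨(A y).toContinuousLinearEquivOfDetNeZero (hdet y).ne', by simp⟩
  have h2 : (DForm.d (pontrjagin (taut (S := S)))).val p' x = 0 := by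
    refine d_pontrjagin_val_eq_zero fun i j => ?_
    ext v
    have e : v = ![v 0] := by
      ext i : 1
      fin_cases i
      rfl
    rw [e, taut_val, h0]
    simp
  have h3 : (DForm.d (pontrjagin (taut (S := S)))).val p₁ x =
      (DForm.d (pontrjagin taut)).val p' x := by
    change extDeriv ((pontrjagin taut).val p₁) x = extDeriv ((pontrjagin taut).val p') x
    rw [e]
  rw [← DForm.val_congr _ h1, h3, h2]
  rfl

end J2

/-! ## Descent to `P₂` -/

namespace IsRotation

variable {A B : V3 →L[ℝ] V3}

lemma id : IsRotation (ContinuousLinearMap.id ℝ V3) :=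
  ⟨fun _ => rfl, LinearMap.det_id⟩

lemma comp (hA : IsRotation A) (hB : IsRotation B) : IsRotation (A.comp B) := by
  refine ⟨fun v => (hA.1 (B v)).trans (hB.1 v), ?_⟩
  have h : (A.comp B).det = A.det * B.det := LinearMap.det_comp _ _
  rw [h, hA.2, hB.2, one_mul]

lemma isInvertible (hA : IsRotation A) : A.IsInvertible :=
  ⟨A.toContinuousLinearEquivOfDetNeZero (by rw [hA.2]; exact one_ne_zero), by simp⟩

lemma inverse (hA : IsRotation A) : IsRotation A.inverse := by
  have h := hA.isInvertible
  refine ⟨fun v => ?_, ?_⟩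
  · rw [← hA.1 (A.inverse v), h.self_apply_inverse]
  · have h1 : (A.comp A.inverse).det = A.det * A.inverse.det := LinearMap.det_comp _ _
    rw [h.self_comp_inverse, hA.2, one_mul] at h1
    exact h1.symm.trans LinearMap.det_id

end IsRotation

namespace P2

variable {S : Type*} [TopologicalSpace S] [ChartedSpace ℂ S]

/-- The jets `J` and `J'` differ by the rotation `A`. -/
def RotatedBy (A : V3 →L[ℝ] V3) (J J' : J2 S) : Prop :=
  J2.base J' = J2.base J ∧ ∀ κ, IsCoord κ (J2.base J) →
    J2.coordY κ J' = (J2.coordY κ J).comp A ∧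
      ∀ u v, J2.coordYY κ J' u v = J2.coordYY κ J (A u) (A v)

/-- Equality in `P₂` is the equivalence relation generated by rotating a representative. Being
related by one rotation, in terms of coordinates, is already reflexive, symmetric and transitive, so
induction on the generation applies. -/
lemma exists_rotation {J J' : J2 S} (h : proj J = proj J') :
    ∃ A, IsRotation A ∧ RotatedBy A J J' := by
  have h' := Quot.eqvGen_exact h
  clear h
  induction h' with
  | rel J J' h =>
    obtain ⟨j, A, hj, hj', hA, rfl, rfl⟩ := h
    have hq : quadMap 0 A 0 = A := funext fun v => by simp [quadMap]
    have h0 : (j ∘ A) 0 = j 0 := congrArg j (map_zero A)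
    refine ⟨A, hA, h0, fun κ hκ => ?_⟩
    have hκ' : IsCoord κ ((j ∘ A) 0) := by rwa [h0]
    have hκ : IsCoord κ (j 0) := hκ
    have hs := contMDiffAt_coord (f := κ) hκ.smooth.self_of_nhds hj.1.self_of_nhds
    rw [J2.coordY_mk _ hκ'.smooth, J2.coordYY_mk _ hκ'.smooth, J2.coordY_mk _ hκ.smooth,
      J2.coordYY_mk _ hκ.smooth]
    have h1 := J2.fderiv_comp_quadMap (A := A) (B := 0) hs fun _ _ => rfl
    have h2 := J2.fderiv_fderiv_comp_quadMap (A := A) (B := 0) hs fun _ _ => rfl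
    rw [hq] at h1 h2
    refine ⟨h1, fun u v => (h2 u v).trans ?_⟩
    simp only [zero_apply, map_zero, add_zero]
    rfl
  | refl J => exact ⟨_, IsRotation.id, rfl, fun κ _ => ⟨rfl, fun _ _ => rfl⟩⟩
  | symm J J' _ ih =>
    obtain ⟨A, hA, h0, h1⟩ := ih
    have hi := hA.isInvertible
    refine ⟨A.inverse, hA.inverse, h0.symm, fun κ hκ => ?_⟩
    rw [h0] at hκ
    obtain ⟨h2, h3⟩ := h1 κ hκ
    refine ⟨?_, fun u v => ?_⟩
    · rw [h2, ContinuousLinearMap.comp_assoc, hi.self_comp_inverse, ContinuousLinearMap.comp_id]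
    · rw [h3, hi.self_apply_inverse, hi.self_apply_inverse]
  | trans J J' J'' _ _ ih ih' =>
    obtain ⟨A, hA, h0, h1⟩ := ih
    obtain ⟨A', hA', h0', h1'⟩ := ih'
    refine ⟨A.comp A', hA.comp hA', h0'.trans h0, fun κ hκ => ?_⟩
    obtain ⟨h2, h3⟩ := h1 κ hκ
    rw [← h0] at hκ
    obtain ⟨h2', h3'⟩ := h1' κ hκ
    refine ⟨?_, fun u v => ?_⟩
    · rw [h2', h2, ContinuousLinearMap.comp_assoc]
    · rw [h3', h3]
      rfl

lemma isSubduction_proj : IsSubduction (proj : J2 S → P2 S) :=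
  ⟨dSmooth_proj, fun q x => q.2 x⟩

variable [IsManifold 𝓘(ℝ, ℂ) ∞ S]

/-- The rotation that relates the jets at each point is recovered from their first-order coordinates
as `y⁻¹ y'`, which depends smoothly on the point. So two lifts of a plot of `P₂` are related by a
smooth gauge. -/
lemma exists_gauge {n : ℕ} {p p' : Plot (J2 S) n} {x : E n}
    (h : proj ∘ p.1 =ᶠ[𝓝 x] proj ∘ p'.1) : ∃ A : E n → V3 →L[ℝ] V3, ContDiffAt ℝ ∞ A x ∧
      (A x).IsInvertible ∧ J2.IsGauge p.1 p'.1 A x ∧ ∀ᶠ y in 𝓝 x, IsRotation (A y) := by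
  let κ := coordAt (J2.base (p.1 x))
  have hκ : IsCoord κ (J2.base (p.1 x)) := isCoord_coordAt _
  have hb : J2.base (p'.1 x) = J2.base (p.1 x) := by
    obtain ⟨A, -, h0, -⟩ := exists_rotation (J := p.1 x) (J' := p'.1 x) h.self_of_nhds
    exact h0
  let A : E n → V3 →L[ℝ] V3 := fun y =>
    (J2.coordY κ (p.1 y)).inverse.comp (J2.coordY κ (p'.1 y))
  have key : ∀ᶠ y in 𝓝 x, IsRotation (A y) ∧ RotatedBy (A y) (p.1 y) (p'.1 y) := by
    filter_upwards [h, J2.eventually_isCoord p.2 hκ] with y hy hy'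
    obtain ⟨B, hB, h0, h1⟩ := exists_rotation (J := p.1 y) (J' := p'.1 y) hy
    have e : A y = B := by
      change (J2.coordY κ (p.1 y)).inverse.comp (J2.coordY κ (p'.1 y)) = B
      rw [(h1 κ hy').1, ← ContinuousLinearMap.comp_assoc,
        (J2.isInvertible_coordY hy').inverse_comp_self, ContinuousLinearMap.id_comp]
    rw [e]
    exact ⟨hB, h0, h1⟩
  have hi : ContDiffAt ℝ ∞ (fun y => (J2.coordY κ (p.1 y)).inverse) x :=
    ContDiffAt.comp (g := ContinuousLinearMap.inverse) x
      (J2.isInvertible_coordY hκ).contDiffAt_map_inverse (J2.contDiffAt_coordY p.2 hκ)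
  refine ⟨A, hi.clm_comp (J2.contDiffAt_coordY p'.2 (by rwa [hb])),
    key.self_of_nhds.1.isInvertible, ?_, key.mono fun y hy => hy.1⟩
  filter_upwards [key, J2.eventually_isCoord p.2 hκ] with y hy hy'
  exact ⟨hy.2.1, hy.2.2 κ hy'⟩

/-- The first Pontrjagin form on `P₂`. -/
lemma exists_pontrjagin : ∃ p₁ : DForm (P2 S) 4,
    DForm.pullback proj dSmooth_proj p₁ = J2.pontrjagin J2.taut :=
  isSubduction_proj.exists_pullback_eq fun _ _ _ h => by
    obtain ⟨A, hA, hA', hg, -⟩ := exists_gauge h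
    exact hg.pontrjagin_eq hA hA'

end P2

/-! ## Changes of holomorphic coordinates -/

section ComplexCalculus

lemma fderiv_real_apply {T : ℂ → ℂ} {z : ℂ} (h : DifferentiableAt ℂ T z) (u : ℂ) :
    fderiv ℝ T z u = deriv T z * u := by
  rw [(h.hasDerivAt.hasFDerivAt.restrictScalars ℝ).fderiv]
  simp [mul_comm]

lemma fderiv_eq_two_re_dz (f : ℂ → ℝ) (z h : ℂ) : fderiv ℝ f z h = 2 * (dz f z * h).re := by
  have e : h = h.re • (1 : ℂ) + h.im • Complex.I := by
    simp [Complex.re_add_im]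
  conv_lhs => rw [e, map_add, map_smul, map_smul]
  simp [dz]
  ring

lemma dz_eq_of_fderiv {f : ℂ → ℝ} {z c : ℂ} (h : ∀ u, fderiv ℝ f z u = 2 * (c * u).re) :
    dz f z = c := by
  rw [dz, h, h]
  apply Complex.ext <;> simp

/-- For holomorphic `g` without zero, `d log |g|² = 2 Re(g'/g · dz)`. It supplies the inhomogeneous
term in the transformation rule of `∂_z ln ρ`. -/
lemma fderiv_log_norm_sq {g : ℂ → ℂ} {z : ℂ} (hg : DifferentiableAt ℂ g z) (h0 : g z ≠ 0) (u : ℂ) :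
    HasFDerivAt (𝕜 := ℝ) (fun z => Real.log (‖g z‖ ^ 2))
      (fderiv ℝ (fun z => Real.log (‖g z‖ ^ 2)) z) z ∧
    fderiv ℝ (fun z => Real.log (‖g z‖ ^ 2)) z u = 2 * (deriv g z / g z * u).re := by
  have h1 : HasFDerivAt g (fderiv ℝ g z) z :=
    (hg.hasFDerivAt.restrictScalars ℝ).differentiableAt.hasFDerivAt
  have h2 := h1.norm_sq
  have h3 := h2.log (pow_ne_zero 2 (norm_ne_zero_iff.mpr h0))
  refine ⟨h3.differentiableAt.hasFDerivAt, ?_⟩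
  rw [h3.fderiv]
  have hn : (‖g z‖ : ℝ) ^ 2 = Complex.normSq (g z) := (Complex.normSq_eq_norm_sq _).symm
  have hn0 : Complex.normSq (g z) ≠ 0 := by simpa using h0
  simp only [smul_apply, ContinuousLinearMap.comp_apply, smul_eq_mul, hn,
    innerSL_apply_apply, nsmul_eq_mul]
  rw [fderiv_real_apply hg, Complex.inner]
  rw [div_mul_eq_mul_div, Complex.div_re]
  field_simp
  simp

end ComplexCalculus

section Transitions

variable {S : Type*} [TopologicalSpace S] [ChartedSpace ℂ S] {φ ψ : OpenPartialHomeomorph S ℂ}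

lemma analyticAt_transition [IsManifold 𝓘(ℂ, ℂ) ω S]
    (hφ : φ ∈ IsManifold.maximalAtlas 𝓘(ℂ, ℂ) ω S) (hψ : ψ ∈ IsManifold.maximalAtlas 𝓘(ℂ, ℂ) ω S)
    {z : ℂ} (hz : z ∈ (φ.symm.trans ψ).source) :
    AnalyticAt ℂ (fun z => ψ (φ.symm z)) z := by
  have h := StructureGroupoid.compatible_of_mem_maximalAtlas hφ hψ
  rw [contDiffGroupoid, mem_groupoid_of_pregroupoid] at h
  have h1 : ContDiffOn ℂ ω (fun z => ψ (φ.symm z)) (φ.symm.trans ψ).source := by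
    have h2 := h.1
    simp only [contDiffPregroupoid, contDiffPregroupoid, mfld_simps] at h2 ⊢
    exact h2
  exact (h1.contDiffAt ((φ.symm.trans ψ).open_source.mem_nhds hz)).analyticAt

lemma mem_source_transition {s : S} (h : s ∈ φ.source) (h' : s ∈ ψ.source) :
    φ s ∈ (φ.symm.trans ψ).source := by
  simp [h, h']

lemma eventually_arg_mul_exp {z : Circle} (hz : (z : ℂ) ∈ Complex.slitPlane) :
    ∀ᶠ s in 𝓝 (0 : ℝ), Complex.arg ((z * Circle.exp s : Circle) : ℂ) = Complex.arg (z : ℂ) + s := by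
  have h1 : Complex.arg (z : ℂ) + 0 ∈ Set.Ioo (-Real.pi) Real.pi := by
    rw [add_zero]
    exact ⟨Complex.neg_pi_lt_arg _,
      lt_of_le_of_ne (Complex.arg_le_pi _) (Complex.mem_slitPlane_iff_arg.mp hz).1⟩
  have h2 : Continuous fun s : ℝ => Complex.arg (z : ℂ) + s := by fun_prop
  filter_upwards [h2.continuousAt.eventually (isOpen_Ioo.mem_nhds h1)] with s hs
  conv_lhs => rw [← Circle.exp_arg z, ← Circle.exp_add]
  exact Circle.arg_exp hs.1 hs.2.le

/-- Near `y₀` the branch of the angle measured from `t` and the one measured from `y₀` differ by a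
constant, because no branch point is crossed. -/
lemma eventually_arg_div {t y₀ : Circle} (h : ((y₀ / t : Circle) : ℂ) ∈ Complex.slitPlane) :
    ∀ᶠ y in 𝓝 y₀, Complex.arg ((y / t : Circle) : ℂ) =
      Complex.arg ((y₀ / t : Circle) : ℂ) + Complex.arg ((y / y₀ : Circle) : ℂ) := by
  have h1 : ContinuousAt (fun y : Circle => Complex.arg ((y / y₀ : Circle) : ℂ)) y₀ :=
    (contMDiffAt_arg_div (div_self_mem_slitPlane y₀)).continuousAt
  have h2 : Complex.arg ((y₀ / y₀ : Circle) : ℂ) = 0 := by simp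
  rw [ContinuousAt, h2] at h1
  filter_upwards [h1.eventually (eventually_arg_mul_exp h)] with y hy
  rw [← hy, Circle.exp_arg]
  congr 2
  rw [mul_comm, div_mul_div_cancel]

/-- The change of coordinates `(t, z) ↦ (t + c, T(z))`. -/
def prodTransition (c : ℝ) (T : ℂ → ℂ) (v : V3) : V3 := (v.1 + c, T v.2)

lemma eventually_prodCoord_eq {t t' : Circle} {m : Mfd S} (hm : m.2 ∈ φ.source)
    (ht : ((m.1 / t : Circle) : ℂ) ∈ Complex.slitPlane)
    (ht' : ((m.1 / t' : Circle) : ℂ) ∈ Complex.slitPlane) :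
    ∃ c, ∀ᶠ y in 𝓝 m, prodCoord t' ψ y =
      prodTransition c (fun z => ψ (φ.symm z)) (prodCoord t φ y) := by
  refine ⟨Complex.arg ((m.1 / t' : Circle) : ℂ) - Complex.arg ((m.1 / t : Circle) : ℂ), ?_⟩
  have h1 : Filter.Tendsto (fun y : Mfd S => y.1) (𝓝 m) (𝓝 m.1) := continuous_fst.tendsto m
  have h2 : Filter.Tendsto (fun y : Mfd S => y.2) (𝓝 m) (𝓝 m.2) := continuous_snd.tendsto m
  filter_upwards [h1.eventually (eventually_arg_div ht), h1.eventually (eventually_arg_div ht'),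
    h2.eventually (φ.open_source.mem_nhds hm)] with y a b c
  refine Prod.ext ?_ ?_
  · change Complex.arg ((y.1 / t' : Circle) : ℂ) = Complex.arg ((y.1 / t : Circle) : ℂ) + _
    rw [a, b]
    ring
  · change ψ y.2 = ψ (φ.symm (φ y.2))
    rw [φ.left_inv c]

lemma fderiv_apply_apply {U V W : Type*} [NormedAddCommGroup U] [NormedSpace ℝ U]
    [NormedAddCommGroup V] [NormedSpace ℝ V] [NormedAddCommGroup W] [NormedSpace ℝ W]
    {f : U → V →L[ℝ] W} {x : U} (hf : DifferentiableAt ℝ f x) (u : U) (v : V) :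
    fderiv ℝ f x u v = fderiv ℝ (fun y => f y v) x u := by
  rw [(hf.hasFDerivAt.clm_apply (hasFDerivAt_const (𝕜 := ℝ) v x)).fderiv]
  simp

section Derivatives

variable {c : ℝ} {T : ℂ → ℂ} {v : V3} (hT : AnalyticAt ℂ T v.2)

lemma contDiffAt_prodTransition (hT : AnalyticAt ℂ T v.2) :
    ContDiffAt ℝ ∞ (prodTransition c T) v := by
  have h1 : ContDiffAt ℝ ∞ T v.2 := (hT.contDiffAt (n := ∞)).restrict_scalars ℝ
  exact (contDiffAt_fst.add contDiffAt_const).prodMk (ContDiffAt.comp v h1 contDiffAt_snd)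

lemma fderiv_prodTransition (hT : AnalyticAt ℂ T v.2) (u : V3) :
    fderiv ℝ (prodTransition c T) v u = (u.1, deriv T v.2 * u.2) := by
  have h1 : HasFDerivAt T (fderiv ℝ T v.2) v.2 :=
    (hT.differentiableAt.hasFDerivAt.restrictScalars ℝ).differentiableAt.hasFDerivAt
  have h2 : HasFDerivAt (fun v : V3 => T v.2) ((fderiv ℝ T v.2).comp
      (ContinuousLinearMap.snd ℝ ℝ ℂ)) v := h1.comp v hasFDerivAt_snd
  have h3 : HasFDerivAt (prodTransition c T) ((ContinuousLinearMap.fst ℝ ℝ ℂ).prod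
      ((fderiv ℝ T v.2).comp (ContinuousLinearMap.snd ℝ ℝ ℂ))) v :=
    (hasFDerivAt_fst.add_const c).prodMk h2
  rw [h3.fderiv, ← fderiv_real_apply hT.differentiableAt]
  rfl

lemma fderiv_fderiv_prodTransition (hT : AnalyticAt ℂ T v.2) (u w : V3) :
    fderiv ℝ (fderiv ℝ (prodTransition c T)) v u w =
      (0, deriv (deriv T) v.2 * u.2 * w.2) := by
  rw [fderiv_apply_apply (ContDiffAt.differentiableAt_fderiv (contDiffAt_prodTransition hT))]
  have h0 : ∀ᶠ v' : V3 in 𝓝 v, AnalyticAt ℂ T v'.2 :=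
    (continuous_snd.tendsto v).eventually hT.eventually_analyticAt
  have e : (fun v' => fderiv ℝ (prodTransition c T) v' w) =ᶠ[𝓝 v]
      fun v' => (w.1, deriv T v'.2 * w.2) := h0.mono fun v' hv' => fderiv_prodTransition hv' w
  rw [e.fderiv_eq]
  have h1 : HasFDerivAt (deriv T) (fderiv ℝ (deriv T) v.2) v.2 :=
    (hT.deriv.differentiableAt.hasFDerivAt.restrictScalars ℝ).differentiableAt.hasFDerivAt
  have h2 : HasFDerivAt (fun v : V3 => deriv T v.2 * w.2) (w.2 • (fderiv ℝ (deriv T) v.2).comp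
      (ContinuousLinearMap.snd ℝ ℝ ℂ)) v :=
    HasFDerivAt.mul_const (HasFDerivAt.comp v h1 hasFDerivAt_snd) w.2
  have h3 := (hasFDerivAt_const (𝕜 := ℝ) w.1 v).prodMk h2
  rw [h3.fderiv]
  refine Prod.ext rfl ?_
  change w.2 * fderiv ℝ (deriv T) v.2 u.2 = _
  rw [fderiv_real_apply hT.deriv.differentiableAt]
  ring

end Derivatives

/-- The transformation rule of `∂_z ln ρ`. -/
lemma KahlerMetric.dz_log_coeff [IsManifold 𝓘(ℂ, ℂ) ω S] (ρ : KahlerMetric S)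
    (hφ : φ ∈ IsManifold.maximalAtlas 𝓘(ℂ, ℂ) ω S) (hψ : ψ ∈ IsManifold.maximalAtlas 𝓘(ℂ, ℂ) ω S)
    {z : ℂ} (hz : z ∈ (φ.symm.trans ψ).source) :
    deriv (fun z => ψ (φ.symm z)) z ≠ 0 ∧ dz (fun z => Real.log (ρ.coeff φ z)) z =
      dz (fun z => Real.log (ρ.coeff ψ z)) (ψ (φ.symm z)) * deriv (fun z => ψ (φ.symm z)) z +
        deriv (deriv fun z => ψ (φ.symm z)) z / deriv (fun z => ψ (φ.symm z)) z := by
  set T : ℂ → ℂ := fun z => ψ (φ.symm z) with hTdef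
  have hT := analyticAt_transition hφ hψ hz
  have hzφ : z ∈ φ.target := hz.1
  have hzψ : T z ∈ ψ.target := ψ.map_source hz.2
  have hT1 : deriv T z ≠ 0 := by
    intro h
    -- The coefficient in `φ` contains the factor `|T'|²` and is positive, so `T' ≠ 0`.
    have h1 := ρ.transform φ hφ ψ hψ z hz
    have h2 := ρ.pos φ hφ z hzφ
    rw [h1, h] at h2
    simp at h2
  refine ⟨hT1, dz_eq_of_fderiv fun u => ?_⟩
  have hs : ∀ᶠ y in 𝓝 z, y ∈ (φ.symm.trans ψ).source :=
    (φ.symm.trans ψ).open_source.mem_nhds hz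
  have hsource : ∀ᶠ y in 𝓝 z, y ∈ (φ.symm.trans ψ).source ∧ deriv T y ≠ 0 :=
    hs.and (hT.deriv.continuousAt.eventually (isOpen_ne.mem_nhds hT1))
  -- The logarithm turns the transformation rule of `ρ` into a sum, which can be differentiated term
  -- by term.
  have e : (fun z => Real.log (ρ.coeff φ z)) =ᶠ[𝓝 z]
      fun z => Real.log (ρ.coeff ψ (T z)) + Real.log (‖deriv T z‖ ^ 2) := by
    filter_upwards [hsource] with y hy
    rw [ρ.transform φ hφ ψ hψ y hy.1, Real.log_mul]
    · exact (ρ.pos ψ hψ _ (ψ.map_source hy.1.2)).ne'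
    · exact pow_ne_zero 2 (norm_ne_zero_iff.mpr hy.2)
  have h1 : DifferentiableAt ℝ (fun z => Real.log (ρ.coeff ψ z)) (T z) :=
    (((ρ.smooth ψ hψ).contDiffAt (ψ.open_target.mem_nhds hzψ)).differentiableAt (by simp)).log
      (ρ.pos ψ hψ _ hzψ).ne'
  have h2 : HasFDerivAt T (fderiv ℝ T z) z :=
    (hT.differentiableAt.hasFDerivAt.restrictScalars ℝ).differentiableAt.hasFDerivAt
  obtain ⟨h3, h4⟩ := fderiv_log_norm_sq hT.deriv.differentiableAt hT1 u
  have h5 : HasFDerivAt (fun z => Real.log (ρ.coeff ψ (T z))) _ z := h1.hasFDerivAt.comp z h2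
  rw [e.fderiv_eq, (h5.fun_add h3).fderiv]
  change fderiv ℝ (fun z => Real.log (ρ.coeff ψ z)) (T z) (fderiv ℝ T z u) +
    fderiv ℝ (fun z => Real.log (‖deriv T z‖ ^ 2)) z u = _
  rw [h4, fderiv_eq_two_re_dz, fderiv_real_apply hT.differentiableAt, ← mul_add, ← Complex.add_re,
    add_mul, mul_assoc]

section HolCoord

variable {t : Circle}

/-- `(t, φ)` are local coordinates on a neighbourhood of `m`. -/
structure IsHolCoord (t : Circle) (φ : OpenPartialHomeomorph S ℂ) (m : Mfd S) :
    Prop where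
  mem_atlas : φ ∈ IsManifold.maximalAtlas 𝓘(ℂ, ℂ) ω S
  mem_source : m.2 ∈ φ.source
  mem_slitPlane : ((m.1 / t : Circle) : ℂ) ∈ Complex.slitPlane

lemma IsHolCoord.isCoord {m : Mfd S} (h : IsHolCoord t φ m) :
    IsCoord (prodCoord t φ) m :=
  isCoord_prodCoord (mem_maximalAtlas_real h.mem_atlas) h.mem_source h.mem_slitPlane

lemma IsHolCoord.self {m : Mfd S}
    (hφ : φ ∈ IsManifold.maximalAtlas 𝓘(ℂ, ℂ) ω S) (hm : m.2 ∈ φ.source) :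
    IsHolCoord m.1 φ m := ⟨hφ, hm, div_self_mem_slitPlane m.1⟩

lemma IsHolCoord.chartAt [IsManifold 𝓘(ℂ, ℂ) ω S] (m : Mfd S) : IsHolCoord m.1 (chartAt ℂ m.2) m :=
  .self (IsManifold.chart_mem_maximalAtlas m.2) (mem_chart_source ℂ m.2)

lemma IsHolCoord.eventually {m : Mfd S} (h : IsHolCoord t φ m) :
    ∀ᶠ m' in 𝓝 m, IsHolCoord t φ m' := by
  have hs : IsOpen {y : Mfd S | ((y.1 / t : Circle) : ℂ) ∈ Complex.slitPlane ∧ y.2 ∈ φ.source} := by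
    refine IsOpen.inter (Complex.isOpen_slitPlane.preimage ?_) (φ.open_source.preimage continuous_snd)
    fun_prop
  filter_upwards [hs.mem_nhds ⟨h.mem_slitPlane, h.mem_source⟩] with m' h' using ⟨h.1, h'.2, h'.1⟩

end HolCoord

end Transitions

namespace J2

variable {S : Type*} [TopologicalSpace S] [ChartedSpace ℂ S] [IsManifold 𝓘(ℂ, ℂ) ω S]
  {φ ψ : OpenPartialHomeomorph S ℂ} {t t' : Circle} {J : J2 S}

lemma coordY_holTransition (h : IsHolCoord t φ (base J)) (h' : IsHolCoord t' ψ (base J)) (u : V3) :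
    coordY (prodCoord t' ψ) J u = ((coordY (prodCoord t φ) J u).1,
      deriv (fun z => ψ (φ.symm z)) (φ (base J).2) * (coordY (prodCoord t φ) J u).2) := by
  obtain ⟨c, hc⟩ := eventually_prodCoord_eq (ψ := ψ) h.mem_source h.mem_slitPlane h'.mem_slitPlane
  have hT := analyticAt_transition h.mem_atlas h'.mem_atlas
    (mem_source_transition h.mem_source h'.mem_source)
  rw [coordY_transition h.isCoord (contDiffAt_prodTransition hT) hc,
    ContinuousLinearMap.comp_apply]
  exact fderiv_prodTransition hT _

lemma coordYY_holTransition (h : IsHolCoord t φ (base J)) (h' : IsHolCoord t' ψ (base J))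
    (u v : V3) : coordYY (prodCoord t' ψ) J u v = ((coordYY (prodCoord t φ) J u v).1,
      deriv (deriv fun z => ψ (φ.symm z)) (φ (base J).2) * (coordY (prodCoord t φ) J u).2 *
          (coordY (prodCoord t φ) J v).2 +
        deriv (fun z => ψ (φ.symm z)) (φ (base J).2) * (coordYY (prodCoord t φ) J u v).2) := by
  obtain ⟨c, hc⟩ := eventually_prodCoord_eq (ψ := ψ) h.mem_source h.mem_slitPlane h'.mem_slitPlane
  have hT := analyticAt_transition h.mem_atlas h'.mem_atlas
    (mem_source_transition h.mem_source h'.mem_source)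
  rw [coordYY_transition h.isCoord (contDiffAt_prodTransition hT) hc,
    fderiv_prodTransition (v := prodCoord t φ (base J)) hT,
    fderiv_fderiv_prodTransition (v := prodCoord t φ (base J)) hT]
  refine Prod.ext (zero_add _) rfl

end J2

/-! ## Holomorphic jets -/

attribute [instance] isManifold_real

lemma fderiv_div_apply' {W : Type*} [NormedAddCommGroup W] [NormedSpace ℝ W] {f g : W → ℂ} {x : W}
    (hf : DifferentiableAt ℝ f x) (hg : DifferentiableAt ℝ g x) (h0 : g x ≠ 0) :
    fderiv ℝ (fun y => f y / g y) x =
      (g x)⁻¹ • fderiv ℝ f x - (f x / g x ^ 2) • fderiv ℝ g x := by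
  have h1 : HasFDerivAt (fun y => (g y)⁻¹) (-(g x ^ 2)⁻¹ • fderiv ℝ g x) x :=
    (hasDerivAt_inv h0).comp_hasFDerivAt_of_eq x hg.hasFDerivAt rfl
  simp_rw [div_eq_mul_inv]
  rw [(hf.hasFDerivAt.fun_mul h1).fderiv, add_comm, sub_eq_add_neg]
  congr 1
  rw [smul_smul, mul_neg]
  exact neg_smul (f x * (g x ^ 2)⁻¹) (fderiv ℝ g x)

namespace TotCochain

variable {Γ X Y : Type*} [Group Γ] [DiffeologicalSpace X] [MulAction Γ X] [SmoothAction Γ X]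
  {f : X → Y}

lemma Descends.single {n m : ℕ} {u : Cochain Γ X n m} (hu : ∀ s, (u.1 s).Descends f) :
    (TotCochain.single n m u).Descends f := by
  intro n' m' s
  by_cases h : n' = n ∧ m' = m
  · obtain ⟨rfl, rfl⟩ := h
    rw [single_self]
    exact hu s
  · rw [single_ne u h]
    exact fun _ _ _ _ => rfl

lemma Descends.add {u v : TotCochain Γ X} (hu : u.Descends f) (hv : v.Descends f) :
    (u + v).Descends f := fun n m s _ p p' x h =>
  congrArg₂ (· + ·) (hu n m s p p' x h) (hv n m s p p' x h)

end TotCochain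

section HolomorphicJets

variable {S : Type*} [TopologicalSpace S] [ChartedSpace ℂ S] [IsManifold 𝓘(ℂ, ℂ) ω S]
  {φ ψ : OpenPartialHomeomorph S ℂ} {t t' : Circle}

lemma IsHolomorphicGerm.eventually_fst {j : V3 → Mfd S} (hol : IsHolomorphicGerm j)
    (h : IsHolCoord t φ (j 0)) : ∀ᶠ v in 𝓝 (0 : V3),
      (prodCoord t φ (j v)).1 = (prodCoord t φ (j 0)).1 + v.1 := by
  have h1 : Filter.Tendsto (fun v : V3 => v.1) (𝓝 0) (𝓝 0) := continuous_fst.tendsto 0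
  filter_upwards [hol, h1.eventually (eventually_arg_mul_exp h.mem_slitPlane)] with v hv hv'
  change Complex.arg (((j v).1 / t : Circle) : ℂ) = Complex.arg (((j 0).1 / t : Circle) : ℂ) + v.1
  rw [← hv', hv.1, mul_div_right_comm]

/-- The Cauchy–Riemann equations: along the fibres the real derivative is multiplication by the
complex derivative. They are needed on a neighbourhood in order to be differentiated once more. -/
lemma IsHolomorphicGerm.eventually_snd {j : V3 → Mfd S} (hol : IsHolomorphicGerm j)
    (hj : ∀ᶠ v in 𝓝 (0 : V3), ContMDiffAt 𝓘(ℝ, V3) IM ∞ j v) (h : IsHolCoord t φ (j 0)) :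
    ∀ᶠ v in 𝓝 (0 : V3), ∀ z : ℂ, (fderiv ℝ (prodCoord t φ ∘ j) v (0, z)).2 =
      z * (fderiv ℝ (prodCoord t φ ∘ j) v (0, 1)).2 := by
  have hc := hj.self_of_nhds.continuousAt
  filter_upwards [hol, hj, hc.eventually h.eventually] with v hv hv' hv'' z
  have h1 : MDifferentiableAt 𝓘(ℂ, ℂ) 𝓘(ℂ, ℂ) φ (j v).2 :=
    ((contMDiffOn_of_mem_maximalAtlas hv''.mem_atlas).contMDiffAt
      (φ.open_source.mem_nhds hv''.mem_source)).mdifferentiableAt (by simp)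
  have h2 : DifferentiableAt ℂ (fun z : ℂ => φ (j (v.1, z)).2) v.2 :=
    (MDifferentiableAt.comp (g := φ) (f := fun z : ℂ => (j (v.1, z)).2) v.2 h1
      hv.2).differentiableAt
  have h3 : DifferentiableAt ℝ (prodCoord t φ ∘ j) v :=
    (contMDiffAt_coord (f := prodCoord t φ) hv''.isCoord.smooth.self_of_nhds hv').differentiableAt
      (by simp)
  have h4 : HasFDerivAt (fun z : ℂ => φ (j (v.1, z)).2) ((ContinuousLinearMap.snd ℝ ℝ ℂ).comp
      ((fderiv ℝ (prodCoord t φ ∘ j) v).comp (ContinuousLinearMap.inr ℝ ℝ ℂ))) v.2 :=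
    HasFDerivAt.comp (g := fun p : V3 => p.2) (f := fun z : ℂ => prodCoord t φ (j (v.1, z))) v.2
      hasFDerivAt_snd
      (h3.hasFDerivAt.comp (f := fun z : ℂ => (v.1, z)) v.2 (hasFDerivAt_prodMk_right v.1 v.2))
  have h5 : ∀ w, (fderiv ℝ (prodCoord t φ ∘ j) v (0, w)).2 =
      deriv (fun z : ℂ => φ (j (v.1, z)).2) v.2 * w := fun w => by
    rw [← fderiv_real_apply h2, h4.fderiv]
    rfl
  rw [h5, h5]
  ring

namespace HolJ2

variable {J : HolJ2 S}

/-- A germ of holomorphic type with given coordinates has first and second derivatives of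
holomorphic type. -/
lemma coord_hol (h : IsHolCoord t φ (base J)) :
    (∀ u, (J2.coordY (prodCoord t φ) J.1 u).1 = u.1) ∧
    (∀ z : ℂ, (J2.coordY (prodCoord t φ) J.1 (0, z)).2 =
      z * (J2.coordY (prodCoord t φ) J.1 (0, 1)).2) ∧
    (∀ u v, (J2.coordYY (prodCoord t φ) J.1 u v).1 = 0) ∧
    ∀ u (z : ℂ), (J2.coordYY (prodCoord t φ) J.1 u (0, z)).2 =
      z * (J2.coordYY (prodCoord t φ) J.1 u (0, 1)).2 := by
  obtain ⟨J, j, hj, hol, rfl⟩ := J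
  have h : IsHolCoord t φ (j 0) := h
  change (∀ u, (J2.coordY (prodCoord t φ) (J2.mk j hj) u).1 = u.1) ∧
    (∀ z : ℂ, (J2.coordY (prodCoord t φ) (J2.mk j hj) (0, z)).2 =
      z * (J2.coordY (prodCoord t φ) (J2.mk j hj) (0, 1)).2) ∧
    (∀ u v, (J2.coordYY (prodCoord t φ) (J2.mk j hj) u v).1 = 0) ∧
    ∀ u (z : ℂ), (J2.coordYY (prodCoord t φ) (J2.mk j hj) u (0, z)).2 =
      z * (J2.coordYY (prodCoord t φ) (J2.mk j hj) u (0, 1)).2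
  rw [J2.coordY_mk hj h.isCoord.smooth, J2.coordYY_mk hj h.isCoord.smooth]
  set G : V3 → V3 := prodCoord t φ ∘ j with hGdef
  have hG : ContDiffAt ℝ ∞ G 0 :=
    contMDiffAt_coord (f := prodCoord t φ) h.isCoord.smooth.self_of_nhds hj.1.self_of_nhds
  -- The first-order relations hold near `0`, so differentiating them at `0` yields those for the
  -- second derivative.
  have h1 : ∀ᶠ v in 𝓝 (0 : V3), ∀ u, (fderiv ℝ G v u).1 = u.1 := by
    filter_upwards [(hol.eventually_fst h).eventually_nhds,
      ContDiffAt.eventually_differentiableAt hG] with v hv hd u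
    have e : (fun v => (G v).1) =ᶠ[𝓝 v] fun v => (G 0).1 + v.1 := hv
    have e1 : HasFDerivAt (fun v => (G v).1) ((ContinuousLinearMap.fst ℝ ℝ ℂ).comp (fderiv ℝ G v)) v :=
      hasFDerivAt_fst.comp v hd.hasFDerivAt
    have e2 : HasFDerivAt (fun v : V3 => (G 0).1 + v.1) (ContinuousLinearMap.fst ℝ ℝ ℂ) v :=
      hasFDerivAt_fst.const_add _
    exact congrArg (fun T => T u) (e1.unique (e2.congr_of_eventuallyEq e))
  have h2 := hol.eventually_snd hj.1 h
  have hd := ContDiffAt.differentiableAt_fderiv hG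
  refine ⟨h1.self_of_nhds, h2.self_of_nhds, fun u v => ?_, fun u z => ?_⟩
  · have e1 : HasFDerivAt (fun y => (fderiv ℝ G y v).1) ((ContinuousLinearMap.fst ℝ ℝ ℂ).comp
        ((fderiv ℝ (fderiv ℝ G) 0).flip v)) 0 := by
      have := hd.hasFDerivAt.clm_apply (hasFDerivAt_const (𝕜 := ℝ) v (0 : V3))
      rw [ContinuousLinearMap.comp_zero, zero_add] at this
      exact hasFDerivAt_fst.comp 0 this
    have e2 : (fun y => (fderiv ℝ G y v).1) =ᶠ[𝓝 0] fun _ => v.1 := h1.mono fun y hy => hy v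
    exact congrArg (fun T => T u) (e1.unique ((hasFDerivAt_const v.1 _).congr_of_eventuallyEq e2))
  · have e1 : ∀ v, HasFDerivAt (fun y => (fderiv ℝ G y v).2) ((ContinuousLinearMap.snd ℝ ℝ ℂ).comp
        ((fderiv ℝ (fderiv ℝ G) 0).flip v)) 0 := by
      intro v
      have := hd.hasFDerivAt.clm_apply (hasFDerivAt_const (𝕜 := ℝ) v (0 : V3))
      rw [ContinuousLinearMap.comp_zero, zero_add] at this
      exact hasFDerivAt_snd.comp 0 this
    have e2 : (fun y => (fderiv ℝ G y (0, z)).2) =ᶠ[𝓝 0] fun y => z * (fderiv ℝ G y (0, 1)).2 :=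
      h2.mono fun y hy => hy z
    have e3 := (e1 (0, z)).unique (((e1 (0, 1)).const_mul z).congr_of_eventuallyEq e2)
    exact congrArg (fun T => T u) e3

lemma coordYzz_eq (h : IsHolCoord t φ (base J)) :
    coordYzz φ J = (J2.coordY (prodCoord t φ) J.1 (0, 1)).2 := by
  have h' : IsHolCoord t φ (J.1.rep 0) := by
    rw [J2.rep_zero]
    exact h
  have hd : DifferentiableAt ℝ (prodCoord t φ ∘ J.1.rep) 0 :=
    (contMDiffAt_coord (f := prodCoord t φ) h'.isCoord.smooth.self_of_nhds
      J.1.contMDiffAt_rep).differentiableAt (by simp)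
  have e : HasFDerivAt (fun v => φ (J.1.rep v).2) ((ContinuousLinearMap.snd ℝ ℝ ℂ).comp
      (fderiv ℝ (prodCoord t φ ∘ J.1.rep) 0)) 0 := HasFDerivAt.comp
    (g := fun p : V3 => p.2) (f := prodCoord t φ ∘ J.1.rep) 0 hasFDerivAt_snd hd.hasFDerivAt
  rw [coordYzz, e.fderiv]
  rfl

lemma coordY_inr (h : IsHolCoord t φ (base J)) (z : ℂ) :
    J2.coordY (prodCoord t φ) J.1 (0, z) = (0, z * coordYzz φ J) := by
  refine Prod.ext ((coord_hol h).1 _) ?_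
  rw [(coord_hol h).2.1, coordYzz_eq h]

lemma coordYzz_ne_zero (h : IsHolCoord t φ (base J)) : coordYzz φ J ≠ 0 := by
  intro h0
  have h1 := coordY_inr h 1
  rw [h0, mul_zero] at h1
  have h2 := (J2.isInvertible_coordY (J := J.1) h.isCoord).injective
    (h1.trans (map_zero (J2.coordY (prodCoord t φ) J.1)).symm)
  simpa using congrArg Prod.snd h2

lemma coordYzz_transition (h : IsHolCoord t φ (base J)) (h' : IsHolCoord t' ψ (base J)) :
    coordYzz ψ J = deriv (fun z => ψ (φ.symm z)) (φ (base J).2) * coordYzz φ J := by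
  rw [coordYzz_eq h, coordYzz_eq h', J2.coordY_holTransition (J := J.1) h h']
  rfl

/-- `g` multiplies the coordinate `yᶻ_z` of every holomorphic jet at a given point by the same
number, its derivative along the fibre; this number drops out of the quotient of two such jets. -/
lemma coordYzz_div_smul {Γ : Type*} [Group Γ] [MulAction Γ (Mfd S)] [IsConformalLoopAction Γ S]
    {J' : HolJ2 S} (hb : base J = base J') (g : Γ) (h : IsHolCoord t φ (base J))
    (h' : IsHolCoord t' ψ (g • base J)) :
    coordYzz ψ (g • J) / coordYzz ψ (g • J') = coordYzz φ J / coordYzz φ J' := by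
  have hκ' : IsCoord (fun x => prodCoord t' ψ (g • x)) (base J) := h'.isCoord.smul
  obtain ⟨τ, hτ, e⟩ := h.isCoord.exists_transition hκ'.smooth
  set D := fderiv ℝ τ (prodCoord t φ (base J)) with hD
  have key : ∀ J' : HolJ2 S, base J' = base J →
      (D (0, 1)).2 = coordYzz ψ (g • J') / coordYzz φ J' := by
    intro J' hJ'
    have h1 : IsHolCoord t φ (base J') := hJ' ▸ h
    have h2 : IsHolCoord t' ψ (base (g • J')) := by
      rw [base_smul, hJ']
      exact h'
    have h3 := coordY_inr h2 (coordYzz φ J')⁻¹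
    have h4 : J2.coordY (prodCoord t' ψ) (g • J').1 =
        J2.coordY (fun x => prodCoord t' ψ (g • x)) J'.1 :=
      J2.coordY_smul (J := J'.1) (g := g) (by
        change IsCoord _ (g • base J')
        rw [hJ']
        exact h'.isCoord)
    have hJ1 : J2.base J'.1 = base J := hJ'
    rw [h4, J2.coordY_transition (J := J'.1) (κ := prodCoord t φ) h1.isCoord
      (by rw [hJ1]; exact hτ.self_of_nhds) (by rw [hJ1]; exact e),
      ContinuousLinearMap.comp_apply, coordY_inr h1, inv_mul_cancel₀ (coordYzz_ne_zero h1),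
      hJ1, ← hD] at h3
    rw [h3, div_eq_inv_mul]
  have h1 := key J rfl
  have h2 := key J' hb.symm
  have hn := coordYzz_ne_zero h
  have hn' : coordYzz φ J' ≠ 0 := coordYzz_ne_zero (t := t) (by rw [← hb]; exact h)
  have hn'' : coordYzz ψ (g • J') ≠ 0 := coordYzz_ne_zero (t := t') (by
    rw [base_smul, ← hb]; exact h')
  rw [h1, div_eq_div_iff hn hn'] at h2
  rw [div_eq_div_iff hn'' hn', h2]
  ring

section Plots

variable {n : ℕ} {p p' : Plot (HolJ2 S) n} {x : E n}

/-- The underlying plot of `J₂⁺`. -/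
abbrev toJ2 (p : Plot (HolJ2 S) n) : Plot (J2 S) n := p.map incl dSmooth_incl

lemma eventually_isHolCoord (h : IsHolCoord t φ (base (p.1 x))) :
    ∀ᶠ y in 𝓝 x, IsHolCoord t φ (base (p.1 y)) :=
  (J2.contMDiffAt_base (toJ2 p).2 x).continuousAt.eventually h.eventually

lemma contDiffAt_base (h : IsHolCoord t φ (base (p.1 x))) :
    ContDiffAt ℝ ∞ (fun y => φ (base (p.1 y)).2) x :=
  (J2.contDiffAt_coord_base (toJ2 p).2 h.isCoord).snd

lemma contDiffAt_coordYzz (h : IsHolCoord t φ (base (p.1 x))) :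
    ContDiffAt ℝ ∞ (fun y => coordYzz φ (p.1 y)) x := by
  have h1 : ContDiffAt ℝ ∞ (fun y => (J2.coordY (prodCoord t φ) (p.1 y).1 (0, 1)).2) x :=
    ((J2.contDiffAt_coordY (toJ2 p).2 h.isCoord).clm_apply contDiffAt_const).snd
  refine h1.congr_of_eventuallyEq ?_
  filter_upwards [eventually_isHolCoord h] with y hy
  exact coordYzz_eq hy

variable (ρ : KahlerMetric S)

/-- The connection form along a plot, in a holomorphic coordinate. -/
def connAt (φ : OpenPartialHomeomorph S ℂ) (p : Plot (HolJ2 S) n) (x : E n) : E n →L[ℝ] ℂ :=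
  (coordYzz φ (p.1 x))⁻¹ • fderiv ℝ (fun y => coordYzz φ (p.1 y)) x +
    dz (fun z => Real.log (ρ.coeff φ z)) (φ (base (p.1 x)).2) •
      fderiv ℝ (fun y => φ (base (p.1 y)).2) x

/-- With transition map `T`, the term `y⁻¹ dy` gains `(T''/T') dz`, and `∂_z ln ρ dz` loses the same
amount by `KahlerMetric.dz_log_coeff`. -/
lemma connAt_eq (h : IsHolCoord t φ (base (p.1 x))) (h' : IsHolCoord t' ψ (base (p.1 x))) :
    connAt ρ ψ p x = connAt ρ φ p x := by
  have hz := mem_source_transition h.mem_source h'.mem_source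
  have hT := analyticAt_transition h.mem_atlas h'.mem_atlas hz
  obtain ⟨hT1, hdz⟩ := ρ.dz_log_coeff h.mem_atlas h'.mem_atlas hz
  have htr := fun y hy hy' => coordYzz_transition (J := p.1 y) (t := t) (t' := t') (φ := φ)
    (ψ := ψ) hy hy'
  obtain ⟨T, hTdef⟩ : ∃ T : ℂ → ℂ, T = fun z => ψ (φ.symm z) := ⟨_, rfl⟩
  rw [← hTdef] at hT hT1 hdz htr
  have hzd : HasFDerivAt (fun y => φ (base (p.1 y)).2) _ x :=
    ((contDiffAt_base h).differentiableAt (by simp)).hasFDerivAt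
  have had : HasFDerivAt (fun y => coordYzz φ (p.1 y)) _ x :=
    ((contDiffAt_coordYzz h).differentiableAt (by simp)).hasFDerivAt
  have hreal : ∀ {f : ℂ → ℂ} {z : ℂ}, DifferentiableAt ℂ f z → HasFDerivAt f (fderiv ℝ f z) z :=
    fun hf => (hf.hasFDerivAt.restrictScalars ℝ).differentiableAt.hasFDerivAt
  have e1 : (fun y => ψ (base (p.1 y)).2) =ᶠ[𝓝 x] fun y => T (φ (base (p.1 y)).2) := by
    filter_upwards [eventually_isHolCoord h] with y hy
    rw [hTdef]
    change _ = ψ (φ.symm _)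
    rw [φ.left_inv hy.mem_source]
  have e2 : (fun y => coordYzz ψ (p.1 y)) =ᶠ[𝓝 x]
      fun y => deriv T (φ (base (p.1 y)).2) * coordYzz φ (p.1 y) := by
    filter_upwards [eventually_isHolCoord h, eventually_isHolCoord h'] with y hy hy'
    exact htr y hy hy'
  have d1 : HasFDerivAt (fun y => T (φ (base (p.1 y)).2)) _ x :=
    HasFDerivAt.comp (g := T) x (hreal hT.differentiableAt) hzd
  have d2 : HasFDerivAt (fun y => deriv T (φ (base (p.1 y)).2) * coordYzz φ (p.1 y)) _ x :=
    HasFDerivAt.mul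
      (HasFDerivAt.comp (g := deriv T) x (hreal hT.deriv.differentiableAt) hzd) had
  have ha := coordYzz_ne_zero h
  ext w
  rw [connAt, connAt, e1.fderiv_eq, e2.fderiv_eq, d1.fderiv, d2.fderiv, hdz]
  simp only [add_apply, smul_apply, ContinuousLinearMap.comp_apply, smul_eq_mul]
  rw [fderiv_real_apply hT.differentiableAt]
  change _ * (_ + _ * fderiv ℝ (deriv T) (φ (base (p.1 x)).2) _) + _ = _
  rw [fderiv_real_apply hT.deriv.differentiableAt, htr x h h']
  have e3 : ψ (φ.symm (φ (base (p.1 x)).2)) = ψ (base (p.1 x)).2 :=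
    congrArg ψ (φ.left_inv h.mem_source)
  rw [e3]
  field_simp
  ring

lemma contDiffAt_dz {f : ℂ → ℝ} {z : ℂ} (hf : ContDiffAt ℝ ∞ f z) : ContDiffAt ℝ ∞ (dz f) z := by
  have h1 : ContDiffAt ℝ ∞ (fderiv ℝ f) z := hf.fderiv_right (by simp)
  have h2 : ∀ v : ℂ, ContDiffAt ℝ ∞ (fun z => ((fderiv ℝ f z v : ℝ) : ℂ)) z := fun v =>
    Complex.ofRealCLM.contDiff.contDiffAt.comp z (h1.clm_apply contDiffAt_const)
  exact contDiffAt_const.mul ((h2 1).sub (contDiffAt_const.mul (h2 Complex.I)))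

lemma contDiffAt_dz_log_coeff (h : IsHolCoord t φ (base (p.1 x))) :
    ContDiffAt ℝ ∞ (fun y => dz (fun z => Real.log (ρ.coeff φ z)) (φ (base (p.1 y)).2)) x := by
  have hz : φ (base (p.1 x)).2 ∈ φ.target := φ.map_source h.mem_source
  have h1 : ContDiffAt ℝ ∞ (fun z => Real.log (ρ.coeff φ z)) (φ (base (p.1 x)).2) :=
    ((ρ.smooth φ h.mem_atlas).contDiffAt (φ.open_target.mem_nhds hz)).log
      (ρ.pos φ h.mem_atlas _ hz).ne'
  exact ContDiffAt.comp (g := dz fun z => Real.log (ρ.coeff φ z)) x (contDiffAt_dz h1)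
    (contDiffAt_base h)

lemma contDiffAt_connAt (h : IsHolCoord t φ (base (p.1 x))) : ContDiffAt ℝ ∞ (connAt ρ φ p) x := by
  have h1 := contDiffAt_coordYzz h
  exact ((h1.inv (coordYzz_ne_zero h)).smul (h1.fderiv_right (by simp))).add
    ((contDiffAt_dz_log_coeff ρ h).smul ((contDiffAt_base h).fderiv_right (by simp)))

lemma connAt_eventuallyEq (h : IsHolCoord t φ (base (p.1 x))) :
    (fun y => connAt ρ (chartAt ℂ (base (p.1 y)).2) p y) =ᶠ[𝓝 x] connAt ρ φ p := by
  filter_upwards [eventually_isHolCoord h] with y hy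
  exact connAt_eq ρ hy (.chartAt _)

/-- The connection form associated with a Kähler metric. -/
def conn : DForm (HolJ2 S) 1 :=
  DForm.ofOneForm (fun p x => connAt ρ (chartAt ℂ (base (p.1 x)).2) p x)
    (fun p => contDiff_iff_contDiffAt.mpr fun x =>
      (contDiffAt_connAt ρ (.chartAt _)).congr_of_eventuallyEq (connAt_eventuallyEq ρ (.chartAt _)))
    (fun p f hf x => by
      have h := IsHolCoord.chartAt (base (p.1 (f x)))
      have hfd := hf.differentiable (by simp) x
      have e1 := fderiv_comp x ((contDiffAt_coordYzz h).differentiableAt (by simp)) hfd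
      have e2 := fderiv_comp x ((contDiffAt_base h).differentiableAt (by simp)) hfd
      ext w
      have e1' := congrArg (fun T => T w) e1
      have e2' := congrArg (fun T => T w) e2
      exact congrArg₂ (fun a b => (coordYzz _ (p.1 (f x)))⁻¹ * a + dz _ _ * b) e1' e2')

lemma conn_val (h : IsHolCoord t φ (base (p.1 x))) (w : E n) :
    (conn ρ).val p x ![w] = connAt ρ φ p x w :=
  congrArg (fun T => T w) (connAt_eventuallyEq ρ h).self_of_nhds

lemma isConnection_conn : IsConnection ρ (conn ρ) := fun _ hφ _ _ _ w hs =>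
  conn_val ρ (.self hφ hs) w

/-- The metric term depends only on the base point. Along two lifts of the same plot of `M` the
connection therefore differs by the logarithmic derivative of the quotient of the coordinates
`yᶻ_z`. -/
lemma conn_val_sub (h : IsHolCoord t φ (base (p.1 x))) (hb : base ∘ p.1 =ᶠ[𝓝 x] base ∘ p'.1) :
    ∀ᶠ y in 𝓝 x, ∀ w, (conn ρ).val p y ![w] - (conn ρ).val p' y ![w] =
      (coordYzz φ (p.1 y) / coordYzz φ (p'.1 y))⁻¹ *
        fderiv ℝ (fun y => coordYzz φ (p.1 y) / coordYzz φ (p'.1 y)) y w := by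
  filter_upwards [hb.eventually_nhds, eventually_isHolCoord h] with y hy hy1 w
  have hb' : base (p.1 y) = base (p'.1 y) := hy.self_of_nhds
  have hy2 : IsHolCoord t φ (base (p'.1 y)) := hb' ▸ hy1
  have hz : (fun y => φ (base (p.1 y)).2) =ᶠ[𝓝 y] fun y => φ (base (p'.1 y)).2 :=
    hy.mono fun z hz => congrArg (fun m => φ m.2) hz
  have ha := coordYzz_ne_zero hy1
  have ha' := coordYzz_ne_zero hy2
  have e1 := (contDiffAt_coordYzz hy1).differentiableAt (by simp)
  have e2 := (contDiffAt_coordYzz hy2).differentiableAt (by simp)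
  rw [conn_val ρ hy1, conn_val ρ hy2, connAt, connAt, hz.fderiv_eq, ← hb',
    fderiv_div_apply' e1 e2 ha']
  simp only [add_apply, smul_apply, sub_apply, smul_eq_mul]
  field_simp
  ring

end Plots

end HolJ2

/-- `f⁻¹ df` is closed: its derivative is symmetric because the second derivative of `f` and `df ⊗
df` are. -/
lemma fderiv_inv_mul_fderiv_symm {W : Type*} [NormedAddCommGroup W] [NormedSpace ℝ W] {f : W → ℂ}
    {x : W} (hf : ContDiffAt ℝ ∞ f x) (h0 : f x ≠ 0) (u v : W) :
    fderiv ℝ (fun y => (f y)⁻¹ * fderiv ℝ f y v) x u =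
      fderiv ℝ (fun y => (f y)⁻¹ * fderiv ℝ f y u) x v := by
  have h1 : HasFDerivAt f (fderiv ℝ f x) x := (hf.differentiableAt (by simp)).hasFDerivAt
  have h2 : HasFDerivAt (fderiv ℝ f) (fderiv ℝ (fderiv ℝ f) x) x :=
    (ContDiffAt.differentiableAt_fderiv hf).hasFDerivAt
  have h3 : ∀ u v : W, fderiv ℝ (fun y => (f y)⁻¹ * fderiv ℝ f y v) x u =
      (f x)⁻¹ * fderiv ℝ (fderiv ℝ f) x u v - fderiv ℝ f x v * fderiv ℝ f x u / f x ^ 2 := by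
    intro u v
    have h4 : HasFDerivAt (fun y => fderiv ℝ f y v) ((fderiv ℝ (fderiv ℝ f) x).flip v) x := by
      have := h2.clm_apply (hasFDerivAt_const (𝕜 := ℝ) v x)
      rwa [ContinuousLinearMap.comp_zero, zero_add] at this
    have e : (fun y => (f y)⁻¹ * fderiv ℝ f y v) = fun y => fderiv ℝ f y v / f y :=
      funext fun y => by rw [div_eq_inv_mul]
    rw [e, fderiv_div_apply' h4.differentiableAt h1.differentiableAt h0, h4.fderiv]
    simp only [sub_apply, smul_apply, smul_eq_mul, ContinuousLinearMap.flip_apply]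
    ring
  rw [h3, h3, fderiv_fderiv_symm hf u v]
  ring

/-- Two plots have the same value under the differential of a 1-form if the values of the form
differ by a logarithmic derivative. -/
lemma DForm.d_val_eq_of_sub {X : Type*} [DiffeologicalSpace X] {α : DForm X 1} {n : ℕ}
    {p p' : Plot X n} {x : E n} {f : E n → ℂ} (hf : ContDiffAt ℝ ∞ f x) (h0 : f x ≠ 0)
    (h : ∀ᶠ y in 𝓝 x, ∀ w, α.val p y ![w] - α.val p' y ![w] = (f y)⁻¹ * fderiv ℝ f y w) :
    (DForm.d α).val p x = (DForm.d α).val p' x := by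
  have hd : ∀ (q : Plot X n) (w : E n), DifferentiableAt ℝ (fun y => α.val q y ![w]) x :=
    fun q w => by
      let L : (E n [⋀^Fin 1]→L[ℝ] ℂ) →L[ℝ] ℂ := LinearMap.toContinuousLinearMap
        { toFun := fun α => α ![w], map_add' := fun _ _ => rfl, map_smul' := fun _ _ => rfl }
      exact L.differentiableAt.comp x ((α.smooth q).differentiable (by simp) x)
  have hw : ∀ u w : E n, fderiv ℝ (fun y => α.val p y ![w]) x u -
      fderiv ℝ (fun y => α.val p' y ![w]) x u =
        fderiv ℝ (fun y => (f y)⁻¹ * fderiv ℝ f y w) x u := by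
    intro u w
    have e : (fun y => α.val p y ![w] - α.val p' y ![w]) =ᶠ[𝓝 x]
        fun y => (f y)⁻¹ * fderiv ℝ f y w := h.mono fun y hy => hy w
    rw [← e.fderiv_eq, fderiv_fun_sub (hd p w) (hd p' w)]
    rfl
  ext v
  have e : v = ![v 0, v 1] := by
    ext i : 1
    fin_cases i <;> rfl
  rw [e, DForm.d_apply_one, DForm.d_apply_one]
  have h1 := hw (v 0) (v 1)
  have h2 := hw (v 1) (v 0)
  rw [fderiv_inv_mul_fderiv_symm hf h0] at h1
  linear_combination h1 - h2

namespace HolJ2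

variable (ρ : KahlerMetric S)

lemma contDiffAt_coordYzz_div {φ : OpenPartialHomeomorph S ℂ} {t : Circle} {n : ℕ}
    {p p' : Plot (HolJ2 S) n} {x : E n} (h : IsHolCoord t φ (base (p.1 x)))
    (h' : IsHolCoord t φ (base (p'.1 x))) :
    ContDiffAt ℝ ∞ (fun y => coordYzz φ (p.1 y) / coordYzz φ (p'.1 y)) x := by
  simp only [div_eq_mul_inv]
  exact (contDiffAt_coordYzz h).mul ((contDiffAt_coordYzz h').inv (coordYzz_ne_zero h'))

lemma descends_d_conn : (DForm.d (conn ρ)).Descends (base : HolJ2 S → Mfd S) := by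
  intro n p p' x hb
  have h := IsHolCoord.chartAt (base (p.1 x))
  have hb' : base (p.1 x) = base (p'.1 x) := hb.self_of_nhds
  have h' : IsHolCoord (base (p.1 x)).1 (chartAt ℂ (base (p.1 x)).2) (base (p'.1 x)) := hb' ▸ h
  exact DForm.d_val_eq_of_sub (contDiffAt_coordYzz_div h h')
    (div_ne_zero (coordYzz_ne_zero h) (coordYzz_ne_zero h')) (conn_val_sub ρ h hb)

section Action

variable {Γ : Type*} [Group Γ] [MulAction Γ (Mfd S)] [IsConformalLoopAction Γ S]

/-- The difference of the connection along two lifts is the logarithmic derivative of a quotient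
that does not change when both lifts are moved by `g`, by `coordYzz_div_smul`. -/
lemma translate_conn_val_sub {n : ℕ} {p p' : Plot (HolJ2 S) n} {x : E n}
    (hb : base ∘ p.1 =ᶠ[𝓝 x] base ∘ p'.1) (g : Γ) (w : E n) :
    (translate Γ g (conn ρ)).val p x ![w] - (translate Γ g (conn ρ)).val p' x ![w] =
      (conn ρ).val p x ![w] - (conn ρ).val p' x ![w] := by
  have h := IsHolCoord.chartAt (base (p.1 x))
  let q : Plot (HolJ2 S) n := p.map _ (SmoothAction.dSmooth_smul g)
  let q' : Plot (HolJ2 S) n := p'.map _ (SmoothAction.dSmooth_smul g)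
  have hq : IsHolCoord (base (q.1 x)).1 (chartAt ℂ (base (q.1 x)).2) (base (q.1 x)) := .chartAt _
  have hbq : base ∘ q.1 =ᶠ[𝓝 x] base ∘ q'.1 := hb.mono fun y hy => by
    change base (g • p.1 y) = base (g • p'.1 y)
    rw [base_smul, base_smul]
    exact congrArg _ hy
  have e := (conn_val_sub ρ hq hbq).self_of_nhds w
  change (conn ρ).val q x ![w] - (conn ρ).val q' x ![w] = _
  rw [e, (conn_val_sub ρ h hb).self_of_nhds w]
  have ef : (fun y => coordYzz (chartAt ℂ (base (q.1 x)).2) (q.1 y) /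
      coordYzz (chartAt ℂ (base (q.1 x)).2) (q'.1 y)) =ᶠ[𝓝 x]
      fun y => coordYzz (chartAt ℂ (base (p.1 x)).2) (p.1 y) /
        coordYzz (chartAt ℂ (base (p.1 x)).2) (p'.1 y) := by
    filter_upwards [eventually_isHolCoord h, eventually_isHolCoord hq, hb] with y h1 h2 h3
    refine coordYzz_div_smul h3 g h1 (t' := (base (q.1 x)).1) ?_
    rw [← base_smul]
    exact h2
  exact congrArg₂ (fun a (b : E n →L[ℝ] ℂ) => a⁻¹ * b w) ef.self_of_nhds (ef.fderiv_eq (𝕜 := ℝ))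

/-- The de Rham component descends because the ambiguity `f⁻¹ df` is closed, the simplicial
component because this ambiguity is invariant under `Γ` and cancels in the difference of two
translates. -/
lemma descends_D_conn :
    (TotCochain.D (TotCochain.ofForm (conn ρ) : TotCochain Γ (HolJ2 S))).Descends
      (base : HolJ2 S → Mfd S) := by
  rw [TotCochain.ofForm_eq_single, TotCochain.D_single]
  refine .add (.single fun s N p p' x hb => ?_) (.single fun s N p p' x hb => ?_)
  · refine descends_d_conn ρ (p.map _ (SmoothAction.dSmooth_smul (s 0)))
      (p'.map _ (SmoothAction.dSmooth_smul (s 0))) x (hb.mono fun y hy => ?_)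
    change base (s 0 • p.1 y) = base (s 0 • p'.1 y)
    rw [base_smul, base_smul]
    exact congrArg _ hy
  · ext v
    have e : v = ![v 0] := by
      ext i : 1
      fin_cases i
      rfl
    have h0 := translate_conn_val_sub ρ hb (s 0) (v 0)
    have h1 := translate_conn_val_sub ρ hb (s 1) (v 0)
    rw [Cochain.delta_apply, Fin.sum_univ_two]
    simp only [pow_one, Fin.val_zero, pow_zero, Fin.val_one, one_smul, neg_smul, DForm.neg_val,
      DForm.add_val, ContinuousAlternatingMap.neg_apply, ContinuousAlternatingMap.add_apply]
    rw [e]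
    change -((translate Γ (s 1) (conn ρ)).val p x ![v 0] +
      -(translate Γ (s 0) (conn ρ)).val p x ![v 0]) =
        -((translate Γ (s 1) (conn ρ)).val p' x ![v 0] +
      -(translate Γ (s 0) (conn ρ)).val p' x ![v 0])
    linear_combination h0 - h1

end Action

end HolJ2

end HolomorphicJets

/-! ## Determinants -/

/-- The basis of `ℝ³` with coordinates `(uᵗ, Re uᶻ, Im uᶻ)`. -/
def coordBasis : Module.Basis (Fin 3) ℝ V3 :=
  Module.Basis.ofEquivFun
    { toFun := fun v i => J2.coord i v
      map_add' := fun u v => by ext i; fin_cases i <;> simp [J2.coord]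
      map_smul' := fun c v => by ext i; fin_cases i <;> simp [J2.coord]
      invFun := fun c => (c 0, c 1 + c 2 * Complex.I)
      left_inv := fun v => by
        simp [J2.coord, Complex.re_add_im]
      right_inv := fun c => by ext i; fin_cases i <;> simp [J2.coord] }

lemma coordBasis_apply (i : Fin 3) : coordBasis i = J2.vec i := by
  rw [coordBasis, Module.Basis.coe_ofEquivFun]
  refine (LinearEquiv.symm_apply_eq _).mpr (funext fun j => ?_)
  change _ = J2.coord j (J2.vec i)
  fin_cases i <;> fin_cases j <;> simp [J2.coord, J2.vec]

lemma det_eq_det_coord (A : V3 →L[ℝ] V3) :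
    A.det = (Matrix.of fun i j => J2.coord i (A (J2.vec j))).det := by
  rw [ContinuousLinearMap.det, ← LinearMap.det_toMatrix coordBasis]
  congr 1
  ext i j
  rw [LinearMap.toMatrix_apply, coordBasis_apply]
  rfl

/-- The matrix is block triangular; its blocks are `1` and multiplication by `a`, which has real
determinant `|a|²`. -/
lemma det_eq_norm_sq {A : V3 →L[ℝ] V3} {a : ℂ} (h1 : ∀ u, (A u).1 = u.1)
    (h2 : ∀ z : ℂ, (A (0, z)).2 = a * z) : A.det = ‖a‖ ^ 2 := by
  rw [det_eq_det_coord, Matrix.det_fin_three, Complex.sq_norm, Complex.normSq_apply]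
  simp [J2.coord, J2.vec, h1, h2]

/-! ## Local sections of the bundles of jets -/

lemma IsSubduction.of_comp {X Y Z : Type*} [DiffeologicalSpace X] [DiffeologicalSpace Y]
    [DiffeologicalSpace Z] {f : X → Y} {g : Y → Z} (hg : DSmooth g) (hf : DSmooth f)
    (h : IsSubduction (g ∘ f)) : IsSubduction g where
  dSmooth := hg
  exists_lift q x := by
    obtain ⟨P, hP⟩ := h.exists_lift q x
    exact ⟨P.map f hf, hP⟩

section Sections

variable {S : Type*} [TopologicalSpace S] [ChartedSpace ℂ S] [IsManifold 𝓘(ℂ, ℂ) ω S]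
  {φ : OpenPartialHomeomorph S ℂ} {m : Mfd S}

lemma deriv_transition_ne_zero {ψ : OpenPartialHomeomorph S ℂ}
    (hφ : φ ∈ IsManifold.maximalAtlas 𝓘(ℂ, ℂ) ω S) (hψ : ψ ∈ IsManifold.maximalAtlas 𝓘(ℂ, ℂ) ω S)
    {z : ℂ} (hz : z ∈ (φ.symm.trans ψ).source) : deriv (fun z => ψ (φ.symm z)) z ≠ 0 := by
  have h1 := analyticAt_transition hφ hψ hz
  have hz' : ψ (φ.symm z) ∈ (ψ.symm.trans φ).source :=
    mem_source_transition (s := φ.symm z) hz.2 (φ.map_target hz.1)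
  have h2 := analyticAt_transition hψ hφ hz'
  have e : (fun w => φ (ψ.symm w)) ∘ (fun z => ψ (φ.symm z)) =ᶠ[𝓝 z] id := by
    filter_upwards [(φ.symm.trans ψ).open_source.mem_nhds hz] with y hy
    change φ (ψ.symm (ψ (φ.symm y))) = y
    exact (congrArg φ (ψ.left_inv hy.2)).trans (φ.right_inv hy.1)
  have h3 := e.deriv_eq
  rw [deriv_comp z h2.differentiableAt h1.differentiableAt, deriv_id] at h3
  exact right_ne_zero_of_mul (h3 ▸ one_ne_zero)

/-- The germ `u ↦ (t + uᵗ, z + uᶻ)` at the point with coordinates `(t, z = φ)`. -/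
def chartGerm (φ : OpenPartialHomeomorph S ℂ) (m : Mfd S) (v : V3) : Mfd S :=
  (m.1 * Circle.exp v.1, φ.symm (φ m.2 + v.2))

lemma chartGerm_zero (hm : m.2 ∈ φ.source) : chartGerm φ m 0 = m := by
  rw [chartGerm, Prod.fst_zero, Prod.snd_zero, Circle.exp_zero, mul_one, add_zero, φ.left_inv hm]

lemma contMDiffAt_chartGerm (hφ : φ ∈ IsManifold.maximalAtlas 𝓘(ℂ, ℂ) ω S) {W : Type*}
    [NormedAddCommGroup W] [NormedSpace ℝ W] {q : W → Mfd S} {w : W × V3}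
    (hq : ContMDiffAt 𝓘(ℝ, W) IM ∞ q w.1) (hm : (q w.1).2 ∈ φ.source)
    (hw : φ (q w.1).2 + w.2.2 ∈ φ.target) :
    ContMDiffAt 𝓘(ℝ, W × V3) IM ∞ (fun w : W × V3 => chartGerm φ (q w.1) w.2) w := by
  have hφ' := mem_maximalAtlas_real hφ
  have hq' : ContMDiffAt 𝓘(ℝ, W × V3) IM ∞ (fun w : W × V3 => q w.1) w :=
    ContMDiffAt.comp w hq contDiff_fst.contMDiff.contMDiffAt
  have h1 : ContMDiffAt 𝓘(ℝ, W × V3) (𝓡 1) ∞ (fun w : W × V3 => (q w.1).1) w := hq'.fst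
  have h2 : ContMDiffAt 𝓘(ℝ, W × V3) 𝓘(ℝ, ℂ) ∞ (fun w : W × V3 => (q w.1).2) w := hq'.snd
  have h3 : ContMDiffAt 𝓘(ℝ, W × V3) (𝓡 1) ∞ (fun w : W × V3 => Circle.exp w.2.1) w :=
    (contMDiff_circleExp.comp (contDiff_fst.comp contDiff_snd).contMDiff).contMDiffAt
  have h4 : ContMDiffAt 𝓘(ℝ, W × V3) 𝓘(ℝ, ℂ) ∞ (fun w : W × V3 => φ (q w.1).2) w :=
    ((contMDiffOn_of_mem_maximalAtlas hφ').contMDiffAt (φ.open_source.mem_nhds hm)).comp w h2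
  have h5 : ContMDiffAt 𝓘(ℝ, W × V3) 𝓘(ℝ, ℂ) ∞ (fun w : W × V3 => φ (q w.1).2 + w.2.2) w :=
    (h4.contDiffAt.add (contDiff_snd.comp contDiff_snd).contDiffAt).contMDiffAt
  have h6 : ContMDiffAt 𝓘(ℝ, W × V3) 𝓘(ℝ, ℂ) ∞
      (fun w : W × V3 => φ.symm (φ (q w.1).2 + w.2.2)) w :=
    ContMDiffAt.comp (g := φ.symm) w ((contMDiffOn_symm_of_mem_maximalAtlas hφ').contMDiffAt
      (φ.open_target.mem_nhds hw)) h5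
  have : LieGroup (𝓡 1) ∞ Circle := LieGroup.of_le (n := ω) le_top
  exact (h1.mul h3).prodMk h6

lemma eventually_mem_target (hm : m.2 ∈ φ.source) :
    ∀ᶠ v : V3 in 𝓝 0, φ m.2 + v.2 ∈ φ.target := by
  have h : Filter.Tendsto (fun v : V3 => φ m.2 + v.2) (𝓝 0) (𝓝 (φ m.2)) := by
    have h1 : Continuous fun v : V3 => φ m.2 + v.2 := continuous_const.add continuous_snd
    have := h1.tendsto 0
    beta_reduce at this
    rwa [Prod.snd_zero, add_zero] at this
  exact h.eventually (φ.open_target.mem_nhds (φ.map_source hm))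

/-- Only orientation needs an argument: between the chart `φ` and the preferred one the derivative
is the identity on the circle factor and multiplication by a nonzero complex number on the fibre, so
its determinant is positive. -/
lemma isFrame_chartGerm (hφ : φ ∈ IsManifold.maximalAtlas 𝓘(ℂ, ℂ) ω S) (hm : m.2 ∈ φ.source) :
    IsFrame (chartGerm φ m) := by
  have hs : ∀ᶠ v in 𝓝 (0 : V3), ContMDiffAt 𝓘(ℝ, V3) IM ∞ (chartGerm φ m) v := by
    filter_upwards [eventually_mem_target hm] with v hv
    have h := contMDiffAt_chartGerm (W := V3) (q := fun _ => m) (w := (0, v)) hφ contMDiffAt_const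
      hm hv
    exact ContMDiffAt.comp (g := fun w : V3 × V3 => chartGerm φ m w.2) v h
      (contDiff_const.prodMk contDiff_id).contMDiff.contMDiffAt
  refine ⟨hs, ?_⟩
  rw [chartGerm_zero hm]
  obtain ⟨c, hc⟩ := eventually_prodCoord_eq (ψ := chartAt ℂ m.2) (t := m.1) (t' := m.1) hm
    (div_self_mem_slitPlane _) (div_self_mem_slitPlane _)
  have hsrc := mem_source_transition hm (mem_chart_source ℂ m.2)
  have hT := analyticAt_transition hφ (IsManifold.chart_mem_maximalAtlas m.2) hsrc
  have hcont : Filter.Tendsto (chartGerm φ m) (𝓝 0) (𝓝 m) := by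
    have := hs.self_of_nhds.continuousAt
    rwa [ContinuousAt, chartGerm_zero hm] at this
  have e0 : prodCoord m.1 φ ∘ chartGerm φ m =ᶠ[𝓝 0] fun v => (0, φ m.2) + v := by
    have h1 : Filter.Tendsto (fun v : V3 => v.1) (𝓝 0) (𝓝 0) := continuous_fst.tendsto 0
    filter_upwards [eventually_mem_target hm,
      h1.eventually (eventually_arg_mul_exp (div_self_mem_slitPlane m.1))] with v hv hv'
    refine Prod.ext ?_ (φ.right_inv hv)
    change Complex.arg ((m.1 * Circle.exp v.1 / m.1 : Circle) : ℂ) = 0 + v.1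
    rw [mul_div_right_comm, hv']
    simp
  have e : coordAt m ∘ chartGerm φ m =ᶠ[𝓝 0]
      prodTransition c (fun z => chartAt ℂ m.2 (φ.symm z)) ∘ fun v => (0, φ m.2) + v := by
    filter_upwards [hcont.eventually hc, e0] with v hv hv'
    exact hv.trans (congrArg _ hv')
  have e1 : HasFDerivAt (fun v : V3 => ((0, φ m.2) : V3) + v) (ContinuousLinearMap.id ℝ V3) 0 :=
    (hasFDerivAt_id 0).const_add _
  have hT' : AnalyticAt ℂ (fun z => chartAt ℂ m.2 (φ.symm z)) (((0, φ m.2) : V3) + 0).2 := by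
    rwa [add_zero]
  have e2 := ((contDiffAt_prodTransition (c := c) hT').differentiableAt
    (by simp)).hasFDerivAt.comp (0 : V3) e1
  rw [e.fderiv_eq, e2.fderiv, ContinuousLinearMap.comp_id,
    det_eq_norm_sq (a := deriv (fun z => chartAt ℂ m.2 (φ.symm z)) (φ m.2))]
  · have h := deriv_transition_ne_zero hφ (IsManifold.chart_mem_maximalAtlas m.2) hsrc
    positivity
  · intro u
    rw [fderiv_prodTransition hT']
  · intro z
    rw [fderiv_prodTransition hT', add_zero]

lemma isHolomorphicGerm_chartGerm (hφ : φ ∈ IsManifold.maximalAtlas 𝓘(ℂ, ℂ) ω S)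
    (hm : m.2 ∈ φ.source) : IsHolomorphicGerm (chartGerm φ m) := by
  filter_upwards [eventually_mem_target hm] with v hv
  refine ⟨by rw [chartGerm_zero hm]; rfl, ?_⟩
  have h1 : MDifferentiableAt 𝓘(ℂ, ℂ) 𝓘(ℂ, ℂ) φ.symm (φ m.2 + v.2) :=
    ((contMDiffOn_symm_of_mem_maximalAtlas hφ).contMDiffAt
      (φ.open_target.mem_nhds hv)).mdifferentiableAt (by simp)
  have h2 : MDifferentiableAt 𝓘(ℂ, ℂ) 𝓘(ℂ, ℂ) (fun z : ℂ => φ m.2 + z) v.2 :=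
    (differentiableAt_id.const_add _).mdifferentiableAt
  exact MDifferentiableAt.comp (g := φ.symm) v.2 h1 h2

namespace HolJ2

/-- A holomorphic chart provides a local section of the bundle of holomorphic jets: the translation
germs at the points of its domain. Since it takes values in the smallest of the bundles, it also
serves for `J₂⁺` and `P₂`. -/
lemma isSubduction_base : IsSubduction (base : HolJ2 S → Mfd S) where
  dSmooth := dSmooth_base
  exists_lift {n} q x := by
    set φ := chartAt ℂ (q.1 x).2 with hφdef
    have hφ : φ ∈ IsManifold.maximalAtlas 𝓘(ℂ, ℂ) ω S := IsManifold.chart_mem_maximalAtlas _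
    have hq : ∀ y, ContMDiffAt 𝓘(ℝ, E n) IM ∞ q.1 y := q.2
    have hqc : Continuous q.1 := continuous_iff_continuousAt.mpr fun y => (hq y).continuousAt
    -- The section exists only over the chart domain, but the lift must be defined on all of `ℝⁿ`.
    -- The plot is therefore first reparametrised to stay in this domain.
    obtain ⟨f, hf, hfu, hfx⟩ := exists_smooth_into
      (φ.open_source.preimage (continuous_snd.comp hqc)) (x := x) (mem_chart_source ℂ (q.1 x).2)
    have hfu : ∀ y, (q.1 (f y)).2 ∈ φ.source := hfu
    have hqf : ∀ y, ContMDiffAt 𝓘(ℝ, E n) IM ∞ (fun y => q.1 (f y)) y := fun y =>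
      (hq (f y)).comp y hf.contMDiff.contMDiffAt
    have hfr := fun y => isFrame_chartGerm hφ (hfu y)
    have hol := fun y => isHolomorphicGerm_chartGerm hφ (hfu y)
    refine ⟨⟨fun y => ⟨J2.mk _ (hfr y), _, hfr y, hol y, rfl⟩, fun y => ?_⟩, ?_⟩
    · refine ⟨fun w => chartGerm φ (q.1 (f w.1)) w.2, ?_,
        Filter.Eventually.of_forall fun y => ⟨hfr y, rfl⟩⟩
      have hc : ContinuousAt (fun w : E n × V3 => φ (q.1 (f w.1)).2 + w.2.2) (y, 0) := by
        have h1 : ContinuousAt φ (q.1 (f y)).2 := φ.continuousAt (hfu y)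
        have h2 : Continuous fun w : E n × V3 => (q.1 (f w.1)).2 :=
          continuous_snd.comp (hqc.comp (hf.continuous.comp continuous_fst))
        exact (ContinuousAt.comp (g := φ) (f := fun w : E n × V3 => (q.1 (f w.1)).2) h1
          h2.continuousAt).add (continuous_snd.comp continuous_snd).continuousAt
      have ht := hc.eventually (φ.open_target.mem_nhds (by
        beta_reduce
        rw [Prod.snd_zero, add_zero]
        exact φ.map_source (hfu y)))
      filter_upwards [ht] with w hw
      exact contMDiffAt_chartGerm hφ (hqf w.1) (hfu w.1) hw
    · filter_upwards [hfx] with y hy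
      change q.1 y = chartGerm φ (q.1 (f y)) 0
      rw [chartGerm_zero (hfu y), hy]
      rfl

end HolJ2

lemma J2.isSubduction_base : IsSubduction (base : J2 S → Mfd S) :=
  .of_comp J2.dSmooth_base HolJ2.dSmooth_incl HolJ2.isSubduction_base

lemma P2.isSubduction_base : IsSubduction (base : P2 S → Mfd S) :=
  .of_comp P2.dSmooth_base P2.dSmooth_proj J2.isSubduction_base

end Sections

/-! ## The tautological form on holomorphic jets -/

/-- For `|f| = 1` the inverse is the conjugate, and `Re(f̄ df)` is half the differential of `|f|²`.
-/
lemma re_inv_mul_fderiv_eq_zero {W : Type*} [NormedAddCommGroup W] [NormedSpace ℝ W] {f : W → ℂ}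
    {x : W} (hf : DifferentiableAt ℝ f x) (h : ∀ᶠ y in 𝓝 x, ‖f y‖ = 1) (w : W) :
    ((f x)⁻¹ * fderiv ℝ f x w).re = 0 := by
  have h1 := (hf.hasFDerivAt.norm_sq).unique ((hasFDerivAt_const (1 : ℝ) x).congr_of_eventuallyEq
    (h.mono fun y hy => by
      beta_reduce
      rw [hy, one_pow]))
  have h2 := congrArg (fun T => T w) h1
  simp only [ContinuousLinearMap.comp_apply, smul_apply, zero_apply, innerSL_apply_apply,
    Complex.inner] at h2
  have h3 : (f x)⁻¹ = (starRingEnd ℂ) (f x) := by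
    rw [Complex.inv_def, Complex.normSq_eq_norm_sq, h.self_of_nhds]
    simp
  rw [h3]
  simp at h2 ⊢
  linarith

namespace HolJ2

variable {S : Type*} [TopologicalSpace S] [ChartedSpace ℂ S] [IsManifold 𝓘(ℂ, ℂ) ω S]
  {φ : OpenPartialHomeomorph S ℂ} {t : Circle} {n : ℕ} {p p' : Plot (HolJ2 S) n} {x : E n}

/-- The tautological form along a plot preserves the fibres, and is complex linear on them. -/
lemma tautCLM_hol (p : Plot (HolJ2 S) n) (x w : E n) :
    (∀ u, (J2.tautCLM (toJ2 p).1 x w u).1 = 0) ∧ ∀ z : ℂ,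
      (J2.tautCLM (toJ2 p).1 x w (0, z)).2 = z * (J2.tautCLM (toJ2 p).1 x w (0, 1)).2 := by
  have h := IsHolCoord.chartAt (base (p.1 x))
  set κ := prodCoord (base (p.1 x)).1 (chartAt ℂ (base (p.1 x)).2) with hκ
  set T := J2.tautCLM (toJ2 p).1 x w with hT
  set Y := J2.coordY κ (p.1 x).1 with hY
  have hi : Y.IsInvertible := J2.isInvertible_coordY (J := (p.1 x).1) h.isCoord
  have hhol := coord_hol h
  have hd : DifferentiableAt ℝ (fun y => J2.coordY κ (p.1 y).1) x :=
    (J2.contDiffAt_coordY (toJ2 p).2 h.isCoord).differentiableAt (by simp)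
  have d1 : ∀ u, (fderiv ℝ (fun y => J2.coordY κ (p.1 y).1) x w u).1 = 0 := by
    intro u
    have e1 : HasFDerivAt (fun y => (J2.coordY κ (p.1 y).1 u).1) ((ContinuousLinearMap.fst ℝ ℝ ℂ).comp
        ((fderiv ℝ (fun y => J2.coordY κ (p.1 y).1) x).flip u)) x := by
      have := hd.hasFDerivAt.clm_apply (hasFDerivAt_const (𝕜 := ℝ) u x)
      rw [ContinuousLinearMap.comp_zero, zero_add] at this
      exact HasFDerivAt.comp (g := fun v : V3 => v.1) x hasFDerivAt_fst this
    have e2 : (fun y => (J2.coordY κ (p.1 y).1 u).1) =ᶠ[𝓝 x] fun _ => u.1 := by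
      filter_upwards [eventually_isHolCoord h] with y hy
      exact (coord_hol hy).1 u
    exact congrArg (fun T => T w) (e1.unique ((hasFDerivAt_const u.1 _).congr_of_eventuallyEq e2))
  have d2 : ∀ z : ℂ, (fderiv ℝ (fun y => J2.coordY κ (p.1 y).1) x w (0, z)).2 =
      z * (fderiv ℝ (fun y => J2.coordY κ (p.1 y).1) x w (0, 1)).2 := by
    have e1 : ∀ u, HasFDerivAt (fun y => (J2.coordY κ (p.1 y).1 u).2)
        ((ContinuousLinearMap.snd ℝ ℝ ℂ).comp
        ((fderiv ℝ (fun y => J2.coordY κ (p.1 y).1) x).flip u)) x := by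
      intro u
      have := hd.hasFDerivAt.clm_apply (hasFDerivAt_const (𝕜 := ℝ) u x)
      rw [ContinuousLinearMap.comp_zero, zero_add] at this
      exact HasFDerivAt.comp (g := fun v : V3 => v.2) x hasFDerivAt_snd this
    intro z
    have e2 : (fun y => (J2.coordY κ (p.1 y).1 (0, z)).2) =ᶠ[𝓝 x]
        fun y => z * (J2.coordY κ (p.1 y).1 (0, 1)).2 := by
      filter_upwards [eventually_isHolCoord h] with y hy
      exact (coord_hol hy).2.1 z
    exact congrArg (fun T => T w)
      ((e1 (0, z)).unique (((e1 (0, 1)).const_mul z).congr_of_eventuallyEq e2))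
  obtain ⟨e, he⟩ := exists_eq_fderiv (X := fun y => κ (J2.base (p.1 y).1))
    (Y := fun y => J2.coordY κ (p.1 y).1) hi w
  -- In `y θ = dy - y₂(e, ·)` both terms on the right have vanishing `t`-component and are complex
  -- linear on the fibre, and `y` is injective of the same type, so `θ` inherits both properties.
  have key : Y.comp T = fderiv ℝ (fun y => J2.coordY κ (p.1 y).1) x w - J2.coordYY κ (p.1 x).1 e := by
    rw [hT, J2.tautCLM_eq (toJ2 p).2 h.isCoord]
    exact comp_tautForm (Y := fun y => J2.coordY κ (p.1 y).1) hi he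
  have k1 : ∀ u, (T u).1 = 0 := by
    intro u
    have h1 := congrArg (fun A => (A u).1) key
    simp only [ContinuousLinearMap.comp_apply, sub_apply, Prod.fst_sub, d1] at h1
    rw [hY, hhol.1, hκ, hhol.2.2.1, sub_zero] at h1
    exact h1
  refine ⟨k1, fun z => ?_⟩
  have k2 : ∀ z : ℂ, (T (0, z)).2 * coordYzz (chartAt ℂ (base (p.1 x)).2) (p.1 x) =
      (fderiv ℝ (fun y => J2.coordY κ (p.1 y).1) x w (0, z)).2 -
        (J2.coordYY κ (p.1 x).1 e (0, z)).2 := by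
    intro z
    have h1 := congrArg (fun A => (A (0, z)).2) key
    have h2 : T (0, z) = (0, (T (0, z)).2) := Prod.ext (k1 _) rfl
    simp only [ContinuousLinearMap.comp_apply, sub_apply, Prod.snd_sub] at h1
    rw [← h1, h2, hY, coordY_inr h]
  refine mul_right_cancel₀ (coordYzz_ne_zero h) ?_
  rw [mul_assoc, k2, k2, d2, hhol.2.2.2]
  ring

/-- The pullback of `θ¹₁` to the bundle of holomorphic jets. -/
def tautRe : DForm (HolJ2 S) 1 := DForm.pullback incl dSmooth_incl (J2.taut 1 1)

/-- The pullback of `θ²₁` to the bundle of holomorphic jets. -/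
def tautIm : DForm (HolJ2 S) 1 := DForm.pullback incl dSmooth_incl (J2.taut 2 1)

/-- The complex form `θᶻ_z`. -/
def holTaut : DForm (HolJ2 S) 1 := tautRe + Complex.I • tautIm

lemma tautRe_val (p : Plot (HolJ2 S) n) (x w : E n) :
    tautRe.val p x ![w] = ((J2.tautCLM (toJ2 p).1 x w (0, 1)).2.re : ℂ) := entry_apply 1 1 _

lemma tautIm_val (p : Plot (HolJ2 S) n) (x w : E n) :
    tautIm.val p x ![w] = ((J2.tautCLM (toJ2 p).1 x w (0, 1)).2.im : ℂ) := entry_apply 2 1 _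

lemma holTaut_val (p : Plot (HolJ2 S) n) (x w : E n) :
    holTaut.val p x ![w] = (J2.tautCLM (toJ2 p).1 x w (0, 1)).2 := by
  change tautRe.val p x ![w] + Complex.I * tautIm.val p x ![w] = _
  rw [tautRe_val, tautIm_val, mul_comm, Complex.re_add_im]

lemma pullback_taut_zero (j : Fin 3) :
    DForm.pullback incl dSmooth_incl (J2.taut (S := S) 0 j) = 0 :=
  DForm.ext_one fun n p x w => by
    change entry 0 j (J2.tautCLM (toJ2 p).1 x w) = 0
    rw [entry_apply]
    exact congrArg _ ((tautCLM_hol p x w).1 _)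

lemma pullback_taut_one_two :
    DForm.pullback incl dSmooth_incl (J2.taut (S := S) 1 2) = -tautIm :=
  DForm.ext_one fun n p x w => by
    change entry 1 2 (J2.tautCLM (toJ2 p).1 x w) = -tautIm.val p x ![w]
    rw [entry_apply, tautIm_val, ← Complex.ofReal_neg]
    change (((J2.tautCLM (toJ2 p).1 x w (0, Complex.I)).2.re : ℝ) : ℂ) = _
    rw [(tautCLM_hol p x w).2, Complex.I_mul_re]

lemma pullback_taut_two_two :
    DForm.pullback incl dSmooth_incl (J2.taut (S := S) 2 2) = tautRe :=
  DForm.ext_one fun n p x w => by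
    change entry 2 2 (J2.tautCLM (toJ2 p).1 x w) = tautRe.val p x ![w]
    rw [entry_apply, tautRe_val]
    change (((J2.tautCLM (toJ2 p).1 x w (0, Complex.I)).2.im : ℝ) : ℂ) = _
    rw [(tautCLM_hol p x w).2, Complex.I_mul_im]

/-- The rows of `θ` are `(0, 0, 0)`, `(*, a, -b)` and `(*, b, a)`. The lower block is a complex
number, so `θ ∧ θ` contributes nothing to it and the curvature block is `da, -db, db, da`. The
entries `R^1_0` and `R^2_0` only meet the zero row. Thus `½((2 da)² - 2 da² + 2 db²) = da² + db²`.
-/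
lemma pullback_pontrjagin :
    DForm.pullback incl dSmooth_incl (J2.pontrjagin (S := S) J2.taut) =
      DForm.wedge rfl (DForm.d tautRe) (DForm.d tautRe) +
        DForm.wedge rfl (DForm.d tautIm) (DForm.d tautIm) := by
  have hz : ∀ {a b c : ℕ} (h : a + b = c) (β : DForm (HolJ2 S) b),
      DForm.wedge h (0 : DForm (HolJ2 S) a) β = 0 := fun h β => by
    have := DForm.smul_wedge h 0 (0 : DForm (HolJ2 S) _) β
    rwa [zero_smul, zero_smul] at this
  have hz' : ∀ {a b c : ℕ} (h : a + b = c) (β : DForm (HolJ2 S) a),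
      DForm.wedge h β (0 : DForm (HolJ2 S) b) = 0 := fun h β => by
    have := DForm.wedge_smul h 0 β (0 : DForm (HolJ2 S) _)
    rwa [zero_smul, zero_smul] at this
  have hc : ∀ i j, DForm.pullback incl dSmooth_incl (J2.curvature (S := S) J2.taut i j) =
      DForm.d (DForm.pullback incl dSmooth_incl (J2.taut i j)) +
        ∑ k, DForm.wedge rfl (DForm.pullback incl dSmooth_incl (J2.taut i k))
          (DForm.pullback incl dSmooth_incl (J2.taut k j)) := by
    intro i j
    rw [J2.curvature, map_add, map_sum]
    rfl
  have ha : DForm.pullback incl dSmooth_incl (J2.taut (S := S) 1 1) = tautRe := rfl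
  have hb : DForm.pullback incl dSmooth_incl (J2.taut (S := S) 2 1) = tautIm := rfl
  have c0 : ∀ j, DForm.pullback incl dSmooth_incl (J2.curvature (S := S) J2.taut 0 j) = 0 := by
    intro j
    rw [hc]
    simp only [pullback_taut_zero, hz, map_zero, Finset.sum_const_zero, add_zero]
  have c11 : DForm.pullback incl dSmooth_incl (J2.curvature (S := S) J2.taut 1 1) = DForm.d tautRe := by
    rw [hc, Fin.sum_univ_three]
    rw [pullback_taut_zero, hz', pullback_taut_one_two, ha, hb, DForm.wedge_self_one,
      DForm.neg_wedge, DForm.wedge_self_one]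
    simp
  have c21 : DForm.pullback incl dSmooth_incl (J2.curvature (S := S) J2.taut 2 1) = DForm.d tautIm := by
    rw [hc, Fin.sum_univ_three]
    rw [pullback_taut_zero, hz', pullback_taut_two_two, ha, hb, DForm.wedge_comm_one tautRe tautIm]
    simp
  have c12 : DForm.pullback incl dSmooth_incl (J2.curvature (S := S) J2.taut 1 2) = -DForm.d tautIm := by
    rw [hc, Fin.sum_univ_three]
    rw [pullback_taut_zero, hz', pullback_taut_two_two, pullback_taut_one_two, ha,
      DForm.neg_wedge, DForm.wedge_neg, DForm.wedge_comm_one tautRe tautIm, map_neg]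
    simp
  have c22 : DForm.pullback incl dSmooth_incl (J2.curvature (S := S) J2.taut 2 2) = DForm.d tautRe := by
    rw [hc, Fin.sum_univ_three]
    rw [pullback_taut_zero, hz', pullback_taut_two_two, pullback_taut_one_two, hb,
      DForm.wedge_neg, DForm.wedge_self_one, DForm.wedge_self_one]
    simp
  have hp : ∀ (k : ℂ) (α : DForm (J2 S) 4), DForm.pullback incl dSmooth_incl (k • α) =
      k • DForm.pullback incl dSmooth_incl α := fun _ _ => rfl
  have hw : ∀ α β : DForm (J2 S) 2, DForm.pullback incl dSmooth_incl (DForm.wedge (c := 4) rfl α β) =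
      DForm.wedge rfl (DForm.pullback incl dSmooth_incl α) (DForm.pullback incl dSmooth_incl β) :=
    fun _ _ => rfl
  rw [J2.pontrjagin, hp, map_sub, hw]
  simp only [map_add, hw, Fin.sum_univ_three, c0, c11, c12, c21, c22, hz, hz']
  simp only [zero_add, add_zero, DForm.add_wedge, DForm.wedge_add, DForm.neg_wedge,
    DForm.wedge_neg]
  have e : ∀ u v : DForm (HolJ2 S) 4, (1 / 2 : ℂ) • (u + u + (u + u) - (u + -v + (-v + u))) = u + v := by
    intro u v
    have : u + u + (u + u) - (u + -v + (-v + u)) = (2 : ℂ) • (u + v) := by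
      rw [two_smul ℂ (u + v)]
      abel
    rw [this, smul_smul]
    norm_num
  exact e _ _

/-- Holomorphic jets that agree up to rotation differ on the fibre by multiplication by a number
`f`, the quotient of their coordinates `yᶻ_z`. It has modulus one, since a rotation preserves
lengths, and both `θᶻ_z` and `ω` change by the same `f⁻¹ df`. -/
lemma proj_gauge (h : P2.proj ∘ (toJ2 p).1 =ᶠ[𝓝 x] P2.proj ∘ (toJ2 p').1) :
    base ∘ p.1 =ᶠ[𝓝 x] base ∘ p'.1 ∧ ∃ f : E n → ℂ, ContDiffAt ℝ ∞ f x ∧ (∀ᶠ y in 𝓝 x, ‖f y‖ = 1) ∧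
      (∀ᶠ y in 𝓝 x, ∀ w, holTaut.val p y ![w] - holTaut.val p' y ![w] =
        (f y)⁻¹ * fderiv ℝ f y w) ∧
      ∀ ρ : KahlerMetric S, ∀ᶠ y in 𝓝 x, ∀ w, (conn ρ).val p y ![w] - (conn ρ).val p' y ![w] =
        (f y)⁻¹ * fderiv ℝ f y w := by
  have hb : base ∘ p.1 =ᶠ[𝓝 x] base ∘ p'.1 := h.mono fun y hy => congrArg P2.base hy
  refine ⟨hb, ?_⟩
  have hb' : base (p.1 x) = base (p'.1 x) := hb.self_of_nhds
  obtain ⟨A, hA, -, hg, hrot⟩ := P2.exists_gauge h.symm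
  have h1 : IsHolCoord (base (p'.1 x)).1 (chartAt ℂ (base (p'.1 x)).2) (base (p'.1 x)) := .chartAt _
  have h2 : IsHolCoord (base (p'.1 x)).1 (chartAt ℂ (base (p'.1 x)).2) (base (p.1 x)) := by
    rw [hb']
    exact h1
  have hg2 := hg.tautCLM (toJ2 p').2 (toJ2 p).2 hA
  set φ := chartAt ℂ (base (p'.1 x)).2 with hφ
  set f : E n → ℂ := fun y => coordYzz φ (p.1 y) / coordYzz φ (p'.1 y) with hf
  -- The rotation is identified with multiplication by `f` by applying the injective map `y'` to
  -- both sides.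
  have hAf : ∀ᶠ y in 𝓝 x, ∀ z : ℂ, A y (0, z) = (0, z * f y) := by
    filter_upwards [hg, eventually_isHolCoord h1, eventually_isHolCoord h2] with y hy a1 a2 z
    have e1 := congrArg (fun T => T (0, z)) hy.2.1
    have e2 := coordY_inr a2 z
    have e3 := coordY_inr a1 (z * f y)
    have e4 : z * f y * coordYzz φ (p'.1 y) = z * coordYzz φ (p.1 y) := by
      rw [hf, mul_assoc, div_mul_cancel₀ _ (coordYzz_ne_zero a1)]
    rw [e4, ← e2] at e3
    exact (J2.isInvertible_coordY (J := (p'.1 y).1) a1.isCoord).injective (e1.symm.trans e3.symm)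
  have hn : ∀ᶠ y in 𝓝 x, ‖f y‖ = 1 := by
    filter_upwards [hAf, hrot] with y hy hy'
    have := hy'.1 (0, 1)
    rw [hy 1] at this
    have h3 : ‖f y‖ ^ 2 = 1 ^ 2 := by simpa using this
    exact (sq_eq_sq₀ (norm_nonneg _) zero_le_one).mp h3
  refine ⟨f, contDiffAt_coordYzz_div h2 h1, hn, ?_, fun ρ => conn_val_sub ρ h2 hb⟩
  · filter_upwards [hAf.eventually_nhds, hg2, ContDiffAt.eventually_differentiableAt hA, hn] with y
      hy hy' hd hny w
    have e1 := congrArg (fun T => (T (0, 1)).2) (hy' w)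
    simp only [ContinuousLinearMap.comp_apply, add_apply, Prod.snd_add] at e1
    have hy0 := hy.self_of_nhds
    have e2 : J2.tautCLM (toJ2 p).1 y w (0, 1) = (0, holTaut.val p y ![w]) :=
      Prod.ext ((tautCLM_hol p y w).1 _) (holTaut_val p y w).symm
    have e3 : (fderiv ℝ A y w (0, 1)).2 = fderiv ℝ f y w := by
      have d1 : HasFDerivAt (fun y => (A y (0, 1)).2) ((ContinuousLinearMap.snd ℝ ℝ ℂ).comp
          ((fderiv ℝ A y).flip (0, 1))) y := by
        have := hd.hasFDerivAt.clm_apply (hasFDerivAt_const (𝕜 := ℝ) ((0, 1) : V3) y)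
        rw [ContinuousLinearMap.comp_zero, zero_add] at this
        exact HasFDerivAt.comp (g := fun v : V3 => v.2) y hasFDerivAt_snd this
      have e : f =ᶠ[𝓝 y] fun y => (A y (0, 1)).2 := hy.mono fun z hz => by
        beta_reduce
        rw [hz 1, one_mul]
      rw [e.fderiv_eq, d1.fderiv]
      rfl
    rw [e2, hy0, hy0, one_mul, (tautCLM_hol p' y w).2, ← holTaut_val, e3] at e1
    have hfy : f y ≠ 0 := by
      intro h0
      rw [h0, norm_zero] at hny
      exact zero_ne_one hny
    field_simp
    linear_combination e1

/-- Under a change `f⁻¹ df` with `|f| = 1`: the real part of `θᶻ_z` is unchanged because `f⁻¹ df` is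
imaginary, `dθᶻ_z` because it is closed, and `ω - θᶻ_z` because both terms change equally. -/
lemma proj_comp_eventuallyEq (h : P2.proj ∘ (toJ2 p).1 =ᶠ[𝓝 x] P2.proj ∘ (toJ2 p').1) :
    tautRe.val p x = tautRe.val p' x ∧ (DForm.d holTaut).val p x = (DForm.d holTaut).val p' x ∧
      ∀ ρ : KahlerMetric S, (conn ρ - holTaut).val p x = (conn ρ - holTaut).val p' x := by
  obtain ⟨-, f, hf, hn, h1, h2⟩ := proj_gauge h
  have hfx : f x ≠ 0 := fun h0 => by
    have := hn.self_of_nhds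
    rw [h0, norm_zero] at this
    exact zero_ne_one this
  have e : ∀ v : Fin 1 → E n, v = ![v 0] := fun v => by
    ext i : 1
    fin_cases i
    rfl
  refine ⟨?_, DForm.d_val_eq_of_sub hf hfx h1, fun ρ => ?_⟩
  · ext v
    have h3 := congrArg Complex.re (h1.self_of_nhds (v 0))
    rw [re_inv_mul_fderiv_eq_zero (hf.differentiableAt (by simp)) hn, Complex.sub_re, sub_eq_zero,
      holTaut_val, holTaut_val] at h3
    rw [e v, tautRe_val, tautRe_val, h3]
  · ext v
    rw [e v]
    change (conn ρ).val p x ![v 0] - holTaut.val p x ![v 0] =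
      (conn ρ).val p' x ![v 0] - holTaut.val p' x ![v 0]
    linear_combination (h2 ρ).self_of_nhds (v 0) - h1.self_of_nhds (v 0)

end HolJ2

/-! ## Holomorphic jets up to rotation -/

section Quotient

variable (S : Type*) [TopologicalSpace S] [ChartedSpace ℂ S]

/-- The image in `P₂` of the bundle of holomorphic jets. -/
def HolP2 : Type _ := {P : P2 S // ∃ J : HolJ2 S, P2.proj J.1 = P}

variable {S}

namespace HolP2

/-- The quotient map. -/
def proj (J : HolJ2 S) : HolP2 S := ⟨P2.proj J.1, J, rfl⟩

/-- The plots are the maps that lift locally to plots of the bundle of holomorphic jets. -/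
instance : DiffeologicalSpace (HolP2 S) :=
  diffeologyOfGerms
    (fun {n} p x => ∃ P : Plot (HolJ2 S) n, p =ᶠ[𝓝 x] proj ∘ P.1)
    (fun h ⟨P, hP⟩ => ⟨P, h.symm.trans hP⟩)
    (by
      rintro n ⟨_, J, rfl⟩ x
      exact ⟨⟨fun _ => J, isPlot_const⟩, Filter.Eventually.of_forall fun _ => rfl⟩)
    (fun x hf ⟨P, hP⟩ => ⟨P.comp _ hf, (hf.continuous.tendsto x).eventually hP⟩)

lemma isSubduction_proj : IsSubduction (proj : HolJ2 S → HolP2 S) where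
  dSmooth := fun _ p hp _ => ⟨⟨p, hp⟩, Filter.Eventually.of_forall fun _ => rfl⟩
  exists_lift q x := q.2 x

/-- The inclusion in `P₂`. -/
def incl : HolP2 S → P2 S := Subtype.val

lemma dSmooth_incl : DSmooth (incl : HolP2 S → P2 S) := by
  intro n p hp x
  obtain ⟨P, hP⟩ := hp x
  exact ⟨HolJ2.toJ2 P, hP.mono fun y hy => congrArg incl hy⟩

/-- The projection to `M`. -/
def base : HolP2 S → Mfd S := P2.base ∘ incl

lemma dSmooth_base : DSmooth (base : HolP2 S → Mfd S) := P2.dSmooth_base.comp dSmooth_incl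

lemma isSubduction_base [IsManifold 𝓘(ℂ, ℂ) ω S] : IsSubduction (base : HolP2 S → Mfd S) :=
  .of_comp dSmooth_base isSubduction_proj.dSmooth HolJ2.isSubduction_base

section Action

variable {Γ : Type*} [Group Γ] [MulAction Γ (Mfd S)] [IsConformalLoopAction Γ S]

instance : MulAction Γ (HolP2 S) where
  smul g P := ⟨g • P.1, by
    obtain ⟨J, hJ⟩ := P.2
    exact ⟨g • J, by rw [← hJ]; rfl⟩⟩
  one_smul P := Subtype.ext (one_smul Γ P.1)
  mul_smul g g' P := Subtype.ext (mul_smul g g' P.1)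

lemma proj_smul (g : Γ) (J : HolJ2 S) : proj (g • J) = g • proj J := rfl

lemma incl_smul (g : Γ) (P : HolP2 S) : incl (g • P) = g • incl P := rfl

lemma base_smul (g : Γ) (P : HolP2 S) : base (g • P) = g • base P := P2.base_smul g P.1

instance : SmoothAction Γ (HolP2 S) where
  dSmooth_smul g n p hp x := by
    obtain ⟨P, hP⟩ := hp x
    refine ⟨P.map _ (SmoothAction.dSmooth_smul g), ?_⟩
    filter_upwards [hP] with y hy
    exact congrArg (g • ·) hy

end Action

end HolP2

end Quotient

/-! ## The equivariant curvature -/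

section Curvature

variable {S : Type*} [TopologicalSpace S] [ChartedSpace ℂ S] [IsManifold 𝓘(ℂ, ℂ) ω S]
  {Γ : Type*} [Group Γ] [MulAction Γ (Mfd S)] [IsConformalLoopAction Γ S]

lemma TotCochain.ofForm_add {X : Type*} [DiffeologicalSpace X] [MulAction Γ X] [SmoothAction Γ X]
    {m : ℕ} (α β : DForm X m) :
    (TotCochain.ofForm (α + β) : TotCochain Γ X) = TotCochain.ofForm α + TotCochain.ofForm β := by
  rw [ofForm_eq_single, ofForm_eq_single, ofForm_eq_single, ← map_add]
  exact congrArg _ (Subtype.ext (funext fun s => map_add _ _ _))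

lemma TotCochain.ofForm_mem_degree {X : Type*} [DiffeologicalSpace X] [MulAction Γ X]
    [SmoothAction Γ X] {m : ℕ} (α : DForm X m) :
    (TotCochain.ofForm α : TotCochain Γ X) ∈ TotCochain.degree Γ X m :=
  TotCochain.single_mem_degree (zero_add m) _

/-- The equivariant curvature is the pullback of a closed cochain of degree two on `M`. -/
lemma exists_equivariant_curvature (ρ : KahlerMetric S) : ∃ Ω : TotCochain Γ (Mfd S),
    TotCochain.pullback HolJ2.base HolJ2.dSmooth_base HolJ2.base_smul Ω =
      TotCochain.D (TotCochain.ofForm (HolJ2.conn ρ)) ∧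
    Ω ∈ TotCochain.degree Γ (Mfd S) 2 ∧ TotCochain.D Ω = 0 := by
  obtain ⟨Ω, hΩ⟩ := TotCochain.exists_pullback_eq (Γ := Γ) HolJ2.isSubduction_base
    HolJ2.base_smul (HolJ2.descends_D_conn ρ)
  refine ⟨Ω, hΩ, fun n m h => ?_, ?_⟩
  · refine Cochain.pullback_injective HolJ2.isSubduction_base HolJ2.base_smul ?_
    have h1 := congrFun (congrFun hΩ n) m
    rw [TotCochain.D_mem_degree (TotCochain.ofForm_mem_degree _) n m h] at h1
    rw [map_zero]
    exact h1
  · refine TotCochain.pullback_injective HolJ2.isSubduction_base HolJ2.base_smul ?_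
    rw [← TotCochain.D_pullback, hΩ, TotCochain.D_D, map_zero]

lemma TotCochain.mul_self_mem_cocycles {X : Type*} [DiffeologicalSpace X] [MulAction Γ X]
    [SmoothAction Γ X] {k : ℕ} {u : TotCochain Γ X} (hu : u ∈ TotCochain.degree Γ X k)
    (hu' : TotCochain.D u = 0) : TotCochain.mul u u ∈ TotCochain.cocycles Γ X (k + k) := by
  refine ⟨TotCochain.mul_mem_degree hu hu, ?_⟩
  change TotCochain.D _ = 0
  rw [TotCochain.D_mul hu hu, hu', TotCochain.zero_mul, TotCochain.mul_zero, smul_zero, add_zero]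

lemma TotCochain.exists_mul_self_add_D {X : Type*} [DiffeologicalSpace X] [MulAction Γ X]
    [SmoothAction Γ X] {r b : TotCochain Γ X} (hr : r ∈ TotCochain.degree Γ X 2)
    (hr' : TotCochain.D r = 0) (hb : b ∈ TotCochain.degree Γ X 1) : ∃ x,
      TotCochain.mul (r + TotCochain.D b) (r + TotCochain.D b) =
        TotCochain.mul r r + TotCochain.D x := by
  have hDb : TotCochain.D b ∈ TotCochain.degree Γ X 2 := TotCochain.D_mem_degree hb
  refine ⟨TotCochain.mul r b + TotCochain.mul b r + TotCochain.mul b (TotCochain.D b), ?_⟩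
  rw [map_add, map_add, TotCochain.D_mul hr hb, TotCochain.D_mul hb hr, TotCochain.D_mul hb hDb,
    hr', TotCochain.D_D, TotCochain.zero_mul, TotCochain.mul_zero, TotCochain.add_mul, TotCochain.mul_add, TotCochain.mul_add]
  simp only [smul_zero, add_zero, zero_add, even_two, Even.neg_pow, one_pow, one_smul]
  abel

namespace HolP2

lemma descends_proj {m : ℕ} {α : DForm (HolJ2 S) m}
    (h : ∀ {n : ℕ} (p p' : Plot (HolJ2 S) n) (x : E n),
      P2.proj ∘ (HolJ2.toJ2 p).1 =ᶠ[𝓝 x] P2.proj ∘ (HolJ2.toJ2 p').1 → α.val p x = α.val p' x) :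
    α.Descends (proj : HolJ2 S → HolP2 S) :=
  fun p p' x hp => h p p' x (hp.mono fun _ hy => congrArg incl hy)

lemma translate_holTaut (g : Γ) :
    translate Γ g (HolJ2.tautRe (S := S)) = HolJ2.tautRe ∧
      translate Γ g (HolJ2.holTaut (S := S)) = HolJ2.holTaut := by
  have h : ∀ i j, translate Γ g (DForm.pullback HolJ2.incl HolJ2.dSmooth_incl
      (J2.taut (S := S) i j)) = DForm.pullback HolJ2.incl HolJ2.dSmooth_incl (J2.taut i j) := by
    intro i j
    rw [← pullback_translate HolJ2.dSmooth_incl (fun _ _ => rfl), J2.translate_taut]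
  have h1 : translate Γ g (HolJ2.tautRe (S := S)) = HolJ2.tautRe := h 1 1
  have h2 : translate Γ g (HolJ2.tautIm (S := S)) = HolJ2.tautIm := h 2 1
  refine ⟨h1, ?_⟩
  have h3 : translate Γ g (Complex.I • HolJ2.tautIm (S := S)) =
      Complex.I • translate Γ g HolJ2.tautIm := rfl
  rw [HolJ2.holTaut, map_add, h1, h3, h2]

/-- On the bundle of holomorphic jets up to rotation, the square of the equivariant curvature
represents the first Pontrjagin class, with the opposite sign. -/
lemma exists_D_eq (ρ : KahlerMetric S) {Ω : TotCochain Γ (Mfd S)}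
    (hΩ : TotCochain.pullback HolJ2.base HolJ2.dSmooth_base HolJ2.base_smul Ω =
      TotCochain.D (TotCochain.ofForm (HolJ2.conn ρ)))
    {p₁ : DForm (P2 S) 4}
    (hp : DForm.pullback P2.proj P2.dSmooth_proj p₁ = J2.pontrjagin J2.taut) : ∃ x,
      TotCochain.D x = TotCochain.pullback base dSmooth_base base_smul (-(TotCochain.mul Ω Ω)) -
        TotCochain.pullback incl dSmooth_incl incl_smul (TotCochain.ofForm p₁) := by
  have hs := isSubduction_proj (S := S)
  -- The invariants that live on the quotient are `a = Re θᶻ_z`, `R = dθᶻ_z` and `β = ω - θᶻ_z`; the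
  -- form `θᶻ_z` itself changes by an imaginary logarithmic derivative under rotations.
  obtain ⟨a, ha⟩ := hs.exists_pullback_eq (descends_proj (α := HolJ2.tautRe) fun p p' x h =>
    (HolJ2.proj_comp_eventuallyEq h).1)
  obtain ⟨(R : DForm (HolP2 S) 2), hR⟩ := hs.exists_pullback_eq (descends_proj (α := DForm.d HolJ2.holTaut)
    fun p p' x h => (HolJ2.proj_comp_eventuallyEq h).2.1)
  obtain ⟨β, hβ⟩ := hs.exists_pullback_eq (descends_proj (α := HolJ2.conn ρ - HolJ2.holTaut)
    fun p p' x h => (HolJ2.proj_comp_eventuallyEq h).2.2 ρ)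
  have hdR : DForm.d R = 0 := hs.pullback_injective (by
    rw [DForm.pullback_d, hR, DForm.d_d, map_zero])
  -- Invariance under `Γ` ensures that the transgression form built from `a` and `R` has no `δ`
  -- part, so that its total differential is its exterior derivative.
  have hta : ∀ g : Γ, translate Γ g a = a := fun g => hs.pullback_injective (by
    rw [pullback_translate hs.dSmooth proj_smul, ha, (translate_holTaut g).1])
  have htR : ∀ g : Γ, translate Γ g R = R := fun g => hs.pullback_injective (by
    rw [pullback_translate hs.dSmooth proj_smul, hR]
    conv_rhs => rw [← (translate_holTaut g).2]
    rfl)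
  -- Since `R = da + i db`, the form `da² + db²` differs from `-R²` by `R da + da R`, which is exact
  -- because `dR = 0`.
  have hp' : DForm.pullback incl dSmooth_incl p₁ = -DForm.wedge rfl R R +
      DForm.d (DForm.wedge (c := 3) rfl R a + DForm.wedge (c := 3) rfl a R) := by
    refine hs.pullback_injective ?_
    have h1 : DForm.pullback proj hs.dSmooth (DForm.pullback incl dSmooth_incl p₁) =
        DForm.pullback HolJ2.incl HolJ2.dSmooth_incl (J2.pontrjagin J2.taut) := by
      rw [← hp]
      rfl
    rw [h1, HolJ2.pullback_pontrjagin, map_add, map_neg, DForm.pullback_wedge, hR,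
      map_add DForm.d,
      DForm.d_wedge (a := 2) (b := 1) (c := 3) rfl rfl rfl,
      DForm.d_wedge (a := 1) (b := 2) (c := 3) rfl rfl rfl, hdR]
    have hz : DForm.wedge (c := 4) rfl (0 : DForm (HolP2 S) 3) a = 0 := by
      have := DForm.smul_wedge (c := 4) rfl 0 (0 : DForm (HolP2 S) 3) a
      rwa [zero_smul, zero_smul] at this
    have hz' : DForm.wedge (c := 4) rfl a (0 : DForm (HolP2 S) 3) = 0 := by
      have := DForm.wedge_smul (c := 4) rfl 0 a (0 : DForm (HolP2 S) 3)
      rwa [zero_smul, zero_smul] at this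
    rw [hz, hz', smul_zero, zero_add, add_zero, even_two.neg_one_pow, one_smul, map_add,
      DForm.pullback_wedge, DForm.pullback_wedge, hR, DForm.pullback_d, ha, HolJ2.holTaut, map_add,
      DForm.d_smul]
    simp only [DForm.add_wedge, DForm.wedge_add, DForm.smul_wedge, DForm.wedge_smul]
    have e : ∀ A B C F : DForm (HolJ2 S) 4, A + F = -(A + Complex.I • C +
        Complex.I • (B + Complex.I • F)) + (A + Complex.I • C + (A + Complex.I • B)) := by
      intro A B C F
      rw [smul_add Complex.I B, smul_smul, Complex.I_mul_I, neg_one_smul ℂ F]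
      abel
    exact e _ _ _ _
  -- Upstairs this reads `Dω = D(θᶻ_z) + D(ω - θᶻ_z)`, where `D θᶻ_z = dθᶻ_z` by invariance.
  have hΩ' : TotCochain.pullback base dSmooth_base base_smul Ω =
      TotCochain.ofForm R + TotCochain.D (TotCochain.ofForm β) := by
    refine TotCochain.pullback_injective hs proj_smul ?_
    have h1 : TotCochain.pullback proj hs.dSmooth proj_smul
        (TotCochain.pullback base dSmooth_base base_smul Ω) =
          TotCochain.D (TotCochain.ofForm (HolJ2.conn ρ)) := by
      rw [← hΩ]
      rfl
    rw [h1, map_add, ← TotCochain.D_pullback, TotCochain.pullback_ofForm,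
      TotCochain.pullback_ofForm, hR, hβ, ← TotCochain.D_ofForm fun g => (translate_holTaut g).2,
      ← map_add, ← TotCochain.ofForm_add, add_sub_cancel]
  have hDR : TotCochain.D (TotCochain.ofForm R : TotCochain Γ (HolP2 S)) = 0 := by
    rw [TotCochain.D_ofForm htR, hdR, TotCochain.ofForm_eq_single]
    have : (Cochain.ofForm (0 : DForm (HolP2 S) 3) : Cochain Γ (HolP2 S) 0 3) = 0 :=
      Subtype.ext (funext fun s => map_zero _)
    rw [this, map_zero]
  obtain ⟨x, hx⟩ := TotCochain.exists_mul_self_add_D (TotCochain.ofForm_mem_degree R) hDR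
    (TotCochain.ofForm_mem_degree β)
  -- Here `Ω² = R² + Dx` and `p₁ = -R² + dγ` after pullback, so `-Ω² - p₁ = D(-x - γ)`.
  refine ⟨-x - TotCochain.ofForm (DForm.wedge (c := 3) rfl R a + DForm.wedge (c := 3) rfl a R), ?_⟩
  have hγ : ∀ g : Γ, translate Γ g (DForm.wedge (c := 3) rfl R a + DForm.wedge (c := 3) rfl a R) =
      DForm.wedge (c := 3) rfl R a + DForm.wedge (c := 3) rfl a R := by
    intro g
    have h1 : translate Γ g (DForm.wedge (c := 3) rfl R a) =
      DForm.wedge (c := 3) rfl (translate Γ g R) (translate Γ g a) := rfl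
    have h2 : translate Γ g (DForm.wedge (c := 3) rfl a R) =
      DForm.wedge (c := 3) rfl (translate Γ g a) (translate Γ g R) := rfl
    rw [map_add, h1, h2, hta, htR]
  have hDγ := TotCochain.D_ofForm (Γ := Γ) hγ
  generalize DForm.wedge (c := 3) rfl R a + DForm.wedge (c := 3) rfl a R = γ at hp' hDγ ⊢
  rw [map_neg (TotCochain.pullback _ _ _), TotCochain.pullback_mul, hΩ', hx,
    TotCochain.mul_ofForm_ofForm (c := 4) rfl,
    TotCochain.pullback_ofForm, hp', TotCochain.ofForm_add, map_sub, map_neg,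
    hDγ]
  have hn : (TotCochain.ofForm (-DForm.wedge (c := 4) rfl R R) : TotCochain Γ (HolP2 S)) =
      -TotCochain.ofForm (DForm.wedge (c := 4) rfl R R) := by
    rw [eq_neg_iff_add_eq_zero, ← TotCochain.ofForm_add, neg_add_cancel,
      TotCochain.ofForm_eq_single]
    have : (Cochain.ofForm (0 : DForm (HolP2 S) 4) : Cochain Γ (HolP2 S) 0 4) = 0 :=
      Subtype.ext (funext fun s => map_zero _)
    rw [this, map_zero]
  rw [hn]
  abel

end HolP2

lemma P2.ofForm_pontrjagin_mem_cocycles {p₁ : DForm (P2 S) 4}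
    (hp : DForm.pullback P2.proj P2.dSmooth_proj p₁ = J2.pontrjagin J2.taut) :
    TotCochain.ofForm p₁ ∈ TotCochain.cocycles Γ (P2 S) 4 := by
  have hs := P2.isSubduction_proj (S := S)
  refine ⟨TotCochain.ofForm_mem_degree _, ?_⟩
  change TotCochain.D _ = 0
  have h1 : ∀ g : Γ, translate Γ g p₁ = p₁ := fun g => hs.pullback_injective (by
    rw [pullback_translate hs.dSmooth (fun _ _ => rfl), hp, J2.translate_pontrjagin])
  have h2 : DForm.d p₁ = 0 := hs.pullback_injective (by
    rw [DForm.pullback_d, hp, J2.d_pontrjagin_taut, map_zero])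
  rw [TotCochain.D_ofForm h1, h2, TotCochain.ofForm_eq_single]
  have : (Cochain.ofForm (0 : DForm (P2 S) 5) : Cochain Γ (P2 S) 0 5) = 0 :=
    Subtype.ext (funext fun s => map_zero _)
  rw [this, map_zero]

/-- A diagram chase. Contractibility of the fibres of `P₂` yields the unique class on `M` that pulls
back to `p₁`; contractibility of those of `HolP2` allows it to be compared with `-Ω²` after pullback
to `HolP2`, where the two are cohomologous. -/
lemma pontrjagin_class_of_contraction (ρ : KahlerMetric S)
    {h : ℝ → P2 S → P2 S} (H : IsFibreContraction P2.base h)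
    {h' : ℝ → HolP2 S → HolP2 S} (H' : IsFibreContraction HolP2.base h') :
    ∃ (conn : DForm (HolJ2 S) 1) (Ω : TotCochain Γ (Mfd S))
      (θ : Fin 3 → Fin 3 → DForm (J2 S) 1) (p₁ : DForm (P2 S) 4),
      HolJ2.IsConnection ρ conn ∧
      TotCochain.pullback HolJ2.base HolJ2.dSmooth_base HolJ2.base_smul Ω =
        TotCochain.D (TotCochain.ofForm conn) ∧
      J2.IsTautological θ ∧
      DForm.pullback P2.proj P2.dSmooth_proj p₁ = J2.pontrjagin θ ∧
      ∃ (hΩ : -(TotCochain.mul Ω Ω) ∈ TotCochain.cocycles Γ (Mfd S) 4)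
        (hp : TotCochain.ofForm p₁ ∈ TotCochain.cocycles Γ (P2 S) 4),
        ∀ c : EquivCohomology Γ (Mfd S) 4,
          EquivCohomology.pullback P2.base P2.dSmooth_base P2.base_smul c =
              EquivCohomology.mk (TotCochain.ofForm p₁) hp ↔
            c = EquivCohomology.mk (-(TotCochain.mul Ω Ω)) hΩ := by
  obtain ⟨Ω, hΩ, hdeg, hD⟩ := exists_equivariant_curvature (Γ := Γ) ρ
  obtain ⟨p₁, hp₁⟩ := P2.exists_pontrjagin (S := S)
  have hΩ4 : -(TotCochain.mul Ω Ω) ∈ TotCochain.cocycles Γ (Mfd S) 4 :=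
    neg_mem (TotCochain.mul_self_mem_cocycles hdeg hD)
  have hp4 := P2.ofForm_pontrjagin_mem_cocycles (Γ := Γ) hp₁
  refine ⟨HolJ2.conn ρ, Ω, J2.taut, p₁, HolJ2.isConnection_conn ρ, hΩ, J2.isTautological_taut,
    hp₁, hΩ4, hp4, ?_⟩
  -- Injectivity is stated in degree `k + 2` and surjectivity in degree `k + 1`, so the indices `2`
  -- and `3` both mean degree four.
  have hinj := EquivCohomology.pullback_injective (Γ := Γ) H P2.isSubduction_base P2.base_smul 2
  have hsurj := EquivCohomology.pullback_surjective (Γ := Γ) H P2.isSubduction_base P2.base_smul 3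
  have hinj' := EquivCohomology.pullback_injective (Γ := Γ) H' HolP2.isSubduction_base
    HolP2.base_smul 2
  obtain ⟨c₀, hc₀⟩ := hsurj (EquivCohomology.mk (TotCochain.ofForm p₁) hp4)
  -- `HolP2 → M` factors through `P₂`, so the pullback of `c₀` to `HolP2` is represented by the
  -- restriction of `p₁`.
  have key : c₀ = EquivCohomology.mk (-(TotCochain.mul Ω Ω)) hΩ4 := by
    refine hinj' ?_
    obtain ⟨u, hu, rfl⟩ := EquivCohomology.exists_mk c₀
    rw [EquivCohomology.pullback_mk, EquivCohomology.mk_eq_mk] at hc₀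
    obtain ⟨x, hx⟩ := hc₀
    obtain ⟨y, hy⟩ := HolP2.exists_D_eq ρ hΩ hp₁
    rw [EquivCohomology.pullback_mk, EquivCohomology.pullback_mk, EquivCohomology.mk_eq_mk]
    refine ⟨TotCochain.pullback HolP2.incl HolP2.dSmooth_incl HolP2.incl_smul x + y, ?_⟩
    rw [map_add, TotCochain.D_pullback, hx, hy, map_sub, add_comm, sub_add_sub_cancel]
    rfl
  intro c
  rw [← key]
  exact ⟨fun hc => hinj (hc.trans hc₀.symm), fun hc => hc ▸ hc₀⟩

end Curvature

/-! ## The metric and the Levi-Civita connection in a frame -/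

/-- `ContDiff.smul` for values in a space of iterated linear maps, where the instances it needs are
not found. -/
lemma contDiff_smul_bilin {V W : Type*} [NormedAddCommGroup V] [NormedSpace ℝ V]
    [NormedAddCommGroup W] [NormedSpace ℝ W] {f : V → ℝ} {g : V → W} (hf : ContDiff ℝ ∞ f)
    (hg : ContDiff ℝ ∞ g) : ContDiff ℝ ∞ fun x => f x • g x := hf.smul hg

lemma quadComp_apply (Y A : V3 →L[ℝ] V3) (YY B : V3 →L[ℝ] V3 →L[ℝ] V3) (u v : V3) :
    quadComp Y YY A B u v = YY (A u) (A v) + Y (B u v) := rfl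

/-- The bilinear form `(u, v) ↦ (0, c uᶻ vᶻ)`. -/
def christoffel (c : ℂ) : V3 →L[ℝ] V3 →L[ℝ] V3 :=
  (ContinuousLinearMap.compL ℝ V3 ℂ V3 (ContinuousLinearMap.inr ℝ ℝ ℂ)).comp
    (c • (ContinuousLinearMap.mul ℝ ℂ).bilinearComp (ContinuousLinearMap.snd ℝ ℝ ℂ)
      (ContinuousLinearMap.snd ℝ ℝ ℂ))

lemma christoffel_apply (c : ℂ) (u v : V3) : christoffel c u v = (0, c * (u.2 * v.2)) := rfl

lemma contDiff_christoffel : ContDiff ℝ ∞ christoffel :=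
  contDiff_const.clm_comp (contDiff_id.smul contDiff_const)

/-- The bilinear form `uᵗ vᵗ + c Re(conj(uᶻ) vᶻ)`. -/
def planeForm (c : ℝ) : V3 →L[ℝ] V3 →L[ℝ] ℝ :=
  (ContinuousLinearMap.mul ℝ ℝ).bilinearComp (ContinuousLinearMap.fst ℝ ℝ ℂ)
      (ContinuousLinearMap.fst ℝ ℝ ℂ) +
    c • ((ContinuousLinearMap.mul ℝ ℝ).bilinearComp
      (Complex.reCLM.comp (ContinuousLinearMap.snd ℝ ℝ ℂ))
      (Complex.reCLM.comp (ContinuousLinearMap.snd ℝ ℝ ℂ)) +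
    (ContinuousLinearMap.mul ℝ ℝ).bilinearComp
      (Complex.imCLM.comp (ContinuousLinearMap.snd ℝ ℝ ℂ))
      (Complex.imCLM.comp (ContinuousLinearMap.snd ℝ ℝ ℂ)))

lemma planeForm_apply (c : ℝ) (u v : V3) :
    planeForm c u v = u.1 * v.1 + c * (u.2.re * v.2.re + u.2.im * v.2.im) := rfl

lemma planeForm_self (c : ℝ) (u : V3) : planeForm c u u = u.1 ^ 2 + c * ‖u.2‖ ^ 2 := by
  rw [planeForm_apply, Complex.sq_norm, Complex.normSq_apply, sq]

lemma contDiff_planeForm : ContDiff ℝ ∞ planeForm :=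
  contDiff_const.add (contDiff_smul_bilin contDiff_id contDiff_const)

/-- The pullback of a bilinear form. -/
def formComp (g : V3 →L[ℝ] V3 →L[ℝ] ℝ) (A : V3 →L[ℝ] V3) : V3 →L[ℝ] V3 →L[ℝ] ℝ :=
  ((ContinuousLinearMap.compL ℝ V3 V3 ℝ).flip A).comp (g.comp A)

lemma formComp_apply (g : V3 →L[ℝ] V3 →L[ℝ] ℝ) (A : V3 →L[ℝ] V3) (u v : V3) :
    formComp g A u v = g (A u) (A v) := rfl

lemma contDiffAt_formComp {W : Type*} [NormedAddCommGroup W] [NormedSpace ℝ W]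
    {g : W → V3 →L[ℝ] V3 →L[ℝ] ℝ} {A : W → V3 →L[ℝ] V3} {x : W} (hg : ContDiffAt ℝ ∞ g x)
    (hA : ContDiffAt ℝ ∞ A x) : ContDiffAt ℝ ∞ (fun x => formComp (g x) (A x)) x := by
  have h1 : ContDiffAt ℝ ∞ (fun x => (ContinuousLinearMap.compL ℝ V3 V3 ℝ).flip (A x)) x :=
    (ContinuousLinearMap.contDiff _).contDiffAt.comp x hA
  exact h1.clm_comp (hg.clm_comp hA)

namespace J2

variable {S : Type*} [TopologicalSpace S] [ChartedSpace ℂ S] [IsManifold 𝓘(ℂ, ℂ) ω S]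
  {φ ψ : OpenPartialHomeomorph S ℂ} {t t' : Circle} {J J' : J2 S} (ρ : KahlerMetric S)

/-- The Christoffel symbol in the coordinate `φ`. -/
def symbol (φ : OpenPartialHomeomorph S ℂ) (m : Mfd S) : ℂ :=
  dz (fun z => Real.log (ρ.coeff φ z)) (φ m.2)

/-- The covariant second derivative of a jet, in the frame of the jet. -/
def covAt (t : Circle) (φ : OpenPartialHomeomorph S ℂ) (J : J2 S) : V3 →L[ℝ] V3 →L[ℝ] V3 :=
  quadComp (coordY (prodCoord t φ) J).inverse 0 0 (coordYY (prodCoord t φ) J +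
    quadComp 0 (christoffel (symbol ρ φ (base J))) (coordY (prodCoord t φ) J) 0)

lemma coordY_covAt (h : IsHolCoord t φ (base J)) (u v : V3) :
    coordY (prodCoord t φ) J (covAt ρ t φ J u v) = coordYY (prodCoord t φ) J u v +
      christoffel (symbol ρ φ (base J)) (coordY (prodCoord t φ) J u)
        (coordY (prodCoord t φ) J v) := by
  rw [covAt, quadComp_apply, zero_apply, zero_apply, zero_add,
    (isInvertible_coordY h.isCoord).self_apply_inverse, add_apply, add_apply, quadComp_apply,
    zero_apply, add_zero]

/-- A change of holomorphic coordinate adds a `T''` term to the second derivative; the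
transformation rule of `∂_z ln ρ` removes it, as expected of a covariant derivative. -/
lemma covAt_eq (h : IsHolCoord t φ (base J)) (h' : IsHolCoord t' ψ (base J)) :
    covAt ρ t' ψ J = covAt ρ t φ J := by
  refine ContinuousLinearMap.ext fun u => ContinuousLinearMap.ext fun v =>
    (isInvertible_coordY h'.isCoord).injective ?_
  have hz := mem_source_transition h.mem_source h'.mem_source
  obtain ⟨hT, e⟩ := ρ.dz_log_coeff h.mem_atlas h'.mem_atlas hz
  rw [coordY_covAt ρ h', coordY_holTransition h h' (covAt ρ t φ J u v), coordY_covAt ρ h,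
    coordYY_holTransition h h', coordY_holTransition h h' u, coordY_holTransition h h' v,
    christoffel_apply, christoffel_apply,
    symbol, symbol, e, φ.left_inv h.mem_source]
  refine Prod.ext rfl ?_
  simp only [Prod.snd_add]
  field_simp
  ring

/-- The covariant second derivative of a jet. -/
def cov (J : J2 S) : V3 →L[ℝ] V3 →L[ℝ] V3 := covAt ρ (base J).1 (chartAt ℂ (base J).2) J

lemma cov_eq (h : IsHolCoord t φ (base J)) : cov ρ J = covAt ρ t φ J :=
  covAt_eq ρ h (.chartAt _)

lemma coordY_cov (h : IsHolCoord t φ (base J)) (u v : V3) :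
    coordY (prodCoord t φ) J (cov ρ J u v) = coordYY (prodCoord t φ) J u v +
      christoffel (symbol ρ φ (base J)) (coordY (prodCoord t φ) J u)
        (coordY (prodCoord t φ) J v) := by
  rw [cov_eq ρ h, coordY_covAt ρ h]

lemma cov_symm (J : J2 S) (u v : V3) : cov ρ J u v = cov ρ J v u := by
  have h := IsHolCoord.chartAt (base J)
  refine (isInvertible_coordY h.isCoord).injective ?_
  rw [coordY_cov ρ h, coordY_cov ρ h, coordYY_symm h.isCoord, christoffel_apply,
    christoffel_apply, mul_comm (coordY _ J u).2]

/-- The metric in the frame of a jet, in given coordinates. -/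
def metricAt (t : Circle) (φ : OpenPartialHomeomorph S ℂ) (J : J2 S) : V3 →L[ℝ] V3 →L[ℝ] ℝ :=
  formComp (planeForm (ρ.coeff φ (φ (base J).2))) (coordY (prodCoord t φ) J)

/-- The factor `|T'|²` gained by the coefficient `ρ` compensates the factor `T'` acquired by each
fibre component. -/
lemma metricAt_eq (h : IsHolCoord t φ (base J)) (h' : IsHolCoord t' ψ (base J)) :
    metricAt ρ t' ψ J = metricAt ρ t φ J := by
  refine ContinuousLinearMap.ext fun u => ContinuousLinearMap.ext fun v => ?_
  have hz := mem_source_transition h.mem_source h'.mem_source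
  rw [metricAt, metricAt, formComp_apply, formComp_apply, coordY_holTransition h h',
    coordY_holTransition h h', planeForm_apply, planeForm_apply,
    ρ.transform φ h.mem_atlas ψ h'.mem_atlas _ hz, φ.left_inv h.mem_source]
  set T := deriv (fun z => ψ (φ.symm z)) (φ (base J).2)
  rw [Complex.sq_norm, Complex.normSq_apply, Complex.mul_re, Complex.mul_re, Complex.mul_im,
    Complex.mul_im]
  ring

/-- The metric in the frame of a jet. -/
def metric (J : J2 S) : V3 →L[ℝ] V3 →L[ℝ] ℝ := metricAt ρ (base J).1 (chartAt ℂ (base J).2) J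

lemma metric_eq (h : IsHolCoord t φ (base J)) : metric ρ J = metricAt ρ t φ J :=
  metricAt_eq ρ h (.chartAt _)

lemma metric_apply (h : IsHolCoord t φ (base J)) (u v : V3) : metric ρ J u v =
    planeForm (ρ.coeff φ (φ (base J).2)) (coordY (prodCoord t φ) J u)
      (coordY (prodCoord t φ) J v) := by
  rw [metric_eq ρ h]
  rfl

lemma planeForm_pos {c : ℝ} (hc : 0 < c) {u : V3} (hu : u ≠ 0) : 0 < planeForm c u u := by
  rw [planeForm_self]
  by_cases h : u.1 = 0
  · have h2 : u.2 ≠ 0 := fun h2 => hu (Prod.ext h h2)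
    rw [h]
    have := norm_pos_iff.mpr h2
    positivity
  · have := sq_pos_of_ne_zero h
    positivity

lemma planeForm_symm (c : ℝ) (u v : V3) : planeForm c u v = planeForm c v u := by
  rw [planeForm_apply, planeForm_apply]
  ring

lemma metric_pos (J : J2 S) {u : V3} (hu : u ≠ 0) : 0 < metric ρ J u u := by
  have h := IsHolCoord.chartAt (base J)
  rw [metric_apply ρ h]
  refine planeForm_pos (ρ.pos _ h.mem_atlas _ (OpenPartialHomeomorph.map_source _ h.mem_source)) fun h0 => hu ?_
  exact (isInvertible_coordY h.isCoord).injective (h0.trans (map_zero _).symm)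

lemma metric_symm (J : J2 S) (u v : V3) : metric ρ J u v = metric ρ J v u := by
  have h := IsHolCoord.chartAt (base J)
  rw [metric_apply ρ h, metric_apply ρ h, planeForm_symm]

section Plots

variable {n : ℕ} {p : E n → J2 S} {x : E n}

lemma eventually_isHolCoord (hp : IsPlot p) (h : IsHolCoord t φ (base (p x))) :
    ∀ᶠ y in 𝓝 x, IsHolCoord t φ (base (p y)) :=
  (contMDiffAt_base hp x).continuousAt.eventually h.eventually

lemma contDiff_cov (hp : IsPlot p) : ContDiff ℝ ∞ fun y => cov ρ (p y) := by
  rw [contDiff_iff_contDiffAt]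
  intro x
  have h := IsHolCoord.chartAt (base (p x))
  set φ := chartAt ℂ (base (p x)).2
  have hY := contDiffAt_coordY hp h.isCoord
  have hb : ContDiffAt ℝ ∞ (fun y => φ (base (p y)).2) x := (contDiffAt_coord_base hp h.isCoord).snd
  have hz : φ (base (p x)).2 ∈ φ.target := φ.map_source h.mem_source
  have h1 : ContDiffAt ℝ ∞ (fun z => Real.log (ρ.coeff φ z)) (φ (base (p x)).2) :=
    ((ρ.smooth φ h.mem_atlas).contDiffAt (φ.open_target.mem_nhds hz)).log
      (ρ.pos φ h.mem_atlas _ hz).ne'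
  have h2 : ContDiffAt ℝ ∞ (fun y => symbol ρ φ (base (p y))) x :=
    ContDiffAt.comp (g := dz fun z => Real.log (ρ.coeff φ z)) x (HolJ2.contDiffAt_dz h1) hb
  have h3 : ContDiffAt ℝ ∞ (fun y => christoffel (symbol ρ φ (base (p y)))) x :=
    contDiff_christoffel.contDiffAt.comp x h2
  have hi : ContDiffAt ℝ ∞ (fun y => (coordY (prodCoord (base (p x)).1 φ) (p y)).inverse) x :=
    ContDiffAt.comp (g := ContinuousLinearMap.inverse) x
      (isInvertible_coordY h.isCoord).contDiffAt_map_inverse hY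
  have h4 : ContDiffAt ℝ ∞ (fun y => covAt ρ (base (p x)).1 φ (p y)) x :=
    contDiffAt_quadComp hi contDiffAt_const contDiffAt_const
      ((contDiffAt_coordYY hp h.isCoord).add
        (contDiffAt_quadComp contDiffAt_const h3 hY contDiffAt_const))
  refine h4.congr_of_eventuallyEq ?_
  filter_upwards [eventually_isHolCoord hp h] with y hy using cov_eq ρ hy

lemma contDiff_metric (hp : IsPlot p) : ContDiff ℝ ∞ fun y => metric ρ (p y) := by
  rw [contDiff_iff_contDiffAt]
  intro x
  have h := IsHolCoord.chartAt (base (p x))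
  set φ := chartAt ℂ (base (p x)).2
  have hb : ContDiffAt ℝ ∞ (fun y => φ (base (p y)).2) x := (contDiffAt_coord_base hp h.isCoord).snd
  have h1 : ContDiffAt ℝ ∞ (ρ.coeff φ) (φ (base (p x)).2) :=
    (ρ.smooth φ h.mem_atlas).contDiffAt (φ.open_target.mem_nhds (φ.map_source h.mem_source))
  have h2 : ContDiffAt ℝ ∞ (fun y => planeForm (ρ.coeff φ (φ (base (p y)).2))) x :=
    contDiff_planeForm.contDiffAt.comp x (ContDiffAt.comp (g := ρ.coeff φ) x h1 hb)
  have h3 : ContDiffAt ℝ ∞ (fun y => metricAt ρ (base (p x)).1 φ (p y)) x :=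
    contDiffAt_formComp h2 (contDiffAt_coordY hp h.isCoord)
  refine h3.congr_of_eventuallyEq ?_
  filter_upwards [eventually_isHolCoord hp h] with y hy using metric_eq ρ hy

end Plots

/-- The linear change of frame `N`, and the contraction of the covariant second derivative. -/
def shrink (s : ℝ) (N : V3 →L[ℝ] V3) (hN : 0 < N.det) (J : J2 S) : J2 S :=
  -- The quadratic term is chosen to subtract the fraction `1 - s` of the covariant second
  -- derivative, read in the new frame.
  act J N (quadComp 0 (-(1 - s) • cov ρ J) N 0) hN fun u v => by
    simp only [quadComp_apply, zero_apply, add_zero, smul_apply, cov_symm ρ J (N u)]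

variable {s : ℝ} {N N' : V3 →L[ℝ] V3} {hN : 0 < N.det} {hN' : 0 < N'.det}

lemma base_shrink : base (shrink ρ s N hN J) = base J := base_act _ _

lemma coordY_shrink (h : IsHolCoord t φ (base J)) :
    coordY (prodCoord t φ) (shrink ρ s N hN J) = (coordY (prodCoord t φ) J).comp N :=
  coordY_act _ _ h.isCoord

/-- Adding the Christoffel term to both sides, the covariant second derivative of the new jet is `s`
times that of the old one in the frame `N`. At `s = 0` the second-order part of the jet is thus
determined by its frame. -/
lemma coordYY_shrink (h : IsHolCoord t φ (base J)) (u v : V3) :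
    coordYY (prodCoord t φ) (shrink ρ s N hN J) u v =
      s • coordYY (prodCoord t φ) J (N u) (N v) -
        (1 - s) • christoffel (symbol ρ φ (base J)) (coordY (prodCoord t φ) J (N u))
          (coordY (prodCoord t φ) J (N v)) := by
  rw [shrink, coordYY_act _ _ h.isCoord, quadComp_apply, zero_apply, add_zero, smul_apply,
    smul_apply, map_smul, coordY_cov ρ h]
  module

lemma shrink_one (hid : 0 < (ContinuousLinearMap.id ℝ V3).det) :
    shrink ρ 1 (ContinuousLinearMap.id ℝ V3) hid J = J := by
  have h := IsHolCoord.chartAt (base J)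
  refine ext_coord (κ := prodCoord (base J).1 (chartAt ℂ (base J).2)) ?_ (base_shrink ρ) ?_ ?_
  · rw [base_shrink]
    exact h.isCoord
  · rw [coordY_shrink ρ h, ContinuousLinearMap.comp_id]
  · refine ContinuousLinearMap.ext fun u => ContinuousLinearMap.ext fun v => ?_
    rw [coordYY_shrink ρ h]
    simp

lemma isPlot_shrink {n : ℕ} {p : E n → J2 S} (hp : IsPlot p) {s : E n → ℝ}
    {N : E n → V3 →L[ℝ] V3} (hN : ∀ y, 0 < (N y).det) (hsN : ContDiff ℝ ∞ N)
    (hs : ContDiff ℝ ∞ s) : IsPlot fun y => shrink ρ (s y) (N y) (hN y) (p y) := by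
  refine isPlot_act hp hN _ hsN ?_
  rw [contDiff_iff_contDiffAt]
  intro y
  have h1 : ContDiff ℝ ∞ fun y => -(1 - s y) := (contDiff_const.sub hs).neg
  have h2 : ContDiff ℝ ∞ fun y => -(1 - s y) • cov ρ (p y) := contDiff_smul_bilin h1 (contDiff_cov ρ hp)
  exact contDiffAt_quadComp contDiffAt_const h2.contDiffAt hsN.contDiffAt contDiffAt_const

/-- Jets whose coordinates differ by a rotation have the same image in `P₂`. -/
lemma proj_eq_of_coord {κ : Mfd S → V3} {K : V3 →L[ℝ] V3} (hK : IsRotation K)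
    (h0 : base J = base J') (hκ : IsCoord κ (base J))
    (h1 : coordY κ J' = (coordY κ J).comp K)
    (h2 : ∀ u v, coordYY κ J' u v = coordYY κ J (K u) (K v)) : P2.proj J = P2.proj J' := by
  have hdet : 0 < K.det := by rw [hK.2]; exact one_pos
  have e : J' = act J K 0 hdet fun _ _ => rfl := by
    refine ext_coord (κ := κ) (by rwa [← h0]) (by rw [base_act, h0]) ?_ ?_
    · rw [h1, coordY_act _ _ hκ]
    · refine ContinuousLinearMap.ext fun u => ContinuousLinearMap.ext fun v => ?_
      rw [h2, coordYY_act _ _ hκ]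
      simp
  have hq : quadMap 0 K 0 = K := funext fun v => by simp [quadMap]
  have hfr : IsFrame (J.rep ∘ K) := by
    have := isFrame_comp_quadMap J.isFrame_rep hdet (B := 0) fun _ _ => rfl
    rwa [hq] at this
  refine Quot.sound ⟨J.rep, K, J.isFrame_rep, hfr, hK, (mk_rep J).symm, ?_⟩
  rw [e]
  simp only [act, hq]

/-- The Christoffel term is tensorial in the frame and depends on the jet only through the frame and
base point, so it follows from the first-order relation. The second-order condition carries the
factor `s` and is empty at `s = 0`. -/
lemma proj_shrink_eq {K : V3 →L[ℝ] V3} (hK : IsRotation K) (h : IsHolCoord t φ (base J))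
    (h0 : base J = base J')
    (h1 : (coordY (prodCoord t φ) J').comp N' = ((coordY (prodCoord t φ) J).comp N).comp K)
    (h2 : ∀ u v, s • coordYY (prodCoord t φ) J' (N' u) (N' v) =
      s • coordYY (prodCoord t φ) J (N (K u)) (N (K v))) :
    P2.proj (shrink ρ s N hN J) = P2.proj (shrink ρ s N' hN' J') := by
  have h' : IsHolCoord t φ (base J') := h0 ▸ h
  refine proj_eq_of_coord (κ := prodCoord t φ) hK ?_ ?_ ?_ fun u v => ?_
  · rw [base_shrink, base_shrink, h0]
  · rw [base_shrink]
    exact h.isCoord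
  · rw [coordY_shrink ρ h, coordY_shrink ρ h', h1]
  · have h3 : ∀ u, coordY (prodCoord t φ) J' (N' u) = coordY (prodCoord t φ) J (N (K u)) := fun u =>
      congrArg (fun A => A u) h1
    rw [coordYY_shrink ρ h, coordYY_shrink ρ h', h2, h3, h3, h0]

end J2

/-! ## Orthonormal frames -/

/-- `g` is symmetric and positive definite. -/
structure IsInner (g : V3 →L[ℝ] V3 →L[ℝ] ℝ) : Prop where
  symm : ∀ u v, g u v = g v u
  pos : ∀ u, u ≠ 0 → 0 < g u u

lemma isInner_planeForm {c : ℝ} (hc : 0 < c) : IsInner (planeForm c) :=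
  ⟨J2.planeForm_symm c, fun _ hu => J2.planeForm_pos hc hu⟩

/-- The unit vector in the direction of `v`. -/
def unitVec (g : V3 →L[ℝ] V3 →L[ℝ] ℝ) (v : V3) : V3 := (√(g v v))⁻¹ • v

namespace IsInner

variable {g g' : V3 →L[ℝ] V3 →L[ℝ] ℝ} (hg : IsInner g)

/-- Inner products form a convex set; this is what makes the frames up to rotation contractible. -/
lemma segment (hg : IsInner g) (hg' : IsInner g') {s : ℝ} (h0 : 0 ≤ s) (h1 : s ≤ 1) :
    IsInner ((1 - s) • g + s • g') where
  symm u v := by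
    simp only [add_apply, smul_apply, hg.symm u, hg'.symm u]
  pos u hu := by
    have a := hg.pos u hu
    have b := hg'.pos u hu
    simp only [add_apply, smul_apply, smul_eq_mul]
    rcases h1.eq_or_lt with rfl | h1
    · simpa using b
    · exact add_pos_of_pos_of_nonneg (mul_pos (sub_pos.mpr h1) a) (mul_nonneg h0 b.le)

lemma self_unitVec (hg : IsInner g) {v : V3} (hv : v ≠ 0) : g (unitVec g v) (unitVec g v) = 1 := by
  have h := hg.pos v hv
  have h' := Real.sqrt_ne_zero'.mpr h
  rw [unitVec, map_smul, map_smul, smul_apply, smul_eq_mul, smul_eq_mul]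
  field_simp
  exact (Real.sq_sqrt h.le).symm

lemma unitVec_scale_pos (hg : IsInner g) {v : V3} (hv : v ≠ 0) : 0 < (√(g v v))⁻¹ :=
  inv_pos.mpr (Real.sqrt_pos.mpr (hg.pos v hv))

end IsInner

/-- The first vector of the orthonormal frame of `g`. -/
def orthoT (g : V3 →L[ℝ] V3 →L[ℝ] ℝ) : V3 := unitVec g (J2.vec 0)

/-- The component of the second basis vector orthogonal to the first. -/
def preX (g : V3 →L[ℝ] V3 →L[ℝ] ℝ) : V3 := J2.vec 1 - g (J2.vec 1) (orthoT g) • orthoT g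

/-- The second vector of the orthonormal frame of `g`. -/
def orthoX (g : V3 →L[ℝ] V3 →L[ℝ] ℝ) : V3 := unitVec g (preX g)

/-- The component of the third basis vector orthogonal to the others. -/
def preY (g : V3 →L[ℝ] V3 →L[ℝ] ℝ) : V3 :=
  J2.vec 2 - g (J2.vec 2) (orthoT g) • orthoT g - g (J2.vec 2) (orthoX g) • orthoX g

/-- The third vector of the orthonormal frame of `g`. -/
def orthoY (g : V3 →L[ℝ] V3 →L[ℝ] ℝ) : V3 := unitVec g (preY g)

/-- The orthonormal frame of `g` given by the Gram–Schmidt process. -/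
def orthoFrame (g : V3 →L[ℝ] V3 →L[ℝ] ℝ) : V3 →L[ℝ] V3 :=
  (ContinuousLinearMap.fst ℝ ℝ ℂ).smulRight (orthoT g) +
    ((Complex.reCLM.comp (ContinuousLinearMap.snd ℝ ℝ ℂ)).smulRight (orthoX g) +
      (Complex.imCLM.comp (ContinuousLinearMap.snd ℝ ℝ ℂ)).smulRight (orthoY g))

lemma orthoFrame_apply (g : V3 →L[ℝ] V3 →L[ℝ] ℝ) (u : V3) :
    orthoFrame g u = u.1 • orthoT g + (u.2.re • orthoX g + u.2.im • orthoY g) := rfl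

lemma vec_zero_ne : J2.vec 0 ≠ 0 := fun h => one_ne_zero (congrArg Prod.fst h)

lemma orthoT_snd (g : V3 →L[ℝ] V3 →L[ℝ] ℝ) : (orthoT g).2 = 0 := by
  simp [orthoT, unitVec, J2.vec]

/-- Gram–Schmidt is triangular: subtracting a multiple of the earlier vector does not touch this
coordinate, so the result is nonzero without any argument on linear independence. The same holds for
`preY`. -/
lemma preX_snd (g : V3 →L[ℝ] V3 →L[ℝ] ℝ) : (preX g).2 = 1 := by
  simp [preX, orthoT_snd, J2.vec]

lemma preX_ne (g : V3 →L[ℝ] V3 →L[ℝ] ℝ) : preX g ≠ 0 := fun h =>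
  one_ne_zero ((preX_snd g).symm.trans (congrArg Prod.snd h))

lemma orthoX_snd (g : V3 →L[ℝ] V3 →L[ℝ] ℝ) :
    (orthoX g).2 = ((√(g (preX g) (preX g)))⁻¹ : ℝ) := by
  simp [orthoX, unitVec, preX_snd]

lemma preY_im (g : V3 →L[ℝ] V3 →L[ℝ] ℝ) : (preY g).2.im = 1 := by
  simp only [preY, Prod.snd_sub, Prod.smul_snd, orthoT_snd, orthoX_snd, Complex.sub_im,
    Complex.smul_im, Complex.ofReal_im, J2.vec]
  simp

lemma preY_ne (g : V3 →L[ℝ] V3 →L[ℝ] ℝ) : preY g ≠ 0 := fun h =>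
  one_ne_zero ((preY_im g).symm.trans (congrArg (fun v : V3 => v.2.im) h))

namespace IsInner

variable {g : V3 →L[ℝ] V3 →L[ℝ] ℝ}

lemma orthoT_self (hg : IsInner g) : g (orthoT g) (orthoT g) = 1 := hg.self_unitVec vec_zero_ne

lemma orthoX_self (hg : IsInner g) : g (orthoX g) (orthoX g) = 1 := hg.self_unitVec (preX_ne g)

lemma orthoY_self (hg : IsInner g) : g (orthoY g) (orthoY g) = 1 := hg.self_unitVec (preY_ne g)

lemma orthoX_orthoT (hg : IsInner g) : g (orthoX g) (orthoT g) = 0 := by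
  rw [orthoX, unitVec, preX]
  simp [hg.orthoT_self]

lemma orthoY_orthoT (hg : IsInner g) : g (orthoY g) (orthoT g) = 0 := by
  rw [orthoY, unitVec, preY]
  simp [hg.orthoT_self, hg.orthoX_orthoT]

lemma orthoY_orthoX (hg : IsInner g) : g (orthoY g) (orthoX g) = 0 := by
  rw [orthoY, unitVec, preY]
  simp [hg.orthoX_self, hg.symm (orthoT g), hg.orthoX_orthoT]

lemma orthoFrame_apply (hg : IsInner g) (u v : V3) :
    g (orthoFrame g u) (orthoFrame g v) = planeForm 1 u v := by
  simp only [EquivJet.orthoFrame_apply, map_add, map_smul, add_apply, smul_apply, smul_eq_mul,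
    hg.orthoT_self, hg.orthoX_self, hg.orthoY_self, hg.orthoX_orthoT, hg.orthoY_orthoT,
    hg.orthoY_orthoX, hg.symm (orthoT g) (orthoX g), hg.symm (orthoT g) (orthoY g),
    hg.symm (orthoX g) (orthoY g), planeForm_apply]
  ring

/-- The matrix of the frame is triangular, with the positive normalising factors on the diagonal. -/
lemma det_orthoFrame_pos (hg : IsInner g) : 0 < (orthoFrame g).det := by
  have h1 := hg.unitVec_scale_pos vec_zero_ne
  have h2 := hg.unitVec_scale_pos (preX_ne g)
  have h3 := hg.unitVec_scale_pos (preY_ne g)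
  have e1 : (orthoT g).1 = (√(g (J2.vec 0) (J2.vec 0)))⁻¹ := by
    simp [orthoT, unitVec, J2.vec]
  have e3 : (orthoY g).2.im = (√(g (preY g) (preY g)))⁻¹ := by
    simp [orthoY, unitVec, preY_im]
  rw [det_eq_det_coord, Matrix.det_fin_three]
  simp only [Matrix.of_apply, J2.coord, J2.vec, Matrix.cons_val, EquivJet.orthoFrame_apply]
  simp only [Prod.fst_add, Prod.snd_add, Prod.smul_fst, Prod.smul_snd, orthoT_snd, orthoX_snd,
    Complex.add_re, Complex.add_im, Complex.smul_re, Complex.smul_im, Complex.ofReal_re,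
    Complex.ofReal_im, Complex.zero_re, Complex.zero_im, Complex.one_re, Complex.one_im,
    Complex.I_re, Complex.I_im, e1, e3]
  simp only [smul_eq_mul, mul_zero, zero_mul, add_zero, zero_add, one_mul, sub_zero]
  positivity

end IsInner

/-- Gram–Schmidt leaves the standard frame alone; this makes the contraction the identity at time
one. -/
lemma orthoFrame_planeForm_one : orthoFrame (planeForm 1) = ContinuousLinearMap.id ℝ V3 := by
  have h0 : orthoT (planeForm 1) = J2.vec 0 := by
    simp [orthoT, unitVec, planeForm_apply, J2.vec]
  have h1 : preX (planeForm 1) = J2.vec 1 := by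
    rw [preX, h0]
    simp [planeForm_apply, J2.vec]
  have h2 : orthoX (planeForm 1) = J2.vec 1 := by
    rw [orthoX, unitVec, h1]
    simp [planeForm_apply, J2.vec]
  have h3 : preY (planeForm 1) = J2.vec 2 := by
    rw [preY, h0, h2]
    simp [planeForm_apply, J2.vec]
  have h4 : orthoY (planeForm 1) = J2.vec 2 := by
    rw [orthoY, unitVec, h3]
    simp [planeForm_apply, J2.vec]
  refine ContinuousLinearMap.ext fun u => ?_
  rw [orthoFrame_apply, h0, h2, h4]
  refine Prod.ext ?_ ?_
  · simp [J2.vec]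
  · simp [J2.vec, Complex.re_add_im]

section Smooth

variable {W : Type*} [NormedAddCommGroup W] [NormedSpace ℝ W] {g : W → V3 →L[ℝ] V3 →L[ℝ] ℝ}

lemma contDiff_unitVec (hg : ContDiff ℝ ∞ g) (hi : ∀ x, IsInner (g x)) {v : W → V3}
    (hv : ContDiff ℝ ∞ v) (h0 : ∀ x, v x ≠ 0) : ContDiff ℝ ∞ fun x => unitVec (g x) (v x) := by
  have h1 : ContDiff ℝ ∞ fun x => g x (v x) (v x) := (hg.clm_apply hv).clm_apply hv
  have h2 : ∀ x, 0 < g x (v x) (v x) := fun x => (hi x).pos _ (h0 x)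
  exact ((h1.sqrt fun x => (h2 x).ne').inv fun x => Real.sqrt_ne_zero'.mpr (h2 x)).smul hv

lemma contDiff_orthoFrame (hg : ContDiff ℝ ∞ g) (hi : ∀ x, IsInner (g x)) :
    ContDiff ℝ ∞ fun x => orthoFrame (g x) := by
  have hc : ∀ {u v : W → V3}, ContDiff ℝ ∞ u → ContDiff ℝ ∞ v →
      ContDiff ℝ ∞ fun x => g x (u x) (v x) := fun hu hv => (hg.clm_apply hu).clm_apply hv
  have h0 : ContDiff ℝ ∞ fun x => orthoT (g x) :=
    contDiff_unitVec hg hi contDiff_const fun _ => vec_zero_ne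
  have h1 : ContDiff ℝ ∞ fun x => preX (g x) :=
    contDiff_const.sub ((hc contDiff_const h0).smul h0)
  have h2 : ContDiff ℝ ∞ fun x => orthoX (g x) := contDiff_unitVec hg hi h1 fun _ => preX_ne _
  have h3 : ContDiff ℝ ∞ fun x => preY (g x) :=
    (contDiff_const.sub ((hc contDiff_const h0).smul h0)).sub ((hc contDiff_const h2).smul h2)
  have h4 : ContDiff ℝ ∞ fun x => orthoY (g x) := contDiff_unitVec hg hi h3 fun _ => preY_ne _
  exact (contDiff_const.smulRight h0).add
    ((contDiff_const.smulRight h2).add (contDiff_const.smulRight h4))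

end Smooth

lemma det_comp_clm (A B : V3 →L[ℝ] V3) : (A.comp B).det = A.det * B.det := LinearMap.det_comp _ _

lemma planeForm_one_self (u : V3) : planeForm 1 u u = u.1 ^ 2 + ‖u.2‖ ^ 2 := by
  rw [planeForm_self, one_mul]

/-- The Gram matrix of the images of the standard basis is the identity, so the determinant squares
to one, and it is positive. -/
lemma isRotation_of_planeForm {K : V3 →L[ℝ] V3}
    (h : ∀ u v, planeForm 1 (K u) (K v) = planeForm 1 u v) (hK : 0 < K.det) : IsRotation K := by
  refine ⟨fun v => by rw [← planeForm_one_self, h, planeForm_one_self], ?_⟩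
  set P : Matrix (Fin 3) (Fin 3) ℝ := Matrix.of fun i j => J2.coord i (K (J2.vec j)) with hP
  have e : K.det = P.det := det_eq_det_coord K
  have h1 : P.transpose * P = 1 := by
    ext i j
    have h2 : planeForm 1 (J2.vec i) (J2.vec j) = (1 : Matrix (Fin 3) (Fin 3) ℝ) i j := by
      fin_cases i <;> fin_cases j <;> simp [planeForm_apply, J2.vec]
    rw [← h2, ← h, Matrix.mul_apply, Fin.sum_univ_three, planeForm_apply]
    simp only [hP, Matrix.transpose_apply, Matrix.of_apply, J2.coord, Matrix.cons_val]
    ring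
  have h3 := congrArg Matrix.det h1
  rw [Matrix.det_mul, Matrix.det_transpose, Matrix.det_one, ← e] at h3
  nlinarith

lemma IsRotation.planeForm_apply {A : V3 →L[ℝ] V3} (hA : IsRotation A) (u v : V3) :
    planeForm 1 (A u) (A v) = planeForm 1 u v := by
  have h : ∀ u, planeForm 1 (A u) (A u) = planeForm 1 u u := fun u => by
    rw [planeForm_one_self, hA.1, planeForm_one_self]
  have h1 := h (u + v)
  simp only [map_add, add_apply, h] at h1
  rw [J2.planeForm_symm 1 (A v) (A u), J2.planeForm_symm 1 v u] at h1
  linarith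

/-- Two positive orthonormal frames differ by a rotation. -/
lemma exists_isRotation_comp {g : V3 →L[ℝ] V3 →L[ℝ] ℝ} {B B' : V3 →L[ℝ] V3} (hB : 0 < B.det)
    (hB' : 0 < B'.det) (h : ∀ u v, g (B u) (B v) = planeForm 1 u v)
    (h' : ∀ u v, g (B' u) (B' v) = planeForm 1 u v) :
    ∃ K, IsRotation K ∧ B' = B.comp K := by
  have hi : B.IsInvertible := ⟨B.toContinuousLinearEquivOfDetNeZero hB.ne', by simp⟩
  have e : B' = B.comp (B.inverse.comp B') := by
    rw [← ContinuousLinearMap.comp_assoc, hi.self_comp_inverse, ContinuousLinearMap.id_comp]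
  refine ⟨B.inverse.comp B', isRotation_of_planeForm (fun u v => ?_) ?_, e⟩
  · rw [← h, ContinuousLinearMap.comp_apply, ContinuousLinearMap.comp_apply,
      hi.self_apply_inverse, hi.self_apply_inverse, h']
  · rw [e, det_comp_clm] at hB'
    exact pos_of_mul_pos_right hB' hB.le

/-! ## The contraction of the fibres of `P₂` -/

section Contraction

variable {S : Type*} [TopologicalSpace S] [ChartedSpace ℂ S] [IsManifold 𝓘(ℂ, ℂ) ω S]
  (ρ : KahlerMetric S)

namespace J2

/-- The interpolation between the metric in the frame of a jet and the standard metric. -/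
def metricPath (s : ℝ) (J : J2 S) : V3 →L[ℝ] V3 →L[ℝ] ℝ := (1 - s) • metric ρ J + s • planeForm 1

variable {s : ℝ} {J : J2 S}

lemma metricPath_apply (u v : V3) : metricPath ρ s J u v =
    (1 - s) * metric ρ J u v + s * planeForm 1 u v := rfl

lemma metricPath_one (hs : s = 1) : metricPath ρ s J = planeForm 1 :=
  ContinuousLinearMap.ext fun u => ContinuousLinearMap.ext fun v => by
    rw [metricPath_apply, hs]
    ring

lemma metricPath_zero (hs : s = 0) : metricPath ρ s J = metric ρ J :=
  ContinuousLinearMap.ext fun u => ContinuousLinearMap.ext fun v => by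
    rw [metricPath_apply, hs]
    ring

lemma isInner_metric (J : J2 S) : IsInner (metric ρ J) := ⟨metric_symm ρ J, fun _ => metric_pos ρ J⟩

/-- The time parameter runs over all of `ℝ`. `Real.smoothTransition` keeps the interpolation
parameter in `[0, 1]`, where positivity holds, without loss of smoothness. -/
lemma isInner_metricPath (r : ℝ) (J : J2 S) : IsInner (metricPath ρ (Real.smoothTransition r) J) :=
  (isInner_metric ρ J).segment (isInner_planeForm one_pos) (Real.smoothTransition.nonneg r)
    (Real.smoothTransition.le_one r)

/-- The contraction of the fibres of `J₂⁺ → M`, up to rotation. -/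
def contract (r : ℝ) (J : J2 S) : J2 S :=
  shrink ρ (Real.smoothTransition r) (orthoFrame (metricPath ρ (Real.smoothTransition r) J))
    (isInner_metricPath ρ r J).det_orthoFrame_pos J

lemma base_contract (r : ℝ) (J : J2 S) : base (contract ρ r J) = base J := base_shrink ρ

lemma contract_one (J : J2 S) : contract ρ 1 J = J := by
  have e : orthoFrame (metricPath ρ (Real.smoothTransition 1) J) = ContinuousLinearMap.id ℝ V3 := by
    rw [metricPath_one ρ Real.smoothTransition.one, orthoFrame_planeForm_one]
  have hid : 0 < (ContinuousLinearMap.id ℝ V3).det := by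
    rw [IsRotation.id.2]
    exact one_pos
  refine Eq.trans ?_ (shrink_one ρ hid (J := J))
  unfold contract
  congr 1
  exact Real.smoothTransition.one

/-- If `J'` is `J` rotated by `A`, its path of metrics is the pullback by `A` of that of `J`, the
standard metric being invariant. Hence `A` composed with the frame of `J'` and the frame of `J` are
orthonormal for the same metric, and differ by a rotation. -/
lemma proj_contract_eq {J J' : J2 S} (h : P2.proj J = P2.proj J') (r : ℝ) :
    P2.proj (contract ρ r J) = P2.proj (contract ρ r J') := by
  obtain ⟨A, hA, h0, h1⟩ := P2.exists_rotation h
  have hc := IsHolCoord.chartAt (base J)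
  have hc' : IsHolCoord (base J).1 (chartAt ℂ (base J).2) (base J') := h0 ▸ hc
  obtain ⟨h2, h3⟩ := h1 _ hc.isCoord
  have hdet : 0 < A.det := by rw [hA.2]; exact one_pos
  set s := Real.smoothTransition r
  have hM : ∀ u v, metricPath ρ s J' u v = metricPath ρ s J (A u) (A v) := fun u v => by
    rw [metricPath_apply, metricPath_apply, hA.planeForm_apply]
    rw [metric_apply ρ hc, metric_apply ρ hc', h2, h0]
    rfl
  have hi := isInner_metricPath ρ r J
  have hi' := isInner_metricPath ρ r J'
  obtain ⟨K, hK, e⟩ := exists_isRotation_comp (g := metricPath ρ s J)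
    (B' := A.comp (orthoFrame (metricPath ρ s J'))) hi.det_orthoFrame_pos
    (by rw [det_comp_clm]; exact mul_pos hdet hi'.det_orthoFrame_pos) hi.orthoFrame_apply
    fun u v => by
      rw [← hi'.orthoFrame_apply, hM]
      rfl
  have e' : ∀ u, A (orthoFrame (metricPath ρ s J') u) = orthoFrame (metricPath ρ s J) (K u) :=
    fun u => congrArg (fun B => B u) e
  refine proj_shrink_eq ρ hK hc h0.symm ?_ fun u v => ?_
  · rw [h2, ContinuousLinearMap.comp_assoc, e, ContinuousLinearMap.comp_assoc]
  · rw [h3, e', e']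

/-- At time zero the new frames are positive and orthonormal for the metric of `M` at the base
point, so any two differ by a rotation, and the covariant second derivatives vanish. -/
lemma proj_contract_zero {J J' : J2 S} (h : base J = base J') :
    P2.proj (contract ρ 0 J) = P2.proj (contract ρ 0 J') := by
  have hc := IsHolCoord.chartAt (base J)
  have hc' : IsHolCoord (base J).1 (chartAt ℂ (base J).2) (base J') := h ▸ hc
  -- These coordinates are `coordAt (base J)` by definition, in which a frame has positive
  -- determinant.
  have hdet : 0 < (coordY (prodCoord (base J).1 (chartAt ℂ (base J).2)) J).det :=
    det_coordY_coordAt J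
  have hdet' : 0 < (coordY (prodCoord (base J).1 (chartAt ℂ (base J).2)) J').det := by
    rw [h]
    exact det_coordY_coordAt J'
  have hs : Real.smoothTransition 0 = 0 := Real.smoothTransition.zero
  have hi := isInner_metricPath ρ 0 J
  have hi' := isInner_metricPath ρ 0 J'
  have hM : ∀ J : J2 S, metricPath ρ (Real.smoothTransition 0) J = metric ρ J := fun J =>
    metricPath_zero ρ hs
  obtain ⟨K, hK, e⟩ := exists_isRotation_comp
    (g := planeForm (ρ.coeff (chartAt ℂ (base J).2) (chartAt ℂ (base J).2 (base J).2)))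
    (B := (coordY (prodCoord (base J).1 (chartAt ℂ (base J).2)) J).comp
      (orthoFrame (metricPath ρ (Real.smoothTransition 0) J)))
    (B' := (coordY (prodCoord (base J).1 (chartAt ℂ (base J).2)) J').comp
      (orthoFrame (metricPath ρ (Real.smoothTransition 0) J')))
    (by rw [det_comp_clm]; exact mul_pos hdet hi.det_orthoFrame_pos)
    (by rw [det_comp_clm]; exact mul_pos hdet' hi'.det_orthoFrame_pos)
    (fun u v => by
      rw [← hi.orthoFrame_apply, hM, metric_apply ρ hc]
      rfl)
    (fun u v => by
      rw [← hi'.orthoFrame_apply, hM, metric_apply ρ hc', h]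
      rfl)
  refine proj_shrink_eq ρ hK hc h e fun u v => ?_
  rw [hs, zero_smul, zero_smul]

lemma isPlot_contract {n : ℕ} {p : E n → J2 S} (hp : IsPlot p) {r : E n → ℝ}
    (hr : ContDiff ℝ ∞ r) : IsPlot fun y => contract ρ (r y) (p y) := by
  have hs : ContDiff ℝ ∞ fun y => Real.smoothTransition (r y) :=
    Real.smoothTransition.contDiff.comp hr
  have hs' : ContDiff ℝ ∞ fun y => 1 - Real.smoothTransition (r y) := contDiff_const.sub hs
  have hM : ContDiff ℝ ∞ fun y => metricPath ρ (Real.smoothTransition (r y)) (p y) :=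
    (contDiff_smul_bilin hs' (contDiff_metric ρ hp)).add (contDiff_smul_bilin hs contDiff_const)
  exact isPlot_shrink ρ hp _ (contDiff_orthoFrame hM fun y => isInner_metricPath ρ (r y) (p y)) hs

end J2

namespace P2

/-- The contraction of the fibres of `P₂ → M`. -/
def contract (r : ℝ) (P : P2 S) : P2 S :=
  Quot.lift (fun J => proj (J2.contract ρ r J))
    (fun _ _ h => J2.proj_contract_eq ρ (Quot.sound h) r) P

lemma isFibreContraction_contract : IsFibreContraction base (contract ρ) where
  isPlot p := fun y => by
    -- The contraction is defined on representatives, so the plot is lifted to jets near the point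
    -- and contracted there.
    obtain ⟨P, hP⟩ := isSubduction_proj.exists_lift p (cylProj _ y)
    refine ⟨⟨_, J2.isPlot_contract ρ (isPlot_reparam P.2 (cylProj _).contDiff)
      (cylTime _).contDiff⟩, ?_⟩
    filter_upwards [((cylProj _).continuous.tendsto y).eventually hP] with z hz
    exact congrArg (contract ρ (cylTime _ z)) hz
  map_fibre r P := by
    obtain ⟨J, rfl⟩ := Quot.exists_rep P
    exact J2.base_contract ρ r J
  one P := by
    obtain ⟨J, rfl⟩ := Quot.exists_rep P
    exact congrArg proj (J2.contract_one ρ J)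
  zero P P' h := by
    obtain ⟨J, rfl⟩ := Quot.exists_rep P
    obtain ⟨J', rfl⟩ := Quot.exists_rep P'
    exact J2.proj_contract_zero ρ h

end P2

end Contraction

/-! ## The contraction of the fibres of the bundle of holomorphic jets -/

/-- The linear map `u ↦ (uᵗ, a uᶻ + b uᵗ)`. -/
def holFrame (a b : ℂ) : V3 →L[ℝ] V3 :=
  (ContinuousLinearMap.inl ℝ ℝ ℂ).comp (ContinuousLinearMap.fst ℝ ℝ ℂ) +
    (ContinuousLinearMap.inr ℝ ℝ ℂ).comp (a • ContinuousLinearMap.snd ℝ ℝ ℂ +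
      b • Complex.ofRealCLM.comp (ContinuousLinearMap.fst ℝ ℝ ℂ))

lemma holFrame_apply (a b : ℂ) (u : V3) : holFrame a b u = (u.1, a * u.2 + b * u.1) :=
  Prod.ext (add_zero u.1) (zero_add _)

lemma contDiff_holFrame {W : Type*} [NormedAddCommGroup W] [NormedSpace ℝ W] {a b : W → ℂ}
    (ha : ContDiff ℝ ∞ a) (hb : ContDiff ℝ ∞ b) : ContDiff ℝ ∞ fun x => holFrame (a x) (b x) :=
  contDiff_const.add (contDiff_const.clm_comp ((ha.smul contDiff_const).add (hb.smul contDiff_const)))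

lemma holFrame_comp (a b a' b' : ℂ) :
    (holFrame a b).comp (holFrame a' b') = holFrame (a * a') (a * b' + b) := by
  refine ContinuousLinearMap.ext fun u => ?_
  rw [ContinuousLinearMap.comp_apply, holFrame_apply, holFrame_apply, holFrame_apply]
  refine Prod.ext rfl ?_
  beta_reduce
  ring

lemma holFrame_one_zero : holFrame 1 0 = ContinuousLinearMap.id ℝ V3 := by
  refine ContinuousLinearMap.ext fun u => ?_
  rw [holFrame_apply, one_mul, zero_mul, add_zero]
  rfl

lemma det_holFrame (a b : ℂ) : (holFrame a b).det = ‖a‖ ^ 2 :=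
  det_eq_norm_sq (fun u => by rw [holFrame_apply]) fun z => by simp [holFrame_apply]

lemma isRotation_holFrame {a : ℂ} (ha : ‖a‖ = 1) : IsRotation (holFrame a 0) := by
  refine ⟨fun v => ?_, by rw [det_holFrame, ha, one_pow]⟩
  rw [holFrame_apply, zero_mul, add_zero, norm_mul, ha, one_mul]

section Germ

variable {S : Type*} [TopologicalSpace S] [ChartedSpace ℂ S]

/-- A quadratic change of variables that is a translation in `uᵗ` and holomorphic in `uᶻ` preserves
holomorphic germs. -/
lemma IsHolomorphicGerm.comp_quadMap {j : V3 → Mfd S} (hol : IsHolomorphicGerm j)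
    {A : V3 →L[ℝ] V3} {B : V3 →L[ℝ] V3 →L[ℝ] V3} (hA : ∀ u, (A u).1 = u.1)
    (hA' : ∀ z : ℂ, (A (0, z)).2 = z * (A (0, 1)).2) (hB : ∀ u v, B u v = B v u)
    (hB1 : ∀ u v, (B u v).1 = 0) (hB2 : ∀ u (z : ℂ), (B u (0, z)).2 = z * (B u (0, 1)).2) :
    IsHolomorphicGerm (j ∘ quadMap 0 A B) := by
  have hc : Filter.Tendsto (quadMap 0 A B) (𝓝 0) (𝓝 0) := by
    have := (contDiff_quadMap 0 A B).continuous.tendsto 0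
    rwa [quadMap_zero] at this
  have h1 : ∀ v, (quadMap 0 A B v).1 = v.1 := fun v => by
    simp [quadMap, hA, hB1]
  have h2 : ∀ (t : ℝ) (z : ℂ), (quadMap 0 A B (t, z)).2 = (A (t, 0)).2 + z * (A (0, 1)).2 +
      (1 / 2 : ℂ) * ((B (t, 0) (t, 0)).2 + 2 * (z * (B (t, 0) (0, 1)).2) +
        z * (z * (B (0, 1) (0, 1)).2)) := fun t z => by
    have e : ((t, z) : V3) = (t, 0) + (0, z) := by simp
    rw [quadMap, e]
    simp only [map_add, add_apply, zero_add, Prod.snd_add, Prod.smul_snd]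
    rw [hB (0, z) (t, 0), hA', hB2 (t, 0), hB2 (0, z) z, hB (0, z) (0, 1), hB2 (0, 1) z, Complex.real_smul]
    push_cast
    ring
  filter_upwards [hc.eventually hol] with v hv
  refine ⟨?_, ?_⟩
  · rw [Function.comp_apply, Function.comp_apply, quadMap_zero, hv.1, h1]
  · have h3 : DifferentiableAt ℂ (fun z : ℂ => (quadMap 0 A B (v.1, z)).2) v.2 := by
      simp only [h2]
      fun_prop
    have h4 := hv.2
    rw [h1] at h4
    have h5 := MDifferentiableAt.comp (g := fun z : ℂ => (j (v.1, z)).2)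
      (f := fun z : ℂ => (quadMap 0 A B (v.1, z)).2) v.2 h4 h3.mdifferentiableAt
    have e : (fun z : ℂ => ((j ∘ quadMap 0 A B) (v.1, z)).2) =
        (fun z : ℂ => (j (v.1, z)).2) ∘ fun z : ℂ => (quadMap 0 A B (v.1, z)).2 := by
      funext z
      exact congrArg (fun u => (j u).2) (Prod.ext (h1 (v.1, z)) rfl)
    rwa [e]

end Germ

namespace HolJ2

variable {S : Type*} [TopologicalSpace S] [ChartedSpace ℂ S] [IsManifold 𝓘(ℂ, ℂ) ω S]
  {φ ψ : OpenPartialHomeomorph S ℂ} {t t' : Circle} {J J' : HolJ2 S} (ρ : KahlerMetric S)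

/-- The quotient `yᶻ_t / yᶻ_z` in given coordinates. -/
def tiltAt (t : Circle) (φ : OpenPartialHomeomorph S ℂ) (J : HolJ2 S) : ℂ :=
  (J2.coordY (prodCoord t φ) J.1 (1, 0)).2 / coordYzz φ J

lemma coordY_eq_holFrame (h : IsHolCoord t φ (base J)) : J2.coordY (prodCoord t φ) J.1 =
    holFrame (coordYzz φ J) (coordYzz φ J * tiltAt t φ J) := by
  refine ContinuousLinearMap.ext fun u => ?_
  have e : u = u.1 • ((1, 0) : V3) + (0, u.2) := by simp
  rw [holFrame_apply, tiltAt, mul_div_cancel₀ _ (coordYzz_ne_zero h)]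
  refine Prod.ext ((coord_hol h).1 u) ?_
  conv_lhs => rw [e]
  rw [map_add, map_smul, coordY_inr h, Prod.snd_add, Prod.smul_snd, Complex.real_smul]
  ring

/-- The quotient `yᶻ_t / yᶻ_z`. -/
def tilt (J : HolJ2 S) : ℂ := tiltAt (base J).1 (chartAt ℂ (base J).2) J

/-- Both `yᶻ_t` and `yᶻ_z` are multiplied by `T'` under a change of coordinate, so their quotient is
intrinsic. -/
lemma tilt_eq (h : IsHolCoord t φ (base J)) : tilt J = tiltAt t φ J := by
  have h' := IsHolCoord.chartAt (base J)
  rw [tilt, tiltAt, tiltAt, coordYzz_transition h h', J2.coordY_holTransition (J := J.1) h h']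
  exact mul_div_mul_left _ _ (deriv_transition_ne_zero h.mem_atlas h'.mem_atlas
    (mem_source_transition h.mem_source h'.mem_source))

/-- The norm of the tangent vector `yᶻ_z`. -/
def frameNorm (J : HolJ2 S) : ℝ := √(J2.metric ρ J.1 (0, 1) (0, 1))

lemma frameNorm_pos (J : HolJ2 S) : 0 < frameNorm ρ J :=
  Real.sqrt_pos.mpr (J2.metric_pos ρ J.1 fun h => one_ne_zero (congrArg Prod.snd h))

lemma frameNorm_eq (h : IsHolCoord t φ (base J)) :
    frameNorm ρ J = √(ρ.coeff φ (φ (base J).2)) * ‖coordYzz φ J‖ := by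
  have e := J2.metric_apply ρ (J := J.1) h (0, 1) (0, 1)
  rw [coordY_inr h, planeForm_self, one_mul] at e
  rw [frameNorm, e, zero_pow two_ne_zero, zero_add, mul_comm,
    Real.sqrt_mul (sq_nonneg _), Real.sqrt_sq (norm_nonneg _), mul_comm]
  rfl

/-- The coefficient of `uᶻ` in the change of frame of the contraction. -/
def scale (s : ℝ) (J : HolJ2 S) : ℝ := (1 - s) * (frameNorm ρ J)⁻¹ + s

lemma scale_pos (r : ℝ) (J : HolJ2 S) : 0 < scale ρ (Real.smoothTransition r) J := by
  have h := inv_pos.mpr (frameNorm_pos ρ J)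
  have h0 := Real.smoothTransition.nonneg r
  rcases (Real.smoothTransition.le_one r).eq_or_lt with h1 | h1
  · rw [scale, h1]
    norm_num
  · exact add_pos_of_pos_of_nonneg (mul_pos (sub_pos.mpr h1) h) h0

/-- The change of frame of the contraction. -/
def frameChange (s : ℝ) (J : HolJ2 S) : V3 →L[ℝ] V3 :=
  holFrame (scale ρ s J) (-((1 - s : ℝ) : ℂ) * tilt J)

lemma det_frameChange_pos (r : ℝ) (J : HolJ2 S) :
    0 < (frameChange ρ (Real.smoothTransition r) J).det := by
  rw [frameChange, det_holFrame]
  have h : (scale ρ (Real.smoothTransition r) J : ℂ) ≠ 0 :=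
    Complex.ofReal_ne_zero.mpr (scale_pos ρ r J).ne'
  have := norm_pos_iff.mpr h
  positivity

/-- The Christoffel term is complex bilinear and without `t`-component, so the covariant second
derivative keeps the shape of a holomorphic second derivative. -/
lemma cov_hol (J : HolJ2 S) (u v : V3) (z : ℂ) : (J2.cov ρ J.1 u v).1 = 0 ∧
    (J2.cov ρ J.1 u (0, z)).2 = z * (J2.cov ρ J.1 u (0, 1)).2 := by
  have h := IsHolCoord.chartAt (base J)
  set φ := chartAt ℂ (base J).2
  obtain ⟨h1, -, h3, h4⟩ := coord_hol h
  have hfst : ∀ u v, (J2.cov ρ J.1 u v).1 = 0 := fun u v => by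
    rw [← h1, J2.coordY_cov ρ (J := J.1) h, Prod.fst_add, h3, christoffel_apply, add_zero]
  refine ⟨hfst u v, ?_⟩
  have hsnd : ∀ z : ℂ, (J2.cov ρ J.1 u (0, z)).2 * coordYzz φ J =
      z * ((J2.coordYY (prodCoord (base J).1 φ) J.1 u (0, 1)).2 +
        J2.symbol ρ φ (base J) * ((J2.coordY (prodCoord (base J).1 φ) J.1 u).2 *
          coordYzz φ J)) := fun z => by
    have e := congrArg Prod.snd (J2.coordY_cov ρ (J := J.1) h u (0, z))
    rw [show J2.cov ρ J.1 u (0, z) = (0, (J2.cov ρ J.1 u (0, z)).2) from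
      Prod.ext (hfst _ _) rfl, coordY_inr h, Prod.snd_add, christoffel_apply, h4,
      coordY_inr h] at e
    refine e.trans ?_
    change _ + J2.symbol ρ φ (base J) * _ = _
    ring
  refine mul_right_cancel₀ (coordYzz_ne_zero h) ?_
  rw [hsnd, mul_assoc, hsnd, one_mul]

/-- The change of frame fixes `uᵗ` and is complex linear in `uᶻ`, and the quadratic part has the
shape given by `cov_hol`, so holomorphy is preserved. Gram–Schmidt would in general rescale `uᵗ`,
which is why holomorphic jets have a contraction of their own. -/
lemma shrink_hol (s : ℝ) {a b : ℂ} (hN : 0 < (holFrame a b).det) (J : HolJ2 S) :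
    ∃ (j : V3 → Mfd S) (hj : IsFrame j), IsHolomorphicGerm j ∧
      J2.shrink ρ s (holFrame a b) hN J.1 = J2.mk j hj := by
  have hcov := cov_hol ρ J
  obtain ⟨J₀, j, hj, hol, rfl⟩ := J
  have e : ∀ z : ℂ, holFrame a b (0, z) = (0, a * z) := fun z => by simp [holFrame_apply]
  refine ⟨_, _, hol.comp_quadMap (fun u => ?_) (fun z => ?_) (fun u v => ?_) (fun u v => ?_)
    (fun u z => ?_), J2.act_mk _ _ hj⟩
  · rw [holFrame_apply]
  · rw [e, e]
    ring
  · simp only [quadComp_apply, zero_apply, add_zero, smul_apply,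
      J2.cov_symm ρ (J2.mk j hj) (holFrame a b u)]
  · rw [quadComp_apply, zero_apply, add_zero, smul_apply, smul_apply, Prod.smul_fst,
      (hcov _ _ 0).1, smul_zero]
  · rw [quadComp_apply, quadComp_apply, zero_apply, zero_apply, add_zero, add_zero, smul_apply,
      smul_apply, smul_apply, Prod.smul_snd, Prod.smul_snd, e, e, (hcov _ 0 (a * z)).2,
      (hcov _ 0 (a * 1)).2, Complex.real_smul, Complex.real_smul]
    ring

/-- The contraction of the fibres of the bundle of holomorphic jets, up to rotation. -/
def contract (r : ℝ) (J : HolJ2 S) : HolJ2 S :=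
  ⟨J2.shrink ρ (Real.smoothTransition r) (frameChange ρ (Real.smoothTransition r) J)
    (det_frameChange_pos ρ r J) J.1, shrink_hol ρ _ (det_frameChange_pos ρ r J) J⟩

lemma contract_val (r : ℝ) (J : HolJ2 S) : (contract ρ r J).1 =
    J2.shrink ρ (Real.smoothTransition r) (frameChange ρ (Real.smoothTransition r) J)
      (det_frameChange_pos ρ r J) J.1 := rfl

lemma base_contract (r : ℝ) (J : HolJ2 S) : base (contract ρ r J) = base J :=
  J2.base_shrink ρ (hN := det_frameChange_pos ρ r J)

lemma contract_one (J : HolJ2 S) : contract ρ 1 J = J := by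
  have hs : Real.smoothTransition 1 = 1 := Real.smoothTransition.one
  have e : frameChange ρ (Real.smoothTransition 1) J = ContinuousLinearMap.id ℝ V3 := by
    rw [frameChange, scale, hs, ← holFrame_one_zero]
    simp
  have hid : 0 < (ContinuousLinearMap.id ℝ V3).det := by
    rw [IsRotation.id.2]
    exact one_pos
  refine Subtype.ext (Eq.trans ?_ (J2.shrink_one ρ hid (J := J.1)))
  rw [contract_val]
  congr 1

/-- Holomorphic jets that differ by a rotation differ by a rotation of `ℂ`. -/
lemma exists_norm_one_of_proj_eq (h : P2.proj J.1 = P2.proj J'.1) :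
    ∃ e : ℂ, ‖e‖ = 1 ∧ P2.RotatedBy (holFrame e 0) J.1 J'.1 := by
  obtain ⟨A, hA, h0, h1⟩ := P2.exists_rotation h
  have hc := IsHolCoord.chartAt (base J)
  have hc' : IsHolCoord (base J).1 (chartAt ℂ (base J).2) (base J') := by
    have e : base J' = base J := h0
    rwa [e]
  set φ := chartAt ℂ (base J).2
  have hY := (h1 _ hc.isCoord).1
  have hfst : ∀ u, (A u).1 = u.1 := fun u => by
    rw [← (coord_hol hc).1, ← (coord_hol hc').1 u, hY]
    rfl
  have h2 : ∀ z : ℂ, A (0, z) = (0, coordYzz φ J' / coordYzz φ J * z) := fun z => by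
    refine (J2.isInvertible_coordY (J := J.1) hc.isCoord).injective ?_
    have e := congrArg (fun T => T (0, z)) hY
    beta_reduce at e
    rw [coordY_inr hc', ContinuousLinearMap.comp_apply] at e
    rw [← e, coordY_inr hc, div_mul_eq_mul_div, div_mul_cancel₀ _ (coordYzz_ne_zero hc), mul_comm]
  -- `A` preserves both `uᵗ` and the length, so the image of `(1, 0)` has no room for a fibre
  -- component.
  have h3 : A (1, 0) = (1, 0) := by
    have e := hA.1 (1, 0)
    rw [hfst, norm_zero] at e
    have e' : ‖(A (1, 0)).2‖ = 0 := by
      have : ‖(A (1, 0)).2‖ ^ 2 = 0 := by linarith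
      exact pow_eq_zero_iff two_ne_zero |>.mp this
    exact Prod.ext (hfst _) (norm_eq_zero.mp e')
  have h4 : A = holFrame (coordYzz φ J' / coordYzz φ J) 0 := by
    refine ContinuousLinearMap.ext fun u => ?_
    have e : u = u.1 • ((1, 0) : V3) + (0, u.2) := by simp
    conv_lhs => rw [e, map_add, map_smul, h3, h2]
    rw [holFrame_apply]
    simp
  refine ⟨coordYzz φ J' / coordYzz φ J, ?_, h0, ?_⟩
  · have e := hA.2
    rw [h4, det_holFrame] at e
    exact (pow_eq_one_iff_of_nonneg (norm_nonneg _) two_ne_zero).mp e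
  · rw [← h4]
    exact h1

/-- Rotation by a number `e` of modulus one leaves `scale` unchanged and multiplies `tilt` by `e⁻¹`,
so the rotation intertwines the two changes of frame. -/
lemma proj_contract_eq (h : P2.proj J.1 = P2.proj J'.1) (r : ℝ) :
    P2.proj (contract ρ r J).1 = P2.proj (contract ρ r J').1 := by
  obtain ⟨e, he, h0, h1⟩ := exists_norm_one_of_proj_eq h
  have hc := IsHolCoord.chartAt (base J)
  have h0 : base J' = base J := h0
  have hc' : IsHolCoord (base J).1 (chartAt ℂ (base J).2) (base J') := by rwa [h0]
  set φ := chartAt ℂ (base J).2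
  obtain ⟨hY, hYY⟩ := h1 _ hc.isCoord
  have he0 : e ≠ 0 := fun h => by simp [h] at he
  have hz : coordYzz φ J' = e * coordYzz φ J := by
    rw [coordYzz_eq hc', hY, ContinuousLinearMap.comp_apply, holFrame_apply]
    simp only [mul_one, Complex.ofReal_zero, mul_zero, add_zero]
    rw [coordY_inr hc]
  have hscale : ∀ s, scale ρ s J' = scale ρ s J := fun s => by
    rw [scale, scale, frameNorm_eq ρ hc, frameNorm_eq ρ hc', h0, hz, norm_mul, he, one_mul]
  have htilt : e * tilt J' = tilt J := by
    have hy := coordYzz_ne_zero hc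
    rw [tilt_eq hc, tilt_eq hc', tiltAt, tiltAt, hz, hY, ContinuousLinearMap.comp_apply,
      holFrame_apply]
    simp only [mul_zero, zero_mul, add_zero]
    field_simp
  set s := Real.smoothTransition r
  have key : (holFrame e 0).comp (frameChange ρ s J') = (frameChange ρ s J).comp (holFrame e 0) := by
    rw [frameChange, frameChange, holFrame_comp, holFrame_comp, hscale, ← htilt]
    congr 1
    · ring
    · ring
  have key' : ∀ u, holFrame e 0 (frameChange ρ s J' u) = frameChange ρ s J (holFrame e 0 u) :=
    fun u => congrArg (fun T => T u) key
  refine J2.proj_shrink_eq ρ (isRotation_holFrame he) (J := J.1) (J' := J'.1)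
    (hN := det_frameChange_pos ρ r J) (hN' := det_frameChange_pos ρ r J') hc h0.symm ?_
    fun u v => ?_
  · rw [hY, ContinuousLinearMap.comp_assoc, key, ContinuousLinearMap.comp_assoc]
  · rw [hYY, key', key']

/-- At time zero the tilt is removed and the vector `yᶻ_z` normalised: the frame is multiplication
by a number of modulus `ρ^(-1/2)`, which depends only on the base point up to rotation of `ℂ`. -/
lemma proj_contract_zero (h : base J = base J') :
    P2.proj (contract ρ 0 J).1 = P2.proj (contract ρ 0 J').1 := by
  have hc := IsHolCoord.chartAt (base J)
  have hc' : IsHolCoord (base J).1 (chartAt ℂ (base J).2) (base J') := by rwa [← h]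
  set φ := chartAt ℂ (base J).2
  have hs : Real.smoothTransition 0 = 0 := Real.smoothTransition.zero
  have hY : ∀ {J' : HolJ2 S}, IsHolCoord (base J).1 φ (base J') →
      (J2.coordY (prodCoord (base J).1 φ) J'.1).comp (frameChange ρ (Real.smoothTransition 0) J') =
        holFrame (coordYzz φ J' * (frameNorm ρ J' : ℂ)⁻¹) 0 := fun {J'} h' => by
    rw [coordY_eq_holFrame h', frameChange, scale, hs, tilt_eq h', holFrame_comp]
    congr 1
    · simp
    · simp
  have hn : ∀ {J' : HolJ2 S}, base J = base J' → IsHolCoord (base J).1 φ (base J') →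
      ‖coordYzz φ J' * (frameNorm ρ J' : ℂ)⁻¹‖ = (√(ρ.coeff φ (φ (base J).2)))⁻¹ :=
    fun {J'} hb h' => by
    have hy := norm_ne_zero_iff.mpr (coordYzz_ne_zero h')
    rw [norm_mul, norm_inv, Complex.norm_real, Real.norm_of_nonneg (frameNorm_pos ρ J').le,
      frameNorm_eq ρ h', ← hb, mul_inv, mul_comm, mul_assoc, inv_mul_cancel₀ hy, mul_one]
  have hy : coordYzz φ J * (frameNorm ρ J : ℂ)⁻¹ ≠ 0 :=
    mul_ne_zero (coordYzz_ne_zero hc)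
      (inv_ne_zero (Complex.ofReal_ne_zero.mpr (frameNorm_pos ρ J).ne'))
  refine J2.proj_shrink_eq ρ (K := holFrame (coordYzz φ J' * (frameNorm ρ J' : ℂ)⁻¹ /
    (coordYzz φ J * (frameNorm ρ J : ℂ)⁻¹)) 0) (isRotation_holFrame ?_) (J := J.1) (J' := J'.1)
    (hN := det_frameChange_pos ρ 0 J) (hN' := det_frameChange_pos ρ 0 J') hc h ?_ fun u v => ?_
  · rw [norm_div, hn h hc', hn rfl hc]
    refine div_self ?_
    rw [← hn rfl hc]
    exact norm_ne_zero_iff.mpr hy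
  · rw [hY hc, hY hc', holFrame_comp, mul_div_cancel₀ _ hy, mul_zero, add_zero]
  · rw [hs, zero_smul, zero_smul]

variable {n : ℕ} (p : Plot (HolJ2 S) n)

lemma contDiff_frameNorm : ContDiff ℝ ∞ fun y => frameNorm ρ (p.1 y) := by
  have h : ContDiff ℝ ∞ fun y => J2.metric ρ (p.1 y).1 (0, 1) (0, 1) :=
    ((J2.contDiff_metric ρ (toJ2 p).2).clm_apply contDiff_const).clm_apply contDiff_const
  exact h.sqrt fun y => (Real.sqrt_pos.mp (frameNorm_pos ρ (p.1 y))).ne'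

lemma contDiff_tilt : ContDiff ℝ ∞ fun y => tilt (p.1 y) := by
  rw [contDiff_iff_contDiffAt]
  intro x
  have h := IsHolCoord.chartAt (base (p.1 x))
  have h1 : ContDiffAt ℝ ∞ (fun y => (J2.coordY (prodCoord (base (p.1 x)).1
      (chartAt ℂ (base (p.1 x)).2)) (p.1 y).1 (1, 0)).2) x :=
    ((J2.contDiffAt_coordY (toJ2 p).2 h.isCoord).clm_apply contDiffAt_const).snd
  have h2 := h1.mul ((contDiffAt_coordYzz h).inv (coordYzz_ne_zero h))
  refine h2.congr_of_eventuallyEq ?_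
  filter_upwards [eventually_isHolCoord h] with y hy
  exact (tilt_eq hy).trans (div_eq_mul_inv _ _)

lemma isPlot_contract {r : E n → ℝ} (hr : ContDiff ℝ ∞ r) :
    IsPlot fun y => contract ρ (r y) (p.1 y) := by
  have hs : ContDiff ℝ ∞ fun y => Real.smoothTransition (r y) :=
    Real.smoothTransition.contDiff.comp hr
  have hs' : ContDiff ℝ ∞ fun y => 1 - Real.smoothTransition (r y) := contDiff_const.sub hs
  have h1 : ContDiff ℝ ∞ fun y => scale ρ (Real.smoothTransition (r y)) (p.1 y) :=
    (hs'.mul ((contDiff_frameNorm ρ p).inv fun y => (frameNorm_pos ρ (p.1 y)).ne')).add hs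
  have h2 : ContDiff ℝ ∞ fun y =>
      -((1 - Real.smoothTransition (r y) : ℝ) : ℂ) * tilt (p.1 y) :=
    (Complex.ofRealCLM.contDiff.comp hs').neg.mul (contDiff_tilt p)
  exact J2.isPlot_shrink ρ (toJ2 p).2 (fun y => det_frameChange_pos ρ (r y) (p.1 y))
    (contDiff_holFrame (Complex.ofRealCLM.contDiff.comp h1) h2) hs

end HolJ2

namespace HolP2

variable {S : Type*} [TopologicalSpace S] [ChartedSpace ℂ S] [IsManifold 𝓘(ℂ, ℂ) ω S]
  (ρ : KahlerMetric S)

/-- The contraction of the fibres of the bundle of holomorphic jets up to rotation. -/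
def contract (r : ℝ) (P : HolP2 S) : HolP2 S := proj (HolJ2.contract ρ r P.2.choose)

/-- The contraction on the quotient is defined through a chosen representative; compatibility with
rotations makes the choice immaterial. -/
lemma contract_proj (r : ℝ) (J : HolJ2 S) : contract ρ r (proj J) = proj (HolJ2.contract ρ r J) :=
  Subtype.ext (HolJ2.proj_contract_eq ρ (proj J).2.choose_spec r)

lemma exists_proj (P : HolP2 S) : ∃ J, proj J = P := by
  obtain ⟨_, J, rfl⟩ := P
  exact ⟨J, rfl⟩

lemma isFibreContraction_contract : IsFibreContraction base (contract ρ) where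
  isPlot p := fun y => by
    obtain ⟨P, hP⟩ := isSubduction_proj.exists_lift p (cylProj _ y)
    refine ⟨⟨_, HolJ2.isPlot_contract ρ (P.comp _ (cylProj _).contDiff)
      (cylTime _).contDiff⟩, ?_⟩
    filter_upwards [((cylProj _).continuous.tendsto y).eventually hP] with z hz
    exact (congrArg (contract ρ (cylTime _ z)) hz).trans (contract_proj ρ _ _)
  map_fibre r P := by
    obtain ⟨J, rfl⟩ := exists_proj P
    rw [contract_proj]
    exact HolJ2.base_contract ρ r J
  one P := by
    obtain ⟨J, rfl⟩ := exists_proj P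
    rw [contract_proj, HolJ2.contract_one]
  zero P P' h := by
    obtain ⟨J, rfl⟩ := exists_proj P
    obtain ⟨J', rfl⟩ := exists_proj P'
    rw [contract_proj, contract_proj]
    exact Subtype.ext (HolJ2.proj_contract_zero ρ h)

end HolP2

end

end EquivJet

/-! ### The theorem. -/

theorem theorem4 {S : Type*} [TopologicalSpace S] [T2Space S] [ChartedSpace ℂ S]
    [IsManifold 𝓘(ℂ, ℂ) ω S] {Γ : Type*} [Group Γ] [MulAction Γ (Mfd S)]
    [IsConformalLoopAction Γ S] (ρ : KahlerMetric S) :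
    ∃ (conn : DForm (HolJ2 S) 1) (Ω : TotCochain Γ (Mfd S))
      (θ : Fin 3 → Fin 3 → DForm (J2 S) 1) (p₁ : DForm (P2 S) 4),
      HolJ2.IsConnection ρ conn ∧
      TotCochain.pullback HolJ2.base HolJ2.dSmooth_base HolJ2.base_smul Ω =
        TotCochain.D (TotCochain.ofForm conn) ∧
      J2.IsTautological θ ∧
      DForm.pullback P2.proj P2.dSmooth_proj p₁ = J2.pontrjagin θ ∧
      ∃ (hΩ : -(TotCochain.mul Ω Ω) ∈ TotCochain.cocycles Γ (Mfd S) 4)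
        (hp : TotCochain.ofForm p₁ ∈ TotCochain.cocycles Γ (P2 S) 4),
        ∀ c : EquivCohomology Γ (Mfd S) 4,
          EquivCohomology.pullback P2.base P2.dSmooth_base P2.base_smul c =
              EquivCohomology.mk (TotCochain.ofForm p₁) hp ↔
            c = EquivCohomology.mk (-(TotCochain.mul Ω Ω)) hΩ := pontrjagin_class_of_contraction ρ (P2.isFibreContraction_contract ρ)
  (HolP2.isFibreContraction_contract ρ)
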